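/- Let $\mathbb{K}$ be a field, let $\mathcal{A}$ be a nonzero unital $\mathbb{Z}$-graded differential graded algebra (dga) over $\mathbb{K}$, with unit $e$, and let $W \in \mathcal{A}^0$ be a central element with $dW = 0$. Write $|a|$ for degrees and $\|a\| = |a| - 1$. (1) $\mathcal{A}_t = \mathcal{A}[t,\epsilon]$ is the dga over $\mathbb{K}[t]$ where $|t| = 0$, $|\epsilon| = -1$, $\epsilon^2 = 0$, $\epsilon a = (-1)^{|a|} a \epsilon$, with differential $d_{\mathcal{A}} + (t - W)\partial_\epsilon$. For a nonzero polynomial $p \in \mathbb{K}[t]$ set $\mathcal{A}_{t,1/p} = \mathbb{K}[t,1/p] \otimes_{\mathbb{K}[t]} \mathcal{A}_t$, a dga over $\mathbb{K}[t,1/p]$. (2) $\mathcal{A}_q = \mathcal{A}[[q]]$, with $|q| = 2$, is the curved dga over $\mathbb{K}[[q]]$ with curvature $qW$. Its Hochschild cohomology $\mathit{HH}^*(\mathcal{A}_q)$ is the cohomology of the normalized, $q$-adically completed Hochschild cochain complex, whose cochains of degree $n$ are the formal series $\phi = \sum_{k \geq 0} q^k \phi_k$, $\phi_k = (\phi_k^l)_{l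 \geq 0}$, where $\phi_k^l : \mathcal{A}^{\otimes l} \to \mathcal{A}$ is $\mathbb{K}$-linear of degree $n - 2k - l$ and vanishes if one of its inputs is $e$. The differential is $q$-linear, given by $$\begin{aligned} (d\phi)^l(a_1,\dots,a_l) = {} & d\phi^l(a_1,\dots,a_l) + \sum_j (-1)^{\|a_1\|+\cdots+\|a_j\|+|\phi|} \phi^l(a_1,\dots,da_{j+1},\dots,a_l) \\ & - (-1)^{|\phi|\,\|a_1\|} a_1 \phi^{l-1}(a_2,\dots,a_l) - \sum_j (-1)^{\|a_1\|+\cdots+\|a_{j+1}\|+|\phi|} \phi^{l-1}(a_1,\dots,a_{j+1}a_{j+2},\dots,a_l) \\ & + (-1)^{\|a_1\|+\cdots+\|a_{l-1}\|+|\phi|} \phi^{l-1}(a_1,\dots,a_{l-1}) a_l \\ & + q \sum_j (-1)^{\|a_1\|+\cdots+\|a_j\|+|\phi|} \phi^{l+1}(a_1,\dots,a_j,W,a_{j+1},\dots,a_l). \end{aligned}$$ The element $W$, seen as a cochain with no inputs, is a cocycle, and defines a class $[W] \in \mathit{HH}^0(\mathcal{A}_q)$; $p([W])$ is formed using the cup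 product $$(\phi \smile \psi)^l(a_1,\dots,a_l) = \sum_j (-1)^{|\psi|(\|a_1\|+\cdots+\|a_j\|)} \phi^j(a_1,\dots,a_j)\, \psi^{l-j}(a_{j+1},\dots,a_l).$$ (3) A dga $\mathcal{B}$ over a commutative ring $R$ is called smooth over $R$ if its diagonal bimodule is perfect, that is, a compact object of the derived category $D(\mathcal{B} \otimes_R \mathcal{B}^{\mathrm{opp}})$ of ($R$-linear) dg bimodules: the functor $\mathrm{Hom}(\mathcal{B}, \cdot)$ on that category commutes with arbitrary direct sums. Suppose that: (i) $\mathcal{A}$ is smooth over $\mathbb{K}$; (ii) for the nonzero polynomial $p \in \mathbb{K}[t]$, the class $q^r p([W]) \in \mathit{HH}^{2r}(\mathcal{A}_q)$ vanishes for some integer $r > 0$. Then $\mathcal{A}_{t,1/p}$ is smooth over $\mathbb{K}[t,1/p]$. -/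

import Mathlib

open CategoryTheory Limits Polynomial
open scoped TensorProduct DirectSum

universe u

noncomputable section

/-! ### Differential graded algebras -/

/-- A (unital, associative, cohomologically `ℤ`-graded) differential graded algebra over `R`. -/
structure DGA (R : Type u) [CommRing R] where
  carrier : Type u
  [ring : Ring carrier]
  [algebra : Algebra R carrier]
  gr : ℤ → Submodule R carrier
  [graded : GradedAlgebra gr]
  d : carrier →ₗ[R] carrier
  d_mem : ∀ (n : ℤ) (a : carrier), a ∈ gr n → d a ∈ gr (n + 1)
  d_d : ∀ a : carrier, d (d a) = 0
  leibniz : ∀ (n : ℤ) (a b : carrier), a ∈ gr n →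
    d (a * b) = d a * b + n.negOnePow • (a * d b)

attribute [instance] DGA.ring DGA.algebra DGA.graded

namespace DGA

/-! ### The sign operators -/

/-- `twist n` multiplies an element of degree `i` by `(-1) ^ (n * i)`. -/
def twist {R : Type u} [CommRing R] (A : DGA R) (n : ℤ) : A.carrier →ₗ[R] A.carrier :=
  (DirectSum.toModule R ℤ A.carrier fun i => (n * i).negOnePow • (A.gr i).subtype) ∘ₗ
    (DirectSum.decomposeLinearEquiv A.gr).toLinearMap

theorem twist_of_mem {R : Type u} [CommRing R] (A : DGA R) (n i : ℤ) {a : A.carrier}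
    (ha : a ∈ A.gr i) : A.twist n a = (n * i).negOnePow • a := by
  rw [twist, LinearMap.comp_apply, LinearEquiv.coe_coe, DirectSum.decomposeLinearEquiv_apply,
    DirectSum.decompose_of_mem A.gr ha, ← DirectSum.lof_eq_of R, DirectSum.toModule_lof]
  rfl

theorem induction_gr {R : Type u} [CommRing R] (A : DGA R) {P : A.carrier → Prop}
    (h : ∀ i, ∀ a ∈ A.gr i, P a) (hadd : ∀ a b, P a → P b → P (a + b)) (a : A.carrier) : P a :=
  DirectSum.Decomposition.inductionOn A.gr (h 0 0 (Submodule.zero_mem _))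
    (fun {i} m => h i m m.2) hadd a

theorem twist_one {R : Type u} [CommRing R] (A : DGA R) (n : ℤ) : A.twist n 1 = 1 := by
  rw [A.twist_of_mem n 0 SetLike.GradedOne.one_mem]; simp

theorem twist_mul {R : Type u} [CommRing R] (A : DGA R) (n : ℤ) (a b : A.carrier) :
    A.twist n (a * b) = A.twist n a * A.twist n b := by
  induction a using A.induction_gr with
  | hadd x y hx hy => simp [add_mul, hx, hy]
  | h i a ha =>
    induction b using A.induction_gr with
    | hadd x y hx hy => simp [mul_add, hx, hy]
    | h j b hb =>
      rw [A.twist_of_mem n i ha, A.twist_of_mem n j hb,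
        A.twist_of_mem n (i + j) (SetLike.GradedMul.mul_mem ha hb), mul_add, Int.negOnePow_add,
        mul_smul, smul_mul_smul_comm, mul_smul]

theorem twist_mem {R : Type u} [CommRing R] (A : DGA R) (n i : ℤ) {a : A.carrier}
    (ha : a ∈ A.gr i) : A.twist n a ∈ A.gr i := by
  rw [A.twist_of_mem n i ha, Units.smul_def]
  exact zsmul_mem ha _

/-! ### Extension of constants -/

/-- The differential graded algebra `S ⊗[R] A` over `S`. -/
def baseChange {R : Type u} [CommRing R] (S : Type u) [CommRing S] [Algebra R S]
    (A : DGA R) : DGA S where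
  carrier := S ⊗[R] A.carrier
  gr := fun i => (A.gr i).baseChange S
  d := A.d.baseChange S
  d_mem := fun n a ha => by
    rw [Submodule.baseChange_eq_span] at ha
    induction ha using Submodule.span_induction with
    | mem x hx =>
      obtain ⟨y, hy, rfl⟩ := hx
      exact Submodule.tmul_mem_baseChange_of_mem _ (A.d_mem n y hy)
    | zero => simp
    | add x y _ _ hx hy => rw [map_add]; exact Submodule.add_mem _ hx hy
    | smul c x _ hx => rw [map_smul]; exact Submodule.smul_mem _ _ hx
  d_d := fun a => by
    induction a using TensorProduct.induction_on with
    | zero => simp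
    | tmul s x => simp [A.d_d]
    | add x y hx hy => simp [hx, hy]
  leibniz := fun n a b ha => by
    rw [Submodule.baseChange_eq_span] at ha
    induction ha using Submodule.span_induction with
    | mem x hx =>
      obtain ⟨y, hy, rfl⟩ := hx
      induction b using TensorProduct.induction_on with
      | zero => simp
      | tmul s z =>
        simp only [TensorProduct.mk_apply, Algebra.TensorProduct.tmul_mul_tmul,
          LinearMap.baseChange_tmul, A.leibniz n y z hy, TensorProduct.tmul_add, Units.smul_def,
          TensorProduct.tmul_smul]
      | add x z hx hz =>
        simp only [mul_add, map_add, hx, hz, smul_add]; abel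
    | zero => simp
    | add x y _ _ hx hy => simp only [add_mul, map_add, hx, hy, smul_add]; abel
    | smul c x _ hx =>
      simp only [smul_mul_assoc, map_smul, hx, smul_add]
      rw [smul_comm c]

/-! ### Central cocycles, and adjoining a variable of degree `-1` -/

/-- `z` is a central element of degree `0` with `d z = 0`. -/
structure IsCentralCocycle {R : Type u} [CommRing R] (A : DGA R) (z : A.carrier) : Prop where
  mem : z ∈ A.gr 0
  closed : A.d z = 0
  central : ∀ a : A.carrier, z * a = a * z

/-- The algebra `A[ε]`, where `ε` has degree `-1`, supercommutes with `A`, and squares to zero.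
The element `⟨a, b⟩` is `a + ε b`. -/
@[ext]
structure Eps {R : Type u} [CommRing R] (A : DGA R) : Type u where
  fst : A.carrier
  snd : A.carrier

namespace Eps

variable {R : Type u} [CommRing R] {A : DGA R}

def equivProd (A : DGA R) : A.Eps ≃ A.carrier × A.carrier where
  toFun x := (x.fst, x.snd)
  invFun x := ⟨x.1, x.2⟩
  left_inv _ := rfl
  right_inv _ := rfl

instance : AddCommGroup A.Eps := (equivProd A).addCommGroup
instance : Module R A.Eps := (equivProd A).module R

@[simp] theorem fst_zero : (0 : A.Eps).fst = 0 := rfl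
@[simp] theorem snd_zero : (0 : A.Eps).snd = 0 := rfl
@[simp] theorem fst_add (x y : A.Eps) : (x + y).fst = x.fst + y.fst := rfl
@[simp] theorem snd_add (x y : A.Eps) : (x + y).snd = x.snd + y.snd := rfl
@[simp] theorem fst_neg (x : A.Eps) : (-x).fst = -x.fst := rfl
@[simp] theorem snd_neg (x : A.Eps) : (-x).snd = -x.snd := rfl
@[simp] theorem fst_smul (c : R) (x : A.Eps) : (c • x).fst = c • x.fst := rfl
@[simp] theorem snd_smul (c : R) (x : A.Eps) : (c • x).snd = c • x.snd := rfl

/-- `(a + ε b) (a' + ε b') = a a' + ε (b a' + (-1) ^ |a| a b')`. -/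
instance : Mul A.Eps where
  mul x y := ⟨x.fst * y.fst, x.snd * y.fst + A.twist 1 x.fst * y.snd⟩

instance : One A.Eps where
  one := ⟨1, 0⟩

@[simp] theorem fst_one : (1 : A.Eps).fst = 1 := rfl
@[simp] theorem snd_one : (1 : A.Eps).snd = 0 := rfl
@[simp] theorem fst_mul (x y : A.Eps) : (x * y).fst = x.fst * y.fst := rfl
@[simp] theorem snd_mul (x y : A.Eps) :
    (x * y).snd = x.snd * y.fst + A.twist 1 x.fst * y.snd := rfl

instance : Ring A.Eps where
  __ := (inferInstance : AddCommGroup A.Eps)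
  left_distrib x y z := by
    ext <;> simp [mul_add]; abel
  right_distrib x y z := by
    ext <;> simp [add_mul]; abel
  zero_mul x := by ext <;> simp
  mul_zero x := by ext <;> simp
  one_mul x := by ext <;> simp [twist_one]
  mul_one x := by ext <;> simp
  mul_assoc x y z := by
    ext
    · simp [mul_assoc]
    · simp [twist_mul, mul_assoc, mul_add, add_mul, add_assoc]

instance : Algebra R A.Eps :=
  Algebra.ofModule (fun c x y => by ext <;> simp) (fun c x y => by ext <;> simp)

/-- Degree `n` in `A[ε]`. -/
def gr (A : DGA R) (n : ℤ) : Submodule R A.Eps where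
  carrier := {x | x.fst ∈ A.gr n ∧ x.snd ∈ A.gr (n + 1)}
  add_mem' hx hy := ⟨add_mem hx.1 hy.1, add_mem hx.2 hy.2⟩
  zero_mem' := ⟨zero_mem _, zero_mem _⟩
  smul_mem' c _ hx := ⟨Submodule.smul_mem _ c hx.1, Submodule.smul_mem _ c hx.2⟩

def inl (A : DGA R) : A.carrier →ₗ[R] A.Eps where
  toFun a := ⟨a, 0⟩
  map_add' a b := by ext <;> simp
  map_smul' c a := by ext <;> simp

def inr (A : DGA R) : A.carrier →ₗ[R] A.Eps where
  toFun b := ⟨0, b⟩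
  map_add' a b := by ext <;> simp
  map_smul' c a := by ext <;> simp

def inlGr (A : DGA R) (n : ℤ) : A.gr n →ₗ[R] gr A n :=
  ((inl A).comp (A.gr n).subtype).codRestrict (gr A n) fun a => ⟨a.2, zero_mem _⟩

def inrGr (A : DGA R) (n : ℤ) : A.gr n →ₗ[R] gr A (n - 1) :=
  ((inr A).comp (A.gr n).subtype).codRestrict (gr A (n - 1)) fun a =>
    ⟨zero_mem _, by simp [inr]⟩

def fstL (A : DGA R) : A.Eps →ₗ[R] A.carrier where
  toFun x := x.fst
  map_add' _ _ := rfl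
  map_smul' _ _ := rfl

def sndL (A : DGA R) : A.Eps →ₗ[R] A.carrier where
  toFun x := x.snd
  map_add' _ _ := rfl
  map_smul' _ _ := rfl

def decomp (A : DGA R) : A.Eps →ₗ[R] ⨁ n, gr A n :=
  (DirectSum.toModule R ℤ _ fun n => (DirectSum.lof R ℤ (fun n => gr A n) n) ∘ₗ inlGr A n) ∘ₗ
      (DirectSum.decomposeLinearEquiv A.gr).toLinearMap ∘ₗ fstL A +
    (DirectSum.toModule R ℤ _ fun n =>
        (DirectSum.lof R ℤ (fun n => gr A n) (n - 1)) ∘ₗ inrGr A n) ∘ₗ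
      (DirectSum.decomposeLinearEquiv A.gr).toLinearMap ∘ₗ sndL A

theorem decomp_inl (n : ℤ) {a : A.carrier} (ha : a ∈ A.gr n) :
    decomp A (inl A a) = DirectSum.lof R ℤ (fun n => gr A n) n (inlGr A n ⟨a, ha⟩) := by
  simp only [decomp, LinearMap.add_apply, LinearMap.comp_apply, LinearEquiv.coe_coe]
  have h1 : fstL A (inl A a) = a := rfl
  have h2 : sndL A (inl A a) = 0 := rfl
  rw [h1, h2, map_zero, map_zero, add_zero, DirectSum.decomposeLinearEquiv_apply,
    DirectSum.decompose_of_mem A.gr ha, ← DirectSum.lof_eq_of R, DirectSum.toModule_lof]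
  rfl

theorem decomp_inr (n : ℤ) {a : A.carrier} (ha : a ∈ A.gr n) :
    decomp A (inr A a) = DirectSum.lof R ℤ (fun n => gr A n) (n - 1) (inrGr A n ⟨a, ha⟩) := by
  simp only [decomp, LinearMap.add_apply, LinearMap.comp_apply, LinearEquiv.coe_coe]
  have h1 : fstL A (inr A a) = 0 := rfl
  have h2 : sndL A (inr A a) = a := rfl
  rw [h1, h2, map_zero, map_zero, zero_add, DirectSum.decomposeLinearEquiv_apply,
    DirectSum.decompose_of_mem A.gr ha, ← DirectSum.lof_eq_of R, DirectSum.toModule_lof]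
  rfl

theorem eq_inl_add_inr (x : A.Eps) : x = inl A x.fst + inr A x.snd := by
  ext <;> simp [inl, inr]

theorem coe_decomp_inl (a : A.carrier) :
    DirectSum.coeLinearMap (gr A) (decomp A (inl A a)) = inl A a := by
  induction a using A.induction_gr with
  | hadd x y hx hy => simp only [map_add, hx, hy]
  | h i a ha => rw [decomp_inl i ha, DirectSum.coeLinearMap_lof]; rfl

theorem coe_decomp_inr (b : A.carrier) :
    DirectSum.coeLinearMap (gr A) (decomp A (inr A b)) = inr A b := by
  induction b using A.induction_gr with
  | hadd x y hx hy => simp only [map_add, hx, hy]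
  | h i a ha => rw [decomp_inr i ha, DirectSum.coeLinearMap_lof]; rfl

theorem lof_congr {m n : ℤ} (h : m = n) (x : gr A m) (y : gr A n)
    (hxy : (x : A.Eps) = y) :
    DirectSum.lof R ℤ (fun n => gr A n) m x = DirectSum.lof R ℤ (fun n => gr A n) n y := by
  subst h
  rw [Subtype.ext hxy]

theorem decomp_inr' (n : ℤ) {b : A.carrier} (hb : b ∈ A.gr (n + 1)) :
    decomp A (inr A b) =
      DirectSum.lof R ℤ (fun n => gr A n) n ⟨inr A b, ⟨zero_mem _, hb⟩⟩ := by
  rw [decomp_inr (n + 1) hb]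
  exact lof_congr (by ring) _ _ rfl

instance : DirectSum.Decomposition (gr A) :=
  DirectSum.Decomposition.ofLinearMap (gr A) (decomp A)
    (LinearMap.ext fun x => by
      rw [eq_inl_add_inr x, LinearMap.comp_apply, map_add, map_add, coe_decomp_inl,
        coe_decomp_inr, LinearMap.id_apply])
    (DirectSum.linearMap_ext R fun n => LinearMap.ext fun x => by
      obtain ⟨x, hx⟩ := x
      have h : decomp A x = decomp A (inl A x.fst) + decomp A (inr A x.snd) := by
        rw [← map_add, ← eq_inl_add_inr]
      simp only [LinearMap.comp_apply, DirectSum.coeLinearMap_lof, LinearMap.id_apply]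
      rw [h, decomp_inl n hx.1, decomp_inr' n hx.2, ← map_add]
      exact lof_congr rfl _ _ (eq_inl_add_inr x).symm)

instance : GradedAlgebra (gr A) where
  one_mem := ⟨SetLike.GradedOne.one_mem, zero_mem _⟩
  mul_mem i j x y hx hy := by
    refine ⟨SetLike.GradedMul.mul_mem hx.1 hy.1, add_mem ?_ ?_⟩
    · have := SetLike.GradedMul.mul_mem hx.2 hy.1
      rwa [show i + 1 + j = i + j + 1 by ring] at this
    · have := SetLike.GradedMul.mul_mem (A.twist_mem 1 i hx.1) hy.2
      rwa [← add_assoc] at this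

end Eps

/-- The differential graded algebra `A[ε]` with `d ε = z`, that is
`d (a + ε b) = d a + z b - ε (d b)`, for a central cocycle `z`. -/
def adjoinEps {R : Type u} [CommRing R] (A : DGA R) (z : A.carrier)
    (hz : A.IsCentralCocycle z) : DGA R where
  carrier := A.Eps
  gr := Eps.gr A
  d :=
    { toFun := fun x => ⟨A.d x.fst + z * x.snd, -A.d x.snd⟩
      map_add' := fun x y => by
        ext <;> simp [mul_add] <;> abel
      map_smul' := fun c x => by
        ext <;> simp }
  d_mem := fun n x hx => by
    refine ⟨add_mem (A.d_mem n _ hx.1) ?_, neg_mem (A.d_mem _ _ hx.2)⟩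
    have := SetLike.GradedMul.mul_mem hz.mem hx.2
    rwa [zero_add] at this
  d_d := fun x => by
    have h := A.leibniz 0 z x.snd hz.mem
    rw [hz.closed] at h
    ext
    · simp [A.d_d, h]
    · simp [A.d_d]
  leibniz := fun n x y hx => by
    have h1 := A.leibniz n x.fst y.fst hx.1
    have h2 := A.leibniz n x.fst y.snd hx.1
    have h3 := A.leibniz (n + 1) x.snd y.fst hx.2
    have h4 := A.twist_of_mem 1 n hx.1
    have h5 := A.twist_of_mem 1 (n + 1) (A.d_mem n _ hx.1)
    have h6 : A.twist 1 (z * x.snd) = (n + 1).negOnePow • (z * x.snd) := by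
      rw [twist_mul, A.twist_of_mem 1 0 hz.mem, A.twist_of_mem 1 (n + 1) hx.2, one_mul]
      rw [Int.negOnePow_zero, one_smul, one_mul, Units.smul_def, mul_smul_comm]
      rfl
    have h7 : ∀ a b : A.carrier, a * (z * b) = z * (a * b) := fun a b => by
      rw [← mul_assoc, ← hz.central, mul_assoc]
    rw [one_mul] at h4 h5
    rw [Int.negOnePow_succ] at h3 h5 h6
    rcases Int.even_or_odd n with hn | hn
    · rw [Int.negOnePow_even n hn] at h1 h2 h3 h4 h5 h6 ⊢
      simp only [one_smul, Units.neg_smul] at h1 h2 h3 h4 h5 h6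
      ext
      · simp only [Eps.fst_mul, Eps.snd_mul, LinearMap.coe_mk, AddHom.coe_mk, Eps.fst_add, h1, h4,
          one_smul, mul_add, add_mul, h7, mul_assoc]
        abel
      · simp only [Eps.fst_mul, Eps.snd_mul, LinearMap.coe_mk, AddHom.coe_mk, Eps.snd_add,
          map_add, h2, h3, h4, h5, h6, one_smul, mul_add, add_mul, h7, mul_assoc, neg_mul, mul_neg]
        abel
    · rw [Int.negOnePow_odd n hn] at h1 h2 h3 h4 h5 h6 ⊢
      simp only [one_smul, Units.neg_smul, neg_neg] at h1 h2 h3 h4 h5 h6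
      rw [Units.neg_smul, one_smul]
      ext
      · simp only [Eps.fst_mul, Eps.snd_mul, LinearMap.coe_mk, AddHom.coe_mk, Eps.fst_add, h1, h4,
          Eps.fst_neg, mul_add, add_mul, h7, mul_assoc, neg_mul, mul_neg]
        abel
      · simp only [Eps.fst_mul, Eps.snd_mul, LinearMap.coe_mk, AddHom.coe_mk, Eps.snd_add,
          map_add, map_neg, h2, h3, h4, h5, h6, Eps.snd_neg, mul_add, add_mul, h7,
          mul_assoc, neg_mul, mul_neg]
        abel

theorem isCentralCocycle_sub {R : Type u} [CommRing R] (A : DGA R) {W : A.carrier}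
    (hW : A.IsCentralCocycle W) :
    (A.baseChange R[X]).IsCentralCocycle
      ((X : R[X]) ⊗ₜ[R] (1 : A.carrier) - (1 : R[X]) ⊗ₜ[R] W) where
  mem := sub_mem (Submodule.tmul_mem_baseChange_of_mem _ SetLike.GradedOne.one_mem)
    (Submodule.tmul_mem_baseChange_of_mem _ hW.mem)
  closed := by
    have h1 : A.d 1 = 0 := by
      have := A.leibniz 0 1 1 SetLike.GradedOne.one_mem
      simpa using this
    change A.d.baseChange R[X] _ = 0
    rw [map_sub, LinearMap.baseChange_tmul, LinearMap.baseChange_tmul, h1, hW.closed]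
    simp
  central := fun a => by
    change R[X] ⊗[R] A.carrier at a
    change (_ : R[X] ⊗[R] A.carrier) * a = a * _
    induction a using TensorProduct.induction_on with
    | zero => simp
    | tmul s x => simp [sub_mul, mul_sub, hW.central, mul_comm]
    | add x y hx hy => rw [mul_add, add_mul, hx, hy]

/-- The `R[t]`-linear differential graded algebra `A_t = A[t, ε]`, where `|t| = 0`, `|ε| = -1`,
with differential `d_A + (t - W) ∂_ε`. -/
def fibre {R : Type u} [CommRing R] (A : DGA R) (W : A.carrier)
    (hW : A.IsCentralCocycle W) : DGA R[X] :=
  (A.baseChange R[X]).adjoinEps _ (A.isCentralCocycle_sub hW)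

/-- `A_{t,1/p} = R[t,1/p] ⊗ A_t`, over the localization `R[t,1/p]` of `R[t]`. -/
def fibreAway {R : Type u} [CommRing R] (A : DGA R) (W : A.carrier)
    (hW : A.IsCentralCocycle W) (p : R[X]) : DGA (Localization.Away p) :=
  (A.fibre W hW).baseChange (Localization.Away p)

/-! ### Differential graded bimodules, the derived category, and smoothness -/

/-- A differential graded `A`-bimodule, with `R` acting in the same way on both sides. This is the
same as a differential graded module over `A ⊗[R] A^opp`. -/
structure Bimod {R : Type u} [CommRing R] (A : DGA R) where
  carrier : Type u
  [addCommGroup : AddCommGroup carrier]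
  [module : Module R carrier]
  /-- the left action -/
  lact : A.carrier →ₐ[R] Module.End R carrier
  /-- the right action -/
  ract : A.carrierᵐᵒᵖ →ₐ[R] Module.End R carrier
  lact_ract : ∀ a b m, lact a (ract b m) = ract b (lact a m)
  gr : ℤ → Submodule R carrier
  isInternal : DirectSum.IsInternal gr
  lact_mem : ∀ i j a m, a ∈ A.gr i → m ∈ gr j → lact a m ∈ gr (i + j)
  ract_mem : ∀ i j a m, a ∈ A.gr i → m ∈ gr j → ract (MulOpposite.op a) m ∈ gr (j + i)
  d : carrier →ₗ[R] carrier
  d_mem : ∀ i m, m ∈ gr i → d m ∈ gr (i + 1)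
  d_d : ∀ m, d (d m) = 0
  d_lact : ∀ i a m, a ∈ A.gr i →
    d (lact a m) = lact (A.d a) m + i.negOnePow • lact a (d m)
  d_ract : ∀ j a m, m ∈ gr j →
    d (ract (MulOpposite.op a) m) =
      ract (MulOpposite.op a) (d m) + j.negOnePow • ract (MulOpposite.op (A.d a)) m

namespace Bimod

attribute [instance] Bimod.addCommGroup Bimod.module

/-- Bimodule maps of degree `0` which commute with the differential. -/
@[ext]
structure Hom {R : Type u} [CommRing R] {A : DGA R} (M N : Bimod A) where
  map : M.carrier →ₗ[R] N.carrier
  map_lact : ∀ a m, map (M.lact a m) = N.lact a (map m)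
  map_ract : ∀ a m, map (M.ract a m) = N.ract a (map m)
  map_mem : ∀ i m, m ∈ M.gr i → map m ∈ N.gr i
  map_d : ∀ m, map (M.d m) = N.d (map m)

instance {R : Type u} [CommRing R] (A : DGA R) : Category.{u} (Bimod A) where
  Hom := Hom
  id M := ⟨LinearMap.id, fun _ _ => rfl, fun _ _ => rfl, fun _ _ h => h, fun _ => rfl⟩
  comp f g := ⟨g.map ∘ₗ f.map, fun a m => by simp [f.map_lact, g.map_lact],
    fun a m => by simp [f.map_ract, g.map_ract],
    fun i m h => g.map_mem i _ (f.map_mem i m h), fun m => by simp [f.map_d, g.map_d]⟩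

/-- The total cohomology `ker d / im d`, the direct sum of its graded pieces. -/
abbrev Cohomology {R : Type u} [CommRing R] {A : DGA R} (M : Bimod A) : Type u :=
  LinearMap.ker M.d ⧸ (LinearMap.range M.d).submoduleOf (LinearMap.ker M.d)

def cocyclesMap {R : Type u} [CommRing R] {A : DGA R} {M N : Bimod A} (f : M ⟶ N) :
    LinearMap.ker M.d →ₗ[R] LinearMap.ker N.d :=
  (Hom.map f).restrict fun m hm => by
    rw [LinearMap.mem_ker] at hm ⊢
    rw [← Hom.map_d, hm, map_zero]

/-- The map induced on cohomology. -/
def cohomologyMap {R : Type u} [CommRing R] {A : DGA R} {M N : Bimod A} (f : M ⟶ N) :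
    M.Cohomology →ₗ[R] N.Cohomology :=
  Submodule.mapQ _ _ (cocyclesMap f) (by
    rintro ⟨_, hm⟩ ⟨x, rfl⟩
    exact ⟨Hom.map f x, (Hom.map_d f x).symm⟩)

/-- A map of bimodules is a quasi-isomorphism if it is bijective on cohomology. -/
def quasiIso {R : Type u} [CommRing R] (A : DGA R) : MorphismProperty (Bimod A) :=
  fun _ _ f => Function.Bijective (cohomologyMap f)

/-- The derived category `D(A ⊗[R] A^opp)` of `A`-bimodules, obtained from the category of
differential graded bimodules by inverting quasi-isomorphisms. -/
abbrev Derived {R : Type u} [CommRing R] (A : DGA R) : Type (u + 1) :=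
  (quasiIso A).Localization

/-- The diagonal bimodule. -/
def diagonal {R : Type u} [CommRing R] (A : DGA R) : Bimod A where
  carrier := A.carrier
  lact := Algebra.lmul R A.carrier
  ract := Algebra.lsmul R R A.carrier
  lact_ract a b m := by simp [mul_assoc]
  gr := A.gr
  isInternal := DirectSum.Decomposition.isInternal A.gr
  lact_mem _ _ _ _ ha hm := SetLike.GradedMul.mul_mem ha hm
  ract_mem _ _ _ _ ha hm := SetLike.GradedMul.mul_mem hm ha
  d := A.d
  d_mem := A.d_mem
  d_d := A.d_d
  d_lact i a m ha := A.leibniz i a m ha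
  d_ract j a m hm := A.leibniz j m a hm

end Bimod

/-- Compactness of an object `P` of an additive category with coproducts: `Hom (P, -)` commutes
with coproducts, that is, every morphism from `P` to a coproduct factors through a finite
subcoproduct. (The canonical map `⨁ Hom (P, M i) → Hom (P, ∐ M)` is always injective; the
condition says that it is onto.) -/
def IsCompactObject {C : Type (u + 1)} [Category C] (P : C) : Prop :=
  ∀ (ι : Type u) (M : ι → C) (c : Cofan M) (_ : IsColimit c) (f : P ⟶ c.pt),
    ∃ (s : Finset ι) (c' : Cofan fun i : s => M i) (hc' : IsColimit c') (g : P ⟶ c'.pt),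
      g ≫ Cofan.IsColimit.desc hc' (fun i => c.inj i) = f

/-- A differential graded algebra `A` over `R` is (homologically) smooth if the diagonal bimodule
is perfect, which means a compact object of `D(A ⊗[R] A^opp)`. -/
def IsSmooth {R : Type u} [CommRing R] (A : DGA R) : Prop :=
  IsCompactObject ((Bimod.quasiIso A).Q.obj (Bimod.diagonal A))

/-! ### Hochschild cohomology of the curved deformation `A_q`

`A_q = A[[q]]`, with `|q| = 2`, is a curved differential graded algebra over `R[[q]]` with
curvature `q W`. Its (normalized, `q`-completed) Hochschild cochains are formal power series
`φ = ∑ q ^ k φ_k` whose coefficients `φ_k` are sequences of multilinear maps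
`φ_k^l : A × ⋯ × A → A` (`l` inputs). -/

/-- The ambient module of all families of functions `φ_k^l`. -/
abbrev PreCochain {R : Type u} [CommRing R] (A : DGA R) : Type u :=
  ∀ (_k l : ℕ), (Fin l → A.carrier) → A.carrier

/-- The Hochschild cochains of `A_q` of degree `n`: each `φ_k^l` is multilinear, vanishes if some
input is the unit, and has degree `n - 2 k - l`. -/
def cochains {R : Type u} [CommRing R] (A : DGA R) (n : ℤ) : Submodule R A.PreCochain where
  carrier := {φ | ∀ k l,
    (∃ m : MultilinearMap R (fun _ : Fin l => A.carrier) A.carrier, ⇑m = φ k l) ∧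
    (∀ a, (∃ i, a i = 1) → φ k l a = 0) ∧
    ∀ (e : Fin l → ℤ) (a : Fin l → A.carrier), (∀ i, a i ∈ A.gr (e i)) →
      φ k l a ∈ A.gr (n - 2 * k - l + ∑ i, e i)}
  add_mem' {φ ψ} hφ hψ k l := by
    obtain ⟨⟨m, hm⟩, h1, h2⟩ := hφ k l
    obtain ⟨⟨m', hm'⟩, h1', h2'⟩ := hψ k l
    refine ⟨⟨m + m', ?_⟩, fun a ha => ?_, fun e a ha => add_mem (h2 e a ha) (h2' e a ha)⟩
    · funext a; simp [← hm, ← hm']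
    · simp [h1 a ha, h1' a ha]
  zero_mem' k l := ⟨⟨0, rfl⟩, fun _ _ => rfl, fun _ _ _ => zero_mem _⟩
  smul_mem' c {φ} hφ k l := by
    obtain ⟨⟨m, hm⟩, h1, h2⟩ := hφ k l
    refine ⟨⟨c • m, ?_⟩, fun a ha => ?_, fun e a ha => Submodule.smul_mem _ _ (h2 e a ha)⟩
    · funext a; simp [← hm]
    · simp [h1 a ha]

/-- The part of the differential coming from `d_A`:
`d φ(a₁,…,a_l) + ∑_j (-1) ^ (‖a₁‖+⋯+‖a_j‖+n) φ(a₁,…,d a_{j+1},…,a_l)`, where `‖a‖ = |a| - 1`.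
Note that `(-1) ^ (‖a₁‖+⋯+‖a_j‖)` is `(-1) ^ j` times the effect of applying `twist 1` to
`a₁,…,a_j`. -/
def dInternal {R : Type u} [CommRing R] (A : DGA R) (n : ℤ) :
    A.PreCochain →ₗ[R] A.PreCochain where
  toFun φ k l a := A.d (φ k l a) + ∑ j : Fin l, (n + (j : ℕ)).negOnePow •
    φ k l (fun i => if i < j then A.twist 1 (a i) else if i = j then A.d (a i) else a i)
  map_add' φ ψ := by
    funext k l a
    simp only [Pi.add_apply, map_add, smul_add, Finset.sum_add_distrib]
    abel
  map_smul' c φ := by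
    funext k l a
    simp only [Pi.smul_apply, map_smul, RingHom.id_apply, smul_add, Finset.smul_sum]
    congr 1
    exact Finset.sum_congr rfl fun _ _ => smul_comm _ _ _

/-- The part of the differential coming from the multiplication:
`- (-1) ^ (n ‖a₁‖) a₁ φ(a₂,…,a_l)
  - ∑_j (-1) ^ (‖a₁‖+⋯+‖a_{j+1}‖+n) φ(a₁,…,a_{j+1} a_{j+2},…,a_l)
  + (-1) ^ (‖a₁‖+⋯+‖a_{l-1}‖+n) φ(a₁,…,a_{l-1}) a_l`. -/
def dProduct {R : Type u} [CommRing R] (A : DGA R) (n : ℤ) :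
    A.PreCochain →ₗ[R] A.PreCochain where
  toFun φ k l := match l with
    | 0 => fun _ => 0
    | l + 1 => fun a =>
      -(n.negOnePow • (A.twist n (a 0) * φ k l (Fin.tail a)))
      - ∑ j : Fin l, (n + (j : ℕ) + 1).negOnePow •
          φ k l (Fin.contractNth j.castSucc (· * ·)
            (fun i => if i ≤ j.castSucc then A.twist 1 (a i) else a i))
      + (n + l).negOnePow • (φ k l (fun i => A.twist 1 (Fin.init a i)) * a (Fin.last l))
  map_add' φ ψ := by
    funext k l a
    cases l with
    | zero => simp
    | succ l =>
      simp only [Pi.add_apply, mul_add, add_mul, smul_add, Finset.sum_add_distrib]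
      abel
  map_smul' c φ := by
    funext k l a
    cases l with
    | zero => simp
    | succ l =>
      simp only [Pi.smul_apply, RingHom.id_apply, smul_add, smul_sub, smul_neg, Finset.smul_sum,
        mul_smul_comm, smul_mul_assoc, smul_comm c]

/-- The part of the differential coming from the curvature `q W`:
`q ∑_j (-1) ^ (‖a₁‖+⋯+‖a_j‖+n) φ(a₁,…,a_j,W,a_{j+1},…,a_l)`. -/
def dCurvature {R : Type u} [CommRing R] (A : DGA R) (W : A.carrier) (n : ℤ) :
    A.PreCochain →ₗ[R] A.PreCochain where
  toFun φ k l a := match k with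
    | 0 => 0
    | k + 1 => ∑ j : Fin (l + 1), (n + (j : ℕ)).negOnePow •
        φ k (l + 1) (Fin.insertNth j W fun i => if i.castSucc < j then A.twist 1 (a i) else a i)
  map_add' φ ψ := by
    funext k l a
    cases k with
    | zero => simp
    | succ k => simp only [Pi.add_apply, smul_add, Finset.sum_add_distrib]
  map_smul' c φ := by
    funext k l a
    cases k with
    | zero => simp
    | succ k => simp only [Pi.smul_apply, RingHom.id_apply, Finset.smul_sum, smul_comm c]

/-- The differential on Hochschild cochains of `A_q` of degree `n`. -/
def dHochschild {R : Type u} [CommRing R] (A : DGA R) (W : A.carrier) (n : ℤ) :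
    A.PreCochain →ₗ[R] A.PreCochain :=
  A.dInternal n + A.dProduct n + A.dCurvature W n

/-- Hochschild cocycles of degree `n`. -/
def cocycles {R : Type u} [CommRing R] (A : DGA R) (W : A.carrier) (n : ℤ) :
    Submodule R A.PreCochain :=
  A.cochains n ⊓ LinearMap.ker (A.dHochschild W n)

/-- Hochschild coboundaries of degree `n`. -/
def coboundaries {R : Type u} [CommRing R] (A : DGA R) (W : A.carrier) (n : ℤ) :
    Submodule R A.PreCochain :=
  (A.cochains (n - 1)).map (A.dHochschild W (n - 1))

/-- The Hochschild cohomology group `HH^n(A_q)`. -/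
abbrev HH {R : Type u} [CommRing R] (A : DGA R) (W : A.carrier) (n : ℤ) : Type u :=
  A.cocycles W n ⧸ (A.coboundaries W n).submoduleOf (A.cocycles W n)

/-- The cup product `φ ⌣ ψ`, where `ψ` has degree `m`:
`(φ ⌣ ψ)(a₁,…,a_l) = ∑_j (-1) ^ (m (‖a₁‖+⋯+‖a_j‖)) φ(a₁,…,a_j) ψ(a_{j+1},…,a_l)`,
extended `q`-bilinearly. -/
def cup {R : Type u} [CommRing R] (A : DGA R) (m : ℤ) (φ ψ : A.PreCochain) : A.PreCochain :=
  fun k l a => ∑ k' ∈ Finset.HasAntidiagonal.antidiagonal k, ∑ j : Fin (l + 1), (m * (j : ℕ)).negOnePow •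
    (φ k'.1 j (fun i => A.twist m (a (Fin.castLE (Nat.lt_succ_iff.mp j.2) i))) *
      ψ k'.2 (l - j) (fun i => a ⟨j + i, by omega⟩))

/-- An element of `A`, as a Hochschild cochain with no inputs and no powers of `q`. -/
def const {R : Type u} [CommRing R] (A : DGA R) (x : A.carrier) : A.PreCochain :=
  fun k l _ => if k = 0 ∧ l = 0 then x else 0

/-- Powers with respect to the cup product of a cochain of degree `0`. -/
def cupPow {R : Type u} [CommRing R] (A : DGA R) (φ : A.PreCochain) : ℕ → A.PreCochain
  | 0 => A.const 1
  | i + 1 => A.cup 0 φ (A.cupPow φ i)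

/-- The value of a polynomial on a cochain of degree `0`, with respect to the cup product. -/
def cupEval {R : Type u} [CommRing R] (A : DGA R) (p : R[X]) (φ : A.PreCochain) :
    A.PreCochain :=
  p.sum fun i c => c • A.cupPow φ i

/-- Multiplication by `q ^ r`. -/
def qMul {R : Type u} [CommRing R] (A : DGA R) (r : ℕ) (φ : A.PreCochain) : A.PreCochain :=
  fun k l a => if r ≤ k then φ (k - r) l a else 0

theorem cup_const {R : Type u} [CommRing R] (A : DGA R) (x y : A.carrier) :
    A.cup 0 (A.const x) (A.const y) = A.const (x * y) := by
  funext k l a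
  by_cases h : k = 0 ∧ l = 0
  · obtain ⟨rfl, rfl⟩ := h
    simp [cup, const]
  · have h0 : A.const (x * y) k l a = 0 := by simp [const, h]
    rw [h0, cup]
    refine Finset.sum_eq_zero fun k' hk' => Finset.sum_eq_zero fun j _ => ?_
    rw [Finset.HasAntidiagonal.mem_antidiagonal] at hk'
    have hj := j.2
    by_cases h1 : k'.1 = 0 ∧ (j : ℕ) = 0
    · have h2 : ¬(k'.2 = 0 ∧ l - (j : ℕ) = 0) := by omega
      simp only [const, if_neg h2, mul_zero, smul_zero]
    · simp only [const, if_neg h1, zero_mul, smul_zero]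

theorem cupPow_const {R : Type u} [CommRing R] (A : DGA R) (x : A.carrier) (i : ℕ) :
    A.cupPow (A.const x) i = A.const (x ^ i) := by
  induction i with
  | zero => simp [cupPow]
  | succ i ih => rw [cupPow, ih, cup_const, pow_succ']

theorem cupEval_const {R : Type u} [CommRing R] (A : DGA R) (p : R[X]) (x : A.carrier) :
    A.cupEval p (A.const x) = A.const (aeval x p) := by
  funext k l a
  rw [cupEval, Polynomial.sum_def, aeval_eq_sum_range' (Nat.lt_succ_self _),
    Finset.sum_apply, Finset.sum_apply, Finset.sum_apply]
  simp only [cupPow_const, Pi.smul_apply, const]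
  split_ifs
  · refine Finset.sum_subset (fun i hi => ?_) fun i _ hi => ?_
    · exact Finset.mem_range.mpr (Nat.lt_succ_of_le (le_natDegree_of_mem_supp i hi))
    · rw [notMem_support_iff.mp hi, zero_smul]
  · simp

theorem qMul_const_mem_cocycles {R : Type u} [CommRing R] (A : DGA R) (W : A.carrier) (r : ℕ)
    {x : A.carrier} (hx : A.IsCentralCocycle x) :
    A.qMul r (A.const x) ∈ A.cocycles W (2 * r) := by
  have h0 : ∀ k l a, l ≠ 0 → A.qMul r (A.const x) k l a = 0 := fun k l a hl => by
    simp [qMul, const, hl]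
  have h1 : ∀ k (a b : Fin 0 → A.carrier),
      A.qMul r (A.const x) k 0 a = A.qMul r (A.const x) k 0 b := fun k a b => rfl
  have h2 : ∀ k a, A.IsCentralCocycle (A.qMul r (A.const x) k 0 a) := fun k a => by
    have hz : A.IsCentralCocycle 0 := ⟨zero_mem _, map_zero _, fun a => by simp⟩
    simp only [qMul, const]
    split_ifs <;> assumption
  refine ⟨fun k l => ?_, ?_⟩
  · cases l with
    | zero =>
      refine ⟨⟨MultilinearMap.constOfIsEmpty R _ (A.qMul r (A.const x) k 0 Fin.elim0), ?_⟩,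
        fun a ⟨i, _⟩ => i.elim0, fun e a _ => ?_⟩
      · funext a; exact h1 k _ _
      · by_cases hk : k = r
        · subst hk
          simpa using (h2 k a).mem
        · have : A.qMul r (A.const x) k 0 a = 0 := by
            simp only [qMul, const]
            split_ifs with h h'
            · omega
            · rfl
            · rfl
          rw [this]; exact zero_mem _
    | succ l =>
      have h : A.qMul r (A.const x) k (l + 1) = fun _ => 0 := by
        funext a; exact h0 k _ a (Nat.succ_ne_zero l)
      rw [h]
      exact ⟨⟨0, rfl⟩, fun _ _ => rfl, fun _ _ _ => zero_mem _⟩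
  · rw [SetLike.mem_coe, LinearMap.mem_ker]
    funext k l a
    have e1 : A.dInternal (2 * r) (A.qMul r (A.const x)) k l a = 0 := by
      cases l with
      | zero => simp [dInternal, (h2 k a).closed]
      | succ l => simp [dInternal, h0]
    have e2 : A.dProduct (2 * r) (A.qMul r (A.const x)) k l a = 0 := by
      cases l with
      | zero => rfl
      | succ l =>
        cases l with
        | succ l => simp [dProduct, h0]
        | zero =>
          have ht : ∀ b, A.twist (2 * r) b = b := fun b => by
            induction b using A.induction_gr with
            | hadd x y hx hy => rw [map_add, hx, hy]
            | h i b hb =>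
              rw [A.twist_of_mem _ i hb, mul_assoc, Int.negOnePow_two_mul, one_smul]
          have hc := (h2 k (Fin.tail a)).central (a 0)
          change -((2 * (r : ℤ)).negOnePow • (A.twist (2 * r) (a 0) *
              A.qMul r (A.const x) k 0 (Fin.tail a))) - Finset.sum Finset.univ _ +
            (2 * (r : ℤ) + (0 : ℕ)).negOnePow •
              (A.qMul r (A.const x) k 0 (Fin.tail a) * a 0) = 0
          rw [ht, Finset.univ_eq_empty, Finset.sum_empty, sub_zero, Nat.cast_zero, add_zero,
            Int.negOnePow_two_mul, one_smul, one_smul, hc, neg_add_cancel]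
    have e3 : A.dCurvature W (2 * r) (A.qMul r (A.const x)) k l a = 0 := by
      cases k with
      | zero => rfl
      | succ k => simp [dCurvature, h0]
    simp only [dHochschild, LinearMap.add_apply, Pi.add_apply, e1, e2, e3, add_zero,
      Pi.zero_apply]

theorem isCentralCocycle_aeval {R : Type u} [CommRing R] (A : DGA R) {W : A.carrier}
    (hW : A.IsCentralCocycle W) (p : R[X]) : A.IsCentralCocycle (aeval W p) := by
  have hadd : ∀ x y, A.IsCentralCocycle x → A.IsCentralCocycle y → A.IsCentralCocycle (x + y) :=
    fun x y hx hy => ⟨add_mem hx.mem hy.mem, by rw [map_add, hx.closed, hy.closed, add_zero],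
      fun a => by rw [add_mul, mul_add, hx.central, hy.central]⟩
  have hmul : ∀ x y, A.IsCentralCocycle x → A.IsCentralCocycle y → A.IsCentralCocycle (x * y) :=
    fun x y hx hy => ⟨by simpa using SetLike.GradedMul.mul_mem hx.mem hy.mem,
      by rw [A.leibniz 0 x y hx.mem, hx.closed, hy.closed]; simp,
      fun a => by rw [mul_assoc, hy.central, ← mul_assoc, hx.central, mul_assoc]⟩
  have h1 : A.d 1 = 0 := by
    simpa using A.leibniz 0 1 1 SetLike.GradedOne.one_mem
  have hc : ∀ c : R, A.IsCentralCocycle (algebraMap R A.carrier c) := fun c => by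
    rw [Algebra.algebraMap_eq_smul_one]
    exact ⟨Submodule.smul_mem _ _ SetLike.GradedOne.one_mem, by rw [map_smul, h1, smul_zero],
      fun a => by simp⟩
  induction p using Polynomial.induction_on with
  | C c => rw [aeval_C]; exact hc c
  | add p q hp hq => rw [map_add]; exact hadd _ _ hp hq
  | monomial n c h =>
    rw [pow_succ, ← mul_assoc, map_mul, aeval_X]
    exact hmul _ _ h hW

/-- The cochain `q ^ r p(W)`, where `p(W)` is formed with the cup product, is a cocycle. -/
theorem qMul_cupEval_mem_cocycles {R : Type u} [CommRing R] (A : DGA R) {W : A.carrier}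
    (hW : A.IsCentralCocycle W) (p : R[X]) (r : ℕ) :
    A.qMul r (A.cupEval p (A.const W)) ∈ A.cocycles W (2 * r) := by
  rw [cupEval_const]
  exact A.qMul_const_mem_cocycles W r (A.isCentralCocycle_aeval hW p)

/-- The class `q ^ r p([W])` in `HH^{2r}(A_q)`. -/
def qPolyClass {R : Type u} [CommRing R] (A : DGA R) {W : A.carrier}
    (hW : A.IsCentralCocycle W) (p : R[X]) (r : ℕ) : A.HH W (2 * r) :=
  Submodule.Quotient.mk
    ⟨A.qMul r (A.cupEval p (A.const W)), A.qMul_cupEval_mem_cocycles hW p r⟩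

end DGA

end

/-!
By transitivity of extension of constants (`epsTowerMap`), the dga in question is isomorphic to
`(R ⊗ A)[ε]` with `R = K[t, 1/p]` and `d ε = θ = t - W`, and smoothness is invariant under
isomorphism (`IsSmooth.of_bijective`). Its diagonal bimodule has an explicit resolution with a
periodicity operator. Assumption (ii) makes a power of that operator nullhomotopic, and assumption
(i) controls the finitely many steps that the operator kills.

**The derived category.** Homotopy classes of bimodule maps have a calculus of right fractions with
respect to quasi-isomorphisms, so that morphisms in the derived category are fractions
(`exists_roof`), direct sums of bimodules are coproducts (`directSumIsColimit`), and compactness of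
an object means that its maps to a direct sum factor through a finite partial sum
(`exists_finset_of_isCompactObject`, `isCompactObject_of_exists_finset`). From a semifree bimodule,
morphisms in the derived category are homotopy classes of maps (`SemiFree.exists_Q_map_eq`,
`SemiFree.homotopic_of_Q_map_eq`).

**The bar resolution.** Let `h` be a free variable of degree `-1` with `d h = 1`. The free product
of `A` with the polynomial algebra in `h` is contractible, since multiplication by `h` is a
contracting homotopy. The bar resolution of the diagonal bimodule of `A` is the quotient of this free
product by `A`, shifted (`AdaptedBasis.bar`, `AdaptedBasis.quasiIso_aug`). It is semifree because `A`
has, over a field, a homogeneous basis consisting of cocycles and of elements whose differentials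
are combinations of these cocycles (`nonempty_adaptedBasis`, `AdaptedBasis.semiFreeBar`). The
derivation `h ↦ h W h` induces an operator `ins W` on it, which squares to zero and is a homotopy
between the left and the right action of `W`.

**The resolution over `A[ε]`.** Write `A` for `R ⊗ A`. The diagonal bimodule of `A[ε]` is resolved by
the bimodule induced from the bar resolution of `A`, with divided power generators `x_k` of degree
`-2 k` adjoined, and with differential
`d (m x_k) = (d m) x_k + (ins W m - ε m ± m ε) x_{k-1}`
(`AdaptedBasis.res`, `AdaptedBasis.semiFreeRes`, `AdaptedBasis.quasiIso_resAug`). The map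
`m x_k ↦ m x_{k-r}` is an endomorphism of it of degree `2 r` (`AdaptedBasis.resDrop`).

**The nullhomotopy.** A Hochschild cochain of `A_q` is a sequence of bilinear maps from the bar
resolution to the diagonal, one for each power of `q`, and the curvature term of the differential is
composition with `ins W`. Hence a cochain that bounds `q ^ r p(W)` gives a homotopy between
zero and `p(W)` times the composition of `resDrop` with the augmentation (`AdaptedBasis.d_resLift`).
Now `p(t) = p(W) + (t - W) c'`, and `t - W = d ε` is a boundary, so `p(W)` may be replaced by the
scalar `p(t)`. As that is invertible in `R`, the map `resDrop` is nullhomotopic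
(`AdaptedBasis.exists_homotopy_resAug`, `AdaptedBasis.exists_homotopy_resDrop`).

**Finiteness.** Let `F` be a map from the resolution to a direct sum. Composing with the nullhomotopy
of `resDrop` gives a homotopy `g` between zero and `m x_k ↦ F (m x_{k-r})`. Smoothness of the
original algebra over `K` implies that a map from the bar resolution to a direct sum, even one of
bimodules over `R ⊗ A`, has values in a finite partial sum up to a coboundary if its own coboundary
has values in a finite partial sum (`AdaptedBasis.exists_finset_sub_coboundary`). Applied to the values of `g` on `m x_0, …, m x_{r-1}`
one after the other, this makes these values lie in a finite partial sum
(`AdaptedBasis.exists_finitelySupported`). Then `m x_k ↦ g (m x_{k+r})` is a homotopy between `F` and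
a map with values in that partial sum (`AdaptedBasis.exists_homotopic_finitelySupported`), so that
the diagonal bimodule is compact (`AdaptedBasis.isSmooth_adjoinEps`).
-/

noncomputable section

namespace DGA

/-! ### Signs and gradings -/

theorem map_negOnePow_smul {M N F : Type*} [AddCommGroup M] [AddCommGroup N] [FunLike F M N]
    [AddMonoidHomClass F M N] (f : F) (n : ℤ) (x : M) :
    f (n.negOnePow • x) = n.negOnePow • f x := by
  rw [Units.smul_def, Units.smul_def, map_zsmul]

theorem negOnePow_smul_self {M : Type*} [AddCommGroup M] (n : ℤ) (x : M) :
    n.negOnePow • n.negOnePow • x = x := by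
  rw [← mul_smul, Int.units_mul_self, one_smul]

theorem negOnePow_smul_mem {R M : Type*} [Ring R] [AddCommGroup M] [Module R M]
    (S : Submodule R M) (n : ℤ) {x : M} (hx : x ∈ S) : n.negOnePow • x ∈ S := by
  rw [Units.smul_def]; exact zsmul_mem hx _

theorem negOnePow_smul_mul {M : Type*} [Ring M] (n : ℤ) (x y : M) :
    (n.negOnePow • x) * y = n.negOnePow • (x * y) := by
  rw [Units.smul_def, Units.smul_def, smul_mul_assoc]

theorem mul_negOnePow_smul {M : Type*} [Ring M] (n : ℤ) (x y : M) :
    x * (n.negOnePow • y) = n.negOnePow • (x * y) := by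
  rw [Units.smul_def, Units.smul_def, mul_smul_comm]

theorem map_negOnePow_smul_apply {R M N F : Type*} [CommRing R] [AddCommGroup M]
    [AddCommGroup N] [Module R N] [FunLike F M (Module.End R N)]
    [AddMonoidHomClass F M (Module.End R N)] (f : F) (n : ℤ) (x : M) (y : N) :
    f (n.negOnePow • x) y = n.negOnePow • f x y := by
  rw [map_negOnePow_smul, Units.smul_def, Units.smul_def, LinearMap.smul_apply]

section Twist

variable {R : Type u} [CommRing R] (A : DGA R)

/-- The sign operator `twist n`, as an automorphism of the underlying algebra. -/
def twistHom (n : ℤ) : A.carrier →ₐ[R] A.carrier :=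
  AlgHom.ofLinearMap (A.twist n) (A.twist_one n) (A.twist_mul n)

@[simp] theorem twistHom_apply (n : ℤ) (a : A.carrier) : A.twistHom n a = A.twist n a := rfl

theorem twist_twist (m n : ℤ) (a : A.carrier) : A.twist m (A.twist n a) = A.twist (m + n) a := by
  induction a using A.induction_gr with
  | hadd x y hx hy => simp only [map_add, hx, hy]
  | h i a ha =>
    rw [A.twist_of_mem n i ha, map_negOnePow_smul, A.twist_of_mem m i ha,
      A.twist_of_mem (m + n) i ha, ← mul_smul, ← Int.negOnePow_add]
    congr 2; ring

theorem twist_even {n : ℤ} (hn : Even n) (a : A.carrier) : A.twist n a = a := by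
  induction a using A.induction_gr with
  | hadd x y hx hy => simp only [map_add, hx, hy]
  | h i a ha => rw [A.twist_of_mem n i ha, Int.negOnePow_even _ (hn.mul_right i), one_smul]

theorem twist_odd {n : ℤ} (hn : Odd n) (a : A.carrier) : A.twist n a = A.twist 1 a := by
  have : A.twist n a = A.twist 1 (A.twist (n - 1) a) := by rw [twist_twist]; congr 2; ring
  rw [this, twist_even A (hn.sub_odd odd_one)]

@[simp] theorem twist_zero (a : A.carrier) : A.twist 0 a = a := A.twist_even Even.zero a

@[simp] theorem twist_one_twist_one (a : A.carrier) : A.twist 1 (A.twist 1 a) = a := by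
  rw [twist_twist]; exact A.twist_even ⟨1, rfl⟩ a

theorem twist_d (n : ℤ) (a : A.carrier) :
    A.twist n (A.d a) = n.negOnePow • A.d (A.twist n a) := by
  induction a using A.induction_gr with
  | hadd x y hx hy => simp only [map_add, hx, hy, smul_add]
  | h i a ha =>
    rw [A.twist_of_mem n i ha, map_negOnePow_smul, A.twist_of_mem n (i + 1) (A.d_mem i a ha),
      ← mul_smul, ← Int.negOnePow_add]
    congr 2; ring

theorem twist_one_d (a : A.carrier) : A.twist 1 (A.d a) = -A.d (A.twist 1 a) := by
  rw [twist_d, Int.negOnePow_one, Units.neg_smul, one_smul]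

theorem d_mul (a b : A.carrier) : A.d (a * b) = A.d a * b + A.twist 1 a * A.d b := by
  induction a using A.induction_gr with
  | hadd x y hx hy => simp only [add_mul, map_add, hx, hy]; abel
  | h i a ha =>
    rw [A.leibniz i a b ha, A.twist_of_mem 1 i ha, one_mul, negOnePow_smul_mul]

theorem d_one : A.d 1 = 0 := by
  simpa using A.leibniz 0 1 1 SetLike.GradedOne.one_mem

end Twist

section Graded

variable {R M : Type*} [CommRing R] [AddCommGroup M] [Module R M]

/-- A family of submodules which has projections onto its members and spans is a grading. -/
theorem isInternal_of_proj (gr : ℤ → Submodule R M) (π : ℤ → M →ₗ[R] M)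
    (hsame : ∀ n m, m ∈ gr n → π n m = m)
    (hne : ∀ n k m, m ∈ gr n → k ≠ n → π k m = 0) (htop : ∀ m, m ∈ ⨆ n, gr n) :
    DirectSum.IsInternal gr := by
  have key : ∀ (x : ⨁ n, gr n) (n : ℤ), π n (DirectSum.coeLinearMap gr x) = x n := by
    intro x n
    induction x using DirectSum.induction_on with
    | zero => simp
    | of i y =>
      rw [← DirectSum.lof_eq_of R, DirectSum.coeLinearMap_lof]
      by_cases h : n = i
      · subst h
        rw [hsame n y y.2, DirectSum.lof_apply]
      · rw [hne i n y y.2 h, DirectSum.lof_eq_of, DirectSum.of_eq_of_ne _ _ _ h]; rfl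
    | add x y hx hy => simp only [map_add, hx, hy, DirectSum.add_apply, Submodule.coe_add]
  constructor
  · intro x y hxy
    ext n
    rw [← key x n, ← key y n]
    exact congrArg _ hxy
  · intro m
    have := htop m
    rw [← DirectSum.range_coeLinearMap] at this
    exact this

end Graded

namespace Bimod

variable {R : Type u} [CommRing R] {A : DGA R}

section Basic

variable (M : Bimod A)

/-- The projection of a bimodule onto its part of degree `n`. -/
def proj (n : ℤ) : M.carrier →ₗ[R] M.carrier :=
  (M.gr n).subtype ∘ₗ DirectSum.component R ℤ (fun n => M.gr n) n ∘ₗ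
    (LinearEquiv.ofBijective (DirectSum.coeLinearMap M.gr) M.isInternal).symm.toLinearMap

theorem proj_coe (x : ⨁ n, M.gr n) (n : ℤ) :
    M.proj n (DirectSum.coeLinearMap M.gr x) = x n := by
  have : (LinearEquiv.ofBijective (DirectSum.coeLinearMap M.gr) M.isInternal).symm
      (DirectSum.coeLinearMap M.gr x) = x :=
    (LinearEquiv.ofBijective (DirectSum.coeLinearMap M.gr) M.isInternal).symm_apply_apply x
  simp only [proj, LinearMap.comp_apply, LinearEquiv.coe_coe, this]
  rfl

theorem proj_mem (n : ℤ) (m : M.carrier) : M.proj n m ∈ M.gr n := Subtype.property _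

theorem proj_same {n : ℤ} {m : M.carrier} (hm : m ∈ M.gr n) : M.proj n m = m := by
  have := M.proj_coe (DirectSum.lof R ℤ (fun n => M.gr n) n ⟨m, hm⟩) n
  rwa [DirectSum.coeLinearMap_lof, DirectSum.lof_apply] at this

theorem proj_ne {n k : ℤ} {m : M.carrier} (hm : m ∈ M.gr n) (h : k ≠ n) : M.proj k m = 0 := by
  have := M.proj_coe (DirectSum.lof R ℤ (fun n => M.gr n) n ⟨m, hm⟩) k
  rwa [DirectSum.coeLinearMap_lof, DirectSum.lof_eq_of, DirectSum.of_eq_of_ne _ _ _ h] at this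

theorem mem_iSup_gr (m : M.carrier) : m ∈ ⨆ n, M.gr n := by
  rw [← DirectSum.range_coeLinearMap]
  exact M.isInternal.2 m

theorem induction_gr {P : M.carrier → Prop} (h : ∀ i, ∀ m ∈ M.gr i, P m)
    (hadd : ∀ a b, P a → P b → P (a + b)) (m : M.carrier) : P m :=
  Submodule.iSup_induction M.gr (motive := P) (M.mem_iSup_gr m) h (h 0 0 (zero_mem _)) hadd

/-- The sign operator on a bimodule: it multiplies elements of degree `i` by `(-1) ^ i`. -/
def sgn : M.carrier →ₗ[R] M.carrier :=
  (DirectSum.toModule R ℤ M.carrier fun i => i.negOnePow • (M.gr i).subtype) ∘ₗ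
    (LinearEquiv.ofBijective (DirectSum.coeLinearMap M.gr) M.isInternal).symm.toLinearMap

theorem sgn_of_mem {i : ℤ} {m : M.carrier} (hm : m ∈ M.gr i) : M.sgn m = i.negOnePow • m := by
  have : (LinearEquiv.ofBijective (DirectSum.coeLinearMap M.gr) M.isInternal).symm m =
      DirectSum.lof R ℤ (fun n => M.gr n) i ⟨m, hm⟩ := by
    rw [LinearEquiv.symm_apply_eq]
    exact (DirectSum.coeLinearMap_lof (R := R) M.gr i ⟨m, hm⟩).symm
  rw [sgn, LinearMap.comp_apply, LinearEquiv.coe_coe, this, DirectSum.toModule_lof]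
  rfl

theorem sgn_mem {i : ℤ} {m : M.carrier} (hm : m ∈ M.gr i) : M.sgn m ∈ M.gr i := by
  rw [M.sgn_of_mem hm]; exact negOnePow_smul_mem _ _ hm

@[simp] theorem sgn_sgn (m : M.carrier) : M.sgn (M.sgn m) = m := by
  induction m using M.induction_gr with
  | hadd x y hx hy => simp only [map_add, hx, hy]
  | h i m hm => rw [M.sgn_of_mem hm, map_negOnePow_smul, M.sgn_of_mem hm, negOnePow_smul_self]

theorem sgn_d (m : M.carrier) : M.sgn (M.d m) = -M.d (M.sgn m) := by
  induction m using M.induction_gr with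
  | hadd x y hx hy => simp only [map_add, hx, hy, neg_add]
  | h i m hm =>
    rw [M.sgn_of_mem hm, M.sgn_of_mem (M.d_mem i m hm), map_negOnePow_smul, Int.negOnePow_succ,
      Units.neg_smul]

theorem sgn_lact (a : A.carrier) (m : M.carrier) :
    M.sgn (M.lact a m) = M.lact (A.twist 1 a) (M.sgn m) := by
  induction m using M.induction_gr with
  | hadd x y hx hy => simp only [map_add, hx, hy]
  | h i m hm =>
    induction a using A.induction_gr with
    | hadd x y hx hy => simp only [map_add, hx, hy, LinearMap.add_apply]
    | h j a ha =>
      rw [M.sgn_of_mem hm, M.sgn_of_mem (M.lact_mem j i a m ha hm), A.twist_of_mem 1 j ha,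
        map_negOnePow_smul_apply, map_negOnePow_smul, one_mul, Int.negOnePow_add, mul_smul]

theorem sgn_ract (a : A.carrier) (m : M.carrier) :
    M.sgn (M.ract (MulOpposite.op a) m) = M.ract (MulOpposite.op (A.twist 1 a)) (M.sgn m) := by
  induction m using M.induction_gr with
  | hadd x y hx hy => simp only [map_add, hx, hy]
  | h i m hm =>
    induction a using A.induction_gr with
    | hadd x y hx hy => simp only [map_add, hx, hy, LinearMap.add_apply, MulOpposite.op_add]
    | h j a ha =>
      rw [M.sgn_of_mem hm, M.sgn_of_mem (M.ract_mem j i a m ha hm), A.twist_of_mem 1 j ha,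
        MulOpposite.op_smul, map_negOnePow_smul_apply, map_negOnePow_smul, one_mul,
        Int.negOnePow_add, mul_smul, ← mul_smul, mul_comm, mul_smul]

theorem d_lact' (a : A.carrier) (m : M.carrier) :
    M.d (M.lact a m) = M.lact (A.d a) m + M.lact (A.twist 1 a) (M.d m) := by
  induction a using A.induction_gr with
  | hadd x y hx hy => simp only [map_add, LinearMap.add_apply, hx, hy]; abel
  | h i a ha =>
    rw [M.d_lact i a m ha, A.twist_of_mem 1 i ha, one_mul, map_negOnePow_smul_apply]

theorem d_ract' (a : A.carrier) (m : M.carrier) :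
    M.d (M.ract (MulOpposite.op a) m) = M.ract (MulOpposite.op a) (M.d m) +
      M.ract (MulOpposite.op (A.d a)) (M.sgn m) := by
  induction m using M.induction_gr with
  | hadd x y hx hy => simp only [map_add, hx, hy]; abel
  | h i m hm => rw [M.d_ract i a m hm, M.sgn_of_mem hm, map_negOnePow_smul]

end Basic

/-! ### Bilinear maps of arbitrary degree -/

/-- A linear map of degree `n` between bimodules which is compatible with the two actions, with
the Koszul sign on the left: `f (a m) = (-1) ^ (n |a|) a (f m)`. No compatibility with the
differentials is asked for. -/
structure IsBi {M N : Bimod A} (n : ℤ) (f : M.carrier →ₗ[R] N.carrier) : Prop where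
  lact : ∀ a m, f (M.lact a m) = N.lact (A.twist n a) (f m)
  ract : ∀ a m, f (M.ract a m) = N.ract a (f m)
  mem : ∀ i m, m ∈ M.gr i → f m ∈ N.gr (i + n)

namespace IsBi

variable {M N L : Bimod A} {m n : ℤ} {f g : M.carrier →ₗ[R] N.carrier}

theorem add (hf : IsBi n f) (hg : IsBi n g) : IsBi n (f + g) where
  lact a m := by simp only [LinearMap.add_apply, hf.lact, hg.lact, map_add]
  ract a m := by simp only [LinearMap.add_apply, hf.ract, hg.ract, map_add]
  mem i m hm := add_mem (hf.mem i m hm) (hg.mem i m hm)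

theorem neg (hf : IsBi n f) : IsBi n (-f) where
  lact a m := by simp only [LinearMap.neg_apply, hf.lact, map_neg]
  ract a m := by simp only [LinearMap.neg_apply, hf.ract, map_neg]
  mem i m hm := neg_mem (hf.mem i m hm)

theorem sub (hf : IsBi n f) (hg : IsBi n g) : IsBi n (f - g) := by
  rw [sub_eq_add_neg]; exact hf.add hg.neg

theorem zero : IsBi n (0 : M.carrier →ₗ[R] N.carrier) where
  lact a m := by simp
  ract a m := by simp
  mem i m _ := zero_mem _

theorem smul (c : R) (hf : IsBi n f) : IsBi n (c • f) where
  lact a m := by simp only [LinearMap.smul_apply, hf.lact, map_smul]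
  ract a m := by simp only [LinearMap.smul_apply, hf.ract, map_smul]
  mem i m hm := Submodule.smul_mem _ c (hf.mem i m hm)

theorem comp {g : N.carrier →ₗ[R] L.carrier} (hg : IsBi m g) (hf : IsBi n f) :
    IsBi (n + m) (g ∘ₗ f) where
  lact a x := by
    rw [LinearMap.comp_apply, hf.lact, hg.lact, twist_twist, add_comm m]; rfl
  ract a x := by simp only [LinearMap.comp_apply, hf.ract, hg.ract]
  mem i x hx := by rw [← add_assoc]; exact hg.mem _ _ (hf.mem _ _ hx)

/-- The coboundary of a bilinear map, its graded commutator with the differentials. -/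
theorem d_comp (hf : IsBi n f) : IsBi (n + 1) (N.d ∘ₗ f + (n + 1).negOnePow • (f ∘ₗ M.d)) where
  lact a x := by
    simp only [LinearMap.add_apply, LinearMap.comp_apply, Units.smul_def, LinearMap.smul_apply]
    simp only [← Units.smul_def]
    rw [hf.lact, M.d_lact', N.d_lact', map_add, hf.lact, hf.lact, twist_d, twist_twist,
      twist_twist, map_negOnePow_smul_apply, Int.negOnePow_succ, Units.neg_smul, Units.neg_smul,
      smul_add, negOnePow_smul_self, map_add, map_neg, map_negOnePow_smul, add_comm 1 n]
    abel
  ract a x := by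
    obtain ⟨a, rfl⟩ := MulOpposite.op_surjective a
    simp only [LinearMap.add_apply, LinearMap.comp_apply, Units.smul_def, LinearMap.smul_apply]
    simp only [← Units.smul_def]
    rw [hf.ract, M.d_ract', N.d_ract', map_add, hf.ract, hf.ract]
    have : N.sgn (f x) = n.negOnePow • f (M.sgn x) := by
      induction x using M.induction_gr with
      | hadd x y hx hy => simp only [map_add, hx, hy, smul_add]
      | h i x hx =>
        rw [N.sgn_of_mem (hf.mem i x hx), M.sgn_of_mem hx, map_negOnePow_smul, ← mul_smul,
          ← Int.negOnePow_add, add_comm i]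
    rw [this, map_add, map_negOnePow_smul, map_negOnePow_smul, Int.negOnePow_succ,
      Units.neg_smul, Units.neg_smul, smul_add]
    abel
  mem i x hx := by
    simp only [LinearMap.add_apply, LinearMap.comp_apply, Units.smul_def, LinearMap.smul_apply]
    refine add_mem ?_ (zsmul_mem ?_ _)
    · rw [← add_assoc]; exact N.d_mem _ _ (hf.mem i x hx)
    · have := hf.mem _ _ (M.d_mem i x hx)
      rwa [show i + 1 + n = i + (n + 1) by ring] at this

theorem sgn (hf : IsBi n f) (x : M.carrier) : N.sgn (f x) = n.negOnePow • f (M.sgn x) := by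
  induction x using M.induction_gr with
  | hadd x y hx hy => simp only [map_add, hx, hy, smul_add]
  | h i x hx =>
    rw [N.sgn_of_mem (hf.mem i x hx), M.sgn_of_mem hx, map_negOnePow_smul, ← mul_smul,
      ← Int.negOnePow_add, add_comm i]

end IsBi

theorem Hom.isBi {M N : Bimod A} (f : M ⟶ N) : IsBi 0 (Hom.map f) where
  lact a m := by rw [twist_zero]; exact Hom.map_lact f a m
  ract := Hom.map_ract f
  mem i m hm := by rw [add_zero]; exact Hom.map_mem f i m hm

/-- A bilinear map of degree `0` which commutes with the differentials, as a morphism. -/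
def IsBi.toHom {M N : Bimod A} {f : M.carrier →ₗ[R] N.carrier} (hf : IsBi 0 f)
    (hd : ∀ m, f (M.d m) = N.d (f m)) : M ⟶ N :=
  (⟨f, fun a m => by rw [hf.lact, twist_zero], hf.ract,
    fun i m hm => by simpa using hf.mem i m hm, hd⟩ : Hom M N)

@[simp] theorem IsBi.toHom_map {M N : Bimod A} {f : M.carrier →ₗ[R] N.carrier} (hf : IsBi 0 f)
    (hd : ∀ m, f (M.d m) = N.d (f m)) : Hom.map (hf.toHom hd) = f := rfl

@[simp] theorem comp_map {M N L : Bimod A} (f : M ⟶ N) (g : N ⟶ L) :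
    Hom.map (f ≫ g) = Hom.map g ∘ₗ Hom.map f := rfl

@[simp] theorem id_map (M : Bimod A) : Hom.map (𝟙 M) = LinearMap.id := rfl

theorem hom_ext {M N : Bimod A} {f g : M ⟶ N} (h : ∀ m, Hom.map f m = Hom.map g m) : f = g :=
  Hom.ext (LinearMap.ext h)

/-! ### Constructions with bimodules -/

/-- The zero bimodule. -/
abbrev zero (A : DGA R) : Bimod A where
  carrier := PUnit
  lact := AlgHom.ofLinearMap 0 (Subsingleton.elim _ _) (fun _ _ => Subsingleton.elim _ _)
  ract := AlgHom.ofLinearMap 0 (Subsingleton.elim _ _) (fun _ _ => Subsingleton.elim _ _)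
  lact_ract _ _ _ := rfl
  gr _ := ⊤
  isInternal := isInternal_of_proj _ 0 (fun _ _ _ => rfl) (fun _ _ _ _ _ => rfl)
    (fun _ => Submodule.mem_iSup_of_mem 0 trivial)
  lact_mem _ _ _ _ _ _ := trivial
  ract_mem _ _ _ _ _ _ := trivial
  d := 0
  d_mem _ _ _ := trivial
  d_d _ := rfl
  d_lact _ _ _ _ := rfl
  d_ract _ _ _ _ := rfl

/-- The zero morphism. -/
def zeroHom (M N : Bimod A) : M ⟶ N := IsBi.zero.toHom (f := 0) (by simp)

@[simp] theorem zeroHom_map (M N : Bimod A) : Hom.map (zeroHom M N) = 0 := rfl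

/-- The shift `M[n]`. The left action and the differential acquire signs. -/
abbrev shift (n : ℤ) (M : Bimod A) : Bimod A where
  carrier := M.carrier
  lact := M.lact.comp (A.twistHom n)
  ract := M.ract
  lact_ract a b m := M.lact_ract _ _ _
  gr i := M.gr (i + n)
  isInternal := isInternal_of_proj _ (fun i => M.proj (i + n)) (fun i m hm => M.proj_same hm)
    (fun i k m hm h => M.proj_ne hm (by simpa using h)) (fun m => by
      induction m using M.induction_gr with
      | hadd x y hx hy => exact add_mem hx hy
      | h i m hm =>
        exact Submodule.mem_iSup_of_mem (i - n) (by simpa using hm))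
  lact_mem i j a m ha hm := by
    rw [add_assoc]; exact M.lact_mem i _ _ m (A.twist_mem n i ha) hm
  ract_mem i j a m ha hm := by
    have := M.ract_mem i _ a m ha hm
    rwa [show j + n + i = j + i + n by ring] at this
  d := n.negOnePow • M.d
  d_mem i m hm := by
    have := M.d_mem _ m hm
    rw [show i + n + 1 = i + 1 + n by ring] at this
    rw [Units.smul_def, LinearMap.smul_apply]
    exact zsmul_mem this _
  d_d m := by
    simp only [Units.smul_def, LinearMap.smul_apply, map_zsmul, M.d_d, smul_zero]
  d_lact i a m ha := by
    simp only [Units.smul_def, LinearMap.smul_apply, AlgHom.comp_apply]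
    simp only [← Units.smul_def, twistHom_apply]
    rw [M.d_lact i _ m (A.twist_mem n i ha), twist_d, map_negOnePow_smul_apply, smul_add,
      map_negOnePow_smul, smul_comm]
  d_ract j a m hm := by
    simp only [Units.smul_def, LinearMap.smul_apply]
    simp only [← Units.smul_def]
    rw [M.d_ract _ a m hm, map_negOnePow_smul, smul_add, Int.negOnePow_add, mul_smul,
      smul_comm n.negOnePow, negOnePow_smul_self]

section shift
variable (n : ℤ) (M N : Bimod A)

theorem shift_lact (a : A.carrier) (m : M.carrier) :
    (shift n M).lact a m = M.lact (A.twist n a) m := rfl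

theorem shift_d (m : M.carrier) : (shift n M).d m = n.negOnePow • M.d m := by
  rw [Units.smul_def]; rfl

variable {M N}

/-- A bilinear map of degree `n` is a bilinear map of degree `0` into a shift. -/
theorem isBi_shift_iff {k : ℤ} {f : M.carrier →ₗ[R] N.carrier} :
    IsBi (M := M) (N := shift n N) k f ↔ IsBi (k + n) f := by
  constructor
  · intro h
    refine ⟨fun a m => ?_, h.ract, fun i m hm => ?_⟩
    · rw [add_comm, ← twist_twist]; exact h.lact a m
    · rw [← add_assoc]; exact h.mem i m hm
  · intro h
    refine ⟨fun a m => ?_, h.ract, fun i m hm => ?_⟩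
    · rw [shift_lact, twist_twist, add_comm n]; exact h.lact a m
    · have := h.mem i m hm
      rwa [← add_assoc] at this

/-- The shift of a morphism. -/
def shiftMap (f : M ⟶ N) : shift n M ⟶ shift n N :=
  (⟨Hom.map (M := M) (N := N) f, fun a m => Hom.map_lact f _ m, Hom.map_ract f,
    fun i m hm => Hom.map_mem f _ m hm,
    fun m => by
      change Hom.map f ((shift n M).d m) = (shift n N).d (Hom.map f m)
      rw [shift_d, shift_d, map_negOnePow_smul]
      exact congrArg _ (Hom.map_d f m)⟩ : Hom (shift n M) (shift n N))

theorem shiftMap_map (f : M ⟶ N) : Hom.map (shiftMap n f) = Hom.map (M := M) (N := N) f := rfl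

end shift

/-- The extension of `M` by `N` given by a map `t : M → N` of degree `1` which anticommutes with
the differentials: the differential is `d (x, y) = (d x, t x + d y)`. -/
abbrev extension (M N : Bimod A) (t : M.carrier →ₗ[R] N.carrier) (ht : IsBi 1 t)
    (htd : ∀ m, N.d (t m) + t (M.d m) = 0) : Bimod A where
  carrier := M.carrier × N.carrier
  lact := (LinearMap.prodMapAlgHom R M.carrier N.carrier).comp (M.lact.prod N.lact)
  ract := (LinearMap.prodMapAlgHom R M.carrier N.carrier).comp (M.ract.prod N.ract)
  lact_ract a b m := Prod.ext (M.lact_ract _ _ _) (N.lact_ract _ _ _)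
  gr i := (M.gr i).prod (N.gr i)
  isInternal := isInternal_of_proj _ (fun i => (M.proj i).prodMap (N.proj i))
    (fun i m hm => Prod.ext (M.proj_same hm.1) (N.proj_same hm.2))
    (fun i k m hm h => Prod.ext (M.proj_ne hm.1 h) (N.proj_ne hm.2 h)) (fun ⟨x, y⟩ => by
      have hx : ((x, 0) : M.carrier × N.carrier) ∈ ⨆ n, (M.gr n).prod (N.gr n) := by
        induction x using M.induction_gr with
        | hadd x y hx hy => simpa using add_mem hx hy
        | h i x hx => exact Submodule.mem_iSup_of_mem i ⟨hx, zero_mem _⟩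
      have hy : ((0, y) : M.carrier × N.carrier) ∈ ⨆ n, (M.gr n).prod (N.gr n) := by
        induction y using N.induction_gr with
        | hadd x y hx hy => simpa using add_mem hx hy
        | h i x hx => exact Submodule.mem_iSup_of_mem i ⟨zero_mem _, hx⟩
      simpa using add_mem hx hy)
  lact_mem i j a m ha hm := ⟨M.lact_mem i j a _ ha hm.1, N.lact_mem i j a _ ha hm.2⟩
  ract_mem i j a m ha hm := ⟨M.ract_mem i j a _ ha hm.1, N.ract_mem i j a _ ha hm.2⟩
  d := (M.d ∘ₗ LinearMap.fst R M.carrier N.carrier).prod (t ∘ₗ LinearMap.fst R M.carrier N.carrier +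
    N.d ∘ₗ LinearMap.snd R M.carrier N.carrier)
  d_mem i m hm := ⟨M.d_mem i _ hm.1, add_mem (ht.mem i _ hm.1) (N.d_mem i _ hm.2)⟩
  d_d m := by
    refine Prod.ext (M.d_d _) ?_
    change t (M.d m.1) + N.d (t m.1 + N.d m.2) = 0
    rw [map_add, N.d_d, add_zero, add_comm, htd]
  d_lact i a m ha := by
    refine Prod.ext (M.d_lact i a _ ha) ?_
    change t (M.lact a m.1) + N.d (N.lact a m.2) = N.lact (A.d a) m.2 +
      i.negOnePow • N.lact a (t m.1 + N.d m.2)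
    rw [N.d_lact i a _ ha, ht.lact, A.twist_of_mem 1 i ha, one_mul, map_negOnePow_smul_apply,
      map_add, smul_add]
    abel
  d_ract j a m hm := by
    refine Prod.ext (M.d_ract j a _ hm.1) ?_
    change t (M.ract _ m.1) + N.d (N.ract _ m.2) = N.ract _ (t m.1 + N.d m.2) +
      j.negOnePow • N.ract _ m.2
    rw [N.d_ract j a _ hm.2, ht.ract, map_add]
    abel

/-- The homotopy pullback of `f : X ⟶ Y` and `s : X' ⟶ Y`: its elements are triples
`(x, x', y)` with differential `(d x, d x', f x - s x' - d y)`. -/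
abbrev hpull {X X' Y : Bimod A} (f : X ⟶ Y) (s : X' ⟶ Y) : Bimod A :=
  extension (extension X X' 0 IsBi.zero (by simp)) (shift (-1) Y)
    (Hom.map f ∘ₗ LinearMap.fst R _ _ - Hom.map s ∘ₗ LinearMap.snd R _ _)
    { lact := fun a m => by
        change Hom.map f (X.lact a m.1) - Hom.map s (X'.lact a m.2) =
          Y.lact (A.twist (-1) (A.twist 1 a)) (Hom.map f m.1 - Hom.map s m.2)
        rw [twist_twist, neg_add_cancel, twist_zero, map_sub, Hom.map_lact, Hom.map_lact]
      ract := fun a m => by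
        change Hom.map f (X.ract a m.1) - Hom.map s (X'.ract a m.2) =
          Y.ract a (Hom.map f m.1 - Hom.map s m.2)
        rw [map_sub, Hom.map_ract, Hom.map_ract]
      mem := fun i m hm => by
        change _ ∈ Y.gr (i + 1 + -1)
        rw [add_neg_cancel_right]
        exact sub_mem (Hom.map_mem f i _ hm.1) (Hom.map_mem s i _ hm.2) }
    (fun m => by
      change (shift (-1) Y).d (Hom.map f m.1 - Hom.map s m.2) +
        (Hom.map f (X.d m.1) - Hom.map s (0 + X'.d m.2)) = 0
      rw [shift_d, Int.negOnePow_neg, Int.negOnePow_one, Units.neg_smul, one_smul, zero_add,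
        Hom.map_d, Hom.map_d]
      simp)

section hpull

variable {X X' Y : Bimod A} (f : X ⟶ Y) (s : X' ⟶ Y)

theorem hpull_d (x : X.carrier) (x' : X'.carrier) (y : Y.carrier) :
    (hpull f s).d ((x, x'), y) =
      ((X.d x, X'.d x'), Hom.map f x - Hom.map s x' - Y.d y) := by
  refine Prod.ext (Prod.ext rfl (zero_add _)) ?_
  change Hom.map f x - Hom.map s x' + (shift (-1) Y).d y = _
  rw [shift_d, Int.negOnePow_neg, Int.negOnePow_one, Units.neg_smul, one_smul,
    sub_eq_add_neg _ (Y.d y)]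

/-- The projection of the homotopy pullback to the source of `f`. -/
def hpullFst : hpull f s ⟶ X :=
  (⟨LinearMap.fst R _ _ ∘ₗ LinearMap.fst R _ _, fun _ _ => rfl, fun _ _ => rfl,
    fun _ _ h => h.1.1, fun _ => rfl⟩ : Hom (hpull f s) X)

/-- The projection of the homotopy pullback to the source of `s`. -/
def hpullSnd : hpull f s ⟶ X' :=
  (⟨LinearMap.snd R _ _ ∘ₗ LinearMap.fst R _ _, fun _ _ => rfl, fun _ _ => rfl,
    fun _ _ h => h.1.2, fun _ => zero_add _⟩ : Hom (hpull f s) X')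

/-- The third coordinate of the homotopy pullback, a bilinear map of degree `-1`. -/
def hpullThd : (hpull f s).carrier →ₗ[R] Y.carrier := LinearMap.snd R _ _

theorem isBi_hpullThd : IsBi (-1) (hpullThd f s) where
  lact _ _ := rfl
  ract _ _ := rfl
  mem _ _ h := h.2

/-- A map into the homotopy pullback is a pair of maps with a homotopy. -/
def hpullLift {M : Bimod A} (g : M ⟶ X) (g' : M ⟶ X') (k : M.carrier →ₗ[R] Y.carrier)
    (hk : IsBi (-1) k)
    (h : ∀ m, Hom.map f (Hom.map g m) - Hom.map s (Hom.map g' m) = Y.d (k m) + k (M.d m)) :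
    M ⟶ hpull f s :=
  (⟨((Hom.map g).prod (Hom.map g')).prod k,
    fun a m => Prod.ext (Prod.ext (Hom.map_lact g a m) (Hom.map_lact g' a m)) (hk.lact a m),
    fun a m => Prod.ext (Prod.ext (Hom.map_ract g a m) (Hom.map_ract g' a m)) (hk.ract a m),
    fun i m hm => ⟨⟨Hom.map_mem g i m hm, Hom.map_mem g' i m hm⟩, hk.mem i m hm⟩,
    fun m => by
      refine Eq.trans ?_ (hpull_d f s _ _ _).symm
      refine Prod.ext (Prod.ext (Hom.map_d g m) (Hom.map_d g' m)) ?_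
      change k (M.d m) = _
      rw [h]; exact (add_sub_cancel_left _ _).symm⟩ : Hom M (hpull f s))

end hpull

end Bimod
end DGA

namespace DGA
namespace Bimod

variable {R : Type u} [CommRing R] {A : DGA R}

/-! ### Quasi-isomorphisms -/

/-- Quasi-isomorphisms are the maps with an acyclic cone, in terms of elements. -/
theorem quasiIso_iff {M N : Bimod A} (f : M ⟶ N) : quasiIso A f ↔
    ∀ (x : M.carrier) (y : N.carrier), M.d x = 0 → Hom.map f x = N.d y →
      ∃ x' y', M.d x' = x ∧ Hom.map f x' + N.d y' = y := by
  constructor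
  · rintro ⟨hi, hs⟩ x y hx hxy
    have h0 : Submodule.Quotient.mk
        (p := (LinearMap.range M.d).submoduleOf (LinearMap.ker M.d)) ⟨x, hx⟩ = 0 := by
      apply hi
      rw [map_zero]
      exact (Submodule.Quotient.mk_eq_zero _).2 ⟨y, hxy.symm⟩
    obtain ⟨x₀, hx₀⟩ := (Submodule.Quotient.mk_eq_zero _).1 h0
    have hx₀ : M.d x₀ = x := hx₀
    have hc : N.d (y - Hom.map f x₀) = 0 := by
      rw [map_sub, ← Hom.map_d, hx₀, hxy, sub_self]
    obtain ⟨q, hq⟩ := hs (Submodule.Quotient.mk ⟨_, hc⟩)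
    obtain ⟨⟨c, hcc⟩, rfl⟩ := Submodule.Quotient.mk_surjective _ q
    obtain ⟨b, hb⟩ := (Submodule.Quotient.eq _).1 hq
    have hb : N.d b = Hom.map f c - (y - Hom.map f x₀) := hb
    refine ⟨x₀ + c, -b, ?_, ?_⟩
    · rw [map_add, hx₀, LinearMap.mem_ker.1 hcc, add_zero]
    · rw [map_add, map_neg, hb]; abel
  · intro h
    constructor
    · rw [← LinearMap.ker_eq_bot, LinearMap.ker_eq_bot']
      intro q hq
      obtain ⟨⟨x, hx⟩, rfl⟩ := Submodule.Quotient.mk_surjective _ q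
      obtain ⟨y, hy⟩ := (Submodule.Quotient.mk_eq_zero _).1 hq
      obtain ⟨x', _, hx', _⟩ := h x y hx (Eq.symm hy)
      exact (Submodule.Quotient.mk_eq_zero _).2 ⟨x', hx'⟩
    · intro q
      obtain ⟨⟨y, hy⟩, rfl⟩ := Submodule.Quotient.mk_surjective _ q
      obtain ⟨x', y', hx', hy'⟩ := h 0 y (map_zero _) (by rw [map_zero]; exact Eq.symm hy)
      refine ⟨Submodule.Quotient.mk ⟨x', hx'⟩, (Submodule.Quotient.eq _).2 ⟨-y', ?_⟩⟩
      change N.d (-y') = Hom.map f x' - y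
      rw [← hy', map_neg]; abel

theorem quasiIso_id (M : Bimod A) : quasiIso A (𝟙 M) :=
  (quasiIso_iff _).2 fun x y _ hxy => ⟨y, 0, hxy.symm, by simp⟩

theorem quasiIso_comp {M N L : Bimod A} {f : M ⟶ N} {g : N ⟶ L} (hf : quasiIso A f)
    (hg : quasiIso A g) : quasiIso A (f ≫ g) := by
  rw [quasiIso_iff] at hf hg ⊢
  intro x z hx hxz
  obtain ⟨y, z', hy, hz⟩ := hg (Hom.map f x) z (by rw [← Hom.map_d, hx, map_zero]) hxz
  obtain ⟨x', y', hx', hy'⟩ := hf x y hx hy.symm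
  refine ⟨x', Hom.map g y' + z', hx', ?_⟩
  rw [← hz, ← hy', map_add, map_add, Hom.map_d, add_assoc]
  rfl

theorem quasiIso_shiftMap (n : ℤ) {M N : Bimod A} {f : M ⟶ N} (hf : quasiIso A f) :
    quasiIso A (shiftMap n f) := by
  rw [quasiIso_iff] at hf ⊢
  intro x y hx hxy
  rw [shift_d] at hx hxy
  have hx' : M.d x = 0 := by
    rw [← negOnePow_smul_self n (M.d x)]; exact (congrArg _ hx).trans (smul_zero _)
  obtain ⟨x', y', h1, h2⟩ := hf x (n.negOnePow • y) hx'
    ((shiftMap_map n f ▸ hxy).trans (map_negOnePow_smul N.d n y).symm)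
  refine ⟨n.negOnePow • x', y', ?_, ?_⟩
  · rw [shift_d, ← h1, map_negOnePow_smul, negOnePow_smul_self]
  · rw [shift_d, shiftMap_map, map_negOnePow_smul]
    refine (smul_add n.negOnePow (Hom.map f x') (N.d y')).symm.trans ?_
    rw [h2, negOnePow_smul_self]

theorem IsBi.proj {M N : Bimod A} {n : ℤ} {f : M.carrier →ₗ[R] N.carrier} (hf : IsBi n f)
    (i : ℤ) (m : M.carrier) : f (M.proj i m) = N.proj (i + n) (f m) := by
  induction m using M.induction_gr with
  | hadd x y hx hy => simp only [map_add, hx, hy]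
  | h j m hm =>
    by_cases h : i = j
    · subst h
      rw [M.proj_same hm, N.proj_same (hf.mem i m hm)]
    · rw [M.proj_ne hm h, map_zero, N.proj_ne (hf.mem j m hm) (by simpa using h)]

theorem d_proj (M : Bimod A) (i : ℤ) (m : M.carrier) :
    M.d (M.proj i m) = M.proj (i + 1) (M.d m) := by
  induction m using M.induction_gr with
  | hadd x y hx hy => simp only [map_add, hx, hy]
  | h j m hm =>
    by_cases h : i = j
    · subst h
      rw [M.proj_same hm, M.proj_same (M.d_mem i m hm)]
    · rw [M.proj_ne hm h, map_zero, M.proj_ne (M.d_mem j m hm) (by simpa using h)]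

theorem Hom.map_proj {M N : Bimod A} (f : M ⟶ N) (i : ℤ) (m : M.carrier) :
    Hom.map f (M.proj i m) = N.proj i (Hom.map f m) := by
  rw [(Hom.isBi f).proj, add_zero]

/-! ### The homotopy category and its calculus of fractions -/

/-- Homotopy of bimodule maps. -/
def homotopic (A : DGA R) : HomRel (Bimod A) := fun M N f g =>
  ∃ k : M.carrier →ₗ[R] N.carrier, IsBi (-1) k ∧
    ∀ m, Hom.map f m - Hom.map g m = N.d (k m) + k (M.d m)

/-- Homotopy is an equivalence relation compatible with composition. -/
instance : Congruence (homotopic A) where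
  equivalence := by
    refine ⟨fun f => ⟨0, IsBi.zero, fun m => by simp⟩, ?_, ?_⟩
    · rintro f g ⟨k, hk, h⟩
      refine ⟨-k, hk.neg, fun m => ?_⟩
      rw [← neg_sub, h]; simp; abel
    · rintro f g l ⟨k, hk, h⟩ ⟨k', hk', h'⟩
      refine ⟨k + k', hk.add hk', fun m => ?_⟩
      rw [← sub_add_sub_cancel _ (Hom.map g m), h, h']; simp; abel
  comp_left := by
    rintro M N L f g g' ⟨k, hk, h⟩
    refine ⟨k ∘ₗ Hom.map f, (hk.comp (Hom.isBi f)), fun m => ?_⟩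
    simp [h, Hom.map_d]
  comp_right := by
    rintro M N L f f' g ⟨k, hk, h⟩
    refine ⟨Hom.map g ∘ₗ k, ((Hom.isBi g).comp hk), fun m => ?_⟩
    simp only [comp_map, LinearMap.comp_apply]
    rw [← map_sub, h, map_add, Hom.map_d]

/-- Quasi-isomorphisms are stable under homotopy pullback. -/
theorem quasiIso_hpullFst {X X' Y : Bimod A} (f : X ⟶ Y) {s : X' ⟶ Y} (hs : quasiIso A s) :
    quasiIso A (hpullFst f s) := by
  rw [quasiIso_iff] at hs ⊢
  rintro ⟨⟨x, x'⟩, y⟩ b hd hb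
  have hd := (hpull_d f s x x' y).symm.trans hd
  have h1 : X.d x = 0 := congrArg (fun z => z.1.1) hd
  have h2 : X'.d x' = 0 := congrArg (fun z => z.1.2) hd
  have h3 : Hom.map f x - Hom.map s x' - Y.d y = 0 := congrArg (fun z => z.2) hd
  have hb : x = X.d b := hb
  obtain ⟨x₁, y₁, h4, h5⟩ := hs x' (Hom.map f b - y) h2 (by
    rw [map_sub, ← Hom.map_d, ← hb]
    rw [sub_sub, sub_eq_zero] at h3
    rw [h3]; abel)
  refine ⟨((b, x₁), y₁), 0, ?_, ?_⟩
  · refine (hpull_d f s _ _ _).trans ?_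
    refine Prod.ext (Prod.ext hb.symm h4) ?_
    change Hom.map f b - Hom.map s x₁ - Y.d y₁ = y
    rw [sub_sub, h5]; abel
  · rw [map_zero, add_zero]; rfl

/-- The square of a homotopy pullback commutes up to the homotopy given by the third coordinate. -/
theorem homotopic_hpull {X X' Y : Bimod A} (f : X ⟶ Y) (s : X' ⟶ Y) :
    homotopic A (hpullFst f s ≫ f) (hpullSnd f s ≫ s) := by
  refine ⟨hpullThd f s, isBi_hpullThd f s, ?_⟩
  rintro ⟨⟨x, x'⟩, y⟩
  change Hom.map f x - Hom.map s x' = Y.d y + hpullThd f s ((hpull f s).d ((x, x'), y))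
  rw [hpull_d]
  change _ = Y.d y + (Hom.map f x - Hom.map s x' - Y.d y)
  abel

/-- Homotopic maps agree in the derived category: both factor through the path object
`hpull (𝟙 N) (𝟙 N)`, whose two projections to `N` have a common section and are isomorphisms in the
derived category. -/
theorem Q_map_eq_of_homotopic {M N : Bimod A} {f g : M ⟶ N} (h : homotopic A f g) :
    (quasiIso A).Q.map f = (quasiIso A).Q.map g := by
  obtain ⟨k, hk, h⟩ := h
  let p := hpullFst (𝟙 N) (𝟙 N)
  let q := hpullSnd (𝟙 N) (𝟙 N)
  -- the inclusion of the constant paths, a common section of the two projections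
  let i : N ⟶ hpull (𝟙 N) (𝟙 N) := hpullLift _ _ (𝟙 N) (𝟙 N) 0 IsBi.zero (by simp)
  have hp : IsIso ((quasiIso A).Q.map p) :=
    (quasiIso A).Q_inverts _ (quasiIso_hpullFst _ (quasiIso_id N))
  have h1 : (quasiIso A).Q.map i ≫ (quasiIso A).Q.map p = 𝟙 _ := by
    rw [← CategoryTheory.Functor.map_comp, ← CategoryTheory.Functor.map_id]; rfl
  have h2 : (quasiIso A).Q.map i ≫ (quasiIso A).Q.map q = 𝟙 _ := by
    rw [← CategoryTheory.Functor.map_comp, ← CategoryTheory.Functor.map_id]; rfl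
  have h3 : (quasiIso A).Q.map i = inv ((quasiIso A).Q.map p) := by
    rw [← cancel_mono ((quasiIso A).Q.map p), h1, IsIso.inv_hom_id]
  have h4 : (quasiIso A).Q.map p = (quasiIso A).Q.map q := by
    rw [h3, IsIso.inv_comp_eq, Category.comp_id] at h2
    exact h2.symm
  -- the homotopy, as a map to the path object
  let l : M ⟶ hpull (𝟙 N) (𝟙 N) := hpullLift _ _ f g k hk h
  have hf : f = l ≫ p := rfl
  have hg : g = l ≫ q := rfl
  rw [hf, hg, CategoryTheory.Functor.map_comp, CategoryTheory.Functor.map_comp, h4]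

/-- The homotopy category of bimodules. -/
abbrev HoCat (A : DGA R) := CategoryTheory.Quotient (homotopic A)

/-- Quasi-isomorphisms in the homotopy category. -/
def hoQuasiIso (A : DGA R) : MorphismProperty (HoCat A) := fun X Y f =>
  ∃ g : X.as ⟶ Y.as, (CategoryTheory.Quotient.functor (homotopic A)).map g = f ∧ quasiIso A g

theorem hoMap_eq_iff {M N : Bimod A} (f g : M ⟶ N) :
    (CategoryTheory.Quotient.functor (homotopic A)).map f =
      (CategoryTheory.Quotient.functor (homotopic A)).map g ↔
      homotopic A f g :=
  CategoryTheory.Quotient.functor_map_eq_iff _ f g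

/-- Maps which become homotopic after a quasi-isomorphism on the target are homotopic after a
quasi-isomorphism on the source. -/
theorem exists_quasiIso_homotopic {N X Y : Bimod A} (f g : N ⟶ X) (s : X ⟶ Y)
    (hs : quasiIso A s) (h : homotopic A (f ≫ s) (g ≫ s)) :
    ∃ (N' : Bimod A) (t : N' ⟶ N), quasiIso A t ∧ homotopic A (t ≫ f) (t ≫ g) := by
  obtain ⟨k, hk, h⟩ := h
  -- `F` is the fibre of `s`, and `c` lifts the difference of `f` and `g` to it.
  let F := hpull (zeroHom (zero A) Y) s
  have hF : quasiIso A (zeroHom (zero A) F) := by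
    have := quasiIso_hpullFst (zeroHom (zero A) Y) hs
    rw [quasiIso_iff] at this ⊢
    intro x y _ hy
    obtain ⟨x', _, hx', _⟩ := this y 0 hy.symm rfl
    exact ⟨0, x', rfl, by rw [hx']; simp⟩
  let df : N ⟶ X := ((Hom.isBi f).sub (Hom.isBi g)).toHom fun m => by
    simp [Hom.map_d]
  let c : N ⟶ F := hpullLift _ _ (zeroHom _ _) df (-k) hk.neg fun m => by
    have := h m
    simp only [comp_map, LinearMap.comp_apply] at this
    simp only [zeroHom_map, df, IsBi.toHom_map, LinearMap.zero_apply, LinearMap.sub_apply,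
      map_sub, this, LinearMap.neg_apply, map_neg]
    abel_nf
  -- the fibre of `c`: on it the lift `c` of `f - g` is homotopic to zero
  refine ⟨hpull c (zeroHom (zero A) F), hpullFst _ _, quasiIso_hpullFst _ hF, ?_⟩
  have h1 := homotopic_hpull c (zeroHom (zero A) F)
  have h2 := HomRel.comp_right (r := homotopic A) (hpullSnd (zeroHom (zero A) Y) s) h1
  obtain ⟨l, hl, h3⟩ := h2
  refine ⟨l, hl, fun m => ?_⟩
  rw [← h3]
  change Hom.map f _ - Hom.map g _ = (Hom.map f _ - Hom.map g _) - 0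
  rw [sub_zero]

/-- Squares are completed by homotopy pullbacks. -/
instance : (hoQuasiIso A).HasRightCalculusOfFractions where
  id_mem X := ⟨𝟙 _, CategoryTheory.Functor.map_id _ _, quasiIso_id _⟩
  comp_mem := by
    rintro X Y Z _ _ ⟨f, rfl, hf⟩ ⟨g, rfl, hg⟩
    exact ⟨f ≫ g, CategoryTheory.Functor.map_comp _ _ _, quasiIso_comp hf hg⟩
  exists_rightFraction := by
    rintro ⟨X⟩ ⟨Y⟩ ⟨s, hs, φ⟩
    obtain ⟨f, rfl⟩ := (CategoryTheory.Quotient.functor (homotopic A)).map_surjective s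
    obtain ⟨t, rfl, ht⟩ := φ
    refine ⟨⟨(CategoryTheory.Quotient.functor (homotopic A)).map (hpullFst f t),
      ⟨_, rfl, quasiIso_hpullFst f ht⟩,
      (CategoryTheory.Quotient.functor (homotopic A)).map (hpullSnd f t)⟩, ?_⟩
    exact CategoryTheory.Quotient.sound _ (homotopic_hpull f t)
  ext := by
    rintro ⟨X⟩ ⟨Y⟩ ⟨Z⟩ f g _ ⟨s, rfl, hs⟩ h
    obtain ⟨f, rfl⟩ := (CategoryTheory.Quotient.functor (homotopic A)).map_surjective f
    obtain ⟨g, rfl⟩ := (CategoryTheory.Quotient.functor (homotopic A)).map_surjective g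
    obtain ⟨N, t, ht, h'⟩ := exists_quasiIso_homotopic f g s hs ((hoMap_eq_iff _ _).1 h)
    exact ⟨_, (CategoryTheory.Quotient.functor (homotopic A)).map t, ⟨t, rfl, ht⟩,
      CategoryTheory.Quotient.sound _ h'⟩

/-- The localization functor on the homotopy category. -/
abbrev hoQ (A : DGA R) : HoCat A ⥤ Derived A :=
  CategoryTheory.Quotient.lift _ (quasiIso A).Q fun _ _ _ _ h => Q_map_eq_of_homotopic h

/-- As homotopic maps agree in the derived category, it has the universal property of a localization
of the homotopy category. -/
def hoQUniversal (A : DGA R) (E : Type*) [Category E] :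
    Localization.StrictUniversalPropertyFixedTarget (hoQ A) (hoQuasiIso A) E where
  inverts := by
    rintro ⟨X⟩ ⟨Y⟩ _ ⟨s, rfl, hs⟩
    exact (quasiIso A).Q_inverts s hs
  lift F hF := Localization.Construction.lift (CategoryTheory.Quotient.functor (homotopic A) ⋙ F)
    fun _ _ s hs => hF _ ⟨s, rfl, hs⟩
  fac F hF := by
    apply Quotient.lift_unique'
    exact Localization.Construction.fac (W := quasiIso A)
      (CategoryTheory.Quotient.functor (homotopic A) ⋙ F) fun _ _ s hs => hF _ ⟨s, rfl, hs⟩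
  uniq F₁ F₂ h := by
    apply Localization.Construction.uniq (W := quasiIso A)
    exact congrArg (fun G => CategoryTheory.Quotient.functor (homotopic A) ⋙ G) h

/-- The derived category is the localization of the homotopy category at quasi-isomorphisms. -/
instance : (hoQ A).IsLocalization (hoQuasiIso A) :=
  Functor.IsLocalization.mk' _ _ (hoQUniversal A _) (hoQUniversal A _)

/-- Every morphism in the derived category is a fraction. -/
theorem exists_roof {X Y : Bimod A} (α : (quasiIso A).Q.obj X ⟶ (quasiIso A).Q.obj Y) :
    ∃ (X' : Bimod A) (s : X' ⟶ X) (a : X' ⟶ Y), quasiIso A s ∧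
      (quasiIso A).Q.map s ≫ α = (quasiIso A).Q.map a := by
  obtain ⟨φ, hφ⟩ := Localization.exists_rightFraction (hoQ A) (hoQuasiIso A)
    (X := (CategoryTheory.Quotient.functor (homotopic A)).obj X)
    (Y := (CategoryTheory.Quotient.functor (homotopic A)).obj Y) α
  have h := φ.map_s_comp_map (hoQ A) (Localization.inverts _ _)
  obtain ⟨g, hg, hq⟩ := φ.hs
  obtain ⟨a, ha⟩ := (CategoryTheory.Quotient.functor (homotopic A)).map_surjective φ.f
  rw [← hφ, ← hg, ← ha] at h
  exact ⟨φ.X'.as, g, a, hq, h⟩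

/-- Maps which agree in the derived category are homotopic after a quasi-isomorphism on the
source. -/
theorem exists_quasiIso_of_Q_map_eq {X Y : Bimod A} {f g : X ⟶ Y}
    (h : (quasiIso A).Q.map f = (quasiIso A).Q.map g) :
    ∃ (X' : Bimod A) (s : X' ⟶ X), quasiIso A s ∧ homotopic A (s ≫ f) (s ≫ g) := by
  obtain ⟨X', s, ⟨t, rfl, ht⟩, h'⟩ := (MorphismProperty.map_eq_iff_precomp (hoQ A) (hoQuasiIso A)
    ((CategoryTheory.Quotient.functor (homotopic A)).map f)
      ((CategoryTheory.Quotient.functor (homotopic A)).map g)).1 h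
  exact ⟨X'.as, t, ht, (hoMap_eq_iff _ _).1 h'⟩

end Bimod
end DGA

namespace DGA
namespace Bimod

variable {R : Type u} [CommRing R] {A : DGA R}

/-! ### Direct sums, and coproducts in the derived category -/

section DirectSum

open Classical in
/-- The direct sum of a family of bimodules. -/
abbrev directSum {ι : Type u} (N : ι → Bimod A) : Bimod A where
  carrier := Π₀ i, (N i).carrier
  lact := AlgHom.ofLinearMap
    { toFun := fun a => DFinsupp.mapRange.linearMap fun i => (N i).lact a
      map_add' := fun a b => by ext x i; simp
      map_smul' := fun c a => by ext x i; simp }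
    (by ext x i; simp) (fun a b => by ext x i; simp)
  ract := AlgHom.ofLinearMap
    { toFun := fun a => DFinsupp.mapRange.linearMap fun i => (N i).ract a
      map_add' := fun a b => by ext x i; simp
      map_smul' := fun c a => by ext x i; simp }
    (by ext x i; simp) (fun a b => by ext x i; simp)
  lact_ract a b m := by ext i; simp [(N i).lact_ract]
  gr n :=
    { carrier := {x | ∀ i, x i ∈ (N i).gr n}
      add_mem' := fun hx hy i => add_mem (hx i) (hy i)
      zero_mem' := fun i => zero_mem _
      smul_mem' := fun c _ hx i => Submodule.smul_mem _ c (hx i) }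
  isInternal := isInternal_of_proj _
    (fun n => DFinsupp.mapRange.linearMap fun i => (N i).proj n)
    (fun n m hm => DFinsupp.ext fun i => by simpa using (N i).proj_same (hm i))
    (fun n k m hm h => DFinsupp.ext fun i => by simpa using (N i).proj_ne (hm i) h)
    (fun m => by
      induction m using DFinsupp.induction with
      | h0 => exact zero_mem _
      | ha i b f _ hb hf =>
        refine add_mem ?_ hf
        clear hb
        induction b using (N i).induction_gr with
        | hadd x y hx hy => rw [DFinsupp.single_add]; exact add_mem hx hy
        | h n x hx =>
          refine Submodule.mem_iSup_of_mem n fun j => ?_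
          by_cases h : j = i
          · subst h; rwa [DFinsupp.single_eq_same]
          · rw [DFinsupp.single_eq_of_ne h]; exact zero_mem _)
  lact_mem i j a m ha hm k := (N k).lact_mem i j a _ ha (hm k)
  ract_mem i j a m ha hm k := (N k).ract_mem i j a _ ha (hm k)
  d := DFinsupp.mapRange.linearMap fun i => (N i).d
  d_mem i m hm k := (N k).d_mem i _ (hm k)
  d_d m := by ext i; simp [(N i).d_d]
  d_lact i a m ha := by
    ext k
    simp only [DFinsupp.add_apply, Units.smul_def, DFinsupp.smul_apply]
    exact (N k).d_lact i a _ ha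
  d_ract j a m hm := by
    ext k
    simp only [DFinsupp.add_apply, Units.smul_def, DFinsupp.smul_apply]
    exact (N k).d_ract j a _ (hm k)

variable {ι : Type u} (N : ι → Bimod A)

theorem directSum_lact_apply (a : A.carrier) (x : (directSum N).carrier) (i : ι) :
    (directSum N).lact a x i = (N i).lact a (x i) := rfl

theorem directSum_ract_apply (a : A.carrierᵐᵒᵖ) (x : (directSum N).carrier) (i : ι) :
    (directSum N).ract a x i = (N i).ract a (x i) := rfl

theorem directSum_d_apply (x : (directSum N).carrier) (i : ι) :
    (directSum N).d x i = (N i).d (x i) := rfl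

theorem directSum_induction {P : (directSum N).carrier → Prop}
    (h : ∀ i m, P (open Classical in DFinsupp.single i m)) (h0 : P 0)
    (hadd : ∀ x y, P x → P y → P (x + y)) (x : (directSum N).carrier) : P x := by
  classical
  induction x using DFinsupp.induction with
  | h0 => exact h0
  | ha i b f _ _ hf =>
    refine hadd _ _ ?_ hf
    convert h i b

open Classical in
/-- The inclusion of a summand. -/
def directSumOf (i : ι) : N i ⟶ directSum N :=
  (⟨DFinsupp.lsingle (R := R) (M := fun i => (N i).carrier) i, fun a m => by
      refine DFinsupp.ext fun j => ?_
      rw [directSum_lact_apply]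
      by_cases h : j = i
      · subst h; simp
      · simp [DFinsupp.single_eq_of_ne h],
    fun a m => by
      refine DFinsupp.ext fun j => ?_
      rw [directSum_ract_apply]
      by_cases h : j = i
      · subst h; simp
      · simp [DFinsupp.single_eq_of_ne h],
    fun n m hm j => by
      by_cases h : j = i
      · subst h; simpa using hm
      · simp [DFinsupp.single_eq_of_ne h],
    fun m => by
      refine DFinsupp.ext fun j => ?_
      rw [directSum_d_apply]
      by_cases h : j = i
      · subst h; simp
      · simp [DFinsupp.single_eq_of_ne h]⟩ : Hom (N i) (directSum N))

variable {N}

open Classical in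
/-- The linear map out of a direct sum with given restrictions to the summands. -/
def directSumLift {X : Bimod A} (f : ∀ i, (N i).carrier →ₗ[R] X.carrier) :
    (directSum N).carrier →ₗ[R] X.carrier :=
  DFinsupp.lsum (R := R) (M := fun i => (N i).carrier) ℕ f

@[simp] theorem directSumLift_of {X : Bimod A} (f : ∀ i, (N i).carrier →ₗ[R] X.carrier) (i : ι)
    (m : (N i).carrier) : directSumLift f (Hom.map (directSumOf N i) m) = f i m := by
  classical
  exact DFinsupp.lsum_single (R := R) (M := fun i => (N i).carrier) ℕ f i m

theorem directSum_induction' {P : (directSum N).carrier → Prop}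
    (h : ∀ i m, P (Hom.map (directSumOf N i) m)) (h0 : P 0)
    (hadd : ∀ x y, P x → P y → P (x + y)) (x : (directSum N).carrier) : P x :=
  directSum_induction N h h0 hadd x

theorem isBi_directSumLift {X : Bimod A} {n : ℤ} {f : ∀ i, (N i).carrier →ₗ[R] X.carrier}
    (hf : ∀ i, IsBi n (f i)) : IsBi n (directSumLift f) where
  lact a m := by
    induction m using directSum_induction' with
    | h i m => rw [← Hom.map_lact, directSumLift_of, directSumLift_of, (hf i).lact]
    | h0 => simp
    | hadd x y hx hy => simp only [map_add, hx, hy]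
  ract a m := by
    induction m using directSum_induction' with
    | h i m => rw [← Hom.map_ract, directSumLift_of, directSumLift_of, (hf i).ract]
    | h0 => simp
    | hadd x y hx hy => simp only [map_add, hx, hy]
  mem n m hm := by
    classical
    rw [directSumLift, DFinsupp.lsum_apply_apply, DFinsupp.sumAddHom_apply]
    exact Submodule.sum_mem _ fun i _ => (hf i).mem _ _ (hm i)

/-- The morphism out of a direct sum with given restrictions to the summands. -/
def directSumDesc {X : Bimod A} (f : ∀ i, N i ⟶ X) : directSum N ⟶ X :=
  (isBi_directSumLift fun i => Hom.isBi (f i)).toHom fun m => by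
    induction m using directSum_induction' with
    | h i m => rw [← Hom.map_d, directSumLift_of, directSumLift_of, Hom.map_d]
    | h0 => simp
    | hadd x y hx hy => simp only [map_add, hx, hy]

@[simp] theorem directSumOf_desc {X : Bimod A} (f : ∀ i, N i ⟶ X) (i : ι) :
    directSumOf N i ≫ directSumDesc f = f i :=
  hom_ext fun m => directSumLift_of (fun i => Hom.map (f i)) i m

theorem directSum_hom_ext {X : Bimod A} {f g : directSum N ⟶ X}
    (h : ∀ i, directSumOf N i ≫ f = directSumOf N i ≫ g) : f = g :=
  hom_ext fun m => by
    induction m using directSum_induction' with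
    | h i m => exact congrArg (fun f => Hom.map f m) (h i)
    | h0 => simp
    | hadd x y hx hy => simp only [map_add, hx, hy]

theorem homotopic_directSumDesc {X : Bimod A} {f g : ∀ i, N i ⟶ X}
    (h : ∀ i, homotopic A (f i) (g i)) : homotopic A (directSumDesc f) (directSumDesc g) := by
  choose k hk h using h
  refine ⟨directSumLift k, isBi_directSumLift hk, fun m => ?_⟩
  induction m using directSum_induction' with
  | h i m =>
    rw [← Hom.map_d, directSumLift_of, directSumLift_of]
    exact (congrArg₂ _ (directSumLift_of _ i m) (directSumLift_of _ i m)).trans (h i m)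
  | h0 => simp
  | hadd x y hx hy =>
    simp only [map_add]
    rw [add_sub_add_comm, hx, hy]; abel

/-- A direct sum of quasi-isomorphisms is a quasi-isomorphism. -/
theorem quasiIso_directSum {M : ι → Bimod A} {f : ∀ i, N i ⟶ M i} (hf : ∀ i, quasiIso A (f i)) :
    quasiIso A (directSumDesc fun i => f i ≫ directSumOf M i) := by
  classical
  have hcomp : ∀ (x : (directSum N).carrier) i,
      Hom.map (directSumDesc fun i => f i ≫ directSumOf M i) x i = Hom.map (f i) (x i) := by
    intro x i
    induction x using directSum_induction' with
    | h j m =>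
      have := congrArg (fun f => Hom.map f m) (directSumOf_desc (fun i => f i ≫ directSumOf M i) j)
      refine (congrArg (fun z : (directSum M).carrier => z i) this).trans ?_
      change DFinsupp.single (β := fun i => (M i).carrier) j (Hom.map (f j) m) i =
        Hom.map (f i) (DFinsupp.single (β := fun i => (N i).carrier) j m i)
      by_cases h : i = j
      · subst h; simp
      · simp [DFinsupp.single_eq_of_ne h]
    | h0 => simp
    | hadd x y hx hy => simp only [map_add, DFinsupp.add_apply, hx, hy]
  simp only [quasiIso_iff] at hf
  rw [quasiIso_iff]
  intro x y hx hxy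
  have hx' : ∀ i, (N i).d (x i) = 0 := fun i =>
    (directSum_d_apply N x i).symm.trans (DFunLike.congr_fun hx i)
  have hxy' : ∀ i, Hom.map (f i) (x i) = (M i).d (y i) := fun i => by
    rw [← hcomp, hxy]; rfl
  choose x' y' h1 h2 using fun i => hf i (x i) (y i) (hx' i) (hxy' i)
  let s := x.support ∪ y.support
  have hs : ∀ i, i ∉ s → x i = 0 ∧ y i = 0 := fun i hi => by
    simpa [s, not_or] using hi
  refine ⟨DFinsupp.mk s fun i => x' i, DFinsupp.mk s fun i => y' i, ?_, ?_⟩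
  · refine DFinsupp.ext fun i => ?_
    rw [directSum_d_apply]
    by_cases hi : i ∈ s
    · rw [DFinsupp.mk_of_mem hi, h1]
    · rw [DFinsupp.mk_of_notMem hi, map_zero, (hs i hi).1]
  · refine DFinsupp.ext fun i => ?_
    rw [DFinsupp.add_apply, hcomp, directSum_d_apply]
    by_cases hi : i ∈ s
    · rw [DFinsupp.mk_of_mem hi, DFinsupp.mk_of_mem hi]
      exact h2 i
    · rw [DFinsupp.mk_of_notMem hi, DFinsupp.mk_of_notMem hi, map_zero, map_zero, add_zero,
        (hs i hi).2]

end DirectSum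

section Coproduct

variable {ι : Type u} (N : ι → Bimod A)

/-- The existence part of the universal property of the direct sum in the derived category. -/
theorem exists_Q_desc {X : Bimod A}
    (α : ∀ i, (quasiIso A).Q.obj (N i) ⟶ (quasiIso A).Q.obj X) :
    ∃ u : (quasiIso A).Q.obj (directSum N) ⟶ (quasiIso A).Q.obj X,
      ∀ i, (quasiIso A).Q.map (directSumOf N i) ≫ u = α i := by
  choose N' s a hs h using fun i => exists_roof (α i)
  have hS := quasiIso_directSum hs
  have : IsIso ((quasiIso A).Q.map (directSumDesc fun i => s i ≫ directSumOf N i)) :=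
    (quasiIso A).Q_inverts _ hS
  refine ⟨inv ((quasiIso A).Q.map (directSumDesc fun i => s i ≫ directSumOf N i)) ≫
    (quasiIso A).Q.map (directSumDesc a), fun i => ?_⟩
  have hi : IsIso ((quasiIso A).Q.map (s i)) := (quasiIso A).Q_inverts _ (hs i)
  rw [← cancel_epi ((quasiIso A).Q.map (s i)), h, ← Category.assoc,
    ← CategoryTheory.Functor.map_comp,
    ← directSumOf_desc (fun i => s i ≫ directSumOf N i) i, CategoryTheory.Functor.map_comp,
    Category.assoc, IsIso.hom_inv_id_assoc, ← CategoryTheory.Functor.map_comp, directSumOf_desc]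

/-- The uniqueness part of the universal property of the direct sum in the derived category. -/
theorem Q_directSum_hom_ext {X : Bimod A}
    {g h : (quasiIso A).Q.obj (directSum N) ⟶ (quasiIso A).Q.obj X}
    (H : ∀ i, (quasiIso A).Q.map (directSumOf N i) ≫ g =
      (quasiIso A).Q.map (directSumOf N i) ≫ h) : g = h := by
  -- represent `g` and `h` by fractions with the same denominator `σ`
  obtain ⟨N₁, s, a, hs, hg⟩ := exists_roof g
  obtain ⟨N₂, s', b, hs', hb⟩ := exists_roof ((quasiIso A).Q.map s ≫ h)
  have hσ : quasiIso A (s' ≫ s) := quasiIso_comp hs' hs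
  have hg' : (quasiIso A).Q.map (s' ≫ s) ≫ g = (quasiIso A).Q.map (s' ≫ a) := by
    simp only [CategoryTheory.Functor.map_comp, Category.assoc, hg]
  have hh' : (quasiIso A).Q.map (s' ≫ s) ≫ h = (quasiIso A).Q.map b := by
    simp only [CategoryTheory.Functor.map_comp, Category.assoc, hb]
  generalize s' ≫ a = a' at hg'
  generalize s' ≫ s = σ at hσ hg' hh'
  -- pull the denominator back to the summands
  let p := fun i => hpullFst (directSumOf N i) σ
  let q := fun i => hpullSnd (directSumOf N i) σ
  have hpq : ∀ i, homotopic A (p i ≫ directSumOf N i) (q i ≫ σ) := fun i => homotopic_hpull _ _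
  have hp : ∀ i, quasiIso A (p i) := fun i => quasiIso_hpullFst _ hσ
  have key : ∀ i, (quasiIso A).Q.map (q i ≫ a') = (quasiIso A).Q.map (q i ≫ b) := fun i => by
    rw [CategoryTheory.Functor.map_comp, CategoryTheory.Functor.map_comp, ← hg', ← hh',
      ← Category.assoc, ← Category.assoc, ← CategoryTheory.Functor.map_comp,
      ← Q_map_eq_of_homotopic (hpq i), CategoryTheory.Functor.map_comp, Category.assoc,
      Category.assoc, H]
  -- the numerators agree on the summands after a further quasi-isomorphism `t i`; the direct sum
  -- of the resulting quasi-isomorphisms factors through `σ` up to homotopy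
  choose N₃ t ht hab using fun i => exists_quasiIso_of_Q_map_eq (key i)
  have hω := quasiIso_directSum fun i => quasiIso_comp (ht i) (hp i)
  have : IsIso ((quasiIso A).Q.map
      (directSumDesc fun i => (t i ≫ p i) ≫ directSumOf N i)) := (quasiIso A).Q_inverts _ hω
  have e : (quasiIso A).Q.map (directSumDesc fun i => (t i ≫ p i) ≫ directSumOf N i) =
      (quasiIso A).Q.map (directSumDesc fun i => t i ≫ q i) ≫ (quasiIso A).Q.map σ := by
    rw [← CategoryTheory.Functor.map_comp]
    have : (directSumDesc fun i => t i ≫ q i) ≫ σ = directSumDesc fun i => t i ≫ q i ≫ σ :=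
      directSum_hom_ext fun i => by
        rw [directSumOf_desc, ← Category.assoc, directSumOf_desc, Category.assoc]
    rw [this]
    refine Q_map_eq_of_homotopic (homotopic_directSumDesc fun i => ?_)
    rw [Category.assoc]
    exact HomRel.comp_left (r := homotopic A) _ (hpq i)
  have hd : ∀ c : N₂ ⟶ X, (directSumDesc fun i => t i ≫ q i) ≫ c =
      directSumDesc fun i => t i ≫ q i ≫ c := fun c => directSum_hom_ext fun i => by
    rw [directSumOf_desc, ← Category.assoc, directSumOf_desc, Category.assoc]
  rw [← cancel_epi ((quasiIso A).Q.map
    (directSumDesc fun i => (t i ≫ p i) ≫ directSumOf N i)), e, Category.assoc, Category.assoc,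
    hg', hh', ← CategoryTheory.Functor.map_comp, ← CategoryTheory.Functor.map_comp, hd, hd]
  exact Q_map_eq_of_homotopic (homotopic_directSumDesc hab)

/-- The direct sum, as a cofan in the derived category. -/
def directSumCofan : Cofan fun i => (quasiIso A).Q.obj (N i) :=
  Cofan.mk ((quasiIso A).Q.obj (directSum N)) fun i => (quasiIso A).Q.map (directSumOf N i)

theorem Q_obj_surjective (X : Derived A) : ∃ M : Bimod A, (quasiIso A).Q.obj M = X :=
  ⟨(Localization.Construction.objEquiv (quasiIso A)).symm X,
    (Localization.Construction.objEquiv (quasiIso A)).apply_symm_apply X⟩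

/-- The direct sum is a coproduct in the derived category. -/
def directSumIsColimit : IsColimit (directSumCofan N) := by
  have H : ∀ t : Cofan fun i => (quasiIso A).Q.obj (N i),
      ∃ u : (quasiIso A).Q.obj (directSum N) ⟶ t.pt,
        ∀ i, (quasiIso A).Q.map (directSumOf N i) ≫ u = t.inj i := fun t => by
    obtain ⟨X, hX⟩ := Q_obj_surjective t.pt
    obtain ⟨u, hu⟩ := exists_Q_desc N (X := X) fun i => t.inj i ≫ eqToHom hX.symm
    exact ⟨u ≫ eqToHom hX, fun i => by rw [← Category.assoc, hu]; simp⟩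
  refine Cofan.IsColimit.mk _ (fun t => Classical.choose (H t))
    (fun t i => Classical.choose_spec (H t) i) (fun t m hm => ?_)
  obtain ⟨X, hX⟩ := Q_obj_surjective t.pt
  rw [← cancel_mono (eqToHom hX.symm)]
  refine Q_directSum_hom_ext N fun i => ?_
  refine (Category.assoc _ _ _).symm.trans (Eq.trans ?_ (Category.assoc _ _ _))
  exact congrArg (· ≫ eqToHom hX.symm) ((hm i).trans (Classical.choose_spec (H t) i).symm)

/-- The inclusion of a partial direct sum. -/
def directSumIncl (s : Finset ι) : directSum (fun i : s => N i) ⟶ directSum N :=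
  directSumDesc fun i => directSumOf N i

/-- A compact object has maps to direct sums which factor through finite direct sums. -/
theorem exists_finset_of_isCompactObject {P : Bimod A}
    (hP : IsCompactObject ((quasiIso A).Q.obj P))
    (f : (quasiIso A).Q.obj P ⟶ (quasiIso A).Q.obj (directSum N)) :
    ∃ (s : Finset ι) (g : (quasiIso A).Q.obj P ⟶
      (quasiIso A).Q.obj (directSum fun i : s => N i)),
      g ≫ (quasiIso A).Q.map (directSumIncl N s) = f := by
  obtain ⟨s, c', hc', g, hg⟩ := hP ι _ (directSumCofan N) (directSumIsColimit N) f
  let v : c'.pt ⟶ (quasiIso A).Q.obj (directSum fun i : s => N i) :=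
    Cofan.IsColimit.desc hc' (fun i => (quasiIso A).Q.map (directSumOf (fun i : s => N i) i))
  refine ⟨s, g ≫ v, ?_⟩
  refine (Category.assoc _ _ _).trans (Eq.trans ?_ hg)
  refine congrArg (g ≫ ·) (Cofan.IsColimit.hom_ext hc' _ _ fun i => ?_)
  have e : (quasiIso A).Q.map (directSumOf (fun i : s => N i) i) ≫
      (quasiIso A).Q.map (directSumIncl N s) = (quasiIso A).Q.map (directSumOf N i) := by
    rw [← CategoryTheory.Functor.map_comp, directSumIncl, directSumOf_desc]
  refine (Category.assoc _ _ _).symm.trans ?_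
  rw [Cofan.IsColimit.fac hc']
  exact e.trans (Cofan.IsColimit.fac hc' (fun i => (directSumCofan N).inj i.1) i).symm

/-- An object is compact if its maps to direct sums factor through finite direct sums. -/
theorem isCompactObject_of_exists_finset {P : Bimod A}
    (hP : ∀ (ι : Type u) (N : ι → Bimod A)
      (f : (quasiIso A).Q.obj P ⟶ (quasiIso A).Q.obj (directSum N)),
      ∃ (s : Finset ι) (g : (quasiIso A).Q.obj P ⟶
        (quasiIso A).Q.obj (directSum fun i : s => N i)),
        g ≫ (quasiIso A).Q.map (directSumIncl N s) = f) :
    IsCompactObject ((quasiIso A).Q.obj P) := by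
  intro ι M c hc f
  choose N hN using fun i => Q_obj_surjective (M i)
  obtain rfl : (fun i => (quasiIso A).Q.obj (N i)) = M := funext hN
  let e : c.pt ⟶ (quasiIso A).Q.obj (directSum N) :=
    Cofan.IsColimit.desc hc fun i => (directSumCofan N).inj i
  let e' : (quasiIso A).Q.obj (directSum N) ⟶ c.pt :=
    Cofan.IsColimit.desc (directSumIsColimit N) fun i => c.inj i
  have he : ∀ i, c.inj i ≫ e = (quasiIso A).Q.map (directSumOf N i) :=
    fun i => Cofan.IsColimit.fac hc _ i
  have he' : ∀ i, (quasiIso A).Q.map (directSumOf N i) ≫ e' = c.inj i :=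
    fun i => Cofan.IsColimit.fac (directSumIsColimit N) _ i
  have hee' : e ≫ e' = 𝟙 _ := Cofan.IsColimit.hom_ext hc _ _ fun i => by
    rw [← Category.assoc, he, he', Category.comp_id]
  obtain ⟨s, g, hg⟩ := hP ι N (f ≫ e)
  refine ⟨s, directSumCofan _, directSumIsColimit _, g, ?_⟩
  have hf : f = g ≫ (quasiIso A).Q.map (directSumIncl N s) ≫ e' := by
    rw [← Category.assoc, hg, Category.assoc, hee', Category.comp_id]
  refine Eq.trans (congrArg (g ≫ ·) ?_) hf.symm
  refine Cofan.IsColimit.hom_ext (directSumIsColimit _) _ _ fun i => ?_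
  rw [Cofan.IsColimit.fac]
  have h : (quasiIso A).Q.map (directSumOf (fun i : s => N i) i) ≫
      (quasiIso A).Q.map (directSumIncl N s) ≫ e' = c.inj i := by
    rw [← Category.assoc, ← CategoryTheory.Functor.map_comp, directSumIncl, directSumOf_desc, he']
  exact h.symm

end Coproduct

end Bimod
end DGA

namespace DGA
namespace Bimod

variable {R : Type u} [CommRing R] {A : DGA R}

/-! ### Semifree bimodules -/

/-- The sub-bimodule generated by the elements `gen x` with `rank x < n`. -/
def genSpan (P : Bimod A) {X : Type u} (gen : X → P.carrier) (rank : X → ℕ) (n : ℕ) :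
    Submodule R P.carrier :=
  Submodule.span R {m | ∃ a b x, rank x < n ∧ m = P.lact a (P.ract b (gen x))}

theorem IsBi.eq_zero_of_mem_genSpan {P N : Bimod A} {X : Type u} {gen : X → P.carrier}
    {rank : X → ℕ} {n : ℕ} {k : ℤ} {f : P.carrier →ₗ[R] N.carrier} (hf : IsBi k f)
    (h : ∀ x, rank x < n → f (gen x) = 0) {m : P.carrier} (hm : m ∈ genSpan P gen rank n) :
    f m = 0 := by
  induction hm using Submodule.span_induction with
  | mem m hm =>
    obtain ⟨a, b, x, hx, rfl⟩ := hm
    rw [hf.lact, hf.ract, h x hx, map_zero, map_zero]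
  | zero => exact map_zero _
  | add x y _ _ hx hy => rw [map_add, hx, hy, add_zero]
  | smul c x _ hx => rw [map_smul, hx, smul_zero]

theorem genSpan_mono (P : Bimod A) {X : Type u} (gen : X → P.carrier) (rank : X → ℕ) {m n : ℕ}
    (h : m ≤ n) : genSpan P gen rank m ≤ genSpan P gen rank n :=
  Submodule.span_mono fun _ ⟨a, b, x, hx, e⟩ => ⟨a, b, x, hx.trans_le h, e⟩

theorem lact_mem_genSpan (P : Bimod A) {X : Type u} {gen : X → P.carrier} {rank : X → ℕ} {n : ℕ}
    (a : A.carrier) {m : P.carrier} (hm : m ∈ genSpan P gen rank n) :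
    P.lact a m ∈ genSpan P gen rank n := by
  induction hm using Submodule.span_induction with
  | mem m hm =>
    obtain ⟨a', b, x, hx, rfl⟩ := hm
    exact Submodule.subset_span ⟨a * a', b, x, hx, by rw [map_mul]; rfl⟩
  | zero => rw [map_zero]; exact zero_mem _
  | add x y _ _ hx hy => rw [map_add]; exact add_mem hx hy
  | smul c x _ hx => rw [map_smul]; exact Submodule.smul_mem _ _ hx

theorem ract_mem_genSpan (P : Bimod A) {X : Type u} {gen : X → P.carrier} {rank : X → ℕ} {n : ℕ}
    (b : A.carrierᵐᵒᵖ) {m : P.carrier} (hm : m ∈ genSpan P gen rank n) :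
    P.ract b m ∈ genSpan P gen rank n := by
  induction hm using Submodule.span_induction with
  | mem m hm =>
    obtain ⟨a, b', x, hx, rfl⟩ := hm
    exact Submodule.subset_span ⟨a, b * b', x, hx, by
      rw [map_mul, ← P.lact_ract]; rfl⟩
  | zero => rw [map_zero]; exact zero_mem _
  | add x y _ _ hx hy => rw [map_add]; exact add_mem hx hy
  | smul c x _ hx => rw [map_smul]; exact Submodule.smul_mem _ _ hx

theorem gen_mem_genSpan (P : Bimod A) {X : Type u} {gen : X → P.carrier} {rank : X → ℕ} {n : ℕ}
    {x : X} (hx : rank x < n) : gen x ∈ genSpan P gen rank n :=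
  Submodule.subset_span ⟨1, 1, x, hx, by simp⟩

/-- A bimodule is semifree if it has free generators `gen x` of degree `deg x` which are ordered
by a rank such that the differential of each generator involves only generators of smaller
rank. Freeness is expressed by the extension property for bilinear maps. -/
structure SemiFree (P : Bimod A) where
  X : Type u
  gen : X → P.carrier
  deg : X → ℤ
  rank : X → ℕ
  gen_mem : ∀ x, gen x ∈ P.gr (deg x)
  mem_top : ∀ m, ∃ n, m ∈ genSpan P gen rank n
  d_gen : ∀ x, P.d (gen x) ∈ genSpan P gen rank (rank x)
  exists_ext : ∀ (N : Bimod A) (φ : ∀ x, N.gr (deg x)),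
    ∃ f : P.carrier →ₗ[R] N.carrier, IsBi 0 f ∧ ∀ x, f (gen x) = φ x

namespace SemiFree

variable {P : Bimod A}

/-- A bilinear map from a semifree bimodule is determined by its values on the generators. -/
theorem eq_zero (S : SemiFree P) {N : Bimod A} {k : ℤ} {f : P.carrier →ₗ[R] N.carrier}
    (hf : IsBi k f)
    (h : ∀ x, f (S.gen x) = 0) : f = 0 := by
  ext m
  obtain ⟨n, hn⟩ := S.mem_top m
  exact hf.eq_zero_of_mem_genSpan (fun x _ => h x) hn

/-- Maps from a semifree bimodule lift against surjective quasi-isomorphisms. The values on the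
generators are chosen by recursion on the rank. -/
theorem exists_lift (S : SemiFree P) {N' N : Bimod A} (s : N' ⟶ N) (hs : quasiIso A s)
    (hsurj : Function.Surjective (Hom.map s)) (F : P ⟶ N) : ∃ F' : P ⟶ N', F' ≫ s = F := by
  classical
  choose E hE hEgen using S.exists_ext N'
  -- `C φ x z`: the element `z` is a suitable value on `gen x` if `φ` gives the previous values
  let C : (∀ x, N'.gr (S.deg x)) → ∀ x, N'.gr (S.deg x) → Prop := fun φ x z =>
    Hom.map s z = Hom.map F (S.gen x) ∧ N'.d z = E φ (P.d (S.gen x))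
  let step : ∀ x, (∀ y, S.rank y < S.rank x → N'.gr (S.deg y)) → N'.gr (S.deg x) := fun x rec =>
    if h : ∃ z, C (fun y => if hy : S.rank y < S.rank x then rec y hy else 0) x z then
      h.choose else 0
  let φ : ∀ x, N'.gr (S.deg x) := (measure S.rank).wf.fix step
  have hφ : ∀ x, φ x = step x (fun y _ => φ y) := fun x => WellFounded.fix_eq _ _ _
  have hagree : ∀ (φ₁ φ₂ : ∀ x, N'.gr (S.deg x)) (n : ℕ) (m : P.carrier),
      (∀ x, S.rank x < n → φ₁ x = φ₂ x) → m ∈ genSpan P S.gen S.rank n → E φ₁ m = E φ₂ m := by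
    intro φ₁ φ₂ n m h hm
    refine sub_eq_zero.1 (((hE φ₁).sub (hE φ₂)).eq_zero_of_mem_genSpan (fun x hx => ?_) hm)
    rw [LinearMap.sub_apply, hEgen, hEgen, h x hx, sub_self]
  have hgood : ∀ x, C φ x (φ x) := by
    intro x
    induction hn : S.rank x using Nat.strong_induction_on generalizing x with
    | _ n ih =>
    subst hn
    -- the extension `E φ` of the values chosen so far lifts `F`, by `h1`, and commutes with the
    -- differentials, by `h2`, on the part where the rank is smaller
    have h1 : ∀ m ∈ genSpan P S.gen S.rank (S.rank x), Hom.map s (E φ m) = Hom.map F m := by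
      intro m hm
      refine sub_eq_zero.1 ((((Hom.isBi s).comp (hE φ)).sub
        (Hom.isBi F)).eq_zero_of_mem_genSpan (fun y hy => ?_) hm)
      rw [LinearMap.sub_apply, LinearMap.comp_apply, hEgen, (ih _ hy y rfl).1, sub_self]
    have h2 : ∀ m ∈ genSpan P S.gen S.rank (S.rank x), N'.d (E φ m) - E φ (P.d m) = 0 := by
      intro m hm
      have := (hE φ).d_comp.eq_zero_of_mem_genSpan (fun y hy => ?_) hm
      · simpa [Units.smul_def, sub_eq_add_neg] using this
      · have := (ih _ hy y rfl).2
        simp [Units.smul_def, hEgen, this]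
    -- since `s` is a quasi-isomorphism, the cocycle `E φ (d (gen x))` bounds an element `z` over
    -- `F (gen x)` up to a boundary `d w`; surjectivity lifts `w`, and projection to the degree of
    -- `gen x` makes the value homogeneous
    have h3 : ∃ z, C φ x z := by
      have hd : N'.d (E φ (P.d (S.gen x))) = 0 := by
        have := h2 _ (S.d_gen x)
        rwa [P.d_d, map_zero, sub_zero] at this
      obtain ⟨z, w, hz, hw⟩ := (quasiIso_iff s).1 hs _ (Hom.map F (S.gen x)) hd
        (by rw [h1 _ (S.d_gen x), Hom.map_d])
      obtain ⟨w, rfl⟩ := hsurj w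
      refine ⟨⟨N'.proj (S.deg x) (z + N'.d w), N'.proj_mem _ _⟩, ?_, ?_⟩
      · change Hom.map s (N'.proj _ _) = _
        rw [Hom.map_proj, map_add, Hom.map_d, hw]
        exact N.proj_same (Hom.map_mem F _ _ (S.gen_mem x))
      · change N'.d (N'.proj _ _) = _
        rw [d_proj, map_add, N'.d_d, add_zero, hz]
        refine N'.proj_same ?_
        have := (hE φ).mem _ _ (P.d_mem _ _ (S.gen_mem x))
        rwa [add_zero] at this
    -- the condition on `z` depends only on the values of `φ` in smaller rank
    have h4 : ∀ z, C φ x z ↔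
        C (fun y => if hy : S.rank y < S.rank x then φ y else 0) x z := by
      intro z
      have : E φ (P.d (S.gen x)) =
          E (fun y => if hy : S.rank y < S.rank x then φ y else 0) (P.d (S.gen x)) :=
        hagree _ _ _ _ (fun y hy => by rw [dif_pos hy]) (S.d_gen x)
      simp only [C, this]
    have h5 : ∃ z, C (fun y => if hy : S.rank y < S.rank x then φ y else 0) x z :=
      h3.imp fun z hz => (h4 z).1 hz
    rw [hφ x, h4]
    simp only [step]
    rw [dif_pos h5]
    exact h5.choose_spec
  refine ⟨(hE φ).toHom fun m => ?_, hom_ext fun m => ?_⟩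
  · have := S.eq_zero (hE φ).d_comp fun x => by
      simp [Units.smul_def, hEgen, (hgood x).2]
    have := LinearMap.congr_fun this m
    simp [Units.smul_def] at this
    rw [← sub_eq_add_neg, sub_eq_zero] at this
    exact this.symm
  · have := S.eq_zero (((Hom.isBi s).comp (hE φ)).sub (Hom.isBi F)) fun x => by
      rw [LinearMap.sub_apply, LinearMap.comp_apply, hEgen, (hgood x).1, sub_self]
    exact sub_eq_zero.1 (LinearMap.congr_fun this m)

/-- A quasi-isomorphism onto a semifree bimodule has a section up to homotopy. -/
theorem exists_section (S : SemiFree P) {P' : Bimod A} (t : P' ⟶ P) (ht : quasiIso A t) :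
    ∃ σ : P ⟶ P', homotopic A (𝟙 P) (σ ≫ t) := by
  obtain ⟨F, hF⟩ := S.exists_lift (hpullFst (𝟙 P) t) (quasiIso_hpullFst _ ht)
    (fun x => ⟨((x, 0), 0), rfl⟩) (𝟙 P)
  refine ⟨F ≫ hpullSnd _ _, ?_⟩
  have := HomRel.comp_left (r := homotopic A) F (homotopic_hpull (𝟙 P) t)
  rw [← Category.assoc, hF] at this
  exact this

/-- Morphisms in the derived category from a semifree bimodule are represented by maps. -/
theorem exists_Q_map_eq (S : SemiFree P) {N : Bimod A}
    (α : (quasiIso A).Q.obj P ⟶ (quasiIso A).Q.obj N) :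
    ∃ a : P ⟶ N, (quasiIso A).Q.map a = α := by
  obtain ⟨X', s, a, hs, h⟩ := exists_roof α
  obtain ⟨σ, hσ⟩ := S.exists_section s hs
  refine ⟨σ ≫ a, ?_⟩
  rw [CategoryTheory.Functor.map_comp, ← h, ← Category.assoc, ← CategoryTheory.Functor.map_comp,
    ← Q_map_eq_of_homotopic hσ, CategoryTheory.Functor.map_id, Category.id_comp]

/-- Maps from a semifree bimodule which agree in the derived category are homotopic. -/
theorem homotopic_of_Q_map_eq (S : SemiFree P) {N : Bimod A} {f g : P ⟶ N}
    (h : (quasiIso A).Q.map f = (quasiIso A).Q.map g) : homotopic A f g := by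
  obtain ⟨X', s, hs, h'⟩ := exists_quasiIso_of_Q_map_eq h
  obtain ⟨σ, hσ⟩ := S.exists_section s hs
  have h1 := HomRel.comp_left (r := homotopic A) σ h'
  rw [← Category.assoc, ← Category.assoc] at h1
  have h2 := HomRel.comp_right (r := homotopic A) f hσ
  have h3 := HomRel.comp_right (r := homotopic A) g hσ
  rw [Category.id_comp] at h2 h3
  have e : Equivalence (@homotopic R _ A P N) := Congruence.equivalence
  exact e.trans h2 (e.trans h1 (e.symm h3))

end SemiFree

end Bimod
end DGA

namespace DGA

/-! ### Words in a contracting variable -/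

/-- A homogeneous basis of a differential graded algebra, divided into two levels. The elements of
level `0` are cocycles, and the differential takes those of level `1` into the span of level `0`.
This makes the differential of a word a combination of words which are smaller in a suitable
  rank. -/
structure AdaptedBasis {R : Type u} [CommRing R] (A : DGA R) where
  I : Type u
  e : Module.Basis I R A.carrier
  deg : I → ℤ
  level : I → ℕ
  mem : ∀ i, e i ∈ A.gr (deg i)
  level_le : ∀ i, level i ≤ 1
  d_mem : ∀ i, A.d (e i) ∈ Submodule.span R (e '' {j | level j < level i})

theorem IsCentralCocycle.twist {R : Type u} [CommRing R] {A : DGA R} {W : A.carrier}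
    (hW : A.IsCentralCocycle W) (n : ℤ) : A.twist n W = W := by
  rw [A.twist_of_mem n 0 hW.mem, mul_zero, Int.negOnePow_zero, one_smul]

namespace AdaptedBasis

variable {R : Type u} [CommRing R] {A : DGA R} (β : A.AdaptedBasis)

theorem gr_le_span (n : ℤ) : A.gr n ≤ Submodule.span R (β.e '' {i | β.deg i = n}) := by
  intro a ha
  have key : ∀ x : A.carrier,
      GradedAlgebra.proj A.gr n x ∈ Submodule.span R (β.e '' {i | β.deg i = n}) := by
    intro x
    induction (β.e.mem_span x) using Submodule.span_induction with
    | mem x hx =>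
      obtain ⟨i, rfl⟩ := hx
      rw [GradedAlgebra.proj_apply]
      by_cases h : β.deg i = n
      · rw [DirectSum.decompose_of_mem_same _ (h ▸ β.mem i)]
        exact Submodule.subset_span ⟨i, h, rfl⟩
      · rw [DirectSum.decompose_of_mem_ne _ (β.mem i) h]
        exact zero_mem _
    | zero => rw [map_zero]; exact zero_mem _
    | add x y _ _ hx hy => rw [map_add]; exact add_mem hx hy
    | smul c x _ hx => rw [map_smul]; exact Submodule.smul_mem _ _ hx
  have := key a
  rwa [GradedAlgebra.proj_apply, DirectSum.decompose_of_mem_same _ ha] at this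

/-- The free product of `A` with a variable `h` of degree `-1` such that `d h = 1`. The basis
element indexed by the word `w = [i₁, …, iₗ]` over `A` is `h e_{i₁} h e_{i₂} ⋯ h e_{iₗ}`. -/
abbrev Words : Type u := List β.I →₀ A.carrier

/-- The degree of the word `h e_{i₁} h e_{i₂} ⋯ h e_{iₗ}`. -/
def wdeg (w : List β.I) : ℤ := (w.map fun i => β.deg i - 1).sum

@[simp] theorem wdeg_nil : β.wdeg [] = 0 := rfl
@[simp] theorem wdeg_cons (i : β.I) (w : List β.I) :
    β.wdeg (i :: w) = β.deg i - 1 + β.wdeg w := rfl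

/-- Left multiplication by `h`. -/
def mulH : β.Words →ₗ[R] β.Words :=
  Finsupp.lsum R fun w => β.e.constr R fun i => Finsupp.single (i :: w) 1

theorem mulH_single (w : List β.I) (i : β.I) :
    β.mulH (Finsupp.single w (β.e i)) = Finsupp.single (i :: w) 1 := by
  rw [mulH, Finsupp.lsum_single, Module.Basis.constr_basis]

theorem smul_single_eq (w : List β.I) (i : β.I) (a : A.carrier) :
    Finsupp.single (i :: w) a = a • β.mulH (Finsupp.single w (β.e i)) := by
  rw [mulH_single, Finsupp.smul_single, smul_eq_mul, mul_one]

/-- The words are generated by `1` under multiplication by `h` and by elements of `A`. -/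
theorem words_induction {P : β.Words → Prop} (h1 : P (Finsupp.single [] 1))
    (hsmul : ∀ (a : A.carrier) z, P z → P (a • z)) (hH : ∀ z, P z → P (β.mulH z))
    (hadd : ∀ x y, P x → P y → P (x + y)) (z : β.Words) : P z := by
  have h : ∀ (w : List β.I) (a : A.carrier), P (Finsupp.single w a) := by
    intro w
    induction w with
    | nil =>
      intro a
      have := hsmul a _ h1
      rwa [Finsupp.smul_single, smul_eq_mul, mul_one] at this
    | cons i w ih =>
      intro a
      rw [smul_single_eq]
      exact hsmul _ _ (hH _ (ih _))
  induction z using Finsupp.induction_linear with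
  | zero => simpa using h [] 0
  | add x y hx hy => exact hadd x y hx hy
  | single w a => exact h w a

theorem linearMap_ext {M : Type*} [AddCommGroup M] [Module R M] {f g : β.Words →ₗ[R] M}
    (h : ∀ w i, f (Finsupp.single w (β.e i)) = g (Finsupp.single w (β.e i))) : f = g :=
  Finsupp.lhom_ext' fun w => β.e.ext fun i => h w i

/-- The linear map `a w ↦ τ(a) φ(w)`, for a sign operator `τ` and `φ` defined on words. -/
def wordExt (n : ℤ) (φ : List β.I → β.Words) : β.Words →ₗ[R] β.Words :=
  Finsupp.lsum R fun w =>
    ((LinearMap.toSpanSingleton A.carrier β.Words (φ w)).restrictScalars R) ∘ₗ A.twist n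

theorem wordExt_single (n : ℤ) (φ : List β.I → β.Words) (w : List β.I) (a : A.carrier) :
    β.wordExt n φ (Finsupp.single w a) = A.twist n a • φ w := by
  rw [wordExt, Finsupp.lsum_single]; rfl

theorem wordExt_smul (n : ℤ) (φ : List β.I → β.Words) (a : A.carrier) (z : β.Words) :
    β.wordExt n φ (a • z) = A.twist n a • β.wordExt n φ z := by
  induction z using Finsupp.induction_linear with
  | zero => simp
  | add x y hx hy => simp only [smul_add, map_add, hx, hy]
  | single w b =>
    rw [Finsupp.smul_single, wordExt_single, wordExt_single, smul_eq_mul, twist_mul, mul_smul]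

/-! #### The differential -/

/-- The differential of a word. -/
def dWord : List β.I → β.Words
  | [] => 0
  | i :: w => Finsupp.single w (β.e i) -
      β.mulH (Finsupp.single w (A.d (β.e i)) + A.twist 1 (β.e i) • dWord w)

/-- The differential on words, which satisfies the Leibniz rule and `d h = 1`. -/
def dW : β.Words →ₗ[R] β.Words := Finsupp.mapRange.linearMap A.d + β.wordExt 1 β.dWord

theorem dW_single (w : List β.I) (a : A.carrier) :
    β.dW (Finsupp.single w a) = Finsupp.single w (A.d a) + A.twist 1 a • β.dWord w := by
  rw [dW, LinearMap.add_apply, wordExt_single, Finsupp.mapRange.linearMap_apply,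
    Finsupp.mapRange_single]

theorem dW_nil (a : A.carrier) :
    β.dW (Finsupp.single [] a) = Finsupp.single [] (A.d a) := by
  rw [dW_single, dWord, smul_zero, add_zero]

theorem dW_smul (a : A.carrier) (z : β.Words) :
    β.dW (a • z) = A.d a • z + A.twist 1 a • β.dW z := by
  induction z using Finsupp.induction_linear with
  | zero => simp
  | add x y hx hy => simp only [smul_add, map_add, hx, hy]; abel
  | single w b =>
    rw [Finsupp.smul_single, dW_single, dW_single, smul_eq_mul, twist_mul, mul_smul, d_mul,
      smul_add, Finsupp.smul_single, Finsupp.smul_single, Finsupp.single_add, smul_eq_mul,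
      smul_eq_mul, add_assoc]

/-- The Leibniz rule for `d h = 1`: multiplication by `h` is a contracting homotopy. -/
theorem dW_mulH (z : β.Words) : β.dW (β.mulH z) = z - β.mulH (β.dW z) := by
  have : β.dW ∘ₗ β.mulH = LinearMap.id - β.mulH ∘ₗ β.dW := β.linearMap_ext fun w i => by
    simp only [LinearMap.comp_apply, LinearMap.sub_apply, LinearMap.id_apply]
    rw [mulH_single, dW_single, dW_single, twist_one, one_smul, d_one, Finsupp.single_zero,
      zero_add, dWord]
  exact LinearMap.congr_fun this z

theorem dW_dW (z : β.Words) : β.dW (β.dW z) = 0 := by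
  induction z using β.words_induction with
  | h1 => rw [dW_nil, d_one, Finsupp.single_zero, map_zero]
  | hsmul a z hz =>
    rw [dW_smul, map_add, dW_smul, dW_smul, hz, A.d_d, twist_one_d, zero_smul, smul_zero,
      neg_smul, zero_add, add_zero, neg_add_cancel]
  | hH z hz => rw [dW_mulH, map_sub, dW_mulH, hz, map_zero, sub_zero, sub_self]
  | hadd x y hx hy => rw [map_add, map_add, hx, hy, add_zero]

/-! #### The right action -/

/-- Right multiplication of a word by elements of `A`. -/
def rWord : List β.I → A.carrier →ₗ[R] β.Words
  | [] => Finsupp.lsingle []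
  | i :: w => β.mulH ∘ₗ Algebra.lsmul R R β.Words (β.e i) ∘ₗ rWord w

/-- Right multiplication by an element of `A`. -/
def rW (b : A.carrier) : β.Words →ₗ[R] β.Words := β.wordExt 0 fun w => β.rWord w b

theorem rW_single (b : A.carrier) (w : List β.I) (a : A.carrier) :
    β.rW b (Finsupp.single w a) = a • β.rWord w b := by
  rw [rW, wordExt_single, twist_zero]

theorem rW_smul (b a : A.carrier) (z : β.Words) : β.rW b (a • z) = a • β.rW b z := by
  rw [rW, wordExt_smul, twist_zero]

theorem rW_nil (b a : A.carrier) :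
    β.rW b (Finsupp.single [] a) = Finsupp.single [] (a * b) := by
  rw [rW_single]; exact Finsupp.smul_single _ _ _

theorem rW_mulH (b : A.carrier) (z : β.Words) : β.rW b (β.mulH z) = β.mulH (β.rW b z) := by
  have : β.rW b ∘ₗ β.mulH = β.mulH ∘ₗ β.rW b := β.linearMap_ext fun w i => by
    simp only [LinearMap.comp_apply]
    rw [mulH_single, rW_single, rW_single, one_smul]; rfl
  exact LinearMap.congr_fun this z

theorem rW_add (b c : A.carrier) (z : β.Words) : β.rW (b + c) z = β.rW b z + β.rW c z := by
  induction z using Finsupp.induction_linear with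
  | zero => simp
  | add x y hx hy => simp only [map_add, hx, hy]; abel
  | single w a => simp only [rW_single, map_add, smul_add]

theorem rW_smul_left (r : R) (b : A.carrier) (z : β.Words) : β.rW (r • b) z = r • β.rW b z := by
  induction z using Finsupp.induction_linear with
  | zero => simp
  | add x y hx hy => simp only [map_add, hx, hy, smul_add]
  | single w a => simp only [rW_single, map_smul]; rw [smul_comm]

theorem rW_one (z : β.Words) : β.rW 1 z = z := by
  induction z using β.words_induction with
  | h1 => rw [rW_nil, mul_one]
  | hsmul a z hz => rw [rW_smul, hz]
  | hH z hz => rw [rW_mulH, hz]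
  | hadd x y hx hy => rw [map_add, hx, hy]

theorem rW_rW (b c : A.carrier) (z : β.Words) : β.rW b (β.rW c z) = β.rW (c * b) z := by
  induction z using β.words_induction with
  | h1 => rw [rW_nil, rW_nil, rW_nil, mul_assoc]
  | hsmul a z hz => rw [rW_smul, rW_smul, rW_smul, hz]
  | hH z hz => rw [rW_mulH, rW_mulH, rW_mulH, hz]
  | hadd x y hx hy => simp only [map_add, hx, hy]

/-! #### Grading and signs -/

/-- The sign operator on words. -/
def sW : β.Words →ₗ[R] β.Words :=
  β.wordExt 1 fun w => (β.wdeg w).negOnePow • Finsupp.single w 1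

theorem sW_smul (a : A.carrier) (z : β.Words) : β.sW (a • z) = A.twist 1 a • β.sW z :=
  β.wordExt_smul _ _ _ _

theorem sW_single (w : List β.I) (a : A.carrier) :
    β.sW (Finsupp.single w a) = (β.wdeg w).negOnePow • Finsupp.single w (A.twist 1 a) := by
  rw [sW, wordExt_single, Units.smul_def, smul_comm, Finsupp.smul_single, smul_eq_mul, mul_one]
  rfl

theorem sW_mulH (z : β.Words) : β.sW (β.mulH z) = -β.mulH (β.sW z) := by
  have : β.sW ∘ₗ β.mulH = -(β.mulH ∘ₗ β.sW) := β.linearMap_ext fun w i => by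
    simp only [LinearMap.comp_apply, LinearMap.neg_apply]
    rw [mulH_single, sW_single, sW_single, twist_one, A.twist_of_mem 1 _ (β.mem i), one_mul,
      map_negOnePow_smul, ← Finsupp.lsingle_apply (R := R) w, map_negOnePow_smul,
      Finsupp.lsingle_apply, map_negOnePow_smul, mulH_single,
      wdeg_cons, Int.negOnePow_add, Int.negOnePow_sub, Int.negOnePow_one, mul_neg_one,
      neg_mul, Units.neg_smul, mul_comm, mul_smul]
  exact LinearMap.congr_fun this z

theorem dW_rW (b : A.carrier) (z : β.Words) :
    β.dW (β.rW b z) = β.rW b (β.dW z) + β.rW (A.d b) (β.sW z) := by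
  induction z using β.words_induction with
  | h1 =>
    rw [rW_nil, dW_nil, one_mul, dW_nil, d_one, Finsupp.single_zero, map_zero, zero_add,
      sW_single, twist_one, wdeg_nil, Int.negOnePow_zero, one_smul, rW_nil, one_mul]
  | hsmul a z hz =>
    rw [rW_smul, dW_smul, dW_smul, hz, sW_smul, map_add, rW_smul, rW_smul, rW_smul, smul_add,
      add_assoc]
  | hH z hz =>
    rw [rW_mulH, dW_mulH, dW_mulH, hz, sW_mulH, map_sub, map_neg, rW_mulH, rW_mulH, map_add]
    abel
  | hadd x y hx hy => simp only [map_add, hx, hy]; abel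

/-- The part of degree `n`. -/
def grW (n : ℤ) : Submodule R β.Words where
  carrier := {z | ∀ w, z w ∈ A.gr (n - β.wdeg w)}
  add_mem' hx hy w := add_mem (hx w) (hy w)
  zero_mem' _ := zero_mem _
  smul_mem' c _ hx w := Submodule.smul_mem _ c (hx w)

theorem single_mem_grW {n m : ℤ} {w : List β.I} {a : A.carrier} (ha : a ∈ A.gr m)
    (h : n = m + β.wdeg w) : Finsupp.single w a ∈ β.grW n := by
  intro v
  by_cases hv : v = w
  · subst hv; rw [Finsupp.single_eq_same, h]; simpa using ha
  · rw [Finsupp.single_eq_of_ne hv]; exact zero_mem _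

theorem grW_induction {n : ℤ} {P : ∀ z, z ∈ β.grW n → Prop}
    (h : ∀ w a (ha : a ∈ A.gr (n - β.wdeg w)),
      P (Finsupp.single w a) (β.single_mem_grW ha (by ring)))
    (h0 : P 0 (zero_mem _))
    (hadd : ∀ x y hx hy, P x hx → P y hy → P (x + y) (add_mem hx hy)) {z : β.Words}
    (hz : z ∈ β.grW n) : P z hz := by
  classical
  have : ∃ h : z ∈ β.grW n, P z h := by
    rw [← Finsupp.sum_single z]
    exact Finset.sum_induction _ (fun z => ∃ h : z ∈ β.grW n, P z h)
      (fun x y ⟨hx, hx'⟩ ⟨hy, hy'⟩ => ⟨add_mem hx hy, hadd x y hx hy hx' hy'⟩) ⟨_, h0⟩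
      fun w _ => ⟨_, h w _ (hz w)⟩
  exact this.2

theorem smul_mem_grW {i j : ℤ} {a : A.carrier} {z : β.Words} (ha : a ∈ A.gr i)
    (hz : z ∈ β.grW j) : a • z ∈ β.grW (i + j) := by
  intro w
  have := SetLike.GradedMul.mul_mem ha (hz w)
  rwa [← add_sub_assoc] at this

theorem mulH_mem_grW {n : ℤ} {z : β.Words} (hz : z ∈ β.grW n) : β.mulH z ∈ β.grW (n - 1) := by
  induction hz using β.grW_induction with
  | h w a ha =>
    have := β.gr_le_span _ ha
    clear ha
    induction this using Submodule.span_induction with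
    | mem x hx =>
      obtain ⟨i, hi, rfl⟩ := hx
      have hi : β.deg i = n - β.wdeg w := hi
      rw [mulH_single]
      refine β.single_mem_grW SetLike.GradedOne.one_mem ?_
      rw [wdeg_cons, hi]; ring
    | zero => simp
    | add x y _ _ hx hy => rw [Finsupp.single_add, map_add]; exact add_mem hx hy
    | smul c x _ hx => rw [← Finsupp.smul_single, map_smul]; exact Submodule.smul_mem _ _ hx
  | h0 => rw [map_zero]; exact zero_mem _
  | hadd x y _ _ hx hy => rw [map_add]; exact add_mem hx hy

theorem wordExt_mem_grW {k n m : ℤ} {φ : List β.I → β.Words}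
    (hφ : ∀ w, φ w ∈ β.grW (β.wdeg w + m)) {z : β.Words} (hz : z ∈ β.grW n) :
    β.wordExt k φ z ∈ β.grW (n + m) := by
  induction hz using β.grW_induction with
  | h w a ha =>
    rw [wordExt_single]
    have := β.smul_mem_grW (A.twist_mem k _ ha) (hφ w)
    rwa [show n - β.wdeg w + (β.wdeg w + m) = n + m by ring] at this
  | h0 => rw [map_zero]; exact zero_mem _
  | hadd x y _ _ hx hy => rw [map_add]; exact add_mem hx hy

theorem dWord_mem (w : List β.I) : β.dWord w ∈ β.grW (β.wdeg w + 1) := by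
  induction w with
  | nil => exact zero_mem _
  | cons i w ih =>
    have h0 := β.mem i
    rw [dWord]
    refine sub_mem (β.single_mem_grW h0 (by rw [wdeg_cons]; ring)) ?_
    have : Finsupp.single w (A.d (β.e i)) + A.twist 1 (β.e i) • β.dWord w ∈
        β.grW (β.deg i + (β.wdeg w + 1)) :=
      add_mem (β.single_mem_grW (A.d_mem _ _ h0) (by ring))
        (β.smul_mem_grW (A.twist_mem 1 _ h0) ih)
    have := β.mulH_mem_grW this
    rwa [show β.deg i + (β.wdeg w + 1) - 1 = β.wdeg (i :: w) + 1 by rw [wdeg_cons]; ring] at this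

theorem dW_mem {n : ℤ} {z : β.Words} (hz : z ∈ β.grW n) : β.dW z ∈ β.grW (n + 1) := by
  refine add_mem (fun w => ?_) (β.wordExt_mem_grW β.dWord_mem hz)
  have := A.d_mem _ _ (hz w)
  rw [show n - β.wdeg w + 1 = n + 1 - β.wdeg w by ring] at this
  simpa using this

theorem rWord_mem {i : ℤ} {b : A.carrier} (hb : b ∈ A.gr i) (w : List β.I) :
    β.rWord w b ∈ β.grW (β.wdeg w + i) := by
  induction w with
  | nil => exact β.single_mem_grW hb (by simp)
  | cons j w ih =>
    have := β.mulH_mem_grW (β.smul_mem_grW (β.mem j) ih)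
    rwa [show β.deg j + (β.wdeg w + i) - 1 = β.wdeg (j :: w) + i by rw [wdeg_cons]; ring] at this

theorem rW_mem {n i : ℤ} {b : A.carrier} (hb : b ∈ A.gr i) {z : β.Words} (hz : z ∈ β.grW n) :
    β.rW b z ∈ β.grW (n + i) := β.wordExt_mem_grW (β.rWord_mem hb) hz

theorem sW_of_mem {n : ℤ} {z : β.Words} (hz : z ∈ β.grW n) : β.sW z = n.negOnePow • z := by
  induction hz using β.grW_induction with
  | h w a ha =>
    rw [sW_single, A.twist_of_mem 1 _ ha, one_mul, ← Finsupp.lsingle_apply (R := R) w,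
      map_negOnePow_smul, ← mul_smul, ← Int.negOnePow_add, add_sub_cancel]
    rfl
  | h0 => simp
  | hadd x y _ _ hx hy => rw [map_add, hx, hy, smul_add]

/-- Projection to the part of degree `n`. -/
def projW (n : ℤ) : β.Words →ₗ[R] β.Words :=
  Finsupp.lsum R fun w => Finsupp.lsingle w ∘ₗ GradedAlgebra.proj A.gr (n - β.wdeg w)

theorem projW_single (n : ℤ) (w : List β.I) (a : A.carrier) :
    β.projW n (Finsupp.single w a) =
      Finsupp.single w (GradedAlgebra.proj A.gr (n - β.wdeg w) a) := by
  rw [projW, Finsupp.lsum_single]; rfl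

/-- The words, as a bimodule. -/
abbrev wordBimod : Bimod A where
  carrier := β.Words
  lact := Algebra.lsmul R R β.Words
  ract := AlgHom.ofLinearMap
    { toFun := fun b => β.rW b.unop
      map_add' := fun b c => LinearMap.ext fun z => β.rW_add _ _ z
      map_smul' := fun r b => LinearMap.ext fun z => β.rW_smul_left _ _ z }
    (LinearMap.ext fun z => β.rW_one z)
    (fun b c => LinearMap.ext fun z => (β.rW_rW b.unop c.unop z).symm)
  lact_ract a b m := (β.rW_smul b.unop a m).symm
  gr := β.grW
  isInternal := isInternal_of_proj _ β.projW
    (fun n m hm => by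
      induction hm using β.grW_induction with
      | h w a ha =>
        rw [projW_single, GradedAlgebra.proj_apply, DirectSum.decompose_of_mem_same _ ha]
      | h0 => rw [map_zero]
      | hadd x y _ _ hx hy => rw [map_add, hx, hy])
    (fun n k m hm h => by
      induction hm using β.grW_induction with
      | h w a ha =>
        rw [projW_single, GradedAlgebra.proj_apply,
          DirectSum.decompose_of_mem_ne _ ha (fun h' => h (by linarith)), Finsupp.single_zero]
      | h0 => rw [map_zero]
      | hadd x y _ _ hx hy => rw [map_add, hx, hy, add_zero])
    (fun m => by
      induction m using Finsupp.induction_linear with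
      | zero => exact zero_mem _
      | add x y hx hy => exact add_mem hx hy
      | single w a =>
        induction a using A.induction_gr with
        | hadd x y hx hy => rw [Finsupp.single_add]; exact add_mem hx hy
        | h i a ha => exact Submodule.mem_iSup_of_mem _ (β.single_mem_grW ha rfl))
  lact_mem i j a m ha hm := β.smul_mem_grW ha hm
  ract_mem i j a m ha hm := β.rW_mem ha hm
  d := β.dW
  d_mem i m hm := β.dW_mem hm
  d_d := β.dW_dW
  d_lact i a m ha := by
    refine (β.dW_smul a m).trans ?_
    rw [A.twist_of_mem 1 i ha, one_mul, Units.smul_def, Units.smul_def, smul_assoc]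
    rfl
  d_ract j a m hm := by
    refine (β.dW_rW a m).trans ?_
    rw [β.sW_of_mem hm, map_negOnePow_smul]
    rfl

/-! #### Insertion of a central cocycle -/

section Insertion

variable {W : A.carrier} (hW : A.IsCentralCocycle W)

/-- The effect of `insW` on a word. -/
def insWord (W : A.carrier) : List β.I → β.Words
  | [] => 0
  | i :: w => β.mulH (W • Finsupp.single (i :: w) 1) -
      β.mulH (A.twist 1 (β.e i) • insWord W w)

/-- The derivation with respect to `h` that maps `h` to `h W h`: the alternating sum over all
insertions of `W` into a word. -/
def insW (W : A.carrier) : β.Words →ₗ[R] β.Words := β.wordExt 1 (β.insWord W)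

theorem insW_nil (a : A.carrier) : β.insW W (Finsupp.single [] a) = 0 := by
  rw [insW, wordExt_single, insWord, smul_zero]

theorem insW_smul (a : A.carrier) (z : β.Words) :
    β.insW W (a • z) = A.twist 1 a • β.insW W z := β.wordExt_smul _ _ _ _

theorem insW_mulH (z : β.Words) :
    β.insW W (β.mulH z) = β.mulH (W • β.mulH z) - β.mulH (β.insW W z) := by
  have : β.insW W ∘ₗ β.mulH = β.mulH ∘ₗ (Algebra.lsmul R R β.Words W) ∘ₗ β.mulH -
      β.mulH ∘ₗ β.insW W := β.linearMap_ext fun w i => by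
    simp only [LinearMap.comp_apply, LinearMap.sub_apply]
    rw [mulH_single, insW, wordExt_single, wordExt_single, twist_one, one_smul]; rfl
  exact LinearMap.congr_fun this z

theorem insW_rW (b : A.carrier) (z : β.Words) :
    β.insW W (β.rW b z) = β.rW b (β.insW W z) := by
  induction z using β.words_induction with
  | h1 => rw [rW_nil, insW_nil, insW_nil, map_zero]
  | hsmul a z hz => rw [rW_smul, insW_smul, insW_smul, rW_smul, hz]
  | hH z hz =>
    rw [rW_mulH, insW_mulH, insW_mulH, hz, map_sub, rW_mulH, rW_mulH, rW_smul, rW_mulH]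
  | hadd x y hx hy => simp only [map_add, hx, hy]

include hW

/-- Insertion of `W` is a homotopy between the two actions of `W`, because
`d (h W h) = W h - h W`. -/
theorem dW_insW (z : β.Words) :
    β.dW (β.insW W z) + β.insW W (β.dW z) = W • z - β.rW W z := by
  induction z using β.words_induction with
  | h1 =>
    rw [insW_nil, dW_nil, insW_nil, rW_nil, Finsupp.smul_single, smul_eq_mul, mul_one, one_mul,
      sub_self, map_zero, add_zero]
  | hsmul a z hz =>
    rw [insW_smul, dW_smul, dW_smul, map_add, insW_smul, insW_smul, twist_one_d,
      twist_one_twist_one, rW_smul, ← mul_smul, hW.central, mul_smul, ← smul_sub, ← hz, smul_add,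
      neg_smul]
    abel
  | hH z hz =>
    rw [insW_mulH, dW_mulH, map_sub, map_sub, dW_mulH, dW_mulH, insW_mulH, dW_smul, hW.closed,
      hW.twist, zero_smul, zero_add, dW_mulH, smul_sub, map_sub, rW_mulH,
      eq_sub_of_add_eq hz, map_sub, map_sub]
    abel
  | hadd x y hx hy =>
    simp only [map_add, smul_add]
    rw [add_add_add_comm, hx, hy]; abel

theorem insW_insW (z : β.Words) : β.insW W (β.insW W z) = 0 := by
  induction z using β.words_induction with
  | h1 => rw [insW_nil, map_zero]
  | hsmul a z hz => rw [insW_smul, insW_smul, hz, smul_zero]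
  | hH z hz =>
    rw [insW_mulH, map_sub, insW_mulH, insW_mulH, insW_smul, hW.twist, hz, map_zero, sub_zero,
      insW_mulH, smul_sub, map_sub]
    abel
  | hadd x y hx hy => simp only [map_add, hx, hy, add_zero]

theorem insW_mem {n : ℤ} {z : β.Words} (hz : z ∈ β.grW n) : β.insW W z ∈ β.grW (n + -1) := by
  refine β.wordExt_mem_grW (fun w => ?_) hz
  induction w with
  | nil => exact zero_mem _
  | cons i w ih =>
    have h1 : Finsupp.single (i :: w) (1 : A.carrier) ∈ β.grW (β.wdeg (i :: w)) :=
      β.single_mem_grW SetLike.GradedOne.one_mem (by ring)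
    have h2 := β.mulH_mem_grW (β.smul_mem_grW hW.mem h1)
    have h3 := β.mulH_mem_grW (β.smul_mem_grW (A.twist_mem 1 _ (β.mem i)) ih)
    rw [show (0 : ℤ) + β.wdeg (i :: w) - 1 = β.wdeg (i :: w) + -1 by ring] at h2
    rw [show β.deg i + (β.wdeg w + -1) - 1 = β.wdeg (i :: w) + -1 by rw [wdeg_cons]; ring] at h3
    exact sub_mem h2 h3

end Insertion

end AdaptedBasis
end DGA

namespace DGA

namespace Bimod

variable {R : Type u} [CommRing R] {A : DGA R}

/-! ### Quotients of bimodules -/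

/-- The quotient of a bimodule by a homogeneous sub-bimodule. -/
abbrev quot (M : Bimod A) (S : Submodule R M.carrier) (hl : ∀ a, ∀ m ∈ S, M.lact a m ∈ S)
    (hr : ∀ a, ∀ m ∈ S, M.ract a m ∈ S) (hp : ∀ n, ∀ m ∈ S, M.proj n m ∈ S)
    (hd : ∀ m ∈ S, M.d m ∈ S) : Bimod A where
  carrier := M.carrier ⧸ S
  lact := AlgHom.ofLinearMap
    { toFun := fun a => S.mapQ S (M.lact a) (hl a)
      map_add' := fun a b => Submodule.linearMap_qext _ (LinearMap.ext fun m => by simp)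
      map_smul' := fun c a => Submodule.linearMap_qext _ (LinearMap.ext fun m => by simp) }
    (Submodule.linearMap_qext _ (LinearMap.ext fun m => by simp))
    (fun a b => Submodule.linearMap_qext _ (LinearMap.ext fun m => by simp))
  ract := AlgHom.ofLinearMap
    { toFun := fun a => S.mapQ S (M.ract a) (hr a)
      map_add' := fun a b => Submodule.linearMap_qext _ (LinearMap.ext fun m => by simp)
      map_smul' := fun c a => Submodule.linearMap_qext _ (LinearMap.ext fun m => by simp) }
    (Submodule.linearMap_qext _ (LinearMap.ext fun m => by simp))
    (fun a b => Submodule.linearMap_qext _ (LinearMap.ext fun m => by simp))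
  lact_ract a b m := by
    obtain ⟨m, rfl⟩ := S.mkQ_surjective m
    exact congrArg S.mkQ (M.lact_ract a b m)
  gr n := (M.gr n).map S.mkQ
  isInternal := isInternal_of_proj _ (fun n => S.mapQ S (M.proj n) (hp n))
    (by
      rintro n _ ⟨m, hm, rfl⟩
      exact congrArg S.mkQ (M.proj_same hm))
    (by
      rintro n k _ ⟨m, hm, rfl⟩ h
      exact (congrArg S.mkQ (M.proj_ne hm h)).trans (map_zero _))
    (fun m => by
      obtain ⟨m, rfl⟩ := S.mkQ_surjective m
      induction m using M.induction_gr with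
      | hadd x y hx hy => rw [map_add]; exact add_mem hx hy
      | h i m hm => exact Submodule.mem_iSup_of_mem i ⟨m, hm, rfl⟩)
  lact_mem := by
    rintro i j a _ ha ⟨m, hm, rfl⟩
    exact ⟨_, M.lact_mem i j a m ha hm, rfl⟩
  ract_mem := by
    rintro i j a _ ha ⟨m, hm, rfl⟩
    exact ⟨_, M.ract_mem i j a m ha hm, rfl⟩
  d := S.mapQ S M.d hd
  d_mem := by
    rintro i _ ⟨m, hm, rfl⟩
    exact ⟨_, M.d_mem i m hm, rfl⟩
  d_d m := by
    obtain ⟨m, rfl⟩ := S.mkQ_surjective m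
    exact (congrArg S.mkQ (M.d_d m)).trans (map_zero _)
  d_lact i a m ha := by
    obtain ⟨m, rfl⟩ := S.mkQ_surjective m
    have e := congrArg S.mkQ (M.d_lact i a m ha)
    rw [map_add, map_negOnePow_smul] at e
    exact e
  d_ract := by
    rintro j a _ ⟨m, hm, rfl⟩
    have e := congrArg S.mkQ (M.d_ract j a m hm)
    rw [map_add, map_negOnePow_smul] at e
    exact e

theorem diagonal_lact (a m : A.carrier) : (diagonal A).lact a m = a * m := rfl

theorem diagonal_ract (a m : A.carrier) : (diagonal A).ract (MulOpposite.op a) m = m * a := rfl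

end Bimod

open DGA.Bimod

namespace AdaptedBasis

variable {R : Type u} [CommRing R] {A : DGA R} (β : A.AdaptedBasis)

/-! ### The bar resolution -/

/-- The coefficient of the empty word. -/
def emptyCoeff : β.Words →ₗ[R] A.carrier := Finsupp.lapply []

@[simp] theorem emptyCoeff_smul (a : A.carrier) (z : β.Words) :
    β.emptyCoeff (a • z) = a * β.emptyCoeff z := rfl

@[simp] theorem emptyCoeff_nil (a : A.carrier) :
    β.emptyCoeff (Finsupp.single [] a) = a := Finsupp.single_eq_same

@[simp] theorem emptyCoeff_mulH (z : β.Words) : β.emptyCoeff (β.mulH z) = 0 := by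
  have : β.emptyCoeff ∘ₗ β.mulH = 0 := β.linearMap_ext fun w i => by
    simp only [LinearMap.comp_apply, LinearMap.zero_apply]
    rw [mulH_single]
    exact Finsupp.single_eq_of_ne (by simp)
  exact LinearMap.congr_fun this z

theorem emptyCoeff_rW (b : A.carrier) (z : β.Words) :
    β.emptyCoeff (β.rW b z) = β.emptyCoeff z * b := by
  induction z using β.words_induction with
  | h1 => simp [rW_nil]
  | hsmul a z hz => rw [rW_smul, emptyCoeff_smul, hz, emptyCoeff_smul, mul_assoc]
  | hH z hz => rw [rW_mulH]; simp
  | hadd x y hx hy => simp only [map_add, hx, hy, add_mul]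

theorem emptyCoeff_sW (z : β.Words) :
    β.emptyCoeff (β.sW z) = A.twist 1 (β.emptyCoeff z) := by
  induction z using β.words_induction with
  | h1 => simp [sW_single]
  | hsmul a z hz => rw [sW_smul, emptyCoeff_smul, hz, emptyCoeff_smul, twist_mul]
  | hH z hz => rw [sW_mulH]; simp
  | hadd x y hx hy => simp only [map_add, hx, hy]

theorem emptyCoeff_insW (W : A.carrier) (z : β.Words) : β.emptyCoeff (β.insW W z) = 0 := by
  induction z using β.words_induction with
  | h1 => rw [insW_nil, map_zero]
  | hsmul a z hz => rw [insW_smul, emptyCoeff_smul, hz, mul_zero]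
  | hH z hz => rw [insW_mulH]; simp
  | hadd x y hx hy => simp only [map_add, hx, hy, add_zero]

/-- The multiples of the empty word. -/
abbrev emptyWords : Submodule R β.Words := LinearMap.range (Finsupp.lsingle [])

theorem smul_mem_emptyWords (a : A.carrier) (z : β.Words) (hz : z ∈ β.emptyWords) :
    a • z ∈ β.emptyWords := by
  obtain ⟨s, rfl⟩ := hz
  exact ⟨a * s, (Finsupp.smul_single (M := A.carrier) a [] s).symm⟩

theorem rW_mem_emptyWords (b : A.carrier) (z : β.Words) (hz : z ∈ β.emptyWords) :
    β.rW b z ∈ β.emptyWords := by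
  obtain ⟨s, rfl⟩ := hz
  exact ⟨s * b, (β.rW_nil b s).symm⟩

theorem proj_mem_emptyWords (n : ℤ) (z : β.Words) (hz : z ∈ β.emptyWords) :
    β.wordBimod.proj n z ∈ β.emptyWords := by
  obtain ⟨s, rfl⟩ := hz
  induction s using A.induction_gr with
  | hadd x y hx hy => rw [map_add, map_add]; exact add_mem hx hy
  | h i a ha =>
    have h : Finsupp.single [] a ∈ β.grW i := β.single_mem_grW ha (by simp)
    by_cases hn : n = i
    · subst hn
      exact (β.wordBimod.proj_same h).symm ▸ ⟨a, rfl⟩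
    · exact (β.wordBimod.proj_ne h hn).symm ▸ zero_mem _

theorem dW_mem_emptyWords (z : β.Words) (hz : z ∈ β.emptyWords) : β.dW z ∈ β.emptyWords := by
  obtain ⟨s, rfl⟩ := hz
  exact ⟨A.d s, (β.dW_nil s).symm⟩

/-- The bar resolution of the diagonal bimodule: the quotient of the words by `A`, shifted. -/
abbrev bar : Bimod A :=
  shift (-1) (quot β.wordBimod β.emptyWords β.smul_mem_emptyWords
    (fun b => β.rW_mem_emptyWords b.unop) β.proj_mem_emptyWords β.dW_mem_emptyWords)

/-- The class of a linear combination of words in the bar resolution. -/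
def toBar : β.Words →ₗ[R] β.bar.carrier := β.emptyWords.mkQ

theorem toBar_surjective : Function.Surjective β.toBar := β.emptyWords.mkQ_surjective

theorem toBar_nil (a : A.carrier) : β.toBar (Finsupp.single [] a) = 0 :=
  (Submodule.Quotient.mk_eq_zero _).2 ⟨a, rfl⟩

theorem bar_lact (a : A.carrier) (z : β.Words) :
    β.bar.lact a (β.toBar z) = β.toBar (A.twist (-1) a • z) := rfl

theorem bar_ract (b : A.carrier) (z : β.Words) :
    β.bar.ract (MulOpposite.op b) (β.toBar z) = β.toBar (β.rW b z) := rfl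

theorem bar_d (z : β.Words) : β.bar.d (β.toBar z) = -β.toBar (β.dW z) := by
  rw [shift_d, Int.negOnePow_neg, Int.negOnePow_one, Units.neg_smul, one_smul]
  rfl

theorem toBar_mem {n : ℤ} {z : β.Words} (hz : z ∈ β.grW (n + -1)) : β.toBar z ∈ β.bar.gr n :=
  ⟨z, hz, rfl⟩

theorem toBar_smul (a : A.carrier) (z : β.Words) :
    β.toBar (a • z) = β.bar.lact (A.twist 1 a) (β.toBar z) := by
  rw [bar_lact, twist_twist]; simp

/-- The augmentation of the bar resolution, on the level of words. -/
def augW : β.Words →ₗ[R] A.carrier := β.emptyCoeff ∘ₗ β.dW - A.d ∘ₗ β.emptyCoeff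

theorem augW_apply (z : β.Words) :
    β.augW z = β.emptyCoeff (β.dW z) - A.d (β.emptyCoeff z) := rfl

theorem augW_smul (a : A.carrier) (z : β.Words) :
    β.augW (a • z) = A.twist 1 a * β.augW z := by
  rw [augW_apply, augW_apply, dW_smul, map_add, emptyCoeff_smul, emptyCoeff_smul,
    emptyCoeff_smul, d_mul, mul_sub]
  abel

theorem augW_rW (b : A.carrier) (z : β.Words) : β.augW (β.rW b z) = β.augW z * b := by
  rw [augW_apply, augW_apply, dW_rW, map_add, emptyCoeff_rW, emptyCoeff_rW, emptyCoeff_rW,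
    emptyCoeff_sW, d_mul, sub_mul]
  abel

/-- The augmentation of the bar resolution, as a linear map. -/
def augL : β.bar.carrier →ₗ[R] (diagonal A).carrier := β.emptyWords.liftQ β.augW (by
  rintro _ ⟨a, rfl⟩
  change β.augW (Finsupp.single [] a) = 0
  rw [augW_apply, dW_nil, emptyCoeff_nil, emptyCoeff_nil, sub_self])

theorem augL_toBar (z : β.Words) : β.augL (β.toBar z) = β.augW z := rfl

theorem isBi_augL : IsBi 0 β.augL where
  lact a m := by
    obtain ⟨z, rfl⟩ := β.toBar_surjective m
    refine (β.augW_smul (A.twist (-1) a) z).trans ?_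
    rw [A.twist_twist 1 (-1) a]
    rfl
  ract a m := by
    obtain ⟨z, rfl⟩ := β.toBar_surjective m
    obtain ⟨a, rfl⟩ := MulOpposite.op_surjective a
    exact β.augW_rW a z
  mem := by
    rintro i _ ⟨z, hz, rfl⟩
    change β.emptyCoeff (β.dW z) - A.d (β.emptyCoeff z) ∈ A.gr (i + 0)
    have h1 := β.dW_mem hz []
    have h2 := A.d_mem _ _ (hz [])
    rw [wdeg_nil, sub_zero, neg_add_cancel_right] at h1
    rw [wdeg_nil, sub_zero, neg_add_cancel_right] at h2
    rw [add_zero]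
    exact sub_mem h1 h2

/-- The augmentation of the bar resolution. -/
def aug : β.bar ⟶ diagonal A := β.isBi_augL.toHom fun m => by
  obtain ⟨z, rfl⟩ := β.toBar_surjective m
  rw [bar_d, map_neg, augL_toBar, augL_toBar]
  change -β.augW (β.dW z) = A.d (β.augW z)
  rw [augW_apply, augW_apply, dW_dW, map_zero, map_sub, A.d_d]
  simp

theorem aug_toBar (z : β.Words) : Hom.map β.aug (β.toBar z) = β.augW z := rfl

/-- The augmentation is the connecting map for the quotient of the words by `A`, and the words are
contracted by multiplication by `h`. -/
theorem quasiIso_aug : quasiIso A β.aug := by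
  rw [Bimod.quasiIso_iff]
  intro x y hx hxy
  obtain ⟨z, rfl⟩ := β.toBar_surjective x
  change A.carrier at y
  rw [bar_d, neg_eq_zero] at hx
  obtain ⟨s, hs⟩ := (Submodule.Quotient.mk_eq_zero _).1 hx
  have hs : Finsupp.single [] s = β.dW z := hs
  have hxy : β.augW z = A.d y := hxy
  rw [augW_apply, ← hs, emptyCoeff_nil] at hxy
  -- a cycle which represents the same class; it is the boundary of its product with `h`
  let z₁ := z - Finsupp.single [] (y + β.emptyCoeff z)
  have h1 : β.dW z₁ = 0 := by
    rw [map_sub, ← hs, dW_nil, map_add, ← hxy, ← Finsupp.single_sub]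
    simp
  have h2 : β.dW (β.mulH z₁) = z₁ := by rw [dW_mulH, h1, map_zero, sub_zero]
  refine ⟨-β.toBar (β.mulH z₁), 0, ?_, ?_⟩
  · rw [map_neg, bar_d, h2, neg_neg, map_sub, toBar_nil, sub_zero]
  · rw [map_neg, map_zero, add_zero, aug_toBar, augW_apply, h2, emptyCoeff_mulH, map_zero, sub_zero,
      map_sub, emptyCoeff_nil]
    exact (neg_sub _ _).trans (add_sub_cancel_right _ _)

/-! #### The generators -/

/-- The word `h e_{i₁} h e_{i₂} ⋯ h e_{iₗ} h`. -/
def gen : List β.I → β.Words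
  | [] => β.mulH (Finsupp.single [] 1)
  | i :: w => β.mulH (β.e i • gen w)

theorem rW_gen (w : List β.I) (j : β.I) :
    β.rW (β.e j) (β.gen w) = Finsupp.single (w ++ [j]) 1 := by
  induction w with
  | nil => rw [gen, rW_mulH, rW_nil, one_mul, mulH_single]; rfl
  | cons i w ih =>
    rw [gen, rW_mulH, rW_smul, ih, Finsupp.smul_single, smul_eq_mul, mul_one, mulH_single]; rfl

theorem single_concat (w : List β.I) (j : β.I) (a : A.carrier) :
    Finsupp.single (w ++ [j]) a = a • β.rW (β.e j) (β.gen w) := by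
  rw [rW_gen, Finsupp.smul_single, smul_eq_mul, mul_one]

theorem gen_mem (w : List β.I) : β.gen w ∈ β.grW (β.wdeg w + -1) := by
  induction w with
  | nil =>
    have := β.mulH_mem_grW (n := 0) (β.single_mem_grW (m := 0) (w := [])
      SetLike.GradedOne.one_mem (by simp))
    rwa [show (0 : ℤ) - 1 = β.wdeg [] + -1 by simp] at this
  | cons i w ih =>
    have := β.mulH_mem_grW (β.smul_mem_grW (β.mem i) ih)
    rwa [show β.deg i + (β.wdeg w + -1) - 1 = β.wdeg (i :: w) + -1 by
      rw [wdeg_cons]; ring] at this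

theorem bar_induction {P : β.bar.carrier → Prop} (h0 : P 0)
    (hgen : ∀ (a b : A.carrier) w, P (β.toBar (a • β.rW b (β.gen w))))
    (hadd : ∀ x y, P x → P y → P (x + y)) (m : β.bar.carrier) : P m := by
  obtain ⟨z, rfl⟩ := β.toBar_surjective m
  induction z using Finsupp.induction_linear with
  | zero => rwa [map_zero]
  | add x y hx hy => rw [map_add]; exact hadd _ _ hx hy
  | single v a =>
    rcases List.eq_nil_or_concat v with rfl | ⟨w, j, rfl⟩
    · rwa [toBar_nil]
    · rw [List.concat_eq_append, single_concat]; exact hgen _ _ _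

/-- The rank of a generator of the bar resolution. Each letter counts `2` more than its level, so
that multiplying two adjacent letters lowers the rank. -/
def rank (w : List β.I) : ℕ := (w.map fun i => 2 + β.level i).sum

theorem rank_nil : β.rank [] = 0 := rfl

theorem rank_cons (i : β.I) (w : List β.I) : β.rank (i :: w) = 2 + β.level i + β.rank w := rfl

/-- The map on words which extends `φ` on the generators of the bar resolution. It is defined on the
basis by `h e_{i₁} ⋯ h e_{iₗ} = gen [i₁, …, iₗ₋₁] e_{iₗ}`. -/
def extW (N : Bimod A) (φ : List β.I → N.carrier) : β.Words →ₗ[R] N.carrier :=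
  Finsupp.lsum R fun v => if h : v ≠ [] then
    N.lact.toLinearMap.flip (N.ract (MulOpposite.op (β.e (v.getLast h))) (φ v.dropLast)) ∘ₗ
      A.twist 1 else 0

theorem extW_nil (N : Bimod A) (φ : List β.I → N.carrier) (a : A.carrier) :
    β.extW N φ (Finsupp.single [] a) = 0 := by
  rw [extW, Finsupp.lsum_single]; simp

theorem extW_gen (N : Bimod A) (φ : List β.I → N.carrier) (a b : A.carrier) (w : List β.I) :
    β.extW N φ (a • β.rW b (β.gen w)) =
      N.lact (A.twist 1 a) (N.ract (MulOpposite.op b) (φ w)) := by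
  induction (β.e.mem_span b) using Submodule.span_induction with
  | mem x hx =>
    obtain ⟨j, rfl⟩ := hx
    rw [← single_concat, extW, Finsupp.lsum_single, dif_pos (by simp)]
    simp
  | zero =>
    have : β.rW 0 (β.gen w) = 0 := by
      have := β.rW_smul_left 0 0 (β.gen w)
      rwa [zero_smul, zero_smul] at this
    rw [this]; simp
  | add x y _ _ hx hy =>
    rw [rW_add, smul_add, map_add, hx, hy, MulOpposite.op_add, map_add, LinearMap.add_apply,
      map_add]
  | smul c x _ hx =>
    rw [rW_smul_left, smul_comm, map_smul, hx, MulOpposite.op_smul, map_smul,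
      LinearMap.smul_apply, map_smul]

/-- The generators of the bar resolution are free. -/
theorem exists_ext (N : Bimod A) (φ : ∀ w, N.gr (β.wdeg w)) :
    ∃ f : β.bar.carrier →ₗ[R] N.carrier, IsBi 0 f ∧ ∀ w, f (β.toBar (β.gen w)) = φ w := by
  let f : β.bar.carrier →ₗ[R] N.carrier := β.emptyWords.liftQ (β.extW N fun w => φ w) (by
    rintro _ ⟨a, rfl⟩
    exact β.extW_nil _ _ a)
  have hf : ∀ z, f (β.toBar z) = β.extW N (fun w => φ w) z := fun _ => rfl
  refine ⟨f, ⟨fun a m => ?_, fun a m => ?_, ?_⟩, fun w => ?_⟩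
  · induction m using β.bar_induction with
    | h0 => simp
    | hadd x y hx hy => simp only [map_add, hx, hy]
    | hgen b c w =>
      rw [bar_lact, hf, hf, ← mul_smul, extW_gen, extW_gen, twist_mul, twist_twist, map_mul]
      simp
  · obtain ⟨a, rfl⟩ := MulOpposite.op_surjective a
    induction m using β.bar_induction with
    | h0 => simp
    | hadd x y hx hy => simp only [map_add, hx, hy]
    | hgen b c w =>
      rw [bar_ract, hf, hf, rW_smul, rW_rW, extW_gen, extW_gen, MulOpposite.op_mul, map_mul,
        ← N.lact_ract]
      rfl
  · rintro i _ ⟨z, hz, rfl⟩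
    change β.extW N (fun w => φ w) z ∈ _
    induction hz using β.grW_induction with
    | h v a ha =>
      rcases List.eq_nil_or_concat v with rfl | ⟨w, j, rfl⟩
      · rw [extW_nil]; exact zero_mem _
      · rw [List.concat_eq_append] at ha ⊢
        rw [single_concat, extW_gen]
        have := N.lact_mem _ _ _ _ (A.twist_mem 1 _ ha) (N.ract_mem _ _ _ _ (β.mem j) (φ w).2)
        convert this using 2
        simp [wdeg]
        ring
    | h0 => rw [map_zero]; exact zero_mem _
    | hadd x y _ _ hx hy => rw [map_add]; exact add_mem hx hy
  · have := β.extW_gen N (fun w => φ w) 1 1 w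
    rw [one_smul, rW_one, twist_one, map_one, MulOpposite.op_one, map_one] at this
    exact this

/-- Multiplication by `h` on the left of the generators, and by an element of `A` in between. -/
theorem mulH_smul_gen_mem (x : A.carrier) (w : List β.I) :
    β.mulH (x • β.gen w) ∈ Submodule.span R (Set.range fun j => β.gen (j :: w)) := by
  induction (β.e.mem_span x) using Submodule.span_induction with
  | mem x hx =>
    obtain ⟨j, rfl⟩ := hx
    exact Submodule.subset_span ⟨j, rfl⟩
  | zero => simp
  | add x y _ _ hx hy => rw [add_smul, map_add]; exact add_mem hx hy
  | smul c x _ hx => rw [smul_assoc, map_smul]; exact Submodule.smul_mem _ _ hx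

/-- A submodule which contains the differentials of the generators of rank `n`. Elements that have
a coefficient on the left have a lower rank, so that the submodules are well behaved with respect
to multiplication by `h e_i`. -/
def lowSpan (n : ℕ) : Submodule R β.Words :=
  β.emptyWords ⊔ Submodule.span R {z | ∃ (b : A.carrier) (w : List β.I), β.rank w < n ∧ z =
    β.rW b (β.gen w)} ⊔
    Submodule.span R {z | ∃ (a b : A.carrier) (w : List β.I), β.rank w + 2 ≤ n ∧ z =
      a • β.rW b (β.gen w)}

theorem rW_gen_mem_lowSpan {n : ℕ} {w : List β.I} (h : β.rank w < n) (b : A.carrier) :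
    β.rW b (β.gen w) ∈ β.lowSpan n :=
  Submodule.mem_sup_left (Submodule.mem_sup_right (Submodule.subset_span ⟨b, w, h, rfl⟩))

theorem mulH_mem_lowSpan {n : ℕ} (i : β.I) {z : β.Words} (hz : z ∈ β.lowSpan n) :
    β.mulH (β.e i • z) ∈ β.lowSpan (2 + β.level i + n) := by
  let f : β.Words →ₗ[R] β.Words := β.mulH ∘ₗ Algebra.lsmul R R β.Words (β.e i)
  suffices h : β.lowSpan n ≤ (β.lowSpan (2 + β.level i + n)).comap f from h hz
  refine sup_le (sup_le ?_ (Submodule.span_le.2 ?_)) (Submodule.span_le.2 ?_)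
  · rintro _ ⟨s, rfl⟩
    change β.mulH (β.e i • Finsupp.single [] s) ∈ β.lowSpan (2 + β.level i + n)
    have : β.mulH (β.e i • Finsupp.single [] s) = β.rW (β.e i * s) (β.gen []) := by
      rw [gen, rW_mulH, rW_nil, one_mul, Finsupp.smul_single, smul_eq_mul]
    rw [this]
    exact β.rW_gen_mem_lowSpan (by rw [rank_nil]; omega) _
  · rintro _ ⟨b, w, hw, rfl⟩
    change β.mulH (β.e i • β.rW b (β.gen w)) ∈ β.lowSpan (2 + β.level i + n)
    have : β.mulH (β.e i • β.rW b (β.gen w)) = β.rW b (β.gen (i :: w)) := by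
      rw [gen, rW_mulH, rW_smul]
    rw [this]
    exact β.rW_gen_mem_lowSpan (by rw [rank_cons]; omega) _
  · rintro _ ⟨a, b, w, hw, rfl⟩
    change β.mulH (β.e i • a • β.rW b (β.gen w)) ∈ β.lowSpan (2 + β.level i + n)
    have : β.mulH (β.e i • a • β.rW b (β.gen w)) =
        β.rW b (β.mulH ((β.e i * a) • β.gen w)) := by
      rw [rW_mulH, rW_smul, mul_smul]
    rw [this]
    suffices h : Submodule.span R (Set.range fun j => β.gen (j :: w)) ≤
        (β.lowSpan (2 + β.level i + n)).comap (β.rW b) from h (β.mulH_smul_gen_mem _ _)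
    rw [Submodule.span_le]
    rintro _ ⟨j, rfl⟩
    refine β.rW_gen_mem_lowSpan ?_ b
    have := β.level_le j
    rw [rank_cons]; omega

theorem twist_e_smul (i : β.I) (z : β.Words) :
    A.twist 1 (β.e i) • z = (β.deg i).negOnePow • (β.e i • z) := by
  rw [A.twist_of_mem 1 _ (β.mem i), one_mul, Units.smul_def, Units.smul_def, smul_assoc]

/-- The differential of a generator consists of terms of smaller rank: deleting a letter `h` lowers
the rank by `2` or, where `e_i e_j` is expanded in the basis again, by at least `1`; replacing `e_i`
by `d e_i` lowers the level. -/
theorem dW_gen_mem (w : List β.I) : β.dW (β.gen w) ∈ β.lowSpan (β.rank w) := by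
  induction w with
  | nil =>
    rw [gen, dW_mulH, dW_nil, d_one, Finsupp.single_zero, map_zero, sub_zero]
    exact Submodule.mem_sup_left (Submodule.mem_sup_left ⟨1, rfl⟩)
  | cons i w ih =>
    rw [gen, dW_mulH, dW_smul, map_add]
    refine sub_mem ?_ (add_mem ?_ ?_)
    · refine Submodule.mem_sup_right (Submodule.subset_span ⟨β.e i, 1, w, ?_, ?_⟩)
      · rw [rank_cons]; omega
      · rw [rW_one]
    · let f : A.carrier →ₗ[R] β.Words :=
        β.mulH ∘ₗ (LinearMap.toSpanSingleton A.carrier β.Words (β.gen w)).restrictScalars R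
      suffices h : Submodule.span R (β.e '' {j | β.level j < β.level i}) ≤
          (β.lowSpan (β.rank (i :: w))).comap f from h (β.d_mem i)
      rw [Submodule.span_le]
      rintro _ ⟨j, hj, rfl⟩
      have hj : β.level j < β.level i := hj
      have := β.rW_gen_mem_lowSpan (n := β.rank (i :: w)) (w := j :: w)
        (by rw [rank_cons, rank_cons]; omega) 1
      rwa [rW_one] at this
    · rw [twist_e_smul, map_negOnePow_smul]
      exact negOnePow_smul_mem _ _ (β.mulH_mem_lowSpan i ih)

theorem toBar_mem_genSpan {n : ℕ} {z : β.Words} (hz : z ∈ β.lowSpan n) :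
    β.toBar z ∈ genSpan β.bar (fun w => β.toBar (β.gen w)) β.rank n := by
  suffices h : β.lowSpan n ≤ (genSpan β.bar (fun w => β.toBar (β.gen w)) β.rank n).comap
    β.toBar from
    h hz
  refine sup_le (sup_le ?_ (Submodule.span_le.2 ?_)) (Submodule.span_le.2 ?_)
  · rintro _ ⟨s, rfl⟩
    rw [Submodule.mem_comap, Finsupp.lsingle_apply, toBar_nil]
    exact zero_mem _
  · rintro _ ⟨b, w, hw, rfl⟩
    exact ract_mem_genSpan _ (MulOpposite.op b) (gen_mem_genSpan _ hw)
  · rintro _ ⟨a, b, w, hw, rfl⟩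
    rw [SetLike.mem_coe, Submodule.mem_comap, toBar_smul]
    exact lact_mem_genSpan _ _ (ract_mem_genSpan _ (MulOpposite.op b)
      (gen_mem_genSpan _ (by omega)))

/-- The bar resolution is semifree. -/
def semiFreeBar : SemiFree β.bar where
  X := List β.I
  gen w := β.toBar (β.gen w)
  deg := β.wdeg
  rank := β.rank
  gen_mem w := β.toBar_mem (β.gen_mem w)
  mem_top m := by
    induction m using β.bar_induction with
    | h0 => exact ⟨0, zero_mem _⟩
    | hgen a b w =>
      refine ⟨β.rank w + 1, ?_⟩
      rw [toBar_smul]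
      exact lact_mem_genSpan _ _ (ract_mem_genSpan _ (MulOpposite.op b)
        (gen_mem_genSpan _ (Nat.lt_succ_self _)))
    | hadd x y hx hy =>
      obtain ⟨m, hm⟩ := hx
      obtain ⟨n, hn⟩ := hy
      exact ⟨max m n, add_mem (genSpan_mono _ _ _ (le_max_left _ _) hm)
        (genSpan_mono _ _ _ (le_max_right _ _) hn)⟩
  d_gen w := by
    rw [bar_d]
    exact neg_mem (β.toBar_mem_genSpan (β.dW_gen_mem w))
  exists_ext := β.exists_ext

theorem aug_gen_nil : Hom.map β.aug (β.toBar (β.gen [])) = (1 : A.carrier) := by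
  rw [aug_toBar, augW_apply, gen, dW_mulH, map_sub, emptyCoeff_mulH, emptyCoeff_mulH, map_zero,
    sub_zero, sub_zero, emptyCoeff_nil]

theorem emptyCoeff_gen (w : List β.I) : β.emptyCoeff (β.gen w) = 0 := by
  cases w <;> exact β.emptyCoeff_mulH _

theorem aug_gen_cons (i : β.I) (w : List β.I) :
    Hom.map β.aug (β.toBar (β.gen (i :: w))) = (0 : A.carrier) := by
  rw [aug_toBar, augW_apply, gen, dW_mulH, map_sub, emptyCoeff_mulH, emptyCoeff_mulH, map_zero,
    sub_zero, sub_zero, emptyCoeff_smul, emptyCoeff_gen, mul_zero]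

/-! #### Insertion of a central cocycle into the bar resolution -/

section Insertion

variable {W : A.carrier} (hW : A.IsCentralCocycle W)

/-- Insertion of `W` in the bar resolution. -/
def ins (W : A.carrier) : β.bar.carrier →ₗ[R] β.bar.carrier :=
  β.emptyWords.mapQ β.emptyWords (β.insW W) (by
    rintro _ ⟨a, rfl⟩
    rw [Submodule.mem_comap, Finsupp.lsingle_apply, insW_nil]
    exact zero_mem _)

theorem ins_toBar (z : β.Words) : β.ins W (β.toBar z) = β.toBar (β.insW W z) := rfl

theorem isBi_ins (hW : A.IsCentralCocycle W) : IsBi (-1) (β.ins W) where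
  lact a m := by
    obtain ⟨z, rfl⟩ := β.toBar_surjective m
    rw [bar_lact, ins_toBar, ins_toBar, bar_lact, insW_smul, twist_twist, twist_twist]
    rw [A.twist_even (n := 1 + -1) ⟨0, by norm_num⟩, A.twist_even (n := -1 + -1) ⟨-1, by norm_num⟩]
  ract a m := by
    obtain ⟨z, rfl⟩ := β.toBar_surjective m
    obtain ⟨a, rfl⟩ := MulOpposite.op_surjective a
    rw [bar_ract, ins_toBar, ins_toBar, bar_ract, insW_rW]
  mem := by
    rintro i _ ⟨z, hz, rfl⟩
    exact β.toBar_mem (β.insW_mem hW hz)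

theorem ins_ins (hW : A.IsCentralCocycle W) (m : β.bar.carrier) : β.ins W (β.ins W m) = 0 := by
  obtain ⟨z, rfl⟩ := β.toBar_surjective m
  rw [ins_toBar, ins_toBar, insW_insW β hW, map_zero]

/-- Insertion of `W` is a homotopy between the two actions of `W`. The shift in the definition of
the bar resolution changes the sign. -/
theorem d_ins (hW : A.IsCentralCocycle W) (m : β.bar.carrier) :
    β.bar.d (β.ins W m) + β.ins W (β.bar.d m) =
      β.bar.ract (MulOpposite.op W) m - β.bar.lact W m := by
  obtain ⟨z, rfl⟩ := β.toBar_surjective m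
  rw [ins_toBar, bar_d, bar_d, map_neg, ins_toBar, bar_ract, bar_lact, hW.twist, ← map_sub,
    ← neg_sub (W • z), ← dW_insW β hW, map_neg, map_add, neg_add]

theorem aug_ins (hW : A.IsCentralCocycle W) (m : β.bar.carrier) :
    Hom.map β.aug (β.ins W m) = 0 := by
  obtain ⟨z, rfl⟩ := β.toBar_surjective m
  rw [ins_toBar, aug_toBar, augW_apply, emptyCoeff_insW, map_zero, sub_zero,
    eq_sub_of_add_eq (β.dW_insW hW z), map_sub, map_sub, emptyCoeff_insW, emptyCoeff_smul,
    emptyCoeff_rW, hW.central, sub_self, sub_zero]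
  rfl

theorem insW_gen_mem (w : List β.I) :
    β.insW W (β.gen w) ∈ Submodule.span R (β.gen '' {v | β.rank v < β.rank w + 4}) := by
  have key : ∀ w, β.mulH (W • β.gen w) ∈
      Submodule.span R (β.gen '' {v | β.rank v < β.rank w + 4}) := fun w => by
    refine Submodule.span_mono ?_ (β.mulH_smul_gen_mem W w)
    rintro _ ⟨j, rfl⟩
    refine ⟨j :: w, ?_, rfl⟩
    have := β.level_le j
    change β.rank (j :: w) < _
    rw [rank_cons]; omega
  induction w with
  | nil =>
    rw [gen, insW_mulH, insW_nil, map_zero, sub_zero]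
    exact key []
  | cons i w ih =>
    rw [gen, insW_mulH, insW_smul, twist_e_smul, map_negOnePow_smul]
    refine sub_mem (key (i :: w)) (negOnePow_smul_mem _ _ ?_)
    let f : β.Words →ₗ[R] β.Words := β.mulH ∘ₗ Algebra.lsmul R R β.Words (β.e i)
    suffices h : Submodule.span R (β.gen '' {v | β.rank v < β.rank w + 4}) ≤
        (Submodule.span R (β.gen '' {v | β.rank v < β.rank (i :: w) + 4})).comap f from h ih
    rw [Submodule.span_le]
    rintro _ ⟨v, hv, rfl⟩
    have hv : β.rank v < β.rank w + 4 := hv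
    refine Submodule.subset_span ⟨i :: v, ?_, rfl⟩
    change β.rank (i :: v) < _
    rw [rank_cons, rank_cons]; omega

/-- Insertion of `W` raises the rank by at most `3`, since `W` is a combination of basis
elements. -/
theorem ins_gen_mem (w : List β.I) : β.ins W (β.toBar (β.gen w)) ∈
    genSpan β.bar (fun w => β.toBar (β.gen w)) β.rank (β.rank w + 4) := by
  rw [ins_toBar]
  suffices h : Submodule.span R (β.gen '' {v | β.rank v < β.rank w + 4}) ≤
      (genSpan β.bar (fun w => β.toBar (β.gen w)) β.rank (β.rank w + 4)).comap β.toBar from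
    h (β.insW_gen_mem w)
  rw [Submodule.span_le]
  rintro _ ⟨v, hv, rfl⟩
  exact gen_mem_genSpan (gen := fun w => β.toBar (β.gen w)) _ hv

end Insertion

end AdaptedBasis
end DGA

namespace DGA

/-! ### Adjoining a variable of degree `-1` -/

section Eps

variable {R : Type u} [CommRing R] {A : DGA R} {θ : A.carrier} (hθ : A.IsCentralCocycle θ)

theorem adjoinEps_twist (n : ℤ) (b : A.Eps) : (A.adjoinEps θ hθ).twist n b =
    (⟨A.twist n b.fst, n.negOnePow • A.twist n b.snd⟩ : A.Eps) := by
  induction b using (A.adjoinEps θ hθ).induction_gr with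
  | hadd x y hx hy =>
    rw [map_add, hx, hy]
    refine Eps.ext ?_ ?_
    · exact (map_add (A.twist n) x.fst y.fst).symm
    · refine Eq.trans ?_ (congrArg (n.negOnePow • ·) (map_add (A.twist n) x.snd y.snd)).symm
      exact (smul_add n.negOnePow (A.twist n x.snd) (A.twist n y.snd)).symm
  | h i b hb =>
    rw [(A.adjoinEps θ hθ).twist_of_mem n i hb, A.twist_of_mem n i hb.1,
      A.twist_of_mem n (i + 1) hb.2, ← mul_smul, ← Int.negOnePow_add]
    have h : (n + n * (i + 1)).negOnePow = (n * i).negOnePow := by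
      rw [show n + n * (i + 1) = n * i + 2 * n by ring, Int.negOnePow_add,
        Int.negOnePow_two_mul, mul_one]
    rw [h]
    refine Eps.ext ?_ ?_
    · exact map_negOnePow_smul (Eps.fstL A) _ b
    · exact map_negOnePow_smul (Eps.sndL A) _ b

theorem adjoinEps_twist_one (b : A.Eps) : (A.adjoinEps θ hθ).twist 1 b =
    (⟨A.twist 1 b.fst, -A.twist 1 b.snd⟩ : A.Eps) := by
  rw [adjoinEps_twist, Int.negOnePow_one, Units.neg_smul, one_smul]

end Eps

namespace Bimod

variable {R : Type u} [CommRing R] {A : DGA R}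

theorem lact_mul (M : Bimod A) (a b : A.carrier) (m : M.carrier) :
    M.lact (a * b) m = M.lact a (M.lact b m) := by rw [map_mul]; rfl

theorem ract_op_mul (M : Bimod A) (a b : A.carrier) (m : M.carrier) :
    M.ract (MulOpposite.op (a * b)) m =
      M.ract (MulOpposite.op b) (M.ract (MulOpposite.op a) m) := by
  rw [MulOpposite.op_mul, map_mul]; rfl

theorem ract_op_add (M : Bimod A) (a b : A.carrier) (m : M.carrier) :
    M.ract (MulOpposite.op (a + b)) m =
      M.ract (MulOpposite.op a) m + M.ract (MulOpposite.op b) m := by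
  rw [MulOpposite.op_add, map_add]; rfl

theorem ract_op_neg (M : Bimod A) (a : A.carrier) (m : M.carrier) :
    M.ract (MulOpposite.op (-a)) m = -M.ract (MulOpposite.op a) m := by
  rw [MulOpposite.op_neg, map_neg]; rfl

theorem lact_add_apply (M : Bimod A) (a b : A.carrier) (m : M.carrier) :
    M.lact (a + b) m = M.lact a m + M.lact b m := by
  rw [map_add]; rfl

theorem d_ract_op (M : Bimod A) (a : A.carrier) (m : M.carrier) :
    M.d (M.ract (MulOpposite.op a) m) = M.ract (MulOpposite.op a) (M.d m) +
      M.ract (MulOpposite.op (A.d a)) (M.sgn m) := M.d_ract' a m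

section Induced

variable {θ : A.carrier} (hθ : A.IsCentralCocycle θ) (M : Bimod A)

/-- The left action on the bimodule induced from `A` to `A[ε]`, whose elements
`(u, v, w, z)` stand for `u + ε v + w ε + ε z ε`. -/
def indLact (b : A.Eps) : (M.carrier × M.carrier × M.carrier × M.carrier) →ₗ[R]
    (M.carrier × M.carrier × M.carrier × M.carrier) where
  toFun m := (M.lact b.fst m.1, M.lact (A.twist 1 b.fst) m.2.1 + M.lact b.snd m.1,
    M.lact b.fst m.2.2.1, M.lact (A.twist 1 b.fst) m.2.2.2 + M.lact b.snd m.2.2.1)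
  map_add' m n := by
    simp only [Prod.fst_add, Prod.snd_add, map_add, Prod.mk_add_mk, Prod.mk.injEq, true_and]
    exact ⟨by abel, by abel⟩
  map_smul' c m := by simp

/-- The right action on the induced bimodule. -/
def indRact (b : A.Eps) : (M.carrier × M.carrier × M.carrier × M.carrier) →ₗ[R]
    (M.carrier × M.carrier × M.carrier × M.carrier) where
  toFun m := (M.ract (MulOpposite.op b.fst) m.1, M.ract (MulOpposite.op b.fst) m.2.1,
    M.ract (MulOpposite.op (A.twist 1 b.fst)) m.2.2.1 +
      M.ract (MulOpposite.op (A.twist 1 b.snd)) m.1,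
    M.ract (MulOpposite.op (A.twist 1 b.fst)) m.2.2.2 +
      M.ract (MulOpposite.op (A.twist 1 b.snd)) m.2.1)
  map_add' m n := by
    simp only [Prod.fst_add, Prod.snd_add, map_add, Prod.mk_add_mk, Prod.mk.injEq, true_and]
    exact ⟨by abel, by abel⟩
  map_smul' c m := by simp

/-- The left action on the induced bimodule, as a linear map. -/
def indLactHom : A.Eps →ₗ[R]
    Module.End R (M.carrier × M.carrier × M.carrier × M.carrier) where
  toFun b := indLact M b
  map_add' b c := LinearMap.ext fun m => by
    simp only [indLact, LinearMap.coe_mk, AddHom.coe_mk, LinearMap.add_apply, Eps.fst_add,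
      Eps.snd_add, map_add, Prod.mk_add_mk, Prod.mk.injEq, true_and]
    exact ⟨by abel, by abel⟩
  map_smul' c b := LinearMap.ext fun m => by simp [indLact]

/-- The right action on the induced bimodule, as a linear map. -/
def indRactHom : A.Epsᵐᵒᵖ →ₗ[R]
    Module.End R (M.carrier × M.carrier × M.carrier × M.carrier) where
  toFun b := indRact M b.unop
  map_add' b c := LinearMap.ext fun m => by
    simp only [indRact, LinearMap.coe_mk, AddHom.coe_mk, LinearMap.add_apply, Eps.fst_add,
      Eps.snd_add, map_add, Prod.mk_add_mk, Prod.mk.injEq, true_and, MulOpposite.unop_add,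
      MulOpposite.op_add]
    exact ⟨by abel, by abel⟩
  map_smul' c b := LinearMap.ext fun m => by simp [indRact]

/-- The differential on the induced bimodule. -/
def indD (θ : A.carrier) : (M.carrier × M.carrier × M.carrier × M.carrier) →ₗ[R]
    (M.carrier × M.carrier × M.carrier × M.carrier) where
  toFun m := (M.d m.1 + M.lact θ m.2.1 + M.ract (MulOpposite.op θ) (M.sgn m.2.2.1),
    -M.d m.2.1 - M.ract (MulOpposite.op θ) (M.sgn m.2.2.2),
    M.d m.2.2.1 + M.lact θ m.2.2.2, -M.d m.2.2.2)
  map_add' m n := by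
    simp only [Prod.fst_add, Prod.snd_add, map_add, Prod.mk_add_mk, Prod.mk.injEq]
    exact ⟨by abel, by abel, by abel, by abel⟩
  map_smul' c m := by simp [smul_sub]

/-- The sign operator on the induced bimodule, which takes into account the degree of `ε`. -/
def indSgn (m : M.carrier × M.carrier × M.carrier × M.carrier) :
    M.carrier × M.carrier × M.carrier × M.carrier :=
  (M.sgn m.1, -M.sgn m.2.1, -M.sgn m.2.2.1, M.sgn m.2.2.2)

variable {M}

theorem indLact_one (m) : indLact M 1 m = m := by
  simp [indLact, twist_one]

theorem indRact_one (m) : indRact M 1 m = m := by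
  simp [indRact, twist_one]

theorem indLact_mul (b c : A.Eps) (m) :
    indLact M (b * c) m = indLact M b (indLact M c m) := by
  simp only [indLact, LinearMap.coe_mk, AddHom.coe_mk, Eps.fst_mul, Eps.snd_mul, twist_mul,
    lact_mul, map_add, LinearMap.add_apply, Prod.mk.injEq, true_and]
  exact ⟨by abel, by abel⟩

theorem indRact_mul (b c : A.Eps) (m) :
    indRact M (b * c) m = indRact M c (indRact M b m) := by
  simp only [indRact, LinearMap.coe_mk, AddHom.coe_mk, Eps.fst_mul, Eps.snd_mul, twist_mul,
    ract_op_mul, ract_op_add, map_add, twist_one_twist_one, Prod.mk.injEq, true_and]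
  exact ⟨by abel, by abel⟩

theorem indLact_indRact (b c : A.Eps) (m) :
    indLact M b (indRact M c m) = indRact M c (indLact M b m) := by
  simp only [indRact, indLact, LinearMap.coe_mk, AddHom.coe_mk, M.lact_ract, map_add,
    Prod.mk.injEq, true_and]
  abel

include hθ in
theorem lact_central (a : A.carrier) (m : M.carrier) :
    M.lact θ (M.lact a m) = M.lact a (M.lact θ m) := by
  rw [← lact_mul, hθ.central, lact_mul]

include hθ in
theorem ract_central (a : A.carrier) (m : M.carrier) :
    M.ract (MulOpposite.op θ) (M.ract (MulOpposite.op a) m) =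
      M.ract (MulOpposite.op a) (M.ract (MulOpposite.op θ) m) := by
  rw [← ract_op_mul, ← hθ.central, ract_op_mul]

include hθ in
theorem indD_indLact (b : A.Eps) (m) :
    indD M θ (indLact M b m) = indLact M (⟨A.d b.fst + θ * b.snd, -A.d b.snd⟩ : A.Eps) m +
      indLact M (⟨A.twist 1 b.fst, -A.twist 1 b.snd⟩ : A.Eps) (indD M θ m) := by
  simp only [indD, indLact, LinearMap.coe_mk, AddHom.coe_mk, lact_mul, map_add, LinearMap.add_apply,
    LinearMap.neg_apply, map_neg, map_sub, twist_one_twist_one, twist_mul, hθ.twist,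
    twist_one_d, d_lact', sgn_lact, lact_central hθ, ← M.lact_ract, Prod.mk_add_mk,
    Prod.mk.injEq]
  exact ⟨by abel, by abel, by abel, by abel⟩

include hθ in
theorem indD_indRact (b : A.Eps) (m) :
    indD M θ (indRact M b m) = indRact M b (indD M θ m) +
      indRact M (⟨A.d b.fst + θ * b.snd, -A.d b.snd⟩ : A.Eps) (indSgn M m) := by
  simp only [indD, indRact, indSgn, LinearMap.coe_mk, AddHom.coe_mk, ract_op_mul, ract_op_add,
    ract_op_neg, map_add, map_neg, map_sub, twist_one_twist_one, twist_mul, hθ.twist,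
    twist_one_d, d_ract_op, sgn_ract, ract_central hθ, M.lact_ract, Prod.mk_add_mk,
    Prod.mk.injEq]
  exact ⟨by abel, by abel, by abel, by abel⟩

include hθ in
theorem indD_indD (m) : indD M θ (indD M θ m) = 0 := by
  simp only [indD, LinearMap.coe_mk, AddHom.coe_mk, map_add, map_neg, map_sub, d_lact',
    d_ract_op, sgn_lact, hθ.closed, hθ.twist, M.d_d, sgn_d, MulOpposite.op_zero,
    map_zero, LinearMap.zero_apply, M.lact_ract]
  refine Prod.ext ?_ (Prod.ext (by simp) (Prod.ext (by simp) (by simp)))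
  simp
  abel

variable (M)

theorem indLact_sign {i : ℤ} {b : A.Eps} (hb : b ∈ Eps.gr A i) (m) :
    indLact M (⟨A.twist 1 b.fst, -A.twist 1 b.snd⟩ : A.Eps) m = i.negOnePow • indLact M b m := by
  have e : (⟨A.twist 1 b.fst, -A.twist 1 b.snd⟩ : A.Eps) = i.negOnePow • b := by
    rw [A.twist_of_mem 1 i hb.1, A.twist_of_mem 1 (i + 1) hb.2, one_mul, one_mul,
      Int.negOnePow_succ, Units.neg_smul, neg_neg]
    refine Eps.ext ?_ ?_
    · exact (map_negOnePow_smul (Eps.fstL A) _ b).symm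
    · exact (map_negOnePow_smul (Eps.sndL A) _ b).symm
  rw [e]
  exact map_negOnePow_smul_apply (indLactHom M) i b m

theorem indSgn_of_mem {n : ℤ} {m : M.carrier × M.carrier × M.carrier × M.carrier}
    (h1 : m.1 ∈ M.gr n) (h2 : m.2.1 ∈ M.gr (n + 1)) (h3 : m.2.2.1 ∈ M.gr (n + 1))
    (h4 : m.2.2.2 ∈ M.gr (n + 2)) : indSgn M m = n.negOnePow • m := by
  have hn : (n + 2).negOnePow = n.negOnePow := by
    rw [Int.negOnePow_add, Int.negOnePow_even 2 ⟨1, rfl⟩, mul_one]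
  simp only [indSgn, M.sgn_of_mem h1, M.sgn_of_mem h2, M.sgn_of_mem h3, M.sgn_of_mem h4, hn,
    Int.negOnePow_succ, Units.neg_smul, neg_neg]
  rfl

/-- The bimodule over `A[ε]` induced from a bimodule over `A`. -/
abbrev ind : Bimod (A.adjoinEps θ hθ) where
  carrier := M.carrier × M.carrier × M.carrier × M.carrier
  lact := AlgHom.ofLinearMap (A := A.Eps) (indLactHom M)
    (LinearMap.ext fun m => indLact_one m)
    (fun b c => LinearMap.ext fun m => indLact_mul b c m)
  ract := AlgHom.ofLinearMap (A := A.Epsᵐᵒᵖ) (indRactHom M)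
    (LinearMap.ext fun m => indRact_one m)
    (fun b c => LinearMap.ext fun m => indRact_mul c.unop b.unop m)
  lact_ract b c m := indLact_indRact (A := A) b c.unop m
  gr n := (M.gr n).prod ((M.gr (n + 1)).prod ((M.gr (n + 1)).prod (M.gr (n + 2))))
  isInternal := isInternal_of_proj _
    (fun n => (M.proj n).prodMap ((M.proj (n + 1)).prodMap
      ((M.proj (n + 1)).prodMap (M.proj (n + 2)))))
    (fun n m hm => Prod.ext (M.proj_same hm.1) (Prod.ext (M.proj_same hm.2.1)
      (Prod.ext (M.proj_same hm.2.2.1) (M.proj_same hm.2.2.2))))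
    (fun n k m hm h => Prod.ext (M.proj_ne hm.1 h)
      (Prod.ext (M.proj_ne hm.2.1 (by simpa using h))
        (Prod.ext (M.proj_ne hm.2.2.1 (by simpa using h)) (M.proj_ne hm.2.2.2 (by simpa using h)))))
    (fun ⟨u, v, w, z⟩ => by
      generalize hg : (fun n => (M.gr n).prod ((M.gr (n + 1)).prod
        ((M.gr (n + 1)).prod (M.gr (n + 2))))) = g
      have hu : ((u, 0, 0, 0) : M.carrier × M.carrier × M.carrier × M.carrier) ∈ ⨆ n, g n := by
        subst hg
        induction u using M.induction_gr with
        | hadd x y hx hy => simpa using add_mem hx hy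
        | h i x hx =>
          exact Submodule.mem_iSup_of_mem i ⟨hx, zero_mem _, zero_mem _, zero_mem _⟩
      have hv : ((0, v, 0, 0) : M.carrier × M.carrier × M.carrier × M.carrier) ∈ ⨆ n, g n := by
        subst hg
        induction v using M.induction_gr with
        | hadd x y hx hy => simpa using add_mem hx hy
        | h i x hx =>
          exact Submodule.mem_iSup_of_mem (i - 1)
            ⟨zero_mem _, by simpa using hx, zero_mem _, zero_mem _⟩
      have hw : ((0, 0, w, 0) : M.carrier × M.carrier × M.carrier × M.carrier) ∈ ⨆ n, g n := by
        subst hg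
        induction w using M.induction_gr with
        | hadd x y hx hy => simpa using add_mem hx hy
        | h i x hx =>
          exact Submodule.mem_iSup_of_mem (i - 1)
            ⟨zero_mem _, zero_mem _, by simpa using hx, zero_mem _⟩
      have hz : ((0, 0, 0, z) : M.carrier × M.carrier × M.carrier × M.carrier) ∈ ⨆ n, g n := by
        subst hg
        induction z using M.induction_gr with
        | hadd x y hx hy => simpa using add_mem hx hy
        | h i x hx =>
          exact Submodule.mem_iSup_of_mem (i - 2)
            ⟨zero_mem _, zero_mem _, zero_mem _, by simpa using hx⟩
      simpa using add_mem hu (add_mem hv (add_mem hw hz)))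
  lact_mem i j b m hb hm := by
    have h1 := M.lact_mem i _ _ _ hb.1 hm.1
    have h2 := M.lact_mem i _ _ _ (A.twist_mem 1 i hb.1) hm.2.1
    have h3 := M.lact_mem i _ _ _ hb.1 hm.2.2.1
    have h4 := M.lact_mem i _ _ _ (A.twist_mem 1 i hb.1) hm.2.2.2
    have h5 := M.lact_mem (i + 1) _ _ _ hb.2 hm.1
    have h6 := M.lact_mem (i + 1) _ _ _ hb.2 hm.2.2.1
    rw [← add_assoc] at h2 h3 h4
    rw [show i + 1 + j = i + j + 1 by ring] at h5
    rw [show i + 1 + (j + 1) = i + j + 2 by ring] at h6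
    exact ⟨h1, add_mem h2 h5, h3, add_mem h4 h6⟩
  ract_mem i j b m hb hm := by
    have h1 := M.ract_mem i _ _ _ hb.1 hm.1
    have h2 := M.ract_mem i _ _ _ hb.1 hm.2.1
    have h3 := M.ract_mem i _ _ _ (A.twist_mem 1 i hb.1) hm.2.2.1
    have h4 := M.ract_mem i _ _ _ (A.twist_mem 1 i hb.1) hm.2.2.2
    have h5 := M.ract_mem (i + 1) _ _ _ (A.twist_mem 1 _ hb.2) hm.1
    have h6 := M.ract_mem (i + 1) _ _ _ (A.twist_mem 1 _ hb.2) hm.2.1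
    rw [show j + 1 + i = j + i + 1 by ring] at h2 h3
    rw [show j + 2 + i = j + i + 2 by ring] at h4
    rw [← add_assoc] at h5
    rw [show j + 1 + (i + 1) = j + i + 2 by ring] at h6
    exact ⟨h1, h2, add_mem h3 h5, add_mem h4 h6⟩
  d := indD M θ
  d_mem i m hm := by
    have h1 := M.d_mem _ _ hm.1
    have h2 := M.lact_mem _ _ _ _ hθ.mem hm.2.1
    have h3 := M.ract_mem _ _ _ _ hθ.mem (M.sgn_mem hm.2.2.1)
    have h4 := M.d_mem _ _ hm.2.1
    have h5 := M.ract_mem _ _ _ _ hθ.mem (M.sgn_mem hm.2.2.2)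
    have h6 := M.d_mem _ _ hm.2.2.1
    have h7 := M.lact_mem _ _ _ _ hθ.mem hm.2.2.2
    have h8 := M.d_mem _ _ hm.2.2.2
    rw [zero_add] at h2 h7
    rw [add_zero] at h3 h5
    have e : i + 2 = i + 1 + 1 := by ring
    have e' : i + 1 + 2 = i + 2 + 1 := by ring
    rw [e] at h5 h7
    refine ⟨add_mem (add_mem h1 h2) h3, sub_mem (neg_mem h4) h5, add_mem h6 h7, ?_⟩
    rw [e']; exact neg_mem h8
  d_d := indD_indD hθ
  d_lact i b m hb := by
    refine (indD_indLact hθ b m).trans ?_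
    exact congrArg (_ + ·) (indLact_sign M hb _)
  d_ract j b m hm := by
    refine (indD_indRact hθ b m).trans ?_
    rw [indSgn_of_mem M hm.1 hm.2.1 hm.2.2.1 hm.2.2.2, map_negOnePow_smul]
    rfl

end Induced

end Bimod
end DGA

namespace DGA

theorem twist_sub_two_mul {R : Type u} [CommRing R] (A : DGA R) (n k : ℤ) (a : A.carrier) :
    A.twist (n - 2 * k) a = A.twist n a := by
  rw [sub_eq_add_neg, ← twist_twist, A.twist_even (n := -(2 * k)) ⟨-k, by ring⟩]

namespace Bimod

variable {R : Type u} [CommRing R] {A : DGA R}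

/-! ### Divided power extensions -/

/-- The map `∑ m_k x_k ↦ ∑ m_k x_{k-r}` on finitely supported sequences. -/
def dropBy (M : Bimod A) (r : ℕ) : (ℕ →₀ M.carrier) →ₗ[R] (ℕ →₀ M.carrier) :=
  Finsupp.lcomapDomain (fun k => k + r) (add_left_injective r)

section Tot

variable (M : Bimod A) (κ : M.carrier →ₗ[R] M.carrier)

/-- The differential of `tot`. -/
def totD : (ℕ →₀ M.carrier) →ₗ[R] (ℕ →₀ M.carrier) :=
  Finsupp.mapRange.linearMap M.d + Finsupp.mapRange.linearMap κ ∘ₗ dropBy M 1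

theorem totD_apply (x : ℕ →₀ M.carrier) (k : ℕ) :
    totD M κ x k = M.d (x k) + κ (x (k + 1)) := rfl

/-- Projection to the elements of degree `n` in `tot`. -/
def totProj (n : ℤ) : (ℕ →₀ M.carrier) →ₗ[R] (ℕ →₀ M.carrier) :=
  Finsupp.lsum R fun k => Finsupp.lsingle k ∘ₗ M.proj (n + 2 * k)

theorem totProj_apply (n : ℤ) (x : ℕ →₀ M.carrier) (k : ℕ) :
    totProj M n x k = M.proj (n + 2 * k) (x k) := by
  induction x using Finsupp.induction_linear with
  | zero => simp
  | add x y hx hy => simp only [map_add, Finsupp.add_apply, hx, hy]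
  | single j m =>
    rw [totProj, Finsupp.lsum_single, LinearMap.comp_apply, Finsupp.lsingle_apply]
    by_cases h : k = j
    · subst h; simp
    · rw [Finsupp.single_eq_of_ne h, Finsupp.single_eq_of_ne h, map_zero]

variable {κ} (hκ : IsBi (-1) κ) (h2 : ∀ m, κ (κ m) = 0) (hd : ∀ m, M.d (κ m) + κ (M.d m) = 0)

/-- Given an operator `κ` of degree `-1` on `M` which squares to zero and anticommutes with the
differential, the bimodule of sums `∑ m_k x_k`, where `x_k` has degree `-2 k`, with differential
`d (m x_k) = (d m) x_k + (κ m) x_{k-1}`. -/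
abbrev tot : Bimod A where
  carrier := ℕ →₀ M.carrier
  lact := AlgHom.ofLinearMap
    { toFun := fun a => Finsupp.mapRange.linearMap (M.lact a)
      map_add' := fun a b => LinearMap.ext fun x => Finsupp.ext fun k => by simp
      map_smul' := fun a b => LinearMap.ext fun x => Finsupp.ext fun k => by simp }
    (LinearMap.ext fun x => Finsupp.ext fun k => by simp)
    (fun a b => LinearMap.ext fun x => Finsupp.ext fun k => by simp)
  ract := AlgHom.ofLinearMap
    { toFun := fun a => Finsupp.mapRange.linearMap (M.ract a)
      map_add' := fun a b => LinearMap.ext fun x => Finsupp.ext fun k => by simp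
      map_smul' := fun a b => LinearMap.ext fun x => Finsupp.ext fun k => by simp }
    (LinearMap.ext fun x => Finsupp.ext fun k => by simp)
    (fun a b => LinearMap.ext fun x => Finsupp.ext fun k => by simp)
  lact_ract a b m := Finsupp.ext fun k => M.lact_ract a b (m k)
  gr n :=
    { carrier := {x | ∀ k : ℕ, x k ∈ M.gr (n + 2 * k)}
      add_mem' := fun hx hy k => add_mem (hx k) (hy k)
      zero_mem' := fun _ => zero_mem _
      smul_mem' := fun c _ hx k => Submodule.smul_mem _ c (hx k) }
  isInternal := isInternal_of_proj _ (totProj M)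
    (fun n m hm => Finsupp.ext fun k => by rw [totProj_apply]; exact M.proj_same (hm k))
    (fun n j m hm h => Finsupp.ext fun k => by
      rw [totProj_apply]; exact M.proj_ne (hm k) (by simpa using h))
    (fun m => by
      induction m using Finsupp.induction_linear with
      | zero => exact zero_mem _
      | add x y hx hy => exact add_mem hx hy
      | single k m =>
        induction m using M.induction_gr with
        | hadd x y hx hy => rw [Finsupp.single_add]; exact add_mem hx hy
        | h i m hm =>
          refine Submodule.mem_iSup_of_mem (i - 2 * k) fun j => ?_
          by_cases h : j = k
          · subst h; simpa using hm
          · rw [Finsupp.single_eq_of_ne h]; exact zero_mem _)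
  lact_mem i j a m ha hm k := by
    rw [add_assoc]; exact M.lact_mem i _ a _ ha (hm k)
  ract_mem i j a m ha hm k := by
    have := M.ract_mem i _ a _ ha (hm k)
    rwa [show j + 2 * (k : ℤ) + i = j + i + 2 * k by ring] at this
  d := totD M κ
  d_mem i m hm k := by
    rw [totD_apply]
    have h1 := M.d_mem _ _ (hm k)
    have h3 := hκ.mem _ _ (hm (k + 1))
    rw [show i + 2 * (k : ℤ) + 1 = i + 1 + 2 * k by ring] at h1
    rw [show i + 2 * ((k + 1 : ℕ) : ℤ) + -1 = i + 1 + 2 * k by push_cast; ring] at h3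
    exact add_mem h1 h3
  d_d m := Finsupp.ext fun k => by
    rw [totD_apply, totD_apply, totD_apply, (M.d).map_add, κ.map_add, M.d_d, h2, zero_add,
      add_zero, hd]
    rfl
  d_lact i a m ha := Finsupp.ext fun k => by
    have e : M.d (M.lact a (m k)) + κ (M.lact a (m (k + 1))) =
        M.lact (A.d a) (m k) + i.negOnePow • M.lact a (M.d (m k) + κ (m (k + 1))) := by
      rw [M.d_lact i a _ ha, hκ.lact, A.twist_odd (n := -1) ⟨-1, rfl⟩, A.twist_of_mem 1 i ha,
        one_mul,
        map_negOnePow_smul_apply, add_assoc, ← smul_add, ← LinearMap.map_add]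
    exact e.trans (congrArg (M.lact (A.d a) (m k) + ·)
      (map_negOnePow_smul (Finsupp.lapply (R := R) k) i
        (Finsupp.mapRange.linearMap (M.lact a) (totD M κ m))).symm)
  d_ract j a m hm := Finsupp.ext fun k => by
    have e : M.d (M.ract (MulOpposite.op a) (m k)) + κ (M.ract (MulOpposite.op a) (m (k + 1))) =
        M.ract (MulOpposite.op a) (M.d (m k) + κ (m (k + 1))) +
          j.negOnePow • M.ract (MulOpposite.op (A.d a)) (m k) := by
      rw [M.d_ract _ a _ (hm k), hκ.ract, Int.negOnePow_add, Int.negOnePow_two_mul, mul_one,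
        add_right_comm, ← LinearMap.map_add]
    exact e.trans (congrArg (M.ract (MulOpposite.op a) (M.d (m k) + κ (m (k + 1))) + ·)
      (map_negOnePow_smul (Finsupp.lapply (R := R) k) j
        (Finsupp.mapRange.linearMap (M.ract (MulOpposite.op (A.d a))) m)).symm)

variable {M}

theorem tot_d_apply (x : ℕ →₀ M.carrier) (k : ℕ) :
    (tot M hκ h2 hd).d x k = M.d (x k) + κ (x (k + 1)) := rfl

/-- The inclusion of the multiples of `x_k`. -/
def totSingle (k : ℕ) : M.carrier →ₗ[R] (tot M hκ h2 hd).carrier := Finsupp.lsingle k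

theorem totSingle_apply (k : ℕ) (m : M.carrier) :
    totSingle hκ h2 hd k m = Finsupp.single k m := rfl

theorem tot_lact_single (a : A.carrier) (k : ℕ) (m : M.carrier) :
    (tot M hκ h2 hd).lact a (totSingle hκ h2 hd k m) = totSingle hκ h2 hd k (M.lact a m) :=
  Finsupp.mapRange_single (hf := map_zero _)

theorem tot_ract_single (a : A.carrierᵐᵒᵖ) (k : ℕ) (m : M.carrier) :
    (tot M hκ h2 hd).ract a (totSingle hκ h2 hd k m) = totSingle hκ h2 hd k (M.ract a m) :=
  Finsupp.mapRange_single (hf := map_zero _)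

theorem tot_d_single_zero (m : M.carrier) :
    (tot M hκ h2 hd).d (totSingle hκ h2 hd 0 m) = totSingle hκ h2 hd 0 (M.d m) :=
  Finsupp.ext fun k => by
    change M.d (Finsupp.single 0 m k) + κ (Finsupp.single 0 m (k + 1)) = Finsupp.single 0 (M.d m) k
    rw [Finsupp.single_eq_of_ne (show k + 1 ≠ 0 by omega), map_zero, add_zero]
    by_cases h : k = 0
    · subst h; rw [Finsupp.single_eq_same, Finsupp.single_eq_same]
    · rw [Finsupp.single_eq_of_ne h, Finsupp.single_eq_of_ne h, map_zero]

theorem tot_d_single_succ (k : ℕ) (m : M.carrier) :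
    (tot M hκ h2 hd).d (totSingle hκ h2 hd (k + 1) m) =
      totSingle hκ h2 hd (k + 1) (M.d m) + totSingle hκ h2 hd k (κ m) :=
  Finsupp.ext fun j => by
    change M.d (Finsupp.single (k + 1) m j) + κ (Finsupp.single (k + 1) m (j + 1)) =
      Finsupp.single (k + 1) (M.d m) j + Finsupp.single k (κ m) j
    congr 1
    · by_cases h : j = k + 1
      · subst h; rw [Finsupp.single_eq_same, Finsupp.single_eq_same]
      · rw [Finsupp.single_eq_of_ne h, Finsupp.single_eq_of_ne h, map_zero]
    · by_cases h : j = k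
      · subst h; rw [Finsupp.single_eq_same, Finsupp.single_eq_same]
      · rw [Finsupp.single_eq_of_ne h, Finsupp.single_eq_of_ne (show j + 1 ≠ k + 1 by omega),
          map_zero]

theorem totSingle_mem {n : ℤ} {k : ℕ} {m : M.carrier} (hm : m ∈ M.gr (n + 2 * k)) :
    totSingle hκ h2 hd k m ∈ (tot M hκ h2 hd).gr n := fun j => by
  rw [totSingle_apply]
  by_cases h : j = k
  · subst h; simpa using hm
  · rw [Finsupp.single_eq_of_ne h]; exact zero_mem _

theorem tot_induction {P : (tot M hκ h2 hd).carrier → Prop} (h0 : P 0)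
    (hs : ∀ k m, P (totSingle hκ h2 hd k m)) (hadd : ∀ x y, P x → P y → P (x + y))
    (x : (tot M hκ h2 hd).carrier) : P x := by
  induction x using Finsupp.induction_linear with
  | zero => exact h0
  | add x y hx hy => exact hadd x y hx hy
  | single k m => exact hs k m

/-- The map on `tot M` with given restrictions to the multiples of each `x_k`. -/
def totLift {N : Bimod A} (F : ℕ → M.carrier →ₗ[R] N.carrier) :
    (tot M hκ h2 hd).carrier →ₗ[R] N.carrier := Finsupp.lsum R F

theorem totLift_single {N : Bimod A} (F : ℕ → M.carrier →ₗ[R] N.carrier) (k : ℕ) (m : M.carrier) :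
    totLift hκ h2 hd F (totSingle hκ h2 hd k m) = F k m := Finsupp.lsum_single R F k m

theorem isBi_totLift {N : Bimod A} {n : ℤ} {F : ℕ → M.carrier →ₗ[R] N.carrier}
    (hF : ∀ k : ℕ, IsBi (n - 2 * k) (F k)) : IsBi n (totLift hκ h2 hd F) where
  lact a m := by
    induction m using tot_induction with
    | h0 => simp
    | hadd x y hx hy => simp only [map_add, hx, hy]
    | hs k m => rw [tot_lact_single, totLift_single, totLift_single, (hF k).lact, twist_sub_two_mul]
  ract a m := by
    induction m using tot_induction with
    | h0 => simp
    | hadd x y hx hy => simp only [map_add, hx, hy]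
    | hs k m => rw [tot_ract_single, totLift_single, totLift_single, (hF k).ract]
  mem i m hm := by
    refine Submodule.sum_mem _ fun k _ => ?_
    have := (hF k).mem _ _ (hm k)
    rwa [show i + 2 * (k : ℤ) + (n - 2 * k) = i + n by ring] at this

/-- The map `m x_k ↦ m x_{k-r}`. -/
def totDrop (r : ℕ) : (tot M hκ h2 hd).carrier →ₗ[R] (tot M hκ h2 hd).carrier := dropBy M r

theorem isBi_totDrop (r : ℕ) : IsBi (2 * r) (totDrop hκ h2 hd r) where
  lact a m := by
    rw [A.twist_even (n := 2 * (r : ℤ)) ⟨r, by ring⟩]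
    exact Finsupp.ext fun k => rfl
  ract a m := Finsupp.ext fun k => rfl
  mem i m hm k := by
    have := hm (k + r)
    rwa [show i + 2 * ((k + r : ℕ) : ℤ) = i + 2 * r + 2 * k by push_cast; ring] at this

theorem d_totDrop (r : ℕ) (x : (tot M hκ h2 hd).carrier) :
    (tot M hκ h2 hd).d (totDrop hκ h2 hd r x) = totDrop hκ h2 hd r ((tot M hκ h2 hd).d x) :=
  Finsupp.ext fun k => by
    change M.d (x (k + r)) + κ (x (k + 1 + r)) = M.d (x (k + r)) + κ (x (k + r + 1))
    rw [add_right_comm]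

variable {N : Bimod A} {κ' : N.carrier →ₗ[R] N.carrier} (hκ' : IsBi (-1) κ')
  (h2' : ∀ m, κ' (κ' m) = 0) (hd' : ∀ m, N.d (κ' m) + κ' (N.d m) = 0)

/-- The functoriality of `tot`. -/
def totMap (f : M ⟶ N) (hf : ∀ m, Hom.map f (κ m) = κ' (Hom.map f m)) :
    tot M hκ h2 hd ⟶ tot N hκ' h2' hd' :=
  (⟨Finsupp.mapRange.linearMap (Hom.map f),
    fun a m => Finsupp.ext fun k => Hom.map_lact f a (m k),
    fun a m => Finsupp.ext fun k => Hom.map_ract f a (m k),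
    fun i m hm k => Hom.map_mem f _ _ (hm k),
    fun m => Finsupp.ext fun k => by
      refine (map_add (Hom.map f) (M.d (m k)) (κ (m (k + 1)))).trans ?_
      rw [hf, Hom.map_d]; rfl⟩ : Hom (tot M hκ h2 hd) (tot N hκ' h2' hd'))

theorem totMap_apply (f : M ⟶ N) (hf : ∀ m, Hom.map f (κ m) = κ' (Hom.map f m))
    (x : ℕ →₀ M.carrier) (k : ℕ) :
    Hom.map (totMap hκ h2 hd hκ' h2' hd' f hf) x k = Hom.map f (x k) := rfl

end Tot

/-- Subtracting a boundary in the cone of `f` does not affect whether an element of the cone is a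
boundary. -/
theorem exists_boundary_of_sub {M N : Bimod A} (f : M ⟶ N) {x x₁ : M.carrier}
    {y y₁ : N.carrier}
    (h : ∃ x' y', M.d x' = x - M.d x₁ ∧ Hom.map f x' + N.d y' = y - (Hom.map f x₁ + N.d y₁)) :
    ∃ x' y', M.d x' = x ∧ Hom.map f x' + N.d y' = y := by
  obtain ⟨x', y', h1, h2⟩ := h
  refine ⟨x' + x₁, y' + y₁, by rw [map_add, h1, sub_add_cancel], ?_⟩
  rw [map_add, map_add, add_add_add_comm, h2, sub_add_cancel]

/-- `tot` preserves quasi-isomorphisms: the coefficients of the `x_k` are eliminated, beginning with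
the largest `k`. -/
theorem quasiIso_totMap {M N : Bimod A} {κ : M.carrier →ₗ[R] M.carrier}
    (hκ : IsBi (-1) κ) (h2 : ∀ m, κ (κ m) = 0) (hd : ∀ m, M.d (κ m) + κ (M.d m) = 0)
    {κ' : N.carrier →ₗ[R] N.carrier} (hκ' : IsBi (-1) κ')
    (h2' : ∀ m, κ' (κ' m) = 0) (hd' : ∀ m, N.d (κ' m) + κ' (N.d m) = 0)
    (f : M ⟶ N) (hf : ∀ m, Hom.map f (κ m) = κ' (Hom.map f m)) (hq : quasiIso A f) :
    quasiIso A (totMap hκ h2 hd hκ' h2' hd' f hf) := by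
  rw [Bimod.quasiIso_iff] at hq ⊢
  -- induction on a strict upper bound `n` for the indices `k` that occur
  have key : ∀ (n : ℕ) (x : (tot M hκ h2 hd).carrier) (y : (tot N hκ' h2' hd').carrier),
      (∀ k, n ≤ k → x k = 0 ∧ y k = 0) → (tot M hκ h2 hd).d x = 0 →
      Hom.map (totMap hκ h2 hd hκ' h2' hd' f hf) x = (tot N hκ' h2' hd').d y →
      ∃ x' y', (tot M hκ h2 hd).d x' = x ∧
        Hom.map (totMap hκ h2 hd hκ' h2' hd' f hf) x' + (tot N hκ' h2' hd').d y' = y := by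
    intro n
    induction n with
    | zero =>
      intro x y h _ _
      have hx : x = 0 := Finsupp.ext fun k => (h k (Nat.zero_le k)).1
      have hy : y = 0 := Finsupp.ext fun k => (h k (Nat.zero_le k)).2
      subst hx hy
      exact ⟨0, 0, map_zero _, by rw [map_zero, map_zero, add_zero]⟩
    | succ n ih =>
      intro x y h hx hxy
      have h1 : M.d (x n) = 0 := by
        have := DFunLike.congr_fun hx n
        rw [tot_d_apply, (h (n + 1) le_rfl).1, map_zero, add_zero] at this
        exact this
      have h3 : Hom.map f (x n) = N.d (y n) := by
        have := DFunLike.congr_fun hxy n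
        rw [tot_d_apply, (h (n + 1) le_rfl).2, map_zero, add_zero] at this
        exact this
      -- subtract the boundary of `x' x_n` and `y' x_n`, which removes the coefficients of `x_n`
      obtain ⟨x', y', hx', hy'⟩ := hq _ _ h1 h3
      refine exists_boundary_of_sub _ (x₁ := totSingle hκ h2 hd n x')
        (y₁ := totSingle hκ' h2' hd' n y') (ih _ _ (fun k hk => ⟨?_, ?_⟩) ?_ ?_)
      · rw [Finsupp.sub_apply, tot_d_apply, totSingle_apply,
          Finsupp.single_eq_of_ne (show k + 1 ≠ n by omega), map_zero, add_zero]
        rcases hk.eq_or_lt with rfl | hk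
        · rw [Finsupp.single_eq_same, hx', sub_self]
        · rw [Finsupp.single_eq_of_ne (show k ≠ n by omega), map_zero, sub_zero, (h k hk).1]
      · rw [Finsupp.sub_apply, Finsupp.add_apply, tot_d_apply, totMap_apply, totSingle_apply,
          totSingle_apply, Finsupp.single_eq_of_ne (show k + 1 ≠ n by omega), map_zero, add_zero]
        rcases hk.eq_or_lt with rfl | hk
        · rw [Finsupp.single_eq_same, Finsupp.single_eq_same, hy', sub_self]
        · rw [Finsupp.single_eq_of_ne (show k ≠ n by omega),
            Finsupp.single_eq_of_ne (show k ≠ n by omega), map_zero, map_zero, add_zero, sub_zero,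
            (h k hk).2]
      · rw [map_sub, hx, Bimod.d_d, sub_zero]
      · rw [map_sub, map_sub, map_add, Bimod.d_d, add_zero, hxy, Hom.map_d]
  intro x y hx hxy
  refine key ((x.support ∪ y.support).sup id + 1) x y (fun k hk => ?_) hx hxy
  have : k ∉ x.support ∪ y.support := fun h => by
    have := Finset.le_sup (f := id) h
    simp only [id] at this
    omega
  rw [Finset.mem_union, not_or, Finsupp.notMem_support_iff, Finsupp.notMem_support_iff] at this
  exact this

end Bimod
end DGA

namespace DGA

/-! ### Restriction and induction of bimodules -/

/-- Homomorphisms of differential graded algebras. -/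
structure Map {R : Type u} [CommRing R] (A B : DGA R) where
  hom : A.carrier →ₐ[R] B.carrier
  mem : ∀ i a, a ∈ A.gr i → hom a ∈ B.gr i
  map_d : ∀ a, hom (A.d a) = B.d (hom a)

variable {R : Type u} [CommRing R] {A : DGA R}

theorem Map.map_twist {B : DGA R} (φ : Map A B) (n : ℤ) (a : A.carrier) :
    φ.hom (A.twist n a) = B.twist n (φ.hom a) := by
  induction a using A.induction_gr with
  | hadd x y hx hy => simp only [map_add, hx, hy]
  | h i a ha =>
    rw [A.twist_of_mem n i ha, B.twist_of_mem n i (φ.mem i a ha), map_negOnePow_smul]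

/-- The inclusion of `A` into `A[ε]`. -/
def epsInl {θ : A.carrier} (hθ : A.IsCentralCocycle θ) : Map A (A.adjoinEps θ hθ) where
  hom := AlgHom.ofLinearMap (B := A.Eps) (Eps.inl A) rfl fun a b => by
    refine Eps.ext rfl ?_
    change (0 : A.carrier) = 0 * b + A.twist 1 a * 0
    rw [zero_mul, mul_zero, add_zero]
  mem i a ha := ⟨ha, zero_mem _⟩
  map_d a := by
    refine Eps.ext ?_ ?_
    · change A.d a = A.d a + θ * 0
      rw [mul_zero, add_zero]
    · change (0 : A.carrier) = -A.d 0
      rw [map_zero, neg_zero]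

namespace Bimod

/-- The restriction of a bimodule along a homomorphism. -/
abbrev restr {B : DGA R} (φ : Map A B) (N : Bimod B) : Bimod A where
  carrier := N.carrier
  lact := N.lact.comp φ.hom
  ract := N.ract.comp (AlgHom.op φ.hom)
  lact_ract a b m := N.lact_ract _ _ _
  gr := N.gr
  isInternal := N.isInternal
  lact_mem i j a m ha hm := N.lact_mem i j _ m (φ.mem i a ha) hm
  ract_mem i j a m ha hm := N.ract_mem i j _ m (φ.mem i a ha) hm
  d := N.d
  d_mem := N.d_mem
  d_d := N.d_d
  d_lact i a m ha := by
    have := N.d_lact i _ m (φ.mem i a ha)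
    rw [← φ.map_d] at this
    exact this
  d_ract j a m hm := by
    have := N.d_ract j (φ.hom a) m hm
    rw [← φ.map_d] at this
    exact this

section Induced

variable {θ : A.carrier} (hθ : A.IsCentralCocycle θ) {M N : Bimod A}

/-- The map `u ↦ u` from a bimodule to the induced one. -/
def indInc (M : Bimod A) : M.carrier →ₗ[R] (ind hθ M).carrier :=
  LinearMap.inl R M.carrier (M.carrier × M.carrier × M.carrier)

theorem indInc_apply (m : M.carrier) : indInc hθ M m = (m, 0, 0, 0) := rfl

theorem ind_d_apply (m) : (ind hθ M).d m =
    (M.d m.1 + M.lact θ m.2.1 + M.ract (MulOpposite.op θ) (M.sgn m.2.2.1),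
    -M.d m.2.1 - M.ract (MulOpposite.op θ) (M.sgn m.2.2.2),
    M.d m.2.2.1 + M.lact θ m.2.2.2, -M.d m.2.2.2) := rfl

theorem ind_lact_inc (a : A.carrier) (m : M.carrier) :
    (ind hθ M).lact ((epsInl hθ).hom a) (indInc hθ M m) = indInc hθ M (M.lact a m) := by
  change indLact M ⟨a, 0⟩ (m, 0, 0, 0) = (M.lact a m, 0, 0, 0)
  simp [indLact]

theorem ind_ract_inc (a : A.carrier) (m : M.carrier) :
    (ind hθ M).ract (MulOpposite.op ((epsInl hθ).hom a)) (indInc hθ M m) =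
      indInc hθ M (M.ract (MulOpposite.op a) m) := by
  change indRact M ⟨a, 0⟩ (m, 0, 0, 0) = (M.ract (MulOpposite.op a) m, 0, 0, 0)
  simp [indRact]

theorem ind_d_inc (m : M.carrier) :
    (ind hθ M).d (indInc hθ M m) = indInc hθ M (M.d m) := by
  change indD M θ (m, 0, 0, 0) = (M.d m, 0, 0, 0)
  simp [indD]

/-- The variable of `A[ε]`. -/
def epsVar : (A.adjoinEps θ hθ).carrier := (⟨0, 1⟩ : A.Eps)

theorem ind_lact_eps (m : M.carrier) :
    (ind hθ M).lact (epsVar hθ) (indInc hθ M m) = (0, m, 0, 0) := by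
  change indLact M ⟨0, 1⟩ (m, 0, 0, 0) = (0, m, 0, 0)
  simp [indLact]

theorem ind_ract_eps (m : M.carrier) :
    (ind hθ M).ract (MulOpposite.op (epsVar hθ)) (indInc hθ M m) = (0, 0, m, 0) := by
  change indRact M ⟨0, 1⟩ (m, 0, 0, 0) = (0, 0, m, 0)
  simp [indRact, twist_one]

theorem ind_lact_eps_ract_eps (m : M.carrier) :
    (ind hθ M).lact (epsVar hθ) ((ind hθ M).ract (MulOpposite.op (epsVar hθ)) (indInc hθ M m)) =
      (0, 0, 0, m) := by
  rw [ind_ract_eps]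
  change indLact M ⟨0, 1⟩ (0, 0, m, 0) = (0, 0, 0, m)
  simp [indLact]

theorem ind_eq (m : (ind hθ M).carrier) : m = indInc hθ M m.1 +
    (ind hθ M).lact (epsVar hθ) (indInc hθ M m.2.1) +
    (ind hθ M).ract (MulOpposite.op (epsVar hθ)) (indInc hθ M m.2.2.1) +
    (ind hθ M).lact (epsVar hθ) ((ind hθ M).ract (MulOpposite.op (epsVar hθ))
      (indInc hθ M m.2.2.2)) := by
  rw [ind_lact_eps_ract_eps, ind_ract_eps, ind_lact_eps, indInc_apply]
  obtain ⟨u, v, w, z⟩ := m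
  simp

theorem isBi_indInc : IsBi (N := restr (epsInl hθ) (ind hθ M)) 0 (indInc hθ M) where
  lact a m := by rw [twist_zero]; exact (ind_lact_inc hθ a m).symm
  ract a m := (ind_ract_inc hθ a.unop m).symm
  mem i m hm := by
    rw [add_zero]
    exact ⟨hm, zero_mem _, zero_mem _, zero_mem _⟩

/-! #### The universal property of induction -/

theorem epsVar_mem : epsVar hθ ∈ Eps.gr A (-1) :=
  ⟨zero_mem _, by rw [neg_add_cancel]; exact SetLike.GradedOne.one_mem⟩

variable {L : Bimod (A.adjoinEps θ hθ)}

/-- The map on the induced bimodule with given values on the elements `u`. -/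
def indLift (n : ℤ) (f : M.carrier →ₗ[R] L.carrier) : (ind hθ M).carrier →ₗ[R] L.carrier where
  toFun m := f m.1 + L.lact ((A.adjoinEps θ hθ).twist n (epsVar hθ)) (f m.2.1) +
    L.ract (MulOpposite.op (epsVar hθ)) (f m.2.2.1) +
    L.lact ((A.adjoinEps θ hθ).twist n (epsVar hθ))
      (L.ract (MulOpposite.op (epsVar hθ)) (f m.2.2.2))
  map_add' x y := by
    simp only [Prod.fst_add, Prod.snd_add, map_add]
    abel
  map_smul' c x := by simp

theorem indLift_inc (n : ℤ) (f : M.carrier →ₗ[R] L.carrier) (m : M.carrier) :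
    indLift hθ n f (indInc hθ M m) = f m := by
  change f m + _ + _ + _ = f m
  simp [indInc]

theorem eps_eq (b : A.Eps) : b = (epsInl hθ).hom b.fst + epsVar hθ * (epsInl hθ).hom b.snd := by
  refine Eps.ext ?_ ?_
  · change b.fst = b.fst + 0 * b.snd
    rw [zero_mul, add_zero]
  · change b.snd = 0 + (1 * b.snd + A.twist 1 0 * 0)
    rw [zero_add, one_mul, mul_zero, add_zero]

theorem inl_mul_eps (a : A.carrier) :
    (epsInl hθ).hom a * epsVar hθ = epsVar hθ *
      (epsInl hθ).hom (A.twist 1 a) := by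
  refine Eps.ext ?_ ?_
  · change a * 0 = 0 * A.twist 1 a
    rw [mul_zero, zero_mul]
  · change 0 * 0 + A.twist 1 a * 1 = 1 * A.twist 1 a + A.twist 1 0 * 0
    simp

theorem eps_mul_inl (a : A.carrier) :
    epsVar hθ * (epsInl hθ).hom a =
      (epsInl hθ).hom (A.twist 1 a) * epsVar hθ := by
  rw [inl_mul_eps, twist_one_twist_one]

theorem eps_mul_eps :
    epsVar hθ * epsVar hθ = 0 := by
  refine Eps.ext ?_ ?_
  · change (0 : A.carrier) * 0 = 0
    rw [mul_zero]
  · change (1 : A.carrier) * 0 + A.twist 1 0 * 1 = 0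
    simp

/-- A map which is bilinear over `A` extends to one which is bilinear over `A[ε]`. -/
theorem isBi_indLift {n : ℤ} {f : M.carrier →ₗ[R] L.carrier}
    (hf : IsBi (N := restr (epsInl hθ) L) n f) : IsBi n (indLift hθ n f) where
  lact b m := by
    have hl : ∀ a m, f (M.lact a m) = L.lact ((epsInl hθ).hom (A.twist n a)) (f m) := hf.lact
    obtain ⟨u, v, w, z⟩ := m
    set t := (A.adjoinEps θ hθ).twist n (epsVar hθ) with ht
    have e1 : ∀ x : L.carrier, L.lact ((A.adjoinEps θ hθ).twist n b) x =
        L.lact ((epsInl hθ).hom (A.twist n b.fst)) x +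
          L.lact t (L.lact ((epsInl hθ).hom (A.twist n b.snd)) x) := fun x => by
      conv_lhs => rw [eps_eq hθ b]
      rw [map_add, lact_add_apply, Map.map_twist]
      congr 1
      refine (congrArg (fun y => L.lact y x) ((A.adjoinEps θ hθ).twist_mul n (epsVar hθ)
        ((epsInl hθ).hom b.snd))).trans ?_
      rw [lact_mul, Map.map_twist]
    have e2 : ∀ (a : A.carrier) (x : L.carrier), L.lact ((epsInl hθ).hom (A.twist n a)) (L.lact t x)
        = L.lact t (L.lact ((epsInl hθ).hom (A.twist n (A.twist 1 a))) x) := fun a x => by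
      rw [← lact_mul, ← lact_mul]
      congr 2
      rw [ht, Map.map_twist, Map.map_twist, ← twist_mul, ← twist_mul, inl_mul_eps]
    have e3 : ∀ x : L.carrier, L.lact t (L.lact t x) = 0 := fun x => by
      rw [← lact_mul, ht, ← twist_mul, eps_mul_eps, map_zero, map_zero, LinearMap.zero_apply]
    have e4 : ∀ a, L.lact t (L.lact ((epsInl hθ).hom (A.twist n b.snd)) (L.lact t a)) = 0 :=
      fun a => by rw [e2, e3]
    change f (M.lact b.fst u) + L.lact t (f (M.lact (A.twist 1 b.fst) v + M.lact b.snd u)) +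
      L.ract (MulOpposite.op (epsVar hθ)) (f (M.lact b.fst w)) +
      L.lact t (L.ract (MulOpposite.op (epsVar hθ))
        (f (M.lact (A.twist 1 b.fst) z + M.lact b.snd w))) = L.lact _ (f u + L.lact t (f v) +
          L.ract (MulOpposite.op (epsVar hθ)) (f w) +
          L.lact t (L.ract (MulOpposite.op (epsVar hθ)) (f z)))
    simp only [map_add, hl, e1, e2, e3, L.lact_ract, map_zero]
    abel
  ract b m := by
    obtain ⟨b, rfl⟩ := MulOpposite.op_surjective b
    have hr : ∀ a m, f (M.ract (MulOpposite.op a) m) =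
      L.ract (MulOpposite.op ((epsInl hθ).hom a)) (f m) := fun a m => hf.ract _ m
    obtain ⟨u, v, w, z⟩ := m
    set t := (A.adjoinEps θ hθ).twist n (epsVar hθ) with ht
    have e1 : ∀ x : L.carrier, L.ract (MulOpposite.op b) x =
        L.ract (MulOpposite.op ((epsInl hθ).hom b.fst)) x +
          L.ract (MulOpposite.op (epsVar hθ))
            (L.ract (MulOpposite.op ((epsInl hθ).hom (A.twist 1 b.snd))) x) := fun x => by
      conv_lhs => rw [eps_eq hθ b]
      refine (L.ract_op_add _ _ x).trans ?_
      congr 1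
      refine (congrArg (fun y => L.ract (MulOpposite.op y) x) (eps_mul_inl hθ b.snd)).trans ?_
      exact L.ract_op_mul _ _ x
    have e2 : ∀ (a : A.carrier) (x : L.carrier), L.ract (MulOpposite.op ((epsInl hθ).hom a))
        (L.ract (MulOpposite.op (epsVar hθ)) x) = L.ract (MulOpposite.op (epsVar hθ))
          (L.ract (MulOpposite.op ((epsInl hθ).hom (A.twist 1 a))) x) := fun a x => by
      refine (L.ract_op_mul _ _ x).symm.trans ?_
      refine (congrArg (fun y => L.ract (MulOpposite.op y) x) (eps_mul_inl hθ a)).trans ?_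
      exact L.ract_op_mul _ _ x
    have e3 : ∀ x : L.carrier, L.ract (MulOpposite.op (epsVar hθ))
        (L.ract (MulOpposite.op (epsVar hθ)) x) = 0 := fun x => by
      refine (L.ract_op_mul _ _ x).symm.trans ?_
      refine (congrArg (fun y => L.ract (MulOpposite.op y) x) (eps_mul_eps hθ)).trans ?_
      rw [MulOpposite.op_zero, map_zero, LinearMap.zero_apply]
    change f (M.ract (MulOpposite.op b.fst) u) + L.lact t (f (M.ract (MulOpposite.op b.fst) v)) +
      L.ract (MulOpposite.op (epsVar hθ)) (f (M.ract (MulOpposite.op (A.twist 1 b.fst)) w +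
        M.ract (MulOpposite.op (A.twist 1 b.snd)) u)) +
      L.lact t (L.ract (MulOpposite.op (epsVar hθ))
        (f (M.ract (MulOpposite.op (A.twist 1 b.fst)) z +
        M.ract (MulOpposite.op (A.twist 1 b.snd)) v))) =
        L.ract (MulOpposite.op b) (f u + L.lact t (f v) +
          L.ract (MulOpposite.op (epsVar hθ)) (f w) +
          L.lact t (L.ract (MulOpposite.op (epsVar hθ)) (f z)))
    simp only [map_add, hr, e1, e2, e3, L.lact_ract]
    abel
  mem i m hm := by
    have ht := (A.adjoinEps θ hθ).twist_mem n (-1) (epsVar_mem hθ)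
    have h1 := hf.mem _ _ hm.1
    have h2 := L.lact_mem _ _ _ _ ht (hf.mem _ _ hm.2.1)
    have h3 := L.ract_mem _ _ _ _ (epsVar_mem hθ) (hf.mem _ _ hm.2.2.1)
    have h4 := L.lact_mem _ _ _ _ ht
      (L.ract_mem _ _ _ _ (epsVar_mem hθ) (hf.mem _ _ hm.2.2.2))
    rw [show -1 + (i + 1 + n) = i + n by ring] at h2
    rw [show i + 1 + n + -1 = i + n by ring] at h3
    rw [show -1 + (i + 2 + n + -1) = i + n by ring] at h4
    exact add_mem (add_mem (add_mem h1 h2) h3) h4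

/-! #### Functoriality -/

/-- The functoriality of induction. -/
def indMap (f : M ⟶ N) : ind hθ M ⟶ ind hθ N :=
  (⟨(Hom.map f).prodMap ((Hom.map f).prodMap ((Hom.map f).prodMap (Hom.map f))),
    fun b m => Prod.ext (Hom.map_lact f _ _) (Prod.ext ((map_add (Hom.map f) _ _).trans
      (congrArg₂ (· + ·) (Hom.map_lact f _ _) (Hom.map_lact f _ _)))
      (Prod.ext (Hom.map_lact f _ _) ((map_add (Hom.map f) _ _).trans
      (congrArg₂ (· + ·) (Hom.map_lact f _ _) (Hom.map_lact f _ _))))),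
    fun b m => Prod.ext (Hom.map_ract f _ _) (Prod.ext (Hom.map_ract f _ _)
      (Prod.ext ((map_add (Hom.map f) _ _).trans
      (congrArg₂ (· + ·) (Hom.map_ract f _ _) (Hom.map_ract f _ _)))
        ((map_add (Hom.map f) _ _).trans
      (congrArg₂ (· + ·) (Hom.map_ract f _ _) (Hom.map_ract f _ _))))),
    fun i m hm => ⟨Hom.map_mem f _ _ hm.1, Hom.map_mem f _ _ hm.2.1, Hom.map_mem f _ _ hm.2.2.1,
      Hom.map_mem f _ _ hm.2.2.2⟩,
    fun m => by
      have hs : ∀ m, Hom.map f (M.sgn m) = N.sgn (Hom.map f m) := fun m => by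
        have := (Hom.isBi f).sgn m
        rw [Int.negOnePow_zero, one_smul] at this
        exact this.symm
      have hl : ∀ m m', Hom.map f (M.d m + M.lact θ m') =
          N.d (Hom.map f m) + N.lact θ (Hom.map f m') := fun m m' => by
        rw [map_add, Hom.map_d, Hom.map_lact]
      have hr : ∀ m, Hom.map f (M.ract (MulOpposite.op θ) (M.sgn m)) =
          N.ract (MulOpposite.op θ) (N.sgn (Hom.map f m)) := fun m => by
        rw [Hom.map_ract, hs]
      have hd : ∀ m, Hom.map f (-M.d m) = -N.d (Hom.map f m) := fun m => by
        rw [map_neg, Hom.map_d]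
      exact Prod.ext ((map_add (Hom.map f) _ _).trans (congrArg₂ (· + ·) (hl _ _) (hr _)))
        (Prod.ext ((map_sub (Hom.map f) _ _).trans (congrArg₂ (· - ·) (hd _) (hr _)))
          (Prod.ext (hl _ _) (hd _)))⟩ : Hom (ind hθ M) (ind hθ N))

theorem indMap_apply (f : M ⟶ N) (m) : Hom.map (indMap hθ f) m =
    (Hom.map f m.1, Hom.map f m.2.1, Hom.map f m.2.2.1, Hom.map f m.2.2.2) := rfl

/-- Induction preserves quasi-isomorphisms: eliminate the components one after the other. -/
theorem quasiIso_indMap (f : M ⟶ N) (hq : quasiIso A f) :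
    quasiIso (A.adjoinEps θ hθ) (indMap hθ f) := by
  rw [Bimod.quasiIso_iff] at hq ⊢
  have step1 : ∀ (u : M.carrier) (u' : N.carrier),
      (ind hθ M).d (u, 0, 0, 0) = 0 →
      Hom.map (indMap hθ f) (u, 0, 0, 0) = (ind hθ N).d (u', 0, 0, 0) →
      ∃ x' y', (ind hθ M).d x' = (u, 0, 0, 0) ∧
        Hom.map (indMap hθ f) x' + (ind hθ N).d y' = (u', 0, 0, 0) := by
    intro u u' h1 h2
    have h1 := congrArg Prod.fst ((ind_d_inc hθ u).symm.trans h1)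
    have h2 := congrArg Prod.fst (h2.trans (ind_d_inc hθ u'))
    obtain ⟨a, b, ha, hb⟩ := hq u u' h1 h2
    refine ⟨indInc hθ M a, indInc hθ N b, ?_, ?_⟩
    · rw [ind_d_inc, ha]; rfl
    · rw [ind_d_inc, ← hb, indMap_apply, indInc_apply, indInc_apply]
      simp
  have step2 : ∀ (u v w : M.carrier) (u' v' w' : N.carrier),
      (ind hθ M).d (u, v, w, 0) = 0 →
      Hom.map (indMap hθ f) (u, v, w, 0) = (ind hθ N).d (u', v', w', 0) →
      ∃ x' y', (ind hθ M).d x' = (u, v, w, 0) ∧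
        Hom.map (indMap hθ f) x' + (ind hθ N).d y' = (u', v', w', 0) := by
    intro u v w u' v' w' h1 h2
    have h1v : -M.d v - M.ract (MulOpposite.op θ) (M.sgn 0) = 0 := congrArg (fun m => m.2.1) h1
    have h1w : M.d w + M.lact θ 0 = 0 := congrArg (fun m => m.2.2.1) h1
    have h2v : Hom.map f v = -N.d v' - N.ract (MulOpposite.op θ) (N.sgn 0) :=
      congrArg (fun m => m.2.1) h2
    have h2w : Hom.map f w = N.d w' + N.lact θ 0 := congrArg (fun m => m.2.2.1) h2
    rw [map_zero, map_zero, sub_zero] at h1v h2v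
    rw [map_zero, add_zero] at h1w h2w
    rw [neg_eq_zero] at h1v
    obtain ⟨a, b, ha, hb⟩ := hq v (-v') h1v (by rw [h2v, map_neg])
    obtain ⟨a', b', ha', hb'⟩ := hq w w' h1w h2w
    refine exists_boundary_of_sub _ (x₁ := (0, -a, a', 0)) (y₁ := (0, b, b', 0)) ?_
    have e1 : ((u, v, w, 0) - (ind hθ M).d (0, -a, a', 0) : (ind hθ M).carrier) =
        (u - (- M.lact θ a + M.ract (MulOpposite.op θ) (M.sgn a')), 0, 0, 0) := by
      rw [ind_d_apply]
      simp [ha, ha']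
      rfl
    have e2 : ((u', v', w', 0) - (Hom.map (indMap hθ f) (0, -a, a', 0) +
        (ind hθ N).d (0, b, b', 0)) : (ind hθ N).carrier) =
        (u' - (N.lact θ b + N.ract (MulOpposite.op θ) (N.sgn b')), 0, 0, 0) := by
      rw [ind_d_apply, indMap_apply]
      simp only [Prod.mk_add_mk, Prod.mk_sub_mk, map_zero, map_neg, zero_add, add_zero, sub_zero,
        hb', sub_self, Prod.mk.injEq, true_and]
      rw [← neg_add, hb, neg_neg, sub_self]
      exact ⟨rfl, by rw [neg_zero, sub_zero]⟩
    rw [e1, e2]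
    refine step1 _ _ ?_ ?_
    · rw [← e1, map_sub, h1, Bimod.d_d, sub_zero]
    · rw [← e1, ← e2, map_sub, map_sub, map_add, Bimod.d_d, add_zero, h2, Hom.map_d]
  rintro ⟨u, v, w, z⟩ ⟨u', v', w', z'⟩ h1 h2
  have h1z : -M.d z = 0 := congrArg (fun m => m.2.2.2) h1
  have h2z : Hom.map f z = -N.d z' := congrArg (fun m => m.2.2.2) h2
  rw [neg_eq_zero] at h1z
  obtain ⟨a, b, ha, hb⟩ := hq z (-z') h1z (by rw [h2z, map_neg])
  refine exists_boundary_of_sub _ (x₁ := (0, 0, 0, -a)) (y₁ := (0, 0, 0, b)) ?_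
  have e1 : ((u, v, w, z) - (ind hθ M).d (0, 0, 0, -a) : (ind hθ M).carrier) =
      (u, v - M.ract (MulOpposite.op θ) (M.sgn a), w + M.lact θ a, 0) := by
    rw [ind_d_apply]
    simp [ha]
  have e2 : ((u', v', w', z') - (Hom.map (indMap hθ f) (0, 0, 0, -a) +
      (ind hθ N).d (0, 0, 0, b)) : (ind hθ N).carrier) =
      (u', v' + N.ract (MulOpposite.op θ) (N.sgn b), w' - N.lact θ b, 0) := by
    rw [ind_d_apply, indMap_apply]
    simp only [Prod.mk_add_mk, Prod.mk_sub_mk, map_zero, map_neg, zero_add, add_zero, sub_zero,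
      neg_zero, zero_sub, sub_neg_eq_add, Prod.mk.injEq, true_and]
    rw [← neg_add, hb, neg_neg, sub_self]
  rw [e1, e2]
  refine step2 _ _ _ _ _ _ ?_ ?_
  · rw [← e1, map_sub, h1, Bimod.d_d, sub_zero]
  · rw [← e1, ← e2, map_sub, map_sub, map_add, Bimod.d_d, add_zero, h2, Hom.map_d]

end Induced

end Bimod
end DGA

namespace DGA
namespace Bimod

variable {R : Type u} [CommRing R] {A : DGA R}

/-! ### The resolution over `A[ε]` -/

section Kappa

variable {θ : A.carrier} (hθ : A.IsCentralCocycle θ) {M : Bimod A}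

/-- The operator `m ↦ δ m - ε m + (-1) ^ |m| m ε` on the induced bimodule, where the operator `δ` on
`M` is extended to a bilinear map. If `δ` is a homotopy between the two actions of `θ`, the operator
anticommutes with the differential, because of `d ε = θ`. -/
def indKappa (δ : M.carrier →ₗ[R] M.carrier) : (ind hθ M).carrier →ₗ[R] (ind hθ M).carrier where
  toFun m := (δ m.1, -δ m.2.1 - m.1, δ m.2.2.1 + M.sgn m.1, -δ m.2.2.2 - m.2.2.1 - M.sgn m.2.1)
  map_add' x y := by
    simp only [Prod.fst_add, Prod.snd_add, map_add, Prod.mk_add_mk, Prod.mk.injEq, true_and]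
    exact ⟨by abel, by abel, by abel⟩
  map_smul' c x := by simp [smul_sub]

theorem indKappa_apply (δ : M.carrier →ₗ[R] M.carrier) (m) : indKappa hθ δ m =
    (δ m.1, -δ m.2.1 - m.1, δ m.2.2.1 + M.sgn m.1, -δ m.2.2.2 - m.2.2.1 - M.sgn m.2.1) := rfl

theorem indKappa_inc (δ : M.carrier →ₗ[R] M.carrier) (m : M.carrier) :
    indKappa hθ δ (indInc hθ M m) =
      indInc hθ M (δ m) - (ind hθ M).lact (epsVar hθ) (indInc hθ M m) +
      (ind hθ M).ract (MulOpposite.op (epsVar hθ)) (indInc hθ M (M.sgn m)) := by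
  rw [ind_lact_eps, ind_ract_eps, indKappa_apply, indInc_apply, indInc_apply]
  simp

variable {δ : M.carrier →ₗ[R] M.carrier} (hδ : IsBi (-1) δ)

include hδ in
theorem sgn_neg_one (m : M.carrier) : M.sgn (δ m) = -δ (M.sgn m) := by
  rw [hδ.sgn, Int.negOnePow_neg, Int.negOnePow_one, Units.neg_smul, one_smul]

include hδ in
theorem neg_one_lact (a : A.carrier) (m : M.carrier) :
    δ (M.lact a m) = M.lact (A.twist 1 a) (δ m) := by
  rw [hδ.lact, A.twist_odd (n := -1) ⟨-1, rfl⟩]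

include hδ in
theorem isBi_indKappa : IsBi (-1) (indKappa hθ δ) where
  lact b m := by
    have e : (A.adjoinEps θ hθ).twist (-1) b = (⟨A.twist 1 b.fst, -A.twist 1 b.snd⟩ : A.Eps) :=
      ((A.adjoinEps θ hθ).twist_odd (n := -1) ⟨-1, rfl⟩ b).trans (adjoinEps_twist_one hθ b)
    rw [e]
    obtain ⟨u, v, w, z⟩ := m
    change indKappa hθ δ (indLact M b (u, v, w, z)) =
      indLact M ⟨A.twist 1 b.fst, -A.twist 1 b.snd⟩ (indKappa hθ δ (u, v, w, z))
    simp only [indKappa, indLact, LinearMap.coe_mk, AddHom.coe_mk, map_add, map_sub, map_neg,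
      LinearMap.neg_apply, neg_one_lact hδ, sgn_lact, twist_one_twist_one, Prod.mk.injEq, true_and]
    exact ⟨by abel, by abel⟩
  ract b m := by
    obtain ⟨b, rfl⟩ := MulOpposite.op_surjective b
    obtain ⟨u, v, w, z⟩ := m
    change indKappa hθ δ (indRact M b (u, v, w, z)) = indRact M b (indKappa hθ δ (u, v, w, z))
    simp only [indKappa, indRact, LinearMap.coe_mk, AddHom.coe_mk, map_add, map_sub, map_neg,
      hδ.ract, sgn_ract, Prod.mk.injEq, true_and]
    exact ⟨by abel, by abel⟩
  mem i m hm := by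
    have h1 := hδ.mem _ _ hm.1
    have h2 := hδ.mem _ _ hm.2.1
    have h3 := hδ.mem _ _ hm.2.2.1
    have h4 := hδ.mem _ _ hm.2.2.2
    have h5 := M.sgn_mem hm.1
    have h6 := M.sgn_mem hm.2.1
    have e1 : i + 1 + -1 = i + -1 + 1 := by ring
    have e2 : i + 2 + -1 = i + -1 + 2 := by ring
    have e3 : i = i + -1 + 1 := by ring
    have e4 : i + 1 = i + -1 + 2 := by ring
    rw [e1] at h2 h3
    rw [e2] at h4
    rw [e3] at h5
    rw [e4] at h6
    exact ⟨h1, sub_mem (neg_mem h2) (e3 ▸ hm.1), add_mem h3 h5,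
      sub_mem (sub_mem (neg_mem h4) (e4 ▸ hm.2.2.1)) h6⟩

include hδ in
theorem indKappa_indKappa (h2 : ∀ m, δ (δ m) = 0) (m) : indKappa hθ δ (indKappa hθ δ m) = 0 := by
  simp only [indKappa, LinearMap.coe_mk, AddHom.coe_mk, map_add, map_sub, map_neg, h2,
    sgn_neg_one hδ]
  refine Prod.ext rfl (Prod.ext ?_ (Prod.ext ?_ ?_)) <;> simp
  abel

include hδ in
theorem d_indKappa (hd : ∀ m, M.d (δ m) + δ (M.d m) = M.lact θ m - M.ract (MulOpposite.op θ) m)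
    (m) : (ind hθ M).d (indKappa hθ δ m) + indKappa hθ δ ((ind hθ M).d m) = 0 := by
  have hd' : ∀ m, M.d (δ m) = M.lact θ m - M.ract (MulOpposite.op θ) m - δ (M.d m) :=
    fun m => eq_sub_of_add_eq (hd m)
  obtain ⟨u, v, w, z⟩ := m
  change indD M θ (indKappa hθ δ (u, v, w, z)) + indKappa hθ δ (indD M θ (u, v, w, z)) = 0
  simp only [indKappa, indD, LinearMap.coe_mk, AddHom.coe_mk, map_add, map_sub, map_neg,
    sgn_neg_one hδ, neg_one_lact hδ, hδ.ract, sgn_d, sgn_lact, sgn_ract, hθ.twist, hd',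
    Prod.mk_add_mk, sgn_sgn]
  simp only [Prod.mk_eq_zero]
  exact ⟨by abel, by abel, by abel, by abel⟩

variable (h2 : ∀ m, δ (δ m) = 0)
  (hd : ∀ m, M.d (δ m) + δ (M.d m) = M.lact θ m - M.ract (MulOpposite.op θ) m)

/-- The bimodule over `A[ε]` obtained from a bimodule `M` over `A`, with a homotopy `δ` between
the two actions of `θ`. -/
abbrev totInd : Bimod (A.adjoinEps θ hθ) :=
  tot (ind hθ M) (isBi_indKappa hθ hδ) (indKappa_indKappa hθ hδ h2) (d_indKappa hθ hδ hd)

/-- The map `m ↦ m x_k`. -/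
def totIndSingle (k : ℕ) : M.carrier →ₗ[R] (totInd hθ hδ h2 hd).carrier :=
  totSingle (isBi_indKappa hθ hδ) (indKappa_indKappa hθ hδ h2) (d_indKappa hθ hδ hd) k ∘ₗ
    indInc hθ M

theorem totIndSingle_mem {k : ℕ} {n : ℤ} {m : M.carrier} (hm : m ∈ M.gr (n + 2 * k)) :
    totIndSingle hθ hδ h2 hd k m ∈ (totInd hθ hδ h2 hd).gr n :=
  totSingle_mem _ _ _ (by
    have := (isBi_indInc hθ (M := M)).mem _ _ hm
    rwa [add_zero] at this)

theorem totInd_lact_single (k : ℕ) (a : A.carrier) (m : M.carrier) :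
    (totInd hθ hδ h2 hd).lact ((epsInl hθ).hom a) (totIndSingle hθ hδ h2 hd k m) =
      totIndSingle hθ hδ h2 hd k (M.lact a m) :=
  (tot_lact_single _ _ _ _ _ _).trans (congrArg (totSingle _ _ _ k) (ind_lact_inc hθ a m))

theorem totInd_ract_single (k : ℕ) (a : A.carrier) (m : M.carrier) :
    (totInd hθ hδ h2 hd).ract (MulOpposite.op ((epsInl hθ).hom a)) (totIndSingle hθ hδ h2 hd k m) =
      totIndSingle hθ hδ h2 hd k (M.ract (MulOpposite.op a) m) :=
  (tot_ract_single _ _ _ _ _ _).trans (congrArg (totSingle _ _ _ k) (ind_ract_inc hθ a m))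

theorem totInd_d_single_zero (m : M.carrier) :
    (totInd hθ hδ h2 hd).d (totIndSingle hθ hδ h2 hd 0 m) =
      totIndSingle hθ hδ h2 hd 0 (M.d m) :=
  (tot_d_single_zero _ _ _ _).trans (congrArg (totSingle _ _ _ 0) (ind_d_inc hθ m))

theorem totInd_d_single_succ (k : ℕ) (m : M.carrier) :
    (totInd hθ hδ h2 hd).d (totIndSingle hθ hδ h2 hd (k + 1) m) =
      totIndSingle hθ hδ h2 hd (k + 1) (M.d m) + (totIndSingle hθ hδ h2 hd k (δ m) -
        (totInd hθ hδ h2 hd).lact (epsVar hθ) (totIndSingle hθ hδ h2 hd k m) +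
        (totInd hθ hδ h2 hd).ract (MulOpposite.op (epsVar hθ))
          (totIndSingle hθ hδ h2 hd k (M.sgn m))) := by
  refine (tot_d_single_succ _ _ _ _ _).trans (congrArg₂ (· + ·)
    (congrArg (totSingle _ _ _ (k + 1)) (ind_d_inc hθ m)) ?_)
  rw [indKappa_inc, map_add, map_sub, ← tot_lact_single, ← tot_ract_single]
  rfl

theorem totInd_induction {P : (totInd hθ hδ h2 hd).carrier → Prop} (h0 : P 0)
    (hs : ∀ k m, P (totIndSingle hθ hδ h2 hd k m))
    (hl : ∀ x, P x → P ((totInd hθ hδ h2 hd).lact (epsVar hθ) x))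
    (hr : ∀ x, P x → P ((totInd hθ hδ h2 hd).ract (MulOpposite.op (epsVar hθ)) x))
    (hadd : ∀ x y, P x → P y → P (x + y))
    (x : (totInd hθ hδ h2 hd).carrier) : P x := by
  induction x using tot_induction with
  | h0 => exact h0
  | hadd x y hx hy => exact hadd x y hx hy
  | hs k m =>
    rw [ind_eq hθ m, map_add, map_add, map_add, ← tot_lact_single, ← tot_lact_single,
      ← tot_ract_single, ← tot_ract_single]
    exact hadd _ _ (hadd _ _ (hadd _ _ (hs _ _) (hl _ (hs _ _))) (hr _ (hs _ _)))
      (hl _ (hr _ (hs _ _)))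

variable {L : Bimod (A.adjoinEps θ hθ)}

/-- The map which takes `m x_k` to `f k m`. -/
def totIndLift (n : ℤ) (f : ℕ → M.carrier →ₗ[R] L.carrier) :
    (totInd hθ hδ h2 hd).carrier →ₗ[R] L.carrier :=
  totLift _ _ _ fun k => indLift hθ (n - 2 * k) (f k)

theorem totIndLift_single (n : ℤ) (f : ℕ → M.carrier →ₗ[R] L.carrier) (k : ℕ) (m : M.carrier) :
    totIndLift hθ hδ h2 hd n f (totIndSingle hθ hδ h2 hd k m) = f k m :=
  (totLift_single _ _ _ _ _ _).trans (indLift_inc _ _ _ _)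

theorem isBi_totIndLift {n : ℤ} {f : ℕ → M.carrier →ₗ[R] L.carrier}
    (hf : ∀ k : ℕ, IsBi (N := restr (epsInl hθ) L) (n - 2 * k) (f k)) :
    IsBi n (totIndLift hθ hδ h2 hd n f) :=
  isBi_totLift _ _ _ fun k => isBi_indLift hθ (hf k)

/-- `m ↦ m x_k` is bilinear. -/
theorem isBi_totIndSingle (k : ℕ) :
    IsBi (N := restr (epsInl hθ) (totInd hθ hδ h2 hd)) (-(2 * k)) (totIndSingle hθ hδ h2 hd k) where
  lact a m := by
    rw [A.twist_even (n := -(2 * (k : ℤ))) ⟨-k, by ring⟩]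
    exact (totInd_lact_single hθ hδ h2 hd k a m).symm
  ract a m := (totInd_ract_single hθ hδ h2 hd k a.unop m).symm
  mem i m hm := totIndSingle_mem hθ hδ h2 hd (by simpa using hm)

theorem isBi_restr {B : DGA R} (φ : Map A B) {N L : Bimod B} {n : ℤ} {f : N.carrier →ₗ[R] L.carrier}
    (hf : IsBi n f) : IsBi (M := restr φ N) (N := restr φ L) n f where
  lact a m := by
    have := hf.lact (φ.hom a) m
    rwa [← φ.map_twist] at this
  ract a m := hf.ract (MulOpposite.op (φ.hom a.unop)) m
  mem := hf.mem

section SemiFree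

variable (S : SemiFree M) (hδS : ∀ x, δ (S.gen x) ∈ genSpan M S.gen S.rank (S.rank x + 4))

theorem totIndSingle_mem_genSpan (k : ℕ) {n : ℕ} {m : M.carrier}
    (hm : m ∈ genSpan M S.gen S.rank n) : totIndSingle hθ hδ h2 hd k m ∈
      genSpan (totInd hθ hδ h2 hd)
        (fun x : S.X × ℕ => totIndSingle hθ hδ h2 hd x.2 (S.gen x.1))
        (fun x => 4 * x.2 + S.rank x.1) (4 * k + n) := by
  induction hm using Submodule.span_induction with
  | mem m hm =>
    obtain ⟨a, b, x, hx, rfl⟩ := hm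
    obtain ⟨b, rfl⟩ := MulOpposite.op_surjective b
    rw [← totInd_lact_single, ← totInd_ract_single]
    exact lact_mem_genSpan _ _ (ract_mem_genSpan _ _
      (gen_mem_genSpan (x := ((x, k) : S.X × ℕ)) (totInd hθ hδ h2 hd)
        (gen := fun x : S.X × ℕ => totIndSingle hθ hδ h2 hd x.2 (S.gen x.1))
        (rank := fun x => 4 * x.2 + S.rank x.1) (by simpa using hx)))
  | zero => rw [map_zero]; exact zero_mem _
  | add x y _ _ hx hy => rw [map_add]; exact add_mem hx hy
  | smul c x _ hx => rw [map_smul]; exact Submodule.smul_mem _ _ hx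

/-- If `M` is semifree, then so is the associated bimodule over `A[ε]`. -/
def semiFreeTotInd : SemiFree (totInd hθ hδ h2 hd) where
  X := S.X × ℕ
  gen x := totIndSingle hθ hδ h2 hd x.2 (S.gen x.1)
  deg x := S.deg x.1 - 2 * x.2
  rank x := 4 * x.2 + S.rank x.1
  gen_mem x := totIndSingle_mem hθ hδ h2 hd (by
    rw [sub_add_cancel]; exact S.gen_mem x.1)
  mem_top m := by
    induction m using totInd_induction with
    | h0 => exact ⟨0, zero_mem _⟩
    | hs k m =>
      obtain ⟨n, hn⟩ := S.mem_top m
      exact ⟨_, totIndSingle_mem_genSpan hθ hδ h2 hd S k hn⟩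
    | hl x hx => exact hx.imp fun n hn => lact_mem_genSpan _ _ hn
    | hr x hx => exact hx.imp fun n hn => ract_mem_genSpan _ _ hn
    | hadd x y hx hy =>
      obtain ⟨m, hm⟩ := hx
      obtain ⟨n, hn⟩ := hy
      exact ⟨max m n, add_mem (genSpan_mono _ _ _ (le_max_left _ _) hm)
        (genSpan_mono _ _ _ (le_max_right _ _) hn)⟩
  d_gen := by
    rintro ⟨x, k⟩
    cases k with
    | zero =>
      rw [totInd_d_single_zero]
      exact totIndSingle_mem_genSpan hθ hδ h2 hd S 0 (S.d_gen x)
    | succ k =>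
      have e : 4 * (k + 1) + S.rank x = 4 * k + (S.rank x + 4) := by ring
      have hx : S.gen x ∈ genSpan M S.gen S.rank (S.rank x + 4) := gen_mem_genSpan _ (by omega)
      rw [totInd_d_single_succ]
      refine add_mem (totIndSingle_mem_genSpan hθ hδ h2 hd S (k + 1) (S.d_gen x)) ?_
      change _ ∈ genSpan _ _ _ (4 * (k + 1) + S.rank x)
      rw [e]
      refine add_mem (sub_mem (totIndSingle_mem_genSpan hθ hδ h2 hd S k (hδS x))
        (lact_mem_genSpan _ _ (totIndSingle_mem_genSpan hθ hδ h2 hd S k hx)))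
        (ract_mem_genSpan _ _ (totIndSingle_mem_genSpan hθ hδ h2 hd S k ?_))
      rw [M.sgn_of_mem (S.gen_mem x)]
      exact negOnePow_smul_mem _ _ hx
  exists_ext N φ := by
    choose f hf hφ using fun k : ℕ => S.exists_ext (shift (-(2 * (k : ℤ))) (restr (epsInl hθ) N))
      fun x => ⟨φ (x, k), by
        change _ ∈ N.gr (S.deg x + -(2 * (k : ℤ)))
        rw [← sub_eq_add_neg]
        exact (φ (x, k)).2⟩
    refine ⟨totIndLift hθ hδ h2 hd 0 f, isBi_totIndLift hθ hδ h2 hd fun k => ?_, fun x => ?_⟩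
    · have := (isBi_shift_iff (M := M) (N := restr (epsInl hθ) N) (-(2 * (k : ℤ)))).1 (hf k)
      rwa [zero_add, ← zero_sub] at this
    · rw [totIndLift_single]
      exact hφ x.2 x.1

end SemiFree

end Kappa

end Bimod
end DGA

namespace DGA
namespace Bimod

variable {R : Type u} [CommRing R] {A : DGA R}

/-! ### The diagonal bimodule of `A[ε]` -/

/-- The map `m x_k ↦ m x_{k+r}`. -/
def raiseBy (M : Bimod A) (r : ℕ) : (ℕ →₀ M.carrier) →ₗ[R] (ℕ →₀ M.carrier) :=
  Finsupp.lmapDomain M.carrier R fun k => k + r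

theorem raiseBy_apply_add (M : Bimod A) (r : ℕ) (x : ℕ →₀ M.carrier) (k : ℕ) :
    raiseBy M r x (k + r) = x k :=
  Finsupp.mapDomain_apply (add_left_injective r) x k

theorem raiseBy_apply_lt (M : Bimod A) {r : ℕ} (x : ℕ →₀ M.carrier) {k : ℕ} (h : k < r) :
    raiseBy M r x k = 0 :=
  Finsupp.mapDomain_of_notMem_range x k fun ⟨j, hj⟩ => by
    change j + r = k at hj
    omega

theorem diagonal_sgn (m : A.carrier) : (diagonal A).sgn m = A.twist 1 m := by
  induction m using A.induction_gr with
  | hadd x y hx hy =>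
    exact (map_add (diagonal A).sgn x y).trans
      ((congrArg₂ (fun x y : A.carrier => x + y) hx hy).trans (map_add (A.twist 1) x y).symm)
  | h i m hm =>
    rw [A.twist_of_mem 1 i hm, one_mul]
    exact (diagonal A).sgn_of_mem hm

section Diagonal

variable {θ : A.carrier} (hθ : A.IsCentralCocycle θ)

include hθ in
theorem diagonal_homotopy (m : (diagonal A).carrier) :
    (diagonal A).d ((0 : (diagonal A).carrier →ₗ[R] (diagonal A).carrier) m) +
      (0 : (diagonal A).carrier →ₗ[R] (diagonal A).carrier) ((diagonal A).d m) =
      (diagonal A).lact θ m - (diagonal A).ract (MulOpposite.op θ) m := by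
  rw [LinearMap.zero_apply, LinearMap.zero_apply, map_zero, add_zero]
  refine (sub_eq_zero.2 ?_).symm
  exact hθ.central m

/-- The bimodule over `A[ε]` obtained from the diagonal bimodule over `A`. -/
abbrev totDiagonal : Bimod (A.adjoinEps θ hθ) :=
  totInd hθ (M := diagonal A) (δ := 0) IsBi.zero (fun _ => rfl) (diagonal_homotopy hθ)

/-- The differential of `totDiagonal`. -/
def totDiagonalD : (ℕ →₀ A.carrier × A.carrier × A.carrier × A.carrier) →ₗ[R]
    (ℕ →₀ A.carrier × A.carrier × A.carrier × A.carrier) := (totDiagonal hθ).d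

theorem totDiagonalD_apply (x : ℕ →₀ A.carrier × A.carrier × A.carrier × A.carrier) (k : ℕ) :
    totDiagonalD hθ x k =
      (A.d (x k).1 + θ * (x k).2.1 + A.twist 1 (x k).2.2.1 * θ,
        -A.d (x k).2.1 - A.twist 1 (x k).2.2.2 * θ - (x (k + 1)).1,
        A.d (x k).2.2.1 + θ * (x k).2.2.2 + A.twist 1 (x (k + 1)).1,
        -A.d (x k).2.2.2 - (x (k + 1)).2.2.1 - A.twist 1 (x (k + 1)).2.1) := by
  let σ : A.carrier → A.carrier := fun m => (diagonal A).sgn m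
  have hσ : σ = fun m => A.twist 1 m := funext diagonal_sgn
  have h : totDiagonalD hθ x k =
      ((A.d (x k).1 + θ * (x k).2.1 + σ (x k).2.2.1 * θ,
        -A.d (x k).2.1 - σ (x k).2.2.2 * θ,
        A.d (x k).2.2.1 + θ * (x k).2.2.2, -A.d (x k).2.2.2) :
          A.carrier × A.carrier × A.carrier × A.carrier) +
      (0, -0 - (x (k + 1)).1, 0 + σ (x (k + 1)).1,
        -0 - (x (k + 1)).2.2.1 - σ (x (k + 1)).2.1) := rfl
  rw [h, hσ]
  simp only [Prod.mk_add_mk, Prod.mk.injEq]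
  exact ⟨by abel, by abel, by abel, by abel⟩

/-- The augmentation of `totDiagonal`, which takes `(u + ε v + w ε + ε z ε) x_k` to
`u + ε v + w ε` if `k = 0`, and to zero otherwise. -/
def totDiagonalAugL : (totDiagonal hθ).carrier →ₗ[R] (diagonal (A.adjoinEps θ hθ)).carrier :=
  ({ toFun := fun x => ⟨(x 0).1, (x 0).2.1 + A.twist 1 (x 0).2.2.1⟩
     map_add' := fun x y => by
      refine Eps.ext rfl ?_
      change (x 0).2.1 + (y 0).2.1 + A.twist 1 ((x 0).2.2.1 + (y 0).2.2.1) =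
        (x 0).2.1 + A.twist 1 (x 0).2.2.1 + ((y 0).2.1 + A.twist 1 (y 0).2.2.1)
      rw [map_add]; abel
     map_smul' := fun c x => by
      refine Eps.ext rfl ?_
      change c • (x 0).2.1 + A.twist 1 (c • (x 0).2.2.1) =
        c • ((x 0).2.1 + A.twist 1 (x 0).2.2.1)
      rw [map_smul, smul_add] } :
    (ℕ →₀ A.carrier × A.carrier × A.carrier × A.carrier) →ₗ[R] A.Eps)

theorem totDiagonalAugL_apply (x : ℕ →₀ A.carrier × A.carrier × A.carrier × A.carrier) :
    totDiagonalAugL hθ x = (⟨(x 0).1, (x 0).2.1 + A.twist 1 (x 0).2.2.1⟩ : A.Eps) := rfl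

theorem isBi_totDiagonalAugL : IsBi 0 (totDiagonalAugL hθ) where
  lact b x := by
    rw [twist_zero]
    change ℕ →₀ A.carrier × A.carrier × A.carrier × A.carrier at x
    change A.Eps at b
    refine Eps.ext rfl ?_
    change A.twist 1 b.fst * (x 0).2.1 + b.snd * (x 0).1 + A.twist 1 (b.fst * (x 0).2.2.1) =
      b.snd * (x 0).1 + A.twist 1 b.fst * ((x 0).2.1 + A.twist 1 (x 0).2.2.1)
    rw [twist_mul, mul_add]; abel
  ract b x := by
    obtain ⟨b, rfl⟩ := MulOpposite.op_surjective b
    change ℕ →₀ A.carrier × A.carrier × A.carrier × A.carrier at x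
    change A.Eps at b
    refine Eps.ext rfl ?_
    change (x 0).2.1 * b.fst + A.twist 1 ((x 0).2.2.1 * A.twist 1 b.fst +
        (x 0).1 * A.twist 1 b.snd) =
      ((x 0).2.1 + A.twist 1 (x 0).2.2.1) * b.fst + A.twist 1 (x 0).1 * b.snd
    rw [map_add, twist_mul, twist_mul, twist_one_twist_one, twist_one_twist_one, add_mul]; abel
  mem i x hx := by
    have h := hx 0
    rw [Nat.cast_zero, mul_zero, add_zero] at h
    rw [add_zero]
    exact ⟨h.1, add_mem h.2.1 (A.twist_mem 1 _ h.2.2.1)⟩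

/-- The augmentation of `totDiagonal`. -/
def totDiagonalAug : totDiagonal hθ ⟶ diagonal (A.adjoinEps θ hθ) :=
  (isBi_totDiagonalAugL hθ).toHom fun x => by
    change ℕ →₀ A.carrier × A.carrier × A.carrier × A.carrier at x
    refine (totDiagonalAugL_apply hθ (totDiagonalD hθ x)).trans ?_
    rw [totDiagonalD_apply]
    refine Eps.ext ?_ ?_
    · change A.d (x 0).1 + θ * (x 0).2.1 + A.twist 1 (x 0).2.2.1 * θ =
        A.d (x 0).1 + θ * ((x 0).2.1 + A.twist 1 (x 0).2.2.1)
      rw [mul_add, ← hθ.central (A.twist 1 _), add_assoc]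
    · change -A.d (x 0).2.1 - A.twist 1 (x 0).2.2.2 * θ - (x 1).1 +
        A.twist 1 (A.d (x 0).2.2.1 + θ * (x 0).2.2.2 + A.twist 1 (x 1).1) =
        -A.d ((x 0).2.1 + A.twist 1 (x 0).2.2.1)
      simp only [map_add, twist_mul, twist_one_twist_one, twist_one_d, hθ.twist,
        ← hθ.central (A.twist 1 _)]
      abel

/-- A contracting homotopy for the augmentation of `totDiagonal` is given by
`(u, v, w, z) x_k ↦ (-v, 0, -z, 0) x_{k+1}`. -/
theorem quasiIso_totDiagonalAug : quasiIso (A.adjoinEps θ hθ) (totDiagonalAug hθ) := by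
  rw [Bimod.quasiIso_iff]
  intro x y hx hxy
  let T : Type u := A.carrier × A.carrier × A.carrier × A.carrier
  let s : T →ₗ[R] T :=
    { toFun := fun m => (-m.2.1, 0, -m.2.2.2, 0)
      map_add' := fun m n => by simp [T, add_comm]
      map_smul' := fun c m => by simp [T] }
  change ℕ →₀ T at x
  change A.Eps at y
  let Sx : ℕ →₀ T := raiseBy (ind hθ (diagonal A)) 1 (Finsupp.mapRange.linearMap s x)
  have hS0 : Sx 0 = 0 := raiseBy_apply_lt _ _ one_pos
  have hS : ∀ k, Sx (k + 1) = s (x k) := fun k => raiseBy_apply_add _ 1 _ k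
  -- the last summand is a preimage of `y` under the augmentation
  let x' : ℕ →₀ T := Sx + Finsupp.single 0 (y.fst, 0, A.twist 1 y.snd, 0)
  have hx'0 : x' 0 = (y.fst, 0, A.twist 1 y.snd, 0) := by
    rw [Finsupp.add_apply, hS0, Finsupp.single_eq_same, zero_add]
  have hx' : ∀ k, x' (k + 1) = s (x k) := fun k => by
    rw [Finsupp.add_apply, hS, Finsupp.single_eq_of_ne (Nat.succ_ne_zero k), add_zero]
  have hd : ∀ k, ((A.d (x k).1 + θ * (x k).2.1 + A.twist 1 (x k).2.2.1 * θ,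
        -A.d (x k).2.1 - A.twist 1 (x k).2.2.2 * θ - (x (k + 1)).1,
        A.d (x k).2.2.1 + θ * (x k).2.2.2 + A.twist 1 (x (k + 1)).1,
        -A.d (x k).2.2.2 - (x (k + 1)).2.2.1 - A.twist 1 (x (k + 1)).2.1) : T) = 0 := fun k => by
    rw [← totDiagonalD_apply hθ x k]
    exact DFunLike.congr_fun hx k
  have hq : (⟨(x 0).1, (x 0).2.1 + A.twist 1 (x 0).2.2.1⟩ : A.Eps) =
    ⟨A.d y.fst + θ * y.snd, -A.d y.snd⟩ := hxy
  refine ⟨x', 0, ?_, ?_⟩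
  · refine Finsupp.ext fun k => (totDiagonalD_apply hθ x' k).trans ?_
    rw [hx']
    cases k with
    | zero =>
      have h1 : (x 0).1 = A.d y.fst + θ * y.snd := congrArg Eps.fst hq
      have h2 : (x 0).2.1 + A.twist 1 (x 0).2.2.1 = -A.d y.snd := congrArg Eps.snd hq
      rw [hx'0]
      refine Prod.ext ?_ (Prod.ext ?_ (Prod.ext ?_ ?_))
      · change A.d y.fst + θ * 0 + A.twist 1 (A.twist 1 y.snd) * θ = (x 0).1
        rw [h1, twist_one_twist_one, mul_zero, add_zero, hθ.central]
      · change -A.d 0 - A.twist 1 0 * θ - -(x 0).2.1 = (x 0).2.1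
        simp
      · change A.d (A.twist 1 y.snd) + θ * 0 + A.twist 1 (-(x 0).2.1) = (x 0).2.2.1
        rw [eq_sub_of_add_eq h2, mul_zero, add_zero, neg_sub, map_sub, twist_one_twist_one,
          map_neg, twist_one_d]
        abel
      · change -A.d 0 - -(x 0).2.2.2 - A.twist 1 0 = (x 0).2.2.2
        simp
    | succ k =>
      rw [hx']
      have h1 : -A.d (x k).2.1 - A.twist 1 (x k).2.2.2 * θ - (x (k + 1)).1 = 0 :=
        congrArg (fun m : T => m.2.1) (hd k)
      have h2 : -A.d (x k).2.2.2 - (x (k + 1)).2.2.1 - A.twist 1 (x (k + 1)).2.1 = 0 :=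
        congrArg (fun m : T => m.2.2.2) (hd k)
      refine Prod.ext ?_ (Prod.ext ?_ (Prod.ext ?_ ?_))
      · change A.d (-(x k).2.1) + θ * 0 + A.twist 1 (-(x k).2.2.2) * θ = (x (k + 1)).1
        rw [map_neg, map_neg, mul_zero, neg_mul]
        refine sub_eq_zero.1 (Eq.trans ?_ h1)
        abel
      · change -A.d 0 - A.twist 1 0 * θ - -(x (k + 1)).2.1 = (x (k + 1)).2.1
        simp
      · change A.d (-(x k).2.2.2) + θ * 0 + A.twist 1 (-(x (k + 1)).2.1) = (x (k + 1)).2.2.1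
        rw [map_neg, map_neg, mul_zero]
        refine sub_eq_zero.1 (Eq.trans ?_ h2)
        abel
      · change -A.d 0 - -(x (k + 1)).2.2.2 - A.twist 1 0 = (x (k + 1)).2.2.2
        simp
  · rw [map_zero, add_zero]
    refine (totDiagonalAugL_apply hθ x').trans ?_
    rw [hx'0]
    refine Eps.ext rfl ?_
    change 0 + A.twist 1 (A.twist 1 y.snd) = y.snd
    rw [twist_one_twist_one, zero_add]

end Diagonal

section Functoriality

variable {θ : A.carrier} (hθ : A.IsCentralCocycle θ) {M N : Bimod A}
  {δ : M.carrier →ₗ[R] M.carrier} (hδ : IsBi (-1) δ) (h2 : ∀ m, δ (δ m) = 0)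
  (hd : ∀ m, M.d (δ m) + δ (M.d m) = M.lact θ m - M.ract (MulOpposite.op θ) m)
  {δ' : N.carrier →ₗ[R] N.carrier} (hδ' : IsBi (-1) δ') (h2' : ∀ m, δ' (δ' m) = 0)
  (hd' : ∀ m, N.d (δ' m) + δ' (N.d m) = N.lact θ m - N.ract (MulOpposite.op θ) m)

theorem Hom.map_sgn (f : M ⟶ N) (m : M.carrier) : Hom.map f (M.sgn m) = N.sgn (Hom.map f m) := by
  have := (Hom.isBi f).sgn m
  rw [Int.negOnePow_zero, one_smul] at this
  exact this.symm

theorem indMap_indKappa (f : M ⟶ N) (hf : ∀ m, Hom.map f (δ m) = δ' (Hom.map f m)) (m) :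
    Hom.map (indMap hθ f) (indKappa hθ δ m) = indKappa hθ δ' (Hom.map (indMap hθ f) m) := by
  rw [indMap_apply, indMap_apply, indKappa_apply, indKappa_apply]
  simp only [map_add, map_sub, map_neg, hf, Hom.map_sgn]

/-- The functoriality of `totInd`. -/
def totIndMap (f : M ⟶ N) (hf : ∀ m, Hom.map f (δ m) = δ' (Hom.map f m)) :
    totInd hθ hδ h2 hd ⟶ totInd hθ hδ' h2' hd' :=
  totMap _ _ _ _ _ _ (indMap hθ f) (indMap_indKappa hθ f hf)

theorem quasiIso_totIndMap (f : M ⟶ N) (hf : ∀ m, Hom.map f (δ m) = δ' (Hom.map f m))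
    (hq : quasiIso A f) :
    quasiIso (A.adjoinEps θ hθ) (totIndMap hθ hδ h2 hd hδ' h2' hd' f hf) :=
  quasiIso_totMap _ _ _ _ _ _ _ _ (quasiIso_indMap hθ f hq)

end Functoriality

end Bimod

open DGA.Bimod

namespace AdaptedBasis

variable {R : Type u} [CommRing R] {A : DGA R} (β : A.AdaptedBasis)
  {θ W : A.carrier} (hθ : A.IsCentralCocycle θ) (hW : A.IsCentralCocycle W)
  (t : R) (ht : θ = algebraMap R A.carrier t - W)

theorem lact_algebraMap (M : Bimod A) (t : R) (m : M.carrier) :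
    M.lact (algebraMap R A.carrier t) m = t • m := by
  rw [AlgHom.commutes]; rfl

theorem ract_algebraMap (M : Bimod A) (t : R) (m : M.carrier) :
    M.ract (MulOpposite.op (algebraMap R A.carrier t)) m = t • m :=
  LinearMap.congr_fun (M.ract.commutes t) m

include hW ht in
theorem bar_homotopy (m : β.bar.carrier) : β.bar.d (β.ins W m) + β.ins W (β.bar.d m) =
    β.bar.lact θ m - β.bar.ract (MulOpposite.op θ) m := by
  rw [β.d_ins hW, ht, map_sub, MulOpposite.op_sub, map_sub, LinearMap.sub_apply,
    LinearMap.sub_apply, lact_algebraMap, ract_algebraMap, sub_sub_sub_cancel_left]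

/-- The resolution of the diagonal bimodule of `A[ε]`, for `d ε = θ = t - W` with `t` in the ground
ring. Insertion of `W` in the bar resolution is a homotopy between the two actions of `θ`, because
those of `t` agree. -/
abbrev res : Bimod (A.adjoinEps θ hθ) :=
  totInd hθ (β.isBi_ins hW) (β.ins_ins hW) (β.bar_homotopy hW t ht)

/-- The element `m x_k` of the resolution, for an element `m` of the bar resolution of `A`. -/
def resSingle (k : ℕ) : β.bar.carrier →ₗ[R] (β.res hθ hW t ht).carrier :=
  totIndSingle hθ (β.isBi_ins hW) (β.ins_ins hW) (β.bar_homotopy hW t ht) k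

/-- The resolution is semifree. -/
def semiFreeRes : SemiFree (β.res hθ hW t ht) :=
  semiFreeTotInd hθ _ _ _ β.semiFreeBar β.ins_gen_mem

/-- The augmentation of the resolution. -/
def resAug : β.res hθ hW t ht ⟶ diagonal (A.adjoinEps θ hθ) :=
  totIndMap hθ (β.isBi_ins hW) (β.ins_ins hW) (β.bar_homotopy hW t ht) IsBi.zero (fun _ => rfl)
    (diagonal_homotopy hθ) β.aug (β.aug_ins hW) ≫ totDiagonalAug hθ

theorem quasiIso_resAug : quasiIso _ (β.resAug hθ hW t ht) :=
  quasiIso_comp (quasiIso_totIndMap _ _ _ _ _ _ _ _ _ β.quasiIso_aug)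
    (quasiIso_totDiagonalAug hθ)

theorem resAug_zero (m : β.bar.carrier) :
    Hom.map (β.resAug hθ hW t ht) (β.resSingle hθ hW t ht 0 m) =
      (⟨Hom.map β.aug m, 0⟩ : A.Eps) := by
  have e : Hom.map (totIndMap hθ (β.isBi_ins hW) (β.ins_ins hW) (β.bar_homotopy hW t ht)
      IsBi.zero (fun _ => rfl) (diagonal_homotopy hθ) β.aug (β.aug_ins hW))
      (β.resSingle hθ hW t ht 0 m) = Finsupp.single 0 (Hom.map β.aug m, 0, 0, 0) := by
    refine (Finsupp.mapRange_single (hf := map_zero (Hom.map (indMap hθ β.aug)))).trans ?_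
    change Finsupp.single 0 (Hom.map β.aug m, Hom.map β.aug 0, Hom.map β.aug 0, Hom.map β.aug 0) = _
    rw [map_zero]
  refine (congrArg (Hom.map (totDiagonalAug hθ)) e).trans ?_
  refine Eps.ext ?_ ?_
  · change (Finsupp.single 0 (Hom.map β.aug m, (0 : A.carrier), (0 : A.carrier), (0 : A.carrier))
      0).1 = Hom.map β.aug m
    rw [Finsupp.single_eq_same]
  · change (Finsupp.single 0 (Hom.map β.aug m, (0 : A.carrier), (0 : A.carrier), (0 : A.carrier))
      0).2.1 + A.twist 1 (Finsupp.single 0 (Hom.map β.aug m, (0 : A.carrier), (0 : A.carrier),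
      (0 : A.carrier)) 0).2.2.1 = 0
    rw [Finsupp.single_eq_same, map_zero, add_zero]

theorem resAug_succ (k : ℕ) (m : β.bar.carrier) :
    Hom.map (β.resAug hθ hW t ht) (β.resSingle hθ hW t ht (k + 1) m) = 0 := by
  have e : (show ℕ →₀ A.carrier × A.carrier × A.carrier × A.carrier from
      Hom.map (totIndMap hθ (β.isBi_ins hW) (β.ins_ins hW) (β.bar_homotopy hW t ht)
      IsBi.zero (fun _ => rfl) (diagonal_homotopy hθ) β.aug (β.aug_ins hW))
      (β.resSingle hθ hW t ht (k + 1) m)) 0 = 0 := by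
    refine (totMap_apply _ _ _ _ _ _ _ _ _ _).trans ?_
    refine (congrArg _ (Finsupp.single_eq_of_ne (Nat.succ_ne_zero k).symm)).trans (map_zero _)
  refine (totDiagonalAugL_apply hθ _).trans ?_
  refine Eps.ext (congrArg Prod.fst e) ?_
  refine (congrArg (fun m : A.carrier × A.carrier × A.carrier × A.carrier =>
    m.2.1 + A.twist 1 m.2.2.1) e).trans ?_
  change (0 : A.carrier) + A.twist 1 0 = 0
  rw [map_zero, add_zero]

/-- The map `m x_k ↦ m x_{k-r}` on the resolution. -/
def resDrop (r : ℕ) : (β.res hθ hW t ht).carrier →ₗ[R] (β.res hθ hW t ht).carrier :=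
  totDrop (isBi_indKappa hθ (β.isBi_ins hW))
    (indKappa_indKappa hθ (β.isBi_ins hW) (β.ins_ins hW))
    (d_indKappa hθ (β.isBi_ins hW) (β.bar_homotopy hW t ht)) r

theorem isBi_resDrop (r : ℕ) : IsBi (2 * r) (β.resDrop hθ hW t ht r) :=
  isBi_totDrop (isBi_indKappa hθ (β.isBi_ins hW))
    (indKappa_indKappa hθ (β.isBi_ins hW) (β.ins_ins hW))
    (d_indKappa hθ (β.isBi_ins hW) (β.bar_homotopy hW t ht)) r

theorem d_resDrop (r : ℕ) (x : (β.res hθ hW t ht).carrier) :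
    (β.res hθ hW t ht).d (β.resDrop hθ hW t ht r x) =
      β.resDrop hθ hW t ht r ((β.res hθ hW t ht).d x) :=
  d_totDrop (isBi_indKappa hθ (β.isBi_ins hW))
    (indKappa_indKappa hθ (β.isBi_ins hW) (β.ins_ins hW))
    (d_indKappa hθ (β.isBi_ins hW) (β.bar_homotopy hW t ht)) r x

theorem resDrop_single_add (r k : ℕ) (m : β.bar.carrier) :
    β.resDrop hθ hW t ht r (β.resSingle hθ hW t ht (k + r) m) = β.resSingle hθ hW t ht k m := by
  refine Finsupp.ext fun j => ?_
  change Finsupp.single (k + r) (indInc hθ β.bar m) (j + r) =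
    Finsupp.single k (indInc hθ β.bar m) j
  by_cases h : j = k
  · subst h; rw [Finsupp.single_eq_same, Finsupp.single_eq_same]
  · rw [Finsupp.single_eq_of_ne h, Finsupp.single_eq_of_ne (by omega)]

theorem resDrop_single_lt {r k : ℕ} (h : k < r) (m : β.bar.carrier) :
    β.resDrop hθ hW t ht r (β.resSingle hθ hW t ht k m) = 0 := by
  refine Finsupp.ext fun j => ?_
  change Finsupp.single k (indInc hθ β.bar m) (j + r) = 0
  exact Finsupp.single_eq_of_ne (by omega)

/-- If the composition of the augmentation with the map `m x_k ↦ m x_{k-r}` is homotopic to zero,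
then so is the map itself. -/
theorem exists_homotopy_resDrop (r : ℕ)
    (h : ∃ G : (β.res hθ hW t ht).carrier →ₗ[R] (diagonal (A.adjoinEps θ hθ)).carrier,
      IsBi (2 * r - 1) G ∧ ∀ m, (diagonal (A.adjoinEps θ hθ)).d (G m) +
        G ((β.res hθ hW t ht).d m) = Hom.map (β.resAug hθ hW t ht) (β.resDrop hθ hW t ht r m)) :
    ∃ G : (β.res hθ hW t ht).carrier →ₗ[R] (β.res hθ hW t ht).carrier, IsBi (2 * r - 1) G ∧
      ∀ m, (β.res hθ hW t ht).d (G m) + G ((β.res hθ hW t ht).d m) = β.resDrop hθ hW t ht r m := by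
  obtain ⟨G, hG, hGd⟩ := h
  have hd : ∀ (N : Bimod (A.adjoinEps θ hθ)) (m : N.carrier),
      (shift (2 * r) N).d m = N.d m := fun N m => by
    rw [shift_d, Int.negOnePow_two_mul, one_smul]
  -- shifting by the even number `2 r` turns `resDrop` into a morphism `F`; in the derived category
  -- `F` is zero, because its composition with the invertible augmentation is
  let F : β.res hθ hW t ht ⟶ shift (2 * r) (β.res hθ hW t ht) :=
    IsBi.toHom (f := β.resDrop hθ hW t ht r) ((isBi_shift_iff (M := β.res hθ hW t ht)
      (N := β.res hθ hW t ht) (2 * (r : ℤ))).2 (by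
        rw [zero_add]; exact β.isBi_resDrop hθ hW t ht r))
      fun m => (β.d_resDrop hθ hW t ht r m).symm.trans (hd _ _).symm
  have h1 : homotopic _ (F ≫ shiftMap (2 * r) (β.resAug hθ hW t ht)) (zeroHom _ _) := by
    refine ⟨G, (isBi_shift_iff (M := β.res hθ hW t ht)
      (N := diagonal (A.adjoinEps θ hθ)) (2 * (r : ℤ))).2 ?_, fun m => ?_⟩
    · rwa [neg_add_eq_sub]
    · refine (sub_zero _).trans ((hGd m).symm.trans ?_)
      exact congrArg (fun x : (diagonal (A.adjoinEps θ hθ)).carrier => x + _) (hd _ _).symm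
  have h3 := Q_map_eq_of_homotopic h1
  have h4 : IsIso ((quasiIso (A.adjoinEps θ hθ)).Q.map
      (shiftMap (2 * (r : ℤ)) (β.resAug hθ hW t ht))) :=
    (quasiIso _).Q_inverts _ (quasiIso_shiftMap _ (β.quasiIso_resAug hθ hW t ht))
  have h5 : (quasiIso (A.adjoinEps θ hθ)).Q.map F = (quasiIso _).Q.map (zeroHom _ _) := by
    rw [← cancel_mono ((quasiIso (A.adjoinEps θ hθ)).Q.map
      (shiftMap (2 * (r : ℤ)) (β.resAug hθ hW t ht))), ← CategoryTheory.Functor.map_comp, h3,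
      ← CategoryTheory.Functor.map_comp]
    congr 1
    exact hom_ext fun m => (map_zero (Hom.map (β.resAug hθ hW t ht))).symm
  obtain ⟨k, hk, hkd⟩ := (β.semiFreeRes hθ hW t ht).homotopic_of_Q_map_eq h5
  refine ⟨k, ?_, fun m => ?_⟩
  · have := (isBi_shift_iff (M := β.res hθ hW t ht)
      (N := β.res hθ hW t ht) (2 * (r : ℤ))).1 hk
    rwa [neg_add_eq_sub] at this
  · refine Eq.trans ?_ ((hkd m).symm.trans (sub_zero _))
    exact congrArg (fun x : (β.res hθ hW t ht).carrier => x + _) (hd _ _).symm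

end AdaptedBasis
end DGA

namespace DGA

variable {R : Type u} [CommRing R] {A : DGA R}

namespace Bimod

/-! ### Bounding cochains and homotopies -/

/-- Multiplication by a supercentral element is a bilinear map. -/
theorem isBi_lact (N : Bimod A) {n : ℤ} {z : A.carrier} (hz : z ∈ A.gr n)
    (h : ∀ a, z * a = A.twist n a * z) : IsBi n (N.lact z) where
  lact a m := by rw [← lact_mul, h, lact_mul]
  ract a m := N.lact_ract z a m
  mem i m hm := by
    rw [add_comm]
    exact N.lact_mem _ _ _ _ hz hm

end Bimod

open DGA.Bimod

theorem gr_mul_mem (A : DGA R) {i j : ℤ} {a b : A.carrier} (ha : a ∈ A.gr i) (hb : b ∈ A.gr j) :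
    a * b ∈ A.gr (i + j) := SetLike.GradedMul.mul_mem ha hb

theorem IsCentralCocycle.map {B : DGA R} {c : A.carrier} (hc : A.IsCentralCocycle c) (φ : Map A B)
    (h : ∀ b, φ.hom c * b = b * φ.hom c) : B.IsCentralCocycle (φ.hom c) :=
  ⟨φ.mem 0 c hc.mem, by rw [← φ.map_d, hc.closed, map_zero], h⟩

section Eps

variable {θ : A.carrier} (hθ : A.IsCentralCocycle θ)

theorem isCentralCocycle_epsInl {c : A.carrier} (hc : A.IsCentralCocycle c) :
    (A.adjoinEps θ hθ).IsCentralCocycle ((epsInl hθ).hom c) :=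
  hc.map _ fun b => by
    change A.Eps at b
    refine Eps.ext (hc.central b.fst) ?_
    change 0 * b.fst + A.twist 1 c * b.snd = b.snd * c + A.twist 1 b.fst * 0
    rw [hc.twist, zero_mul, mul_zero, zero_add, add_zero, hc.central]

theorem twist_epsVar {n : ℤ} (hn : Odd n) :
    (A.adjoinEps θ hθ).twist n (epsVar hθ) = -epsVar hθ := by
  refine ((A.adjoinEps θ hθ).twist_odd hn _).trans ((adjoinEps_twist_one hθ _).trans ?_)
  refine Eps.ext ?_ ?_
  · change A.twist 1 0 = -0
    rw [map_zero, neg_zero]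
  · change -A.twist 1 1 = -1
    rw [twist_one]

/-- The product of the variable `ε` with a central cocycle is supercentral. -/
theorem eps_mul_central {c : A.carrier} (hc : A.IsCentralCocycle c)
    (b : (A.adjoinEps θ hθ).carrier) :
    epsVar hθ * (epsInl hθ).hom c * b =
      (A.adjoinEps θ hθ).twist (-1) b * (epsVar hθ * (epsInl hθ).hom c) := by
  have e : (A.adjoinEps θ hθ).twist (-1) b = _ :=
    ((A.adjoinEps θ hθ).twist_odd (n := -1) ⟨-1, rfl⟩ b).trans (adjoinEps_twist_one hθ b)
  rw [mul_assoc, (isCentralCocycle_epsInl hθ hc).central b, ← mul_assoc, ← mul_assoc, e]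
  refine congrArg (fun x => x * (epsInl hθ).hom c) ?_
  change A.Eps at b
  refine Eps.ext ?_ ?_
  · change 0 * b.fst = A.twist 1 b.fst * 0
    rw [zero_mul, mul_zero]
  · change 1 * b.fst + A.twist 1 0 * b.snd =
      -A.twist 1 b.snd * 0 + A.twist 1 (A.twist 1 b.fst) * 1
    rw [twist_one_twist_one, map_zero, zero_mul, mul_zero, one_mul, mul_one, add_zero, zero_add]

theorem eps_mul_central_mem {c : A.carrier} (hc : A.IsCentralCocycle c) :
    epsVar hθ * (epsInl hθ).hom c ∈ (A.adjoinEps θ hθ).gr (-1) := by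
  have := (A.adjoinEps θ hθ).gr_mul_mem (epsVar_mem hθ) (isCentralCocycle_epsInl hθ hc).mem
  rwa [add_zero] at this

theorem d_eps_mul_central {c : A.carrier} (hc : A.IsCentralCocycle c) :
    (A.adjoinEps θ hθ).d (epsVar hθ * (epsInl hθ).hom c) = (epsInl hθ).hom (θ * c) := by
  refine Eps.ext ?_ ?_
  · change A.d (0 * c) + θ * (1 * c + A.twist 1 0 * 0) = θ * c
    simp
  · change -A.d (1 * c + A.twist 1 0 * 0) = 0
    simp [hc.closed]

end Eps

namespace AdaptedBasis

variable (β : A.AdaptedBasis)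
  {θ W : A.carrier} (hθ : A.IsCentralCocycle θ) (hW : A.IsCentralCocycle W)
  (t : R) (ht : θ = algebraMap R A.carrier t - W)

section Hochschild

variable {r : ℕ} {Ψ : ℕ → β.bar.carrier →ₗ[R] A.carrier}
  (hΨ : ∀ k : ℕ, IsBi (N := diagonal A) (2 * r - 1 - 2 * k) (Ψ k))

/-- The map on the resolution which is given by a sequence of maps on the bar resolution. -/
def resLift (r : ℕ) (Ψ : ℕ → β.bar.carrier →ₗ[R] A.carrier) :
    (β.res hθ hW t ht).carrier →ₗ[R] (diagonal (A.adjoinEps θ hθ)).carrier :=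
  totIndLift hθ (β.isBi_ins hW) (β.ins_ins hW) (β.bar_homotopy hW t ht)
    (L := diagonal (A.adjoinEps θ hθ)) (2 * r - 1)
    fun k => (epsInl hθ).hom.toLinearMap ∘ₗ Ψ k

theorem resLift_single (k : ℕ) (m : β.bar.carrier) :
    β.resLift hθ hW t ht r Ψ (β.resSingle hθ hW t ht k m) = (epsInl hθ).hom (Ψ k m) :=
  totIndLift_single hθ (β.isBi_ins hW) (β.ins_ins hW) (β.bar_homotopy hW t ht)
    (L := diagonal (A.adjoinEps θ hθ)) _ _ k m

include hΨ in
theorem isBi_resLift : IsBi (2 * r - 1) (β.resLift hθ hW t ht r Ψ) :=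
  isBi_totIndLift _ _ _ _ fun k =>
    { lact := fun a m => (congrArg (epsInl hθ).hom ((hΨ k).lact a m)).trans
        (map_mul (epsInl hθ).hom (A.twist _ a) (Ψ k m))
      ract := fun a m => (congrArg (epsInl hθ).hom ((hΨ k).ract a m)).trans
        (map_mul (epsInl hθ).hom (Ψ k m) a.unop)
      mem := fun i m hm => (epsInl hθ).mem _ _ ((hΨ k).mem i m hm) }

theorem d_resLift_zero (m : β.bar.carrier) :
    (diagonal (A.adjoinEps θ hθ)).d (β.resLift hθ hW t ht r Ψ (β.resSingle hθ hW t ht 0 m)) +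
      β.resLift hθ hW t ht r Ψ ((β.res hθ hW t ht).d (β.resSingle hθ hW t ht 0 m)) =
      (epsInl hθ).hom (A.d (Ψ 0 m) + Ψ 0 (β.bar.d m)) := by
  have e := congrArg (β.resLift hθ hW t ht r Ψ)
    (totInd_d_single_zero hθ (β.isBi_ins hW) (β.ins_ins hW) (β.bar_homotopy hW t ht) m)
  have e1 := e.trans (β.resLift_single hθ hW t ht 0 (β.bar.d m))
  have e2 : (A.adjoinEps θ hθ).d (β.resLift hθ hW t ht r Ψ (β.resSingle hθ hW t ht 0 m)) =
      (epsInl hθ).hom (A.d (Ψ 0 m)) := by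
    rw [Map.map_d]
    exact congrArg _ (β.resLift_single hθ hW t ht 0 m)
  rw [map_add]
  exact congrArg₂ (fun x y : (A.adjoinEps θ hθ).carrier => x + y) e2 e1

include hΨ in
theorem d_resLift_succ (k : ℕ) (m : β.bar.carrier) :
    (diagonal (A.adjoinEps θ hθ)).d (β.resLift hθ hW t ht r Ψ (β.resSingle hθ hW t ht (k + 1) m)) +
      β.resLift hθ hW t ht r Ψ ((β.res hθ hW t ht).d (β.resSingle hθ hW t ht (k + 1) m)) =
      (epsInl hθ).hom (A.d (Ψ (k + 1) m) + Ψ (k + 1) (β.bar.d m) + Ψ k (β.ins W m)) := by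
  have hB := β.isBi_resLift hθ hW t ht hΨ
  have hodd : Odd (2 * (r : ℤ) - 1) := ⟨r - 1, by ring⟩
  have hoddk : Odd (2 * (r : ℤ) - 1 - 2 * k) := ⟨r - 1 - k, by ring⟩
  set G := β.resLift hθ hW t ht r Ψ with hG
  have e := congrArg G
    (totInd_d_single_succ hθ (β.isBi_ins hW) (β.ins_ins hW) (β.bar_homotopy hW t ht) k m)
  have e1 : ∀ k m, G (β.resSingle hθ hW t ht k m) = (epsInl hθ).hom (Ψ k m) :=
    β.resLift_single hθ hW t ht
  have e2 : (A.adjoinEps θ hθ).d (G (β.resSingle hθ hW t ht (k + 1) m)) =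
      (epsInl hθ).hom (A.d (Ψ (k + 1) m)) := by
    rw [Map.map_d]
    exact congrArg _ (e1 (k + 1) m)
  have e3 : G ((β.res hθ hW t ht).lact (epsVar hθ) (β.resSingle hθ hW t ht k m)) =
      -(epsVar hθ * (epsInl hθ).hom (Ψ k m)) := by
    rw [hB.lact, twist_epsVar hθ hodd]
    refine (congrArg _ (e1 k m)).trans ?_
    exact neg_mul (epsVar hθ) ((epsInl hθ).hom (Ψ k m))
  have e4 : G ((β.res hθ hW t ht).ract (MulOpposite.op (epsVar hθ))
      (β.resSingle hθ hW t ht k (β.bar.sgn m))) = -(epsVar hθ * (epsInl hθ).hom (Ψ k m)) := by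
    rw [hB.ract]
    refine (congrArg _ (e1 k _)).trans ?_
    have h1 : A.twist 1 (Ψ k (β.bar.sgn m)) = -Ψ k m := by
      have := (hΨ k).sgn (β.bar.sgn m)
      rw [sgn_sgn, Int.negOnePow_odd _ hoddk, Units.neg_smul, one_smul] at this
      exact (diagonal_sgn _).symm.trans this
    refine (inl_mul_eps hθ (Ψ k (β.bar.sgn m))).trans ?_
    rw [h1, map_neg, mul_neg]
  have e5 : G ((β.res hθ hW t ht).d (β.resSingle hθ hW t ht (k + 1) m)) =
      (epsInl hθ).hom (Ψ (k + 1) (β.bar.d m)) + ((epsInl hθ).hom (Ψ k (β.ins W m)) -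
        -(epsVar hθ * (epsInl hθ).hom (Ψ k m)) + -(epsVar hθ * (epsInl hθ).hom (Ψ k m))) := by
    refine e.trans ?_
    refine (map_add G _ _).trans (congrArg₂ (fun x y : (A.adjoinEps θ hθ).carrier => x + y)
      (e1 _ _) ?_)
    refine (map_add G _ _).trans (congrArg₂ (fun x y : (A.adjoinEps θ hθ).carrier => x + y)
      ?_ e4)
    exact (map_sub G _ _).trans (congrArg₂ (fun x y : (A.adjoinEps θ hθ).carrier => x - y)
      (e1 _ _) e3)
  refine (congrArg₂ (fun x y : (A.adjoinEps θ hθ).carrier => x + y) e2 e5).trans ?_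
  rw [map_add, map_add]
  abel

theorem resAug_resDrop_of_ne (w : List β.I) (k : ℕ) (h : ¬(k = r ∧ w = [])) :
    Hom.map (β.resAug hθ hW t ht) (β.resDrop hθ hW t ht r
      (β.resSingle hθ hW t ht k (β.toBar (β.gen w)))) = 0 := by
  by_cases hk : k < r
  · exact (congrArg _ (β.resDrop_single_lt hθ hW t ht hk _)).trans (map_zero _)
  · obtain ⟨j, rfl⟩ := Nat.exists_eq_add_of_le' (not_lt.1 hk)
    rw [resDrop_single_add]
    cases j with
    | succ j => exact β.resAug_succ hθ hW t ht j _
    | zero =>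
      refine (β.resAug_zero hθ hW t ht _).trans ?_
      cases w with
      | nil => simp at h
      | cons i w => exact Eps.ext (β.aug_gen_cons i w) rfl

theorem resAug_resDrop_self : Hom.map (β.resAug hθ hW t ht) (β.resDrop hθ hW t ht r
      (β.resSingle hθ hW t ht r (β.toBar (β.gen [])))) = (1 : A.Eps) := by
  have := β.resDrop_single_add hθ hW t ht r 0 (β.toBar (β.gen []))
  rw [zero_add] at this
  rw [this]
  refine (β.resAug_zero hθ hW t ht _).trans ?_
  exact Eps.ext β.aug_gen_nil rfl

/-- A bounding cochain for `q ^ r c` gives a homotopy between zero and the product of `c` with the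
map `m x_k ↦ m x_{k-r}`, composed with the augmentation. -/
theorem d_resLift {c : A.carrier} (hc : A.IsCentralCocycle c) (hΨ : ∀ k : ℕ,
    IsBi (N := diagonal A) (2 * r - 1 - 2 * k) (Ψ k))
    (h0 : ∀ w, A.d (Ψ 0 (β.toBar (β.gen w))) + Ψ 0 (β.bar.d (β.toBar (β.gen w))) =
      if 0 = r ∧ w.length = 0 then c else 0)
    (hs : ∀ k w, A.d (Ψ (k + 1) (β.toBar (β.gen w))) + Ψ (k + 1) (β.bar.d (β.toBar (β.gen w))) +
      Ψ k (β.ins W (β.toBar (β.gen w))) = if k + 1 = r ∧ w.length = 0 then c else 0)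
    (m : (β.res hθ hW t ht).carrier) :
    (diagonal (A.adjoinEps θ hθ)).d (β.resLift hθ hW t ht r Ψ m) +
      β.resLift hθ hW t ht r Ψ ((β.res hθ hW t ht).d m) =
      (diagonal (A.adjoinEps θ hθ)).lact ((epsInl hθ).hom c)
        (Hom.map (β.resAug hθ hW t ht) (β.resDrop hθ hW t ht r m)) := by
  have hB := (β.isBi_resLift hθ hW t ht hΨ).d_comp
  have h1 : IsBi (2 * r) ((diagonal (A.adjoinEps θ hθ)).d ∘ₗ β.resLift hθ hW t ht r Ψ +
      β.resLift hθ hW t ht r Ψ ∘ₗ (β.res hθ hW t ht).d) := by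
    rwa [sub_add_cancel, Int.negOnePow_two_mul, one_smul] at hB
  have h2 := (isBi_lact (diagonal (A.adjoinEps θ hθ))
    (isCentralCocycle_epsInl hθ hc).mem fun a => by
    rw [twist_zero, (isCentralCocycle_epsInl hθ hc).central]).comp
    ((Hom.isBi (β.resAug hθ hW t ht)).comp (β.isBi_resDrop hθ hW t ht r))
  rw [add_zero, add_zero] at h2
  have key : ∀ (w : List β.I) (k : ℕ), (diagonal (A.adjoinEps θ hθ)).d (β.resLift hθ hW t ht r Ψ
        (β.resSingle hθ hW t ht k (β.toBar (β.gen w)))) +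
      β.resLift hθ hW t ht r Ψ ((β.res hθ hW t ht).d
        (β.resSingle hθ hW t ht k (β.toBar (β.gen w)))) =
      (diagonal (A.adjoinEps θ hθ)).lact ((epsInl hθ).hom c)
        (Hom.map (β.resAug hθ hW t ht) (β.resDrop hθ hW t ht r
          (β.resSingle hθ hW t ht k (β.toBar (β.gen w))))) := fun w k => by
    have e : (diagonal (A.adjoinEps θ hθ)).d (β.resLift hθ hW t ht r Ψ
        (β.resSingle hθ hW t ht k (β.toBar (β.gen w)))) +
      β.resLift hθ hW t ht r Ψ ((β.res hθ hW t ht).d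
        (β.resSingle hθ hW t ht k (β.toBar (β.gen w)))) =
        (epsInl hθ).hom (if k = r ∧ w.length = 0 then c else 0) := by
      cases k with
      | zero => exact (β.d_resLift_zero hθ hW t ht _).trans (congrArg _ (h0 w))
      | succ k => exact (β.d_resLift_succ hθ hW t ht hΨ k _).trans (congrArg _ (hs k w))
    refine e.trans ?_
    split_ifs with hkw
    · obtain ⟨rfl, hw⟩ := hkw
      obtain rfl := List.length_eq_zero_iff.1 hw
      rw [resAug_resDrop_self]
      exact (mul_one ((epsInl hθ).hom c)).symm
    · rw [resAug_resDrop_of_ne β hθ hW t ht w k fun h => hkw ⟨h.1, by rw [h.2, List.length_nil]⟩,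
        map_zero, map_zero]
      rfl
  have h3 := (β.semiFreeRes hθ hW t ht).eq_zero (h1.sub h2) fun x => sub_eq_zero.2 (key x.1 x.2)
  exact sub_eq_zero.1 (LinearMap.congr_fun h3 m)

/-- A bounding cochain for `q ^ r c` makes the composition of the augmentation with the map
`m x_k ↦ m x_{k-r}` homotopic to zero, if `c` is a unit of the ground ring modulo `θ`: the
multiple of that composition by `θ c'` is the coboundary of its multiple by `ε c'`. -/
theorem exists_homotopy_resAug {u : R} (hu : IsUnit u) {c c' : A.carrier}
    (hc : A.IsCentralCocycle c) (hc' : A.IsCentralCocycle c')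
    (huc : algebraMap R A.carrier u = c + θ * c')
    (hΨ : ∀ k : ℕ, IsBi (N := diagonal A) (2 * r - 1 - 2 * k) (Ψ k))
    (h0 : ∀ w, A.d (Ψ 0 (β.toBar (β.gen w))) + Ψ 0 (β.bar.d (β.toBar (β.gen w))) =
      if 0 = r ∧ w.length = 0 then c else 0)
    (hs : ∀ k w, A.d (Ψ (k + 1) (β.toBar (β.gen w))) + Ψ (k + 1) (β.bar.d (β.toBar (β.gen w))) +
      Ψ k (β.ins W (β.toBar (β.gen w))) = if k + 1 = r ∧ w.length = 0 then c else 0) :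
    ∃ G : (β.res hθ hW t ht).carrier →ₗ[R] (diagonal (A.adjoinEps θ hθ)).carrier,
      IsBi (2 * r - 1) G ∧ ∀ m, (diagonal (A.adjoinEps θ hθ)).d (G m) +
        G ((β.res hθ hW t ht).d m) = Hom.map (β.resAug hθ hW t ht) (β.resDrop hθ hW t ht r m) := by
  obtain ⟨v, hv⟩ := hu.exists_left_inv
  let Δ := diagonal (A.adjoinEps θ hθ)
  let F : (β.res hθ hW t ht).carrier →ₗ[R] Δ.carrier :=
    Hom.map (β.resAug hθ hW t ht) ∘ₗ β.resDrop hθ hW t ht r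
  have hF : IsBi (2 * r) F := by
    have := (Hom.isBi (β.resAug hθ hW t ht)).comp (β.isBi_resDrop hθ hW t ht r)
    rwa [add_zero] at this
  have hFd : ∀ m, Δ.d (F m) = F ((β.res hθ hW t ht).d m) := fun m => by
    change Δ.d (Hom.map (β.resAug hθ hW t ht) (β.resDrop hθ hW t ht r m)) =
      Hom.map (β.resAug hθ hW t ht) (β.resDrop hθ hW t ht r ((β.res hθ hW t ht).d m))
    rw [← d_resDrop, Hom.map_d]
  -- the coboundary of the multiple of `F` by `ε c'` is the multiple of `F` by `d (ε c') = θ c'`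
  let z := epsVar hθ * (epsInl hθ).hom c'
  have hz : IsBi (2 * r - 1) (Δ.lact z ∘ₗ F) := by
    have := (isBi_lact Δ (eps_mul_central_mem hθ hc') (eps_mul_central hθ hc')).comp hF
    rwa [← sub_eq_add_neg] at this
  have hzd : ∀ m, Δ.d (Δ.lact z (F m)) + Δ.lact z (F ((β.res hθ hW t ht).d m)) =
      Δ.lact ((epsInl hθ).hom (θ * c')) (F m) := fun m => by
    rw [Δ.d_lact _ _ _ (eps_mul_central_mem hθ hc'), d_eps_mul_central hθ hc', hFd,
      Int.negOnePow_neg, Int.negOnePow_one, Units.neg_smul, one_smul, neg_add_cancel_right]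
  have hu' : ∀ x : Δ.carrier, Δ.lact ((epsInl hθ).hom c) x +
      Δ.lact ((epsInl hθ).hom (θ * c')) x = u • x := fun x => by
    rw [← lact_add_apply, ← map_add, ← huc, AlgHom.commutes, lact_algebraMap]
  refine ⟨v • (β.resLift hθ hW t ht r Ψ + Δ.lact z ∘ₗ F),
    ((β.isBi_resLift hθ hW t ht hΨ).add hz).smul v, fun m => ?_⟩
  have e : Δ.d (v • (β.resLift hθ hW t ht r Ψ m + Δ.lact z (F m))) +
      v • (β.resLift hθ hW t ht r Ψ ((β.res hθ hW t ht).d m) +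
        Δ.lact z (F ((β.res hθ hW t ht).d m))) = F m := by
    rw [map_smul, ← smul_add, map_add, add_add_add_comm, hzd,
      β.d_resLift hθ hW t ht hc hΨ h0 hs m]
    refine (congrArg (fun x => v • x) (hu' (F m))).trans ?_
    rw [← mul_smul, hv, one_smul]
  exact e

end Hochschild

end AdaptedBasis
end DGA

namespace DGA

/-! ### Adapted bases and extension of constants -/

section BaseChange

variable {K : Type u} [CommRing K] (A : DGA K) (R : Type u) [CommRing R] [Algebra K R]

/-- The extension of constants `R ⊗ A`, as a module over the original ground ring. -/
instance moduleBaseChange : Module K (A.baseChange R).carrier :=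
  inferInstanceAs (Module K (R ⊗[K] A.carrier))

instance isScalarTowerBaseChange : IsScalarTower K R (A.baseChange R).carrier :=
  inferInstanceAs (IsScalarTower K R (R ⊗[K] A.carrier))

/-- The inclusion `a ↦ 1 ⊗ a` of `A` into `R ⊗ A`. -/
def unitMap : A.carrier →ₗ[K] (A.baseChange R).carrier := TensorProduct.mk K R A.carrier 1

variable {A}

theorem unitMap_mul (a b : A.carrier) :
    A.unitMap R (a * b) = A.unitMap R a * A.unitMap R b := by
  change (1 : R) ⊗ₜ[K] (a * b) = ((1 : R) ⊗ₜ[K] a) * ((1 : R) ⊗ₜ[K] b)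
  rw [Algebra.TensorProduct.tmul_mul_tmul, one_mul]

theorem unitMap_one : A.unitMap R 1 = 1 := rfl

theorem unitMap_d (a : A.carrier) : (A.baseChange R).d (A.unitMap R a) = A.unitMap R (A.d a) :=
  LinearMap.baseChange_tmul _ _ _

theorem unitMap_mem {n : ℤ} {a : A.carrier} (ha : a ∈ A.gr n) :
    A.unitMap R a ∈ (A.baseChange R).gr n := Submodule.tmul_mem_baseChange_of_mem _ ha

theorem unitMap_twist (n : ℤ) (a : A.carrier) :
    (A.baseChange R).twist n (A.unitMap R a) = A.unitMap R (A.twist n a) := by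
  induction a using A.induction_gr with
  | hadd x y hx hy => simp only [map_add, hx, hy]
  | h i a ha =>
    rw [A.twist_of_mem n i ha, (A.baseChange R).twist_of_mem n i (unitMap_mem R ha),
      map_negOnePow_smul]

theorem baseChange_induction {P : (A.baseChange R).carrier → Prop}
    (h : ∀ (s : R) a, P (s • A.unitMap R a)) (hadd : ∀ x y, P x → P y → P (x + y))
    (x : (A.baseChange R).carrier) : P x := by
  have h0 : P 0 := by simpa using h 0 0
  refine TensorProduct.induction_on (motive := P) x h0 (fun s a => ?_) hadd
  have : s ⊗ₜ[K] a = s • ((1 : R) ⊗ₜ[K] a) := by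
    rw [TensorProduct.smul_tmul', smul_eq_mul, mul_one]
  rw [this]
  exact h s a

theorem IsCentralCocycle.unitMap {W : A.carrier} (hW : A.IsCentralCocycle W) :
    (A.baseChange R).IsCentralCocycle (A.unitMap R W) where
  mem := unitMap_mem R hW.mem
  closed := by rw [unitMap_d, hW.closed, map_zero]
  central x := by
    induction x using baseChange_induction R with
    | h s a => rw [mul_smul_comm, smul_mul_assoc, ← unitMap_mul, ← unitMap_mul, hW.central]
    | hadd x y hx hy => rw [mul_add, add_mul, hx, hy]

theorem unitMap_mem_span {S : Set A.carrier} {a : A.carrier} (ha : a ∈ Submodule.span K S) :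
    A.unitMap R a ∈ Submodule.span R (A.unitMap R '' S) := by
  induction ha using Submodule.span_induction with
  | mem x hx => exact Submodule.subset_span ⟨x, hx, rfl⟩
  | zero => rw [map_zero]; exact zero_mem _
  | add x y _ _ hx hy => rw [map_add]; exact add_mem hx hy
  | smul c x _ hx =>
    rw [map_smul, ← algebraMap_smul R c]
    exact Submodule.smul_mem _ _ hx

/-- The basis `1 ⊗ e i` of `R ⊗ A`. -/
def unitBasis {I : Type*} (b : Module.Basis I K A.carrier) :
    Module.Basis I R (A.baseChange R).carrier := Algebra.TensorProduct.basis R b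

theorem unitBasis_apply {I : Type*} (b : Module.Basis I K A.carrier) (i : I) :
    unitBasis R b i = A.unitMap R (b i) := Algebra.TensorProduct.basis_apply _ _

/-- The extension of an adapted basis of `A` to `R ⊗ A`. -/
def AdaptedBasis.baseChange (β : A.AdaptedBasis) : (A.baseChange R).AdaptedBasis where
  I := β.I
  e := unitBasis R β.e
  deg := β.deg
  level := β.level
  mem i := by
    rw [unitBasis_apply]
    exact unitMap_mem R (β.mem i)
  level_le := β.level_le
  d_mem i := by
    have := unitMap_mem_span R (β.d_mem i)
    rw [Set.image_image] at this
    rw [unitBasis_apply, unitMap_d]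
    simpa only [unitBasis_apply] using this

theorem AdaptedBasis.baseChange_e (β : A.AdaptedBasis) (i : β.I) :
    (β.baseChange R).e i = A.unitMap R (β.e i) := unitBasis_apply R β.e i

end BaseChange

/-! ### Words in elements of the algebra -/

namespace AdaptedBasis

variable {K : Type u} [CommRing K] {A : DGA K} {R : Type u} [CommRing R] [Algebra K R]
  (β : (A.baseChange R).AdaptedBasis)

/-- Left multiplication by `h a`, for `a` in `A`. -/
def mulHUnit : A.carrier →ₗ[K] β.Words →ₗ[K] β.Words :=
  LinearMap.mk₂ K (fun a z => β.mulH (A.unitMap R a • z))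
    (fun a b z => by rw [map_add, add_smul, map_add])
    (fun c a z => by
      rw [map_smul (A.unitMap R), ← algebraMap_smul R c (A.unitMap R a),
        smul_assoc (algebraMap K R c), map_smul, algebraMap_smul])
    (fun a x y => by rw [smul_add, map_add])
    (fun c a z => by
      rw [← algebraMap_smul R c, ← algebraMap_smul R c, smul_comm, map_smul])

theorem mulHUnit_apply (a : A.carrier) (z : β.Words) :
    β.mulHUnit a z = β.mulH (A.unitMap R a • z) := rfl

/-- The word `h a₁ h a₂ ⋯ h aₗ h`, as a multilinear function of elements `a₁, …, aₗ` of `A`. -/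
def barWord : ∀ l : ℕ, MultilinearMap K (fun _ : Fin l => A.carrier) β.Words
  | 0 => MultilinearMap.constOfIsEmpty K _ (β.mulH (Finsupp.single [] 1))
  | l + 1 => LinearMap.uncurryLeft
    { toFun a := (β.mulHUnit a).compMultilinearMap (barWord l)
      map_add' a b := by ext; simp
      map_smul' c a := by ext; simp }

theorem barWord_zero (a : Fin 0 → A.carrier) :
    β.barWord 0 a = β.mulH (Finsupp.single [] 1) := rfl

theorem barWord_succ {l : ℕ} (a : Fin (l + 1) → A.carrier) :
    β.barWord (l + 1) a = β.mulH (A.unitMap R (a 0) • β.barWord l (Fin.tail a)) := rfl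

theorem barWord_cons {l : ℕ} (x : A.carrier) (a : Fin l → A.carrier) :
    β.barWord (l + 1) (Fin.cons x a : Fin (l + 1) → A.carrier) =
      β.mulH (A.unitMap R x • β.barWord l a) := by
  rw [barWord_succ, Fin.cons_zero, Fin.tail_cons]

theorem barWord_basis (β : A.AdaptedBasis) {l : ℕ} (v : Fin l → (β.baseChange R).I) :
    (β.baseChange R).barWord l (fun i => β.e (v i)) = (β.baseChange R).gen (List.ofFn v) := by
  induction l with
  | zero => rw [barWord_zero, List.ofFn_zero, gen]
  | succ l ih =>
    have h : Fin.tail (fun i => β.e (v i)) = fun i => β.e (Fin.tail v i) := rfl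
    rw [barWord_succ, h, ih, List.ofFn_succ, gen]
    exact congrArg (fun x => (β.baseChange R).mulH
      (x • (β.baseChange R).gen (List.ofFn (Fin.tail v)))) (β.baseChange_e R (v 0)).symm

/-- The inputs of the `j`-th summand in the differential of a word which comes from the differential
of `A`. The signs are expressed by the operator `A.twist 1` on the inputs to the left, as in the
definition of the Hochschild differential. -/
def dSlot (A : DGA K) {l : ℕ} (j : Fin l) (a : Fin l → A.carrier) : Fin l → A.carrier :=
  fun i => if i < j then A.twist 1 (a i) else if i = j then A.d (a i) else a i

/-- The inputs of the `j`-th summand in the differential of a word which comes from the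
multiplication of `A`. -/
def mulSlot (A : DGA K) {l : ℕ} (j : Fin l) (a : Fin (l + 1) → A.carrier) : Fin l → A.carrier :=
  Fin.contractNth j.castSucc (· * ·) fun i => if i ≤ j.castSucc then A.twist 1 (a i) else a i

/-- The inputs of the summand in which `W` is inserted in position `j`. -/
def insSlot (A : DGA K) (W : A.carrier) {l : ℕ} (j : Fin (l + 1)) (a : Fin l → A.carrier) :
    Fin (l + 1) → A.carrier :=
  Fin.insertNth j W fun i => if i.castSucc < j then A.twist 1 (a i) else a i

theorem dSlot_zero {l : ℕ} (x : A.carrier) (a : Fin l → A.carrier) :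
    dSlot A 0 (Fin.cons x a : Fin (l + 1) → A.carrier) = Fin.cons (A.d x) a := by
  funext i
  cases i using Fin.cases <;> simp [dSlot]

theorem dSlot_succ {l : ℕ} (j : Fin l) (x : A.carrier) (a : Fin l → A.carrier) :
    dSlot A j.succ (Fin.cons x a : Fin (l + 1) → A.carrier) =
      Fin.cons (A.twist 1 x) (dSlot A j a) := by
  funext i
  cases i using Fin.cases <;> simp [dSlot]

theorem mulSlot_zero {l : ℕ} (x y : A.carrier) (a : Fin l → A.carrier) :
    mulSlot A 0 (Fin.cons x (Fin.cons y a : Fin (l + 1) → A.carrier) : Fin (l + 2) → A.carrier) =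
      Fin.cons (A.twist 1 x * y) a := by
  funext i
  cases i using Fin.cases <;> simp [mulSlot, Fin.contractNth]

theorem mulSlot_succ {l : ℕ} (j : Fin l) (x : A.carrier) (a : Fin (l + 1) → A.carrier) :
    mulSlot A j.succ (Fin.cons x a : Fin (l + 2) → A.carrier) =
      Fin.cons (A.twist 1 x) (mulSlot A j a) := by
  funext i
  cases i using Fin.cases with
  | zero => simp [mulSlot, Fin.contractNth]
  | succ i => simp [mulSlot, Fin.contractNth]

theorem insSlot_zero (W : A.carrier) {l : ℕ} (a : Fin l → A.carrier) :
    insSlot A W 0 a = Fin.cons W a := by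
  simp [insSlot, Fin.insertNth_zero']

theorem insSlot_succ (W : A.carrier) {l : ℕ} (j : Fin (l + 1)) (x : A.carrier)
    (a : Fin l → A.carrier) :
    insSlot A W j.succ (Fin.cons x a : Fin (l + 1) → A.carrier) =
      Fin.cons (A.twist 1 x) (insSlot A W j a) := by
  rw [insSlot, insSlot, ← Fin.insertNth_succ_cons]
  congr 1
  funext i
  cases i using Fin.cases <;> simp

theorem dW_barWord_zero (a : Fin 0 → A.carrier) :
    β.dW (β.barWord 0 a) = Finsupp.single [] 1 := by
  rw [barWord_zero, dW_mulH, dW_nil, d_one, Finsupp.single_zero, map_zero, sub_zero]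

theorem dW_barWord_cons {l : ℕ} (x : A.carrier) (a : Fin l → A.carrier) :
    β.dW (β.barWord (l + 1) (Fin.cons x a : Fin (l + 1) → A.carrier)) =
      A.unitMap R x • β.barWord l a -
        β.barWord (l + 1) (Fin.cons (A.d x) a : Fin (l + 1) → A.carrier) -
        β.mulHUnit (A.twist 1 x) (β.dW (β.barWord l a)) := by
  rw [barWord_cons, dW_mulH, dW_smul, unitMap_d, unitMap_twist, map_add, barWord_cons,
    mulHUnit_apply, sub_sub]

theorem mulHUnit_barWord {l : ℕ} (x : A.carrier) (a : Fin l → A.carrier) :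
    β.mulHUnit x (β.barWord l a) = β.barWord (l + 1) (Fin.cons x a : Fin (l + 1) → A.carrier) := by
  rw [barWord_cons, mulHUnit_apply]

theorem mulHUnit_rW (x : A.carrier) (b : (A.baseChange R).carrier) (z : β.Words) :
    β.mulHUnit x (β.rW b z) = β.rW b (β.mulHUnit x z) := by
  rw [mulHUnit_apply, mulHUnit_apply, rW_mulH, rW_smul]

/-- The differential of the word `h a₁ h a₂ ⋯ h aₗ h`, for `l > 0`. -/
theorem dW_barWord {l : ℕ} (a : Fin (l + 1) → A.carrier) :
    β.dW (β.barWord (l + 1) a) = A.unitMap R (a 0) • β.barWord l (Fin.tail a) +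
      (∑ j : Fin (l + 1), ((j : ℕ) + 1 : ℤ).negOnePow • β.barWord (l + 1) (dSlot A j a)) +
      (∑ j : Fin l, ((j : ℕ) + 1 : ℤ).negOnePow • β.barWord l (mulSlot A j a)) +
      (l + 1 : ℤ).negOnePow • β.rW (A.unitMap R (A.twist 1 (a (Fin.last l))))
        (β.barWord l fun i => A.twist 1 (Fin.init a i)) := by
  induction l with
  | zero =>
    obtain ⟨x, a, rfl⟩ : ∃ x a', a = Fin.cons x a' := ⟨a 0, Fin.tail a, (Fin.cons_self_tail a).symm⟩
    rw [dW_barWord_cons, dW_barWord_zero, mulHUnit_apply]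
    simp only [barWord_zero, rW_mulH, rW_nil, Fin.sum_univ_succ, Finset.univ_eq_empty,
      Finset.sum_empty, Fin.last_zero, Fin.cons_zero, Nat.cast_zero, one_mul,
      Finsupp.smul_single, smul_eq_mul, mul_one, zero_add, Int.negOnePow_one, Units.neg_smul,
      one_smul, add_zero, dSlot_zero, Fin.coe_ofNat_eq_mod, Nat.zero_mod]
    abel
  | succ l ih =>
    obtain ⟨x, a, rfl⟩ : ∃ x a', a = Fin.cons x a' := ⟨a 0, Fin.tail a, (Fin.cons_self_tail a).symm⟩
    obtain ⟨y, b, hb⟩ : ∃ y b, a = Fin.cons y b := ⟨a 0, Fin.tail a, (Fin.cons_self_tail a).symm⟩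
    have hy : a 0 = y := by rw [hb, Fin.cons_zero]
    have hm : β.mulHUnit (A.twist 1 x) (A.unitMap R (a 0) • β.barWord l (Fin.tail a)) =
        β.barWord (l + 1) (mulSlot A 0 (Fin.cons x a : Fin (l + 2) → A.carrier)) := by
      rw [hb, mulSlot_zero, mulHUnit_apply, ← mul_smul, ← unitMap_mul, barWord_cons]; rfl
    have hlast : (Fin.cons x a : Fin (l + 2) → A.carrier) (Fin.last (l + 1)) = a (Fin.last l) := by
      rw [← Fin.succ_last, Fin.cons_succ]
    have hinit : (fun i => A.twist 1 (Fin.init (Fin.cons x a : Fin (l + 2) → A.carrier) i)) =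
        Fin.cons (A.twist 1 x) (fun i => A.twist 1 (Fin.init a i)) := by
      funext i
      cases i using Fin.cases with
      | zero => rfl
      | succ i => simp [Fin.init]
    have hd : ∑ j : Fin (l + 2), ((j : ℕ) + 1 : ℤ).negOnePow •
        β.barWord (l + 2) (dSlot A j (Fin.cons x a : Fin (l + 2) → A.carrier)) =
        -β.barWord (l + 2) (Fin.cons (A.d x) a : Fin (l + 2) → A.carrier) -
          β.mulHUnit (A.twist 1 x) (∑ j : Fin (l + 1), ((j : ℕ) + 1 : ℤ).negOnePow •
            β.barWord (l + 1) (dSlot A j a)) := by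
      rw [Fin.sum_univ_succ, map_sum, sub_eq_add_neg, ← Finset.sum_neg_distrib, dSlot_zero]
      refine congrArg₂ _ ?_ (Finset.sum_congr rfl fun j _ => ?_)
      · simp
      · rw [map_negOnePow_smul, mulHUnit_barWord, dSlot_succ, Fin.val_succ, Nat.cast_add,
          Nat.cast_one, Int.negOnePow_succ _, Units.neg_smul]
    have hp : ∑ j : Fin (l + 1), ((j : ℕ) + 1 : ℤ).negOnePow •
        β.barWord (l + 1) (mulSlot A j (Fin.cons x a : Fin (l + 2) → A.carrier)) =
        -β.barWord (l + 1) (mulSlot A 0 (Fin.cons x a : Fin (l + 2) → A.carrier)) -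
          β.mulHUnit (A.twist 1 x) (∑ j : Fin l, ((j : ℕ) + 1 : ℤ).negOnePow •
            β.barWord l (mulSlot A j a)) := by
      rw [Fin.sum_univ_succ, map_sum, sub_eq_add_neg, ← Finset.sum_neg_distrib]
      refine congrArg₂ _ ?_ (Finset.sum_congr rfl fun j _ => ?_)
      · simp
      · rw [map_negOnePow_smul, mulHUnit_barWord, mulSlot_succ, Fin.val_succ, Nat.cast_add,
          Nat.cast_one, Int.negOnePow_succ _, Units.neg_smul]
    rw [dW_barWord_cons, ih, map_add, map_add, map_add, hm, hd, hp, map_negOnePow_smul,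
      mulHUnit_rW, mulHUnit_barWord, hlast, hinit, Fin.tail_cons, Fin.cons_zero, Nat.cast_add,
      Nat.cast_one, Int.negOnePow_succ ((l : ℤ) + 1), Units.neg_smul]
    abel

/-- Insertion of `W` between the letters is the alternating sum which appears in the curvature term
of the Hochschild differential. -/
theorem insW_barWord (W : A.carrier) {l : ℕ} (a : Fin l → A.carrier) :
    β.insW (A.unitMap R W) (β.barWord l a) =
      ∑ j : Fin (l + 1), ((j : ℕ) : ℤ).negOnePow • β.barWord (l + 1) (insSlot A W j a) := by
  induction l with
  | zero =>
    rw [barWord_zero, insW_mulH, insW_nil, map_zero, sub_zero, Fin.sum_univ_succ, insSlot_zero,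
      barWord_cons]
    simp [barWord_zero]
  | succ l ih =>
    obtain ⟨x, a, rfl⟩ : ∃ x a', a = Fin.cons x a' := ⟨a 0, Fin.tail a, (Fin.cons_self_tail a).symm⟩
    have h : β.mulH (A.unitMap R (A.twist 1 x) • β.insW (A.unitMap R W) (β.barWord l a)) =
        β.mulHUnit (A.twist 1 x) (β.insW (A.unitMap R W) (β.barWord l a)) := rfl
    rw [barWord_cons, insW_mulH, insW_smul, unitMap_twist, h, ih, map_sum,
      Fin.sum_univ_succ (n := l + 1), insSlot_zero, barWord_cons, barWord_cons]
    simp only [map_negOnePow_smul, mulHUnit_barWord, insSlot_succ, Fin.val_zero, Fin.val_succ,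
      Nat.cast_add, Nat.cast_zero, Nat.cast_one, Int.negOnePow_succ, Int.negOnePow_zero,
      Units.neg_smul, one_smul, Finset.sum_neg_distrib, sub_eq_add_neg]

end AdaptedBasis
end DGA

namespace DGA
open DGA.Bimod

namespace AdaptedBasis

/-! ### Hochschild cochains as maps on the bar resolution -/

variable {K : Type u} [CommRing K] {A : DGA K} (R : Type u) [CommRing R] [Algebra K R]
  (β : A.AdaptedBasis)

theorem wdeg_eq (w : List β.I) : β.wdeg w = ∑ i, β.deg (w.get i) - w.length := by
  induction w with
  | nil => simp
  | cons i w ih =>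
    have h : ∑ j : Fin w.length, β.deg ((i :: w).get j.succ) = ∑ j, β.deg (w.get j) := rfl
    rw [wdeg_cons, ih]
    simp only [List.length_cons, Fin.sum_univ_succ, List.get_cons_zero, Nat.cast_add, Nat.cast_one]
    rw [h]
    ring

theorem list_get_ofFn {α M : Type*} (F : ∀ l, (Fin l → α) → M) {l : ℕ} (v : Fin l → α) :
    F (List.ofFn v).length (List.ofFn v).get = F l v :=
  congrArg (fun p : Σ n, Fin n → α => F p.1 p.2) (List.equivSigmaTuple.right_inv ⟨l, v⟩)

theorem gen_baseChange (w : List β.I) : (β.baseChange R).gen w =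
    (β.baseChange R).barWord w.length (fun i => β.e (w.get i)) := by
  have := β.barWord_basis (R := R) w.get
  exact (this.trans (congrArg (β.baseChange R).gen (List.ofFn_get w))).symm

variable {n : ℤ} {ψ : A.PreCochain} (hψ : ψ ∈ A.cochains n)

include hψ in
/-- The components of a Hochschild cochain, as bilinear maps from the bar resolution to the
diagonal. The signs `(-1) ^ l` and `A.twist 1` come from the letters `h`, which have odd degree. -/
theorem exists_barMap (k : ℕ) : ∃ Ψ : (β.baseChange R).bar.carrier →ₗ[R] (A.baseChange R).carrier,
    IsBi (N := diagonal (A.baseChange R)) (n - 2 * k) Ψ ∧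
      ∀ (l : ℕ) (a : Fin l → A.carrier), Ψ ((β.baseChange R).toBar ((β.baseChange R).barWord l a)) =
        (l : ℤ).negOnePow • A.unitMap R (ψ k l fun i => A.twist 1 (a i)) := by
  let F : ∀ l, (Fin l → β.I) → (A.baseChange R).carrier := fun l v =>
    (l : ℤ).negOnePow • A.unitMap R (ψ k l fun i => A.twist 1 (β.e (v i)))
  have hF : ∀ w : List β.I, F w.length w.get ∈
      (shift (n - 2 * k) (diagonal (A.baseChange R))).gr (β.wdeg w) := fun w => by
    change _ ∈ (A.baseChange R).gr (β.wdeg w + (n - 2 * k))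
    refine negOnePow_smul_mem _ _ ?_
    have := unitMap_mem R ((hψ k w.length).2.2 (fun i => β.deg (w.get i)) _
      fun i => A.twist_mem 1 _ (β.mem (w.get i)))
    rwa [show n - 2 * k - (w.length : ℤ) + ∑ i, β.deg (w.get i) = β.wdeg w + (n - 2 * k) by
      rw [wdeg_eq]; ring] at this
  obtain ⟨Ψ, h1, h2⟩ := (β.baseChange R).semiFreeBar.exists_ext
    (shift (n - 2 * k) (diagonal (A.baseChange R))) fun w => ⟨F w.length w.get, hF w⟩
  have h3 : IsBi (M := (β.baseChange R).bar) (N := diagonal (A.baseChange R)) (n - 2 * k) Ψ := by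
    have := (isBi_shift_iff (M := (β.baseChange R).bar) (N := diagonal (A.baseChange R))
      (n - 2 * k)).1 h1
    rwa [zero_add] at this
  replace h2 : ∀ w, Ψ ((β.baseChange R).toBar ((β.baseChange R).gen w)) = F w.length w.get := h2
  clear h1
  change (β.baseChange R).bar.carrier →ₗ[R] (A.baseChange R).carrier at Ψ
  refine ⟨Ψ, h3, fun l => ?_⟩
  obtain ⟨m, hm⟩ := (hψ k l).1
  -- both sides are multilinear, so that they need only be compared on basis elements
  have key : ((Ψ ∘ₗ (β.baseChange R).toBar).restrictScalars K).compMultilinearMap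
      ((β.baseChange R).barWord l) =
      ((l : ℤ).negOnePow • A.unitMap R).compMultilinearMap
        (m.compLinearMap fun _ => A.twist 1) := by
    refine Module.Basis.ext_multilinear (fun _ => β.e) fun v => ?_
    change Ψ ((β.baseChange R).toBar ((β.baseChange R).barWord l fun i => β.e (v i))) =
      (l : ℤ).negOnePow • A.unitMap R (m fun i => A.twist 1 (β.e (v i)))
    rw [hm]
    refine (congrArg (fun z => Ψ ((β.baseChange R).toBar z)) (β.barWord_basis v)).trans ?_
    exact (h2 (List.ofFn v)).trans (list_get_ofFn F v)
  intro a
  rw [← hm]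
  exact MultilinearMap.congr_fun key a

section Slots

include hψ in
theorem apply_twist_dSlot (k : ℕ) {l : ℕ} (j : Fin l) (a : Fin l → A.carrier) :
    ψ k l (fun i => A.twist 1 (dSlot A j a i)) = -ψ k l (dSlot A j fun i => A.twist 1 (a i)) := by
  obtain ⟨m, hm⟩ := (hψ k l).1
  have h : (fun i => A.twist 1 (dSlot A j a i)) =
      Function.update (dSlot A j fun i => A.twist 1 (a i)) j
        (-(dSlot A j (fun i => A.twist 1 (a i)) j)) := by
    funext i
    rcases lt_trichotomy i j with h | rfl | h
    · rw [Function.update_of_ne h.ne, dSlot, dSlot, if_pos h, if_pos h]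
    · rw [Function.update_self, dSlot, dSlot, if_neg (lt_irrefl _), if_neg (lt_irrefl _),
        if_pos rfl, if_pos rfl, twist_one_d]
    · rw [Function.update_of_ne h.ne', dSlot, dSlot, if_neg h.not_gt, if_neg h.not_gt,
        if_neg h.ne', if_neg h.ne']
  rw [h, ← hm, MultilinearMap.map_update_neg, Function.update_eq_self]

theorem twist_mulSlot {l : ℕ} (j : Fin l) (a : Fin (l + 1) → A.carrier) :
    (fun i => A.twist 1 (mulSlot A j a i)) = mulSlot A j fun i => A.twist 1 (a i) := by
  funext i
  simp only [mulSlot, Fin.contractNth]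
  split_ifs <;> simp only [twist_mul]

theorem twist_insSlot {W : A.carrier} (hW : A.IsCentralCocycle W) {l : ℕ} (j : Fin (l + 1))
    (a : Fin l → A.carrier) :
    (fun i => A.twist 1 (insSlot A W j a i)) = insSlot A W j fun i => A.twist 1 (a i) := by
  funext i
  cases i using Fin.succAboveCases j with
  | x => simp only [insSlot, Fin.insertNth_apply_same, hW.twist]
  | p i => simp only [insSlot, Fin.insertNth_apply_succAbove]; split_ifs <;> rfl

end Slots

section Differential

variable {k : ℕ} {Ψ : (β.baseChange R).bar.carrier →ₗ[R] (A.baseChange R).carrier}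
  (hΨ : IsBi (N := diagonal (A.baseChange R)) (n - 2 * k) Ψ)
  (h : ∀ (l : ℕ) (a : Fin l → A.carrier),
    Ψ ((β.baseChange R).toBar ((β.baseChange R).barWord l a)) =
      (l : ℤ).negOnePow • A.unitMap R (ψ k l fun i => A.twist 1 (a i)))
  (hn : Odd n)

include hψ hΨ h hn in
/-- The coboundary of the map on the bar resolution given by `ψ k` corresponds to the part of the
Hochschild differential which comes from the differential and the product of `A`. -/
theorem d_barMap {l : ℕ} (a : Fin l → A.carrier) :
    (A.baseChange R).d (Ψ ((β.baseChange R).toBar ((β.baseChange R).barWord l a))) +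
      Ψ ((β.baseChange R).bar.d ((β.baseChange R).toBar ((β.baseChange R).barWord l a))) =
      (l : ℤ).negOnePow • A.unitMap R (A.dInternal n ψ k l (fun i => A.twist 1 (a i)) +
        A.dProduct n ψ k l (fun i => A.twist 1 (a i))) := by
  have hnk : Odd (n - 2 * (k : ℤ)) := hn.sub_even ⟨k, by ring⟩
  have hsign : ∀ m : ℤ, (n + m).negOnePow = -m.negOnePow := fun m => by
    rw [Int.negOnePow_add, Int.negOnePow_odd n hn, neg_one_mul]
  have hint : ∀ l (a : Fin l → A.carrier), A.dInternal n ψ k l a = A.d (ψ k l a) +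
    ∑ j : Fin l, (n + (j : ℕ)).negOnePow • ψ k l (dSlot A j a) := fun _ _ => rfl
  rw [h, map_negOnePow_smul, unitMap_d, bar_d, map_neg, hint]
  cases l with
  | zero =>
    have h0 : A.dProduct n ψ k 0 (fun i => A.twist 1 (a i)) = 0 := rfl
    rw [dW_barWord_zero, toBar_nil, map_zero, neg_zero, h0, Finset.univ_eq_empty, Finset.sum_empty,
      add_zero, add_zero, add_zero]
  | succ l =>
    have hprod : A.dProduct n ψ k (l + 1) (fun i => A.twist 1 (a i)) =
      -(n.negOnePow • (A.twist n (A.twist 1 (a 0)) * ψ k l (fun i => A.twist 1 (Fin.tail a i))))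
      - ∑ j : Fin l, (n + (j : ℕ) + 1).negOnePow •
          ψ k l (mulSlot A j fun i => A.twist 1 (a i))
      + (n + l).negOnePow • (ψ k l (fun i => A.twist 1 (A.twist 1 (Fin.init a i))) *
          A.twist 1 (a (Fin.last l))) := rfl
    have e1 : Ψ ((β.baseChange R).toBar (A.unitMap R (a 0) •
        (β.baseChange R).barWord l (Fin.tail a))) = (l : ℤ).negOnePow •
        A.unitMap R (a 0 * ψ k l (fun i => A.twist 1 (Fin.tail a i))) := by
      rw [toBar_smul]
      refine (hΨ.lact _ _).trans ((diagonal_lact _ _).trans ?_)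
      rw [twist_odd _ hnk, twist_one_twist_one]
      refine (congrArg (fun x : (A.baseChange R).carrier => A.unitMap R (a 0) * x) (h _ _)).trans ?_
      rw [mul_negOnePow_smul, unitMap_mul]
    have e2 : ∀ b (c : Fin l → A.carrier), Ψ ((β.baseChange R).toBar ((β.baseChange R).rW
        (A.unitMap R b) ((β.baseChange R).barWord l c))) =
        (l : ℤ).negOnePow • A.unitMap R (ψ k l (fun i => A.twist 1 (c i)) * b) := fun b c => by
      rw [← bar_ract]
      refine (hΨ.ract _ _).trans ((diagonal_ract _ _).trans ?_)
      refine (congrArg (fun x : (A.baseChange R).carrier => x * A.unitMap R b) (h _ _)).trans ?_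
      rw [negOnePow_smul_mul, unitMap_mul]
    have e3 : Ψ ((β.baseChange R).toBar (∑ j : Fin (l + 1), ((j : ℕ) + 1 : ℤ).negOnePow •
        (β.baseChange R).barWord (l + 1) (dSlot A j a))) =
        -((l + 1 : ℤ).negOnePow • A.unitMap R (∑ j : Fin (l + 1), (n + (j : ℕ)).negOnePow •
          ψ k (l + 1) (dSlot A j fun i => A.twist 1 (a i)))) := by
      rw [map_sum, map_sum, map_sum, Finset.smul_sum, ← Finset.sum_neg_distrib]
      refine Finset.sum_congr rfl fun j _ => ?_
      rw [map_negOnePow_smul, map_negOnePow_smul, map_negOnePow_smul, h, apply_twist_dSlot hψ,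
        hsign, Int.negOnePow_succ, Nat.cast_add, Nat.cast_one, map_neg, smul_neg, smul_neg,
        smul_comm]
    have e4 : Ψ ((β.baseChange R).toBar (∑ j : Fin l, ((j : ℕ) + 1 : ℤ).negOnePow •
        (β.baseChange R).barWord l (mulSlot A j a))) =
        (l + 1 : ℤ).negOnePow • A.unitMap R (∑ j : Fin l, (n + (j : ℕ) + 1).negOnePow •
          ψ k l (mulSlot A j fun i => A.twist 1 (a i))) := by
      rw [map_sum, map_sum, map_sum, Finset.smul_sum]
      refine Finset.sum_congr rfl fun j _ => ?_
      rw [map_negOnePow_smul, map_negOnePow_smul, map_negOnePow_smul, h, twist_mulSlot,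
        add_assoc n, hsign, Int.negOnePow_succ (l : ℤ), Units.neg_smul, Units.neg_smul, smul_neg,
        neg_neg, smul_comm]
    have hn' : ∀ x : A.carrier, A.twist n (A.twist 1 x) = x := fun x => by
      rw [twist_odd _ hn, twist_one_twist_one]
    rw [hprod, dW_barWord]
    simp only [map_add, map_sub, map_neg, smul_add, smul_sub, smul_neg, neg_add, e1, e3, e4,
      map_negOnePow_smul, e2, hn', Int.negOnePow_odd n hn, hsign, Units.neg_smul, one_smul,
      neg_neg, Nat.cast_add, Nat.cast_one, Int.negOnePow_succ (l : ℤ)]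
    abel

include h hn in
/-- Composition with the insertion of `W` corresponds to the curvature term. Since that term has a
factor `q`, the component `ψ k` contributes to the coefficient of `q ^ (k + 1)`. -/
theorem barMap_ins {W : A.carrier} (hW : A.IsCentralCocycle W) {l : ℕ} (a : Fin l → A.carrier) :
    Ψ ((β.baseChange R).ins (A.unitMap R W)
        ((β.baseChange R).toBar ((β.baseChange R).barWord l a))) =
      (l : ℤ).negOnePow • A.unitMap R (A.dCurvature W n ψ (k + 1) l fun i => A.twist 1 (a i)) := by
  have hcurv : A.dCurvature W n ψ (k + 1) l (fun i => A.twist 1 (a i)) =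
      ∑ j : Fin (l + 1), (n + (j : ℕ)).negOnePow •
        ψ k (l + 1) (insSlot A W j fun i => A.twist 1 (a i)) := rfl
  rw [ins_toBar, insW_barWord, map_sum, map_sum, hcurv, map_sum, Finset.smul_sum]
  refine Finset.sum_congr rfl fun j _ => ?_
  rw [map_negOnePow_smul, map_negOnePow_smul, h, map_negOnePow_smul, twist_insSlot hW, ← mul_smul,
    ← mul_smul, Int.negOnePow_add n, Int.negOnePow_odd n hn, Nat.cast_add, Nat.cast_one,
    Int.negOnePow_succ, mul_neg, neg_one_mul, mul_neg, mul_comm]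

end Differential

theorem qMul_const_apply (A : DGA K) (r : ℕ) (c : A.carrier) (k l : ℕ) (a : Fin l → A.carrier) :
    A.qMul r (A.const c) k l a = if k = r ∧ l = 0 then c else 0 := by
  simp only [qMul, const]
  split_ifs <;> first | rfl | omega

/-- A Hochschild cochain which bounds `q ^ r c` gives the maps on the bar resolution which are used
in the construction of the nullhomotopy. -/
theorem exists_barMaps {r : ℕ} {W c : A.carrier} (hW : A.IsCentralCocycle W)
    (hψ : ψ ∈ A.cochains (2 * r - 1)) (h : A.dHochschild W (2 * r - 1) ψ = A.qMul r (A.const c)) :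
    ∃ Ψ : ℕ → (β.baseChange R).bar.carrier →ₗ[R] (A.baseChange R).carrier,
      (∀ k : ℕ, IsBi (N := diagonal (A.baseChange R)) (2 * r - 1 - 2 * k) (Ψ k)) ∧
      (∀ w, (A.baseChange R).d (Ψ 0 ((β.baseChange R).toBar ((β.baseChange R).gen w))) +
        Ψ 0 ((β.baseChange R).bar.d ((β.baseChange R).toBar ((β.baseChange R).gen w))) =
          if 0 = r ∧ w.length = 0 then A.unitMap R c else 0) ∧
      ∀ k w, (A.baseChange R).d (Ψ (k + 1) ((β.baseChange R).toBar ((β.baseChange R).gen w))) +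
        Ψ (k + 1) ((β.baseChange R).bar.d ((β.baseChange R).toBar ((β.baseChange R).gen w))) +
        Ψ k ((β.baseChange R).ins (A.unitMap R W)
          ((β.baseChange R).toBar ((β.baseChange R).gen w))) =
          if k + 1 = r ∧ w.length = 0 then A.unitMap R c else 0 := by
  have hn : Odd (2 * (r : ℤ) - 1) := ⟨r - 1, by ring⟩
  choose Ψ hΨ hval using β.exists_barMap R hψ
  have hd : ∀ k l (a : Fin l → A.carrier), A.dInternal (2 * r - 1) ψ k l a +
      A.dProduct (2 * r - 1) ψ k l a + A.dCurvature W (2 * r - 1) ψ k l a =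
      if k = r ∧ l = 0 then c else 0 := fun k l a => by
    rw [← qMul_const_apply, ← h]; rfl
  have hif : ∀ k l : ℕ, (l : ℤ).negOnePow • A.unitMap R (if k = r ∧ l = 0 then c else 0) =
      if k = r ∧ l = 0 then A.unitMap R c else 0 := fun k l => by
    split_ifs with hkl
    · rw [hkl.2, Nat.cast_zero, Int.negOnePow_zero, one_smul]
    · rw [map_zero, smul_zero]
  have hg : ∀ w : List (β.baseChange R).I, (β.baseChange R).gen w =
      (β.baseChange R).barWord w.length (fun i => β.e (w.get i)) := β.gen_baseChange R
  refine ⟨Ψ, hΨ, fun w => ?_, fun k w => ?_⟩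
  · rw [hg, d_barMap R β hψ (hΨ 0) (hval 0) hn, ← hif, ← hd 0 w.length]
    refine congrArg (fun x => _ • A.unitMap R x) (add_zero _).symm
  · rw [hg, d_barMap R β hψ (hΨ (k + 1)) (hval (k + 1)) hn,
      barMap_ins R β (hval k) hn hW, ← smul_add, ← map_add, hd, hif]

end AdaptedBasis

section Polynomial

variable {K : Type u} [CommRing K] {A : DGA K}

theorem IsCentralCocycle.add {x y : A.carrier} (hx : A.IsCentralCocycle x)
    (hy : A.IsCentralCocycle y) : A.IsCentralCocycle (x + y) :=
  ⟨add_mem hx.mem hy.mem, by rw [map_add, hx.closed, hy.closed, add_zero],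
    fun a => by rw [add_mul, mul_add, hx.central, hy.central]⟩

theorem IsCentralCocycle.smul (s : K) {x : A.carrier} (hx : A.IsCentralCocycle x) :
    A.IsCentralCocycle (s • x) :=
  ⟨Submodule.smul_mem _ _ hx.mem, by rw [map_smul, hx.closed, smul_zero],
    fun a => by rw [smul_mul_assoc, mul_smul_comm, hx.central]⟩

theorem IsCentralCocycle.zero (A : DGA K) : A.IsCentralCocycle 0 :=
  ⟨zero_mem _, map_zero _, fun a => by rw [zero_mul, mul_zero]⟩

/-- Modulo `t - W`, the scalar `p(t)` agrees with `p(W)`. -/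
theorem exists_algebraMap_aeval (R : Type u) [CommRing R] [Algebra K R] {W : A.carrier}
    (hW : A.IsCentralCocycle W) (t : R) (p : K[X]) : ∃ c', (A.baseChange R).IsCentralCocycle c' ∧
      algebraMap R (A.baseChange R).carrier (aeval t p) = A.unitMap R (aeval W p) +
        (algebraMap R (A.baseChange R).carrier t - A.unitMap R W) * c' := by
  induction p using Polynomial.induction_on with
  | C c =>
    refine ⟨0, IsCentralCocycle.zero _, ?_⟩
    rw [aeval_C, aeval_C, mul_zero, add_zero, Algebra.algebraMap_eq_smul_one (algebraMap K R c),
      Algebra.algebraMap_eq_smul_one (A := A.carrier) c, map_smul, unitMap_one, algebraMap_smul]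
  | add p q hp hq =>
    obtain ⟨x, hx, hx'⟩ := hp
    obtain ⟨y, hy, hy'⟩ := hq
    refine ⟨x + y, hx.add hy, ?_⟩
    rw [map_add, map_add, map_add, map_add, hx', hy', mul_add]
    abel
  | monomial n c hp =>
    obtain ⟨x, hx, hx'⟩ := hp
    -- the factor for `s X` is `t c' + s(W)`, where `c'` is the factor for `s`
    refine ⟨t • x + A.unitMap R (aeval W (C c * X ^ n)),
      (hx.smul t).add ((A.isCentralCocycle_aeval hW _).unitMap R), ?_⟩
    have h := (hW.unitMap R).central (A.unitMap R (aeval W (C c * X ^ n)))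
    have e : C c * X ^ (n + 1) = C c * X ^ n * X := by ring
    rw [e, map_mul (aeval t), map_mul (aeval W), aeval_X, aeval_X, unitMap_mul, mul_comm _ t,
      map_mul (algebraMap R _), hx', ← h, Algebra.smul_def t x]
    set T := algebraMap R (A.baseChange R).carrier t
    have hT : ∀ y, T * y = y * T := fun y => Algebra.commutes t y
    rw [mul_add, mul_add, ← mul_assoc T _ x, ← mul_assoc _ T x, hT (T - _),
      sub_mul T _ (A.unitMap R _)]
    abel

theorem exists_cochain_of_qPolyClass_eq_zero {W : A.carrier} (hW : A.IsCentralCocycle W) {p : K[X]}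
    {r : ℕ} (h : A.qPolyClass hW p r = 0) : ∃ ψ ∈ A.cochains (2 * r - 1),
      A.dHochschild W (2 * r - 1) ψ = A.qMul r (A.const (aeval W p)) := by
  obtain ⟨ψ, hψ, e⟩ := (Submodule.Quotient.mk_eq_zero _).1 h
  exact ⟨ψ, hψ, e.trans (congrArg (A.qMul r) (A.cupEval_const p W))⟩

end Polynomial
end DGA

namespace DGA

variable {K : Type u} [CommRing K] {A : DGA K} {R : Type u} [CommRing R] [Algebra K R]

namespace Bimod

/-! ### Restriction of constants -/

/-- A bimodule over `R ⊗ A` is a vector space over the ground ring of `A`. -/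
instance restrModule (N : Bimod (A.baseChange R)) : Module K N.carrier :=
  Module.compHom N.carrier (algebraMap K R)

instance restrIsScalarTower (N : Bimod (A.baseChange R)) : IsScalarTower K R N.carrier :=
  IsScalarTower.of_algebraMap_smul fun _ _ => rfl

/-- A bimodule over `R ⊗ A`, as a bimodule over `A`, along `a ↦ 1 ⊗ a`. -/
def restrConst (N : Bimod (A.baseChange R)) : Bimod A where
  carrier := N.carrier
  lact := AlgHom.ofLinearMap
    { toFun a := (N.lact (A.unitMap R a)).restrictScalars K
      map_add' a b := by ext m; simp
      map_smul' c a := by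
        ext m
        rw [map_smul, ← algebraMap_smul R c (A.unitMap R a), map_smul]
        rfl }
    (by ext m; simp [unitMap_one]) (fun a b => by ext m; simp [unitMap_mul])
  ract := AlgHom.ofLinearMap
    { toFun a := (N.ract (MulOpposite.op (A.unitMap R a.unop))).restrictScalars K
      map_add' a b := by ext m; simp
      map_smul' c a := by
        ext m
        rw [MulOpposite.unop_smul, map_smul, ← algebraMap_smul R c (A.unitMap R a.unop),
          MulOpposite.op_smul, map_smul]
        rfl }
    (by ext m; simp [unitMap_one]) (fun a b => by ext m; simp [unitMap_mul])
  lact_ract a b m := N.lact_ract _ _ _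
  gr i := (N.gr i).restrictScalars K
  isInternal := isInternal_of_proj _ (fun n => (N.proj n).restrictScalars K)
    (fun n m hm => N.proj_same hm) (fun n k m hm h => N.proj_ne hm h) fun m => by
      induction m using N.induction_gr with
      | hadd x y hx hy => exact add_mem hx hy
      | h i m hm => exact Submodule.mem_iSup_of_mem i hm
  lact_mem i j a m ha hm := N.lact_mem i j _ m (unitMap_mem R ha) hm
  ract_mem i j a m ha hm := N.ract_mem i j _ m (unitMap_mem R ha) hm
  d := N.d.restrictScalars K
  d_mem := N.d_mem
  d_d := N.d_d
  d_lact i a m ha := by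
    have := N.d_lact i _ m (unitMap_mem R ha)
    rw [unitMap_d] at this
    exact this
  d_ract j a m hm := by
    have := N.d_ract j (A.unitMap R a) m hm
    rw [unitMap_d] at this
    exact this

end Bimod

open DGA.Bimod

namespace AdaptedBasis

variable (R) (β : A.AdaptedBasis)

/-! ### The bar resolution and extension of constants -/

/-- The inclusion of the words over `A` into those over `R ⊗ A`. -/
def wordsInc : β.Words →ₗ[K] (β.baseChange R).Words :=
  Finsupp.mapRange.linearMap (A.unitMap R)

theorem wordsInc_single (w : List β.I) (a : A.carrier) :
    β.wordsInc R (Finsupp.single w a) =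
      (Finsupp.single w (A.unitMap R a) : (β.baseChange R).Words) :=
  Finsupp.mapRange_single (hf := map_zero _)

theorem wordsInc_smul (a : A.carrier) (z : β.Words) :
    β.wordsInc R (a • z) = A.unitMap R a • β.wordsInc R z := by
  induction z using Finsupp.induction_linear with
  | zero => simp
  | add x y hx hy => simp only [smul_add, map_add, hx, hy]
  | single w b =>
    rw [Finsupp.smul_single, wordsInc_single, wordsInc_single, smul_eq_mul, unitMap_mul]
    exact (Finsupp.smul_single (A.unitMap R a) w (A.unitMap R b)).symm

theorem wordsInc_mulH (z : β.Words) :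
    β.wordsInc R (β.mulH z) = (β.baseChange R).mulH (β.wordsInc R z) := by
  have : β.wordsInc R ∘ₗ β.mulH = ((β.baseChange R).mulH.restrictScalars K) ∘ₗ β.wordsInc R :=
    β.linearMap_ext fun w i => by
      change β.wordsInc R (β.mulH (Finsupp.single w (β.e i))) =
        (β.baseChange R).mulH (β.wordsInc R (Finsupp.single w (β.e i)))
      rw [mulH_single, wordsInc_single, wordsInc_single, ← β.baseChange_e R, unitMap_one]
      exact ((β.baseChange R).mulH_single w i).symm
  exact LinearMap.congr_fun this z

theorem wordsInc_dW (z : β.Words) :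
    β.wordsInc R (β.dW z) = (β.baseChange R).dW (β.wordsInc R z) := by
  induction z using β.words_induction with
  | h1 =>
    rw [dW_nil, wordsInc_single, wordsInc_single, d_one, unitMap_one, map_zero]
    refine Eq.trans ?_ ((β.baseChange R).dW_nil 1).symm
    rw [d_one]
    rfl
  | hsmul a z hz =>
    rw [dW_smul, map_add, wordsInc_smul, wordsInc_smul, wordsInc_smul, dW_smul, hz, unitMap_d,
      unitMap_twist]
  | hH z hz => rw [dW_mulH, map_sub, wordsInc_mulH, wordsInc_mulH, dW_mulH, hz]
  | hadd x y hx hy => simp only [map_add, hx, hy]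

theorem wordsInc_rW (b : A.carrier) (z : β.Words) :
    β.wordsInc R (β.rW b z) = (β.baseChange R).rW (A.unitMap R b) (β.wordsInc R z) := by
  induction z using β.words_induction with
  | h1 =>
    rw [rW_nil, wordsInc_single, wordsInc_single, unitMap_mul]
    exact ((β.baseChange R).rW_nil _ _).symm
  | hsmul a z hz => rw [rW_smul, wordsInc_smul, wordsInc_smul, rW_smul, hz]
  | hH z hz => rw [rW_mulH, wordsInc_mulH, wordsInc_mulH, rW_mulH, hz]
  | hadd x y hx hy => simp only [map_add, hx, hy]

theorem wordsInc_mem {n : ℤ} {z : β.Words} (hz : z ∈ β.grW n) :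
    β.wordsInc R z ∈ (β.baseChange R).grW n := by
  induction hz using β.grW_induction with
  | h w a ha =>
    rw [wordsInc_single]
    exact (β.baseChange R).single_mem_grW (w :=
      w) (unitMap_mem R ha) (sub_add_cancel n (β.wdeg w)).symm
  | h0 => rw [map_zero]; exact zero_mem _
  | hadd x y _ _ hx hy => rw [map_add]; exact add_mem hx hy

theorem wordsInc_gen (w : List β.I) : β.wordsInc R (β.gen w) = (β.baseChange R).gen w := by
  induction w with
  | nil => rw [gen, wordsInc_mulH, wordsInc_single]; rfl
  | cons i w ih =>
    rw [gen, wordsInc_mulH, wordsInc_smul, ih, ← baseChange_e]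
    rfl

/-- The inclusion of the words over `A` into the bar resolution of `R ⊗ A`. -/
def wordsIncBar : β.Words →ₗ[K] (restrConst (β.baseChange R).bar).carrier where
  toFun z := (β.baseChange R).toBar (β.wordsInc R z)
  map_add' x y := (congrArg (β.baseChange R).toBar (map_add _ x y)).trans (map_add _ _ _)
  map_smul' c z := by
    rw [map_smul, ← algebraMap_smul R c (β.wordsInc R z), map_smul]
    rfl

/-- The inclusion of the bar resolution of `A` into that of `R ⊗ A`, as a linear map. -/
def barIncL : β.bar.carrier →ₗ[K] (restrConst (β.baseChange R).bar).carrier :=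
  β.emptyWords.liftQ (β.wordsIncBar R) (by
    rintro _ ⟨a, rfl⟩
    change (β.baseChange R).toBar (β.wordsInc R (Finsupp.single [] a)) = 0
    rw [wordsInc_single]
    exact (β.baseChange R).toBar_nil _)

theorem barIncL_toBar (z : β.Words) :
    β.barIncL R (β.toBar z) = (β.baseChange R).toBar (β.wordsInc R z) := rfl

/-- The inclusion of the bar resolution of `A` into that of `R ⊗ A`. -/
def barInc : β.bar ⟶ restrConst (β.baseChange R).bar :=
  (⟨β.barIncL R,
    fun a m => by
      obtain ⟨z, rfl⟩ := β.toBar_surjective m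
      rw [bar_lact, barIncL_toBar, barIncL_toBar, wordsInc_smul, ← unitMap_twist]
      exact ((β.baseChange R).bar_lact _ _).symm,
    fun a m => by
      obtain ⟨z, rfl⟩ := β.toBar_surjective m
      obtain ⟨a, rfl⟩ := MulOpposite.op_surjective a
      rw [bar_ract, barIncL_toBar, barIncL_toBar, wordsInc_rW]
      exact ((β.baseChange R).bar_ract _ _).symm,
    by
      rintro i _ ⟨z, hz, rfl⟩
      exact (β.baseChange R).toBar_mem (β.wordsInc_mem R hz),
    fun m => by
      obtain ⟨z, rfl⟩ := β.toBar_surjective m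
      rw [bar_d, map_neg, barIncL_toBar, barIncL_toBar, wordsInc_dW]
      exact ((β.baseChange R).bar_d _).symm⟩ : Hom β.bar (restrConst (β.baseChange R).bar))

theorem barInc_gen (w : List β.I) :
    Hom.map (β.barInc R) (β.toBar (β.gen w)) = (β.baseChange R).toBar ((β.baseChange R).gen w) :=
  congrArg (β.baseChange R).toBar (β.wordsInc_gen R w)

end AdaptedBasis
end DGA

namespace DGA

open DGA.Bimod

namespace Bimod

variable {R : Type u} [CommRing R] {A : DGA R} {ι : Type u} {N : ι → Bimod A}

/-! ### Finiteness for the bar resolution -/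

/-- The projection of a direct sum to one of the summands. -/
def directSumProj (N : ι → Bimod A) (i : ι) : directSum N ⟶ N i :=
  (⟨DFinsupp.lapply (R := R) (M := fun i => (N i).carrier) i, fun _ _ => rfl, fun _ _ => rfl,
    fun _ _ hm => hm i, fun _ => rfl⟩ : Hom (directSum N) (N i))

theorem directSumIncl_apply_of_notMem {s : Finset ι} (x : (directSum fun i : s => N i).carrier)
    {i : ι} (hi : i ∉ s) : Hom.map (directSumIncl N s) x i = 0 := by
  classical
  have h : directSumIncl N s ≫ directSumProj N i = zeroHom _ _ := directSum_hom_ext fun j => by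
    refine hom_ext fun m => ?_
    have e : Hom.map (directSumIncl N s) (Hom.map (directSumOf (fun i : s => N i) j) m) =
        Hom.map (directSumOf N j) m :=
      congrArg (fun f => Hom.map f m) (directSumOf_desc (fun i : s => directSumOf N i) j)
    refine (congrArg (fun y : (directSum N).carrier => y i) e).trans ?_
    exact DFinsupp.single_eq_of_ne fun hij => hi (hij ▸ j.2)
  exact congrArg (fun f => Hom.map f x) h

open Classical in
/-- The linear map on a direct sum which sets the components in a finite set to zero. -/
def directSumFilterL (N : ι → Bimod A) (s : Finset ι) :
    (directSum N).carrier →ₗ[R] (directSum N).carrier :=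
  DFinsupp.filterLinearMap R (fun i => (N i).carrier) (· ∉ s)

open Classical in
theorem directSumFilterL_apply (s : Finset ι) (x : (directSum N).carrier) (i : ι) :
    directSumFilterL N s x i = if i ∉ s then x i else 0 := DFinsupp.filter_apply _ _ _

/-- Setting the components in a finite set to zero, as a map of bimodules. -/
def directSumFilter (N : ι → Bimod A) (s : Finset ι) : directSum N ⟶ directSum N :=
  (⟨directSumFilterL N s,
    fun a m => DFinsupp.ext fun i => by
      rw [directSum_lact_apply, directSumFilterL_apply, directSumFilterL_apply]
      split_ifs <;> simp,
    fun a m => DFinsupp.ext fun i => by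
      rw [directSum_ract_apply, directSumFilterL_apply, directSumFilterL_apply]
      split_ifs <;> simp,
    fun n m hm i => by
      rw [directSumFilterL_apply]
      split_ifs
      · exact zero_mem _
      · exact hm i,
    fun m => DFinsupp.ext fun i => by
      rw [directSum_d_apply, directSumFilterL_apply, directSumFilterL_apply]
      split_ifs <;> simp⟩ : Hom (directSum N) (directSum N))

theorem directSumFilter_apply_of_notMem {s : Finset ι} (x : (directSum N).carrier)
    {i : ι} (hi : i ∉ s) : Hom.map (directSumFilter N s) x i = x i :=
  (directSumFilterL_apply s x i).trans (if_pos hi)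

theorem directSumFilter_eq_zero {s : Finset ι} {x : (directSum N).carrier}
    (h : ∀ i ∉ s, x i = 0) : Hom.map (directSumFilter N s) x = 0 := by
  refine DFinsupp.ext fun i => (directSumFilterL_apply s x i).trans ?_
  by_cases hi : i ∈ s
  · exact if_neg (not_not_intro hi)
  · exact (if_pos hi).trans (h i hi)

end Bimod

namespace AdaptedBasis

variable {K : Type u} [CommRing K] {A : DGA K} {R : Type u} [CommRing R] [Algebra K R]
  (β : A.AdaptedBasis) {ι : Type u} {N : ι → Bimod (A.baseChange R)}

/-- The restriction to the bar resolution of `A` of a map from the bar resolution of `R ⊗ A` to a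
direct sum, with values in a direct sum of shifted bimodules. -/
def barRestr (n : ℤ) (z : (β.baseChange R).bar.carrier →ₗ[R] (directSum N).carrier) :
    β.bar.carrier →ₗ[K] (directSum fun i => shift n (restrConst (N i))).carrier where
  toFun m := z (Hom.map (β.barInc R) m)
  map_add' x y := (congrArg z (map_add (Hom.map (β.barInc R)) x y)).trans (map_add z _ _)
  map_smul' c x := (congrArg z (map_smul (Hom.map (β.barInc R)) c x)).trans
    (map_smul z (algebraMap K R c) _)

theorem isBi_barRestr {m n : ℤ} {z : (β.baseChange R).bar.carrier →ₗ[R] (directSum N).carrier}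
    (hz : IsBi (m + n) z) : IsBi m (β.barRestr n z) where
  lact a x := by
    refine DFinsupp.ext fun i => ?_
    have e : z (Hom.map (β.barInc R) (β.bar.lact a x)) =
        (directSum N).lact (A.unitMap R (A.twist (m + n) a)) (z (Hom.map (β.barInc R) x)) := by
      rw [Hom.map_lact]
      refine (hz.lact _ _).trans ?_
      rw [unitMap_twist]
    have e' : A.twist (m + n) a = A.twist n (A.twist m a) := by rw [twist_twist, add_comm]
    rw [e'] at e
    exact congrArg (fun y : (directSum N).carrier => y i) e
  ract a x := by
    refine DFinsupp.ext fun i => ?_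
    have e : z (Hom.map (β.barInc R) (β.bar.ract a x)) =
        (directSum N).ract (MulOpposite.op (A.unitMap R a.unop)) (z (Hom.map (β.barInc R) x)) := by
      rw [Hom.map_ract]
      exact hz.ract _ _
    exact congrArg (fun y : (directSum N).carrier => y i) e
  mem i x hx j := by
    have := hz.mem i _ (Hom.map_mem (β.barInc R) i x hx) j
    rwa [← add_assoc] at this

/-- If the differential of a map from the bar resolution of `R ⊗ A` to a direct sum has values in a
finite partial sum, then so does the map itself,
  up to a coboundary. Restricted to the bar resolution
of `A` over the original ground ring, the components outside of the finite set form a chain map to a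
direct sum of bimodules over `A`, and the diagonal bimodule of `A` is compact. -/
theorem exists_finset_sub_coboundary (hA : A.IsSmooth) {n : ℤ} (hn : Odd n)
    {x : (β.baseChange R).bar.carrier →ₗ[R] (directSum N).carrier} (hx : IsBi n x) {s : Finset ι}
    (h : ∀ m, ∀ i ∉ s, ((directSum N).d (x m) + x ((β.baseChange R).bar.d m)) i = 0) :
    ∃ s' : Finset ι, s ⊆ s' ∧ ∃ y : (β.baseChange R).bar.carrier →ₗ[R] (directSum N).carrier,
      IsBi (n - 1) y ∧ ∀ m, ∀ i ∉ s',
        (x m - ((directSum N).d (y m) - y ((β.baseChange R).bar.d m))) i = 0 := by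
  classical
  let M := fun i => shift n (restrConst (N i))
  have hd : ∀ (u : (directSum N).carrier) i, (directSum M).d u i = -((directSum N).d u i) :=
    fun u i => by
      change n.negOnePow • (N i).d (u i) = _
      rw [Int.negOnePow_odd n hn, Units.neg_smul, one_smul]
      rfl
  -- the components of `x` outside of `s`, which anticommute with the differentials
  let x' := Hom.map (directSumFilter N s) ∘ₗ x
  have hx' : IsBi n x' := by
    have := (Hom.isBi (directSumFilter N s)).comp hx
    rwa [add_zero] at this
  have hx'd : ∀ m, (directSum N).d (x' m) + x' ((β.baseChange R).bar.d m) = 0 := fun m => by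
    have := directSumFilter_eq_zero (h m)
    rw [map_add] at this
    refine Eq.trans ?_ this
    exact congrArg (· + x' ((β.baseChange R).bar.d m)) (Hom.map_d (directSumFilter N s) (x m)).symm
  have hX := β.isBi_barRestr (m := 0) (n := n) (z := x') (by rwa [zero_add])
  let X : β.bar ⟶ directSum M := hX.toHom fun m => DFinsupp.ext fun i => by
    refine Eq.trans ?_ (hd _ i).symm
    have e := congrArg (fun u : (directSum N).carrier => u i) (hx'd (Hom.map (β.barInc R) m))
    have e2 : β.barRestr n x' (β.bar.d m) i =
        x' ((β.baseChange R).bar.d (Hom.map (β.barInc R) m)) i :=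
      congrArg (fun u => x' u i) (Hom.map_d (β.barInc R) m)
    exact e2.trans (eq_neg_of_add_eq_zero_right e)
  -- by compactness, `X` is homotopic to a map `g'` with values in a finite partial sum
  have : IsIso ((quasiIso A).Q.map β.aug) := MorphismProperty.Q_inverts _ _ β.quasiIso_aug
  obtain ⟨s₁, g, hg⟩ := exists_finset_of_isCompactObject M hA
    (inv ((quasiIso A).Q.map β.aug) ≫ (quasiIso A).Q.map X)
  obtain ⟨g', hg'⟩ := β.semiFreeBar.exists_Q_map_eq ((quasiIso A).Q.map β.aug ≫ g)
  obtain ⟨k, hk, hkd⟩ := β.semiFreeBar.homotopic_of_Q_map_eq (f := X) (g := g' ≫ directSumIncl M s₁)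
    (by rw [CategoryTheory.Functor.map_comp, hg', Category.assoc, hg, IsIso.hom_inv_id_assoc])
  -- minus the homotopy `k`, extended from the bar resolution of `A` to that of `R ⊗ A`
  let c : List β.I → (directSum N).carrier := fun w => k (β.toBar (β.gen w))
  have hc : ∀ w i, (-c w) i ∈ (N i).gr (β.wdeg w + (n - 1)) := fun w i => by
    have : c w i ∈ (N i).gr (β.wdeg w + -1 + n) := hk.mem _ _ (β.semiFreeBar.gen_mem w) i
    rw [show β.wdeg w + -1 + n = β.wdeg w + (n - 1) by ring] at this
    exact neg_mem this
  obtain ⟨y, hy0, hy⟩ := (β.baseChange R).semiFreeBar.exists_ext (shift (n - 1) (directSum N))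
    fun w => ⟨-c w, hc w⟩
  have hyb : IsBi (M := (β.baseChange R).bar) (N := directSum N) (n - 1) y := by
    have := (isBi_shift_iff (M := (β.baseChange R).bar) (N := directSum N) (n - 1)).1 hy0
    rwa [zero_add] at this
  change (β.baseChange R).bar.carrier →ₗ[R] (directSum N).carrier at y
  have hyk : ∀ m, β.barRestr n y m = -k m := fun m => by
    have h0 : β.barRestr n y + k = 0 := β.semiFreeBar.eq_zero
      ((β.isBi_barRestr (m := -1) (n := n) (by rwa [neg_add_eq_sub])).add hk) fun w => by
        refine (congrArg (· + k (β.toBar (β.gen w))) ?_).trans (neg_add_cancel _)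
        exact (congrArg y (β.barInc_gen R w)).trans (hy w)
    exact eq_neg_of_add_eq_zero_left (LinearMap.congr_fun h0 m)
  refine ⟨s ∪ s₁, Finset.subset_union_left, y, hyb, fun m i hi => ?_⟩
  rw [Finset.notMem_union] at hi
  -- both sides are bilinear over `R ⊗ A`, so that it suffices to consider generators, which come
  -- from the bar resolution of `A`
  have hbi : IsBi n (Hom.map (directSumProj N i) ∘ₗ
      (x - ((directSum N).d ∘ₗ y - y ∘ₗ (β.baseChange R).bar.d))) := by
    have h1 := hyb.d_comp
    rw [sub_add_cancel, Int.negOnePow_odd n hn, Units.neg_smul, one_smul, ← sub_eq_add_neg] at h1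
    have := (Hom.isBi (directSumProj N i)).comp (hx.sub h1)
    rwa [add_zero] at this
  refine LinearMap.congr_fun ((β.baseChange R).semiFreeBar.eq_zero hbi fun w => ?_) m
  let u := β.toBar (β.gen w)
  have e1 : Hom.map (β.barInc R) u = (β.baseChange R).toBar ((β.baseChange R).gen w) :=
    β.barInc_gen R w
  have e2 : (β.baseChange R).bar.d (Hom.map (β.barInc R) u) = Hom.map (β.barInc R) (β.bar.d u) :=
    (Hom.map_d (β.barInc R) u).symm
  have e3 : Hom.map X u i - Hom.map (g' ≫ directSumIncl M s₁) u i =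
      (directSum M).d (k u) i + k (β.bar.d u) i :=
    congrArg (fun v : (directSum M).carrier => v i) (hkd u)
  have e4 : Hom.map X u i = x (Hom.map (β.barInc R) u) i := directSumFilter_apply_of_notMem _ hi.1
  have e5 : Hom.map (g' ≫ directSumIncl M s₁) u i = 0 := directSumIncl_apply_of_notMem _ hi.2
  have e6 : (directSum N).d (y (Hom.map (β.barInc R) u)) i = (directSum M).d (k u) i := by
    have := congrArg (fun v : (directSum N).carrier => (directSum N).d v i) (hyk u)
    refine this.trans (Eq.trans ?_ (hd (k u) i).symm)
    exact congrArg (fun v : (directSum N).carrier => v i) (map_neg (directSum N).d (k u))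
  have e7 : y ((β.baseChange R).bar.d (Hom.map (β.barInc R) u)) i = -(k (β.bar.d u) i) :=
    (congrArg (fun v => y v i) e2).trans
      (congrArg (fun v : (directSum M).carrier => v i) (hyk (β.bar.d u)))
  have key : ∀ p p' z q q' r r' : (N i).carrier, p' - z = q' + r' → p' = p → z = 0 → q = q' →
      r = -r' → p - (q - r) = 0 := by
    intro p p' z q q' r r' h hp hz hq hr
    have hpq : p' = q' + r' := by rw [← h, hz, sub_zero]
    rw [← hp, hpq, hq, hr]
    abel
  refine (congrArg (fun v : (β.baseChange R).bar.carrier =>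
    (x v - ((directSum N).d (y v) - y ((β.baseChange R).bar.d v))) i) e1.symm).trans ?_
  exact key (x (Hom.map (β.barInc R) u) i) _ _ _ _ _ _ e3 e4 e5 e6 e7

end AdaptedBasis
end DGA

namespace DGA

open DGA.Bimod

variable {R : Type u} [CommRing R] {A : DGA R}

namespace Bimod

/-! ### Compactness of the diagonal bimodule of `A[ε]` -/

variable {ι : Type u} {N : ι → Bimod A}

open Classical in
/-- The projection of a direct sum to a partial sum. -/
def directSumRestrict (N : ι → Bimod A) (s : Finset ι) :
    directSum N ⟶ directSum fun i : s => N i :=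
  (⟨DFinsupp.subtypeDomainLinearMap R (fun i => (N i).carrier) (fun i => i ∈ s),
    fun _ _ => DFinsupp.ext fun _ => rfl,
    fun _ _ => DFinsupp.ext fun _ => rfl, fun _ _ hm i => hm i,
    fun _ => DFinsupp.ext fun _ => rfl⟩ : Hom (directSum N) (directSum fun i : s => N i))

theorem directSumOf_apply_self (N : ι → Bimod A) (i : ι) (m : (N i).carrier) :
    Hom.map (directSumOf N i) m i = m := by
  classical
  exact DFinsupp.single_eq_same

theorem directSumOf_apply_of_ne (i : ι) {j : ι} (m : (N i).carrier) (h : j ≠ i) :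
    Hom.map (directSumOf N i) m j = 0 := by
  classical
  exact DFinsupp.single_eq_of_ne h

theorem directSumIncl_apply_of_mem {s : Finset ι} (x : (directSum fun i : s => N i).carrier)
    {i : ι} (hi : i ∈ s) : Hom.map (directSumIncl N s) x i = x ⟨i, hi⟩ := by
  classical
  have h : directSumIncl N s ≫ directSumProj N i =
      directSumProj (fun i : s => N i) ⟨i, hi⟩ := directSum_hom_ext fun j => by
    refine hom_ext fun m => ?_
    have e : Hom.map (directSumIncl N s) (Hom.map (directSumOf (fun i : s => N i) j) m) =
        Hom.map (directSumOf N j) m :=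
      congrArg (fun f => Hom.map f m) (directSumOf_desc (fun i : s => directSumOf N i) j)
    refine (congrArg (fun y : (directSum N).carrier => y i) e).trans ?_
    by_cases hij : j = ⟨i, hi⟩
    · subst hij
      exact (directSumOf_apply_self N i m).trans
        (directSumOf_apply_self (fun i : s => N i) ⟨i, hi⟩ m).symm
    · exact (directSumOf_apply_of_ne _ _ fun h => hij (Subtype.ext h.symm)).trans
        (directSumOf_apply_of_ne (N := fun i : s => N i) _ _ fun h => hij h.symm).symm
  exact congrArg (fun f => Hom.map f x) h

/-- A map to a direct sum whose components outside of a finite set vanish factors through a finite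
direct sum. -/
theorem comp_directSumRestrict_incl {P : Bimod A} (F : P ⟶ directSum N) (s : Finset ι)
    (h : ∀ m, ∀ i ∉ s, Hom.map F m i = 0) :
    (F ≫ directSumRestrict N s) ≫ directSumIncl N s = F := by
  refine hom_ext fun m => DFinsupp.ext fun i => ?_
  by_cases hi : i ∈ s
  · exact directSumIncl_apply_of_mem _ hi
  · exact (directSumIncl_apply_of_notMem _ hi).trans (h m i hi).symm

end Bimod

namespace AdaptedBasis

/-- Every odd map from the bar resolution to a direct sum, whose differential has values in a finite
partial sum, itself has values in a finite partial sum up to a coboundary. -/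
def FinitelySupported (β : A.AdaptedBasis) : Prop :=
  ∀ ⦃ι : Type u⦄ (N : ι → Bimod A) ⦃n : ℤ⦄, Odd n →
    ∀ (x : β.bar.carrier →ₗ[R] (directSum N).carrier), IsBi n x → ∀ s : Finset ι,
    (∀ m, ∀ i ∉ s, ((directSum N).d (x m) + x (β.bar.d m)) i = 0) →
    ∃ s' : Finset ι, s ⊆ s' ∧ ∃ y : β.bar.carrier →ₗ[R] (directSum N).carrier,
      IsBi (n - 1) y ∧ ∀ m, ∀ i ∉ s', (x m - ((directSum N).d (y m) - y (β.bar.d m))) i = 0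

variable (β : A.AdaptedBasis)
  {θ W : A.carrier} (hθ : A.IsCentralCocycle θ) (hW : A.IsCentralCocycle W)
  (t : R) (ht : θ = algebraMap R A.carrier t - W)

section Values

variable {L : Bimod (A.adjoinEps θ hθ)}

theorem apply_d_resSingle_zero (f : (β.res hθ hW t ht).carrier →ₗ[R] L.carrier)
    (m : β.bar.carrier) : f ((β.res hθ hW t ht).d (β.resSingle hθ hW t ht 0 m)) =
      f (β.resSingle hθ hW t ht 0 (β.bar.d m)) :=
  congrArg f
    (totInd_d_single_zero hθ (β.isBi_ins hW) (β.ins_ins hW) (β.bar_homotopy hW t ht) m)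

theorem apply_d_resSingle_succ {n : ℤ} {f : (β.res hθ hW t ht).carrier →ₗ[R] L.carrier}
    (hf : IsBi n f) (k : ℕ) (m : β.bar.carrier) :
    f ((β.res hθ hW t ht).d (β.resSingle hθ hW t ht (k + 1) m)) =
      f (β.resSingle hθ hW t ht (k + 1) (β.bar.d m)) +
      (f (β.resSingle hθ hW t ht k (β.ins W m)) -
        L.lact ((A.adjoinEps θ hθ).twist n (epsVar hθ)) (f (β.resSingle hθ hW t ht k m)) +
        L.ract (MulOpposite.op (epsVar hθ)) (f (β.resSingle hθ hW t ht k (β.bar.sgn m)))) := by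
  refine (congrArg f (totInd_d_single_succ hθ (β.isBi_ins hW) (β.ins_ins hW)
    (β.bar_homotopy hW t ht) k m)).trans ?_
  refine (map_add f _ _).trans (congrArg (f (β.resSingle hθ hW t ht (k + 1) (β.bar.d m)) + ·) ?_)
  refine (map_add f _ _).trans (congrArg₂ (fun x y : L.carrier => x + y) ?_ (hf.ract _ _))
  exact (map_sub f _ _).trans (congrArg (_ - ·) (hf.lact _ _))

/-- If `f` vanishes on the multiples of `x_j` for `j < k`, then the restriction of the coboundary of
`f` to the multiples of `x_k` is the coboundary of its restriction. -/
theorem apply_d_resSingle_of_eq_zero {n : ℤ} {f : (β.res hθ hW t ht).carrier →ₗ[R] L.carrier}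
    (hf : IsBi n f) {k : ℕ} (h : ∀ j < k, ∀ m, f (β.resSingle hθ hW t ht j m) = 0)
    (m : β.bar.carrier) : f ((β.res hθ hW t ht).d (β.resSingle hθ hW t ht k m)) =
      f (β.resSingle hθ hW t ht k (β.bar.d m)) := by
  cases k with
  | zero => exact β.apply_d_resSingle_zero hθ hW t ht f m
  | succ k =>
    rw [β.apply_d_resSingle_succ hθ hW t ht hf, h k k.lt_succ_self, h k k.lt_succ_self,
      h k k.lt_succ_self, map_zero, map_zero, sub_zero, add_zero, add_zero]

/-- The differential of the resolution is periodic, except on the multiples of `x_0`. -/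
theorem apply_d_resSingle_congr {n n' : ℤ} (hn : Odd n) (hn' : Odd n')
    {f g : (β.res hθ hW t ht).carrier →ₗ[R] L.carrier} (hf : IsBi n f) (hg : IsBi n' g) (r : ℕ)
    (h : ∀ k m, f (β.resSingle hθ hW t ht k m) = g (β.resSingle hθ hW t ht (k + r) m)) (k : ℕ)
    (m : β.bar.carrier) : f ((β.res hθ hW t ht).d (β.resSingle hθ hW t ht (k + 1) m)) =
      g ((β.res hθ hW t ht).d (β.resSingle hθ hW t ht (k + 1 + r) m)) := by
  rw [β.apply_d_resSingle_succ hθ hW t ht hf, h, h, h, h, twist_epsVar hθ hn,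
    show k + 1 + r = k + r + 1 by ring, β.apply_d_resSingle_succ hθ hW t ht hg,
    twist_epsVar hθ hn']

theorem resMap_eq_zero {n : ℤ} {f : (β.res hθ hW t ht).carrier →ₗ[R] L.carrier} (hf : IsBi n f)
    (h : ∀ k m, f (β.resSingle hθ hW t ht k m) = 0) : f = 0 :=
  (β.semiFreeRes hθ hW t ht).eq_zero hf fun x => h x.2 _

/-- The map on the resolution that takes `m x_k` to `f k m`. -/
def resExt (n : ℤ) (f : ℕ → β.bar.carrier →ₗ[R] L.carrier) :
    (β.res hθ hW t ht).carrier →ₗ[R] L.carrier :=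
  totIndLift hθ (β.isBi_ins hW) (β.ins_ins hW) (β.bar_homotopy hW t ht) n f

theorem resExt_single (n : ℤ) (f : ℕ → β.bar.carrier →ₗ[R] L.carrier) (k : ℕ)
    (m : β.bar.carrier) : β.resExt hθ hW t ht n f (β.resSingle hθ hW t ht k m) = f k m :=
  totIndLift_single hθ (β.isBi_ins hW) (β.ins_ins hW) (β.bar_homotopy hW t ht) n f k m

theorem isBi_resExt {n : ℤ} {f : ℕ → β.bar.carrier →ₗ[R] L.carrier}
    (hf : ∀ k : ℕ, IsBi (N := restr (epsInl hθ) L) (n - 2 * k) (f k)) :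
    IsBi n (β.resExt hθ hW t ht n f) := isBi_totIndLift _ _ _ _ hf

theorem isBi_comp_resSingle {n : ℤ} {f : (β.res hθ hW t ht).carrier →ₗ[R] L.carrier}
    (hf : IsBi n f) (k : ℕ) :
    IsBi (N := restr (epsInl hθ) L) (n - 2 * k) (f ∘ₗ β.resSingle hθ hW t ht k) := by
  have := (isBi_restr (epsInl hθ) hf).comp
    (isBi_totIndSingle hθ (β.isBi_ins hW) (β.ins_ins hW) (β.bar_homotopy hW t ht) k)
  rw [neg_add_eq_sub] at this
  exact this

end Values

section Finite

variable {ι : Type u} {N : ι → Bimod (A.adjoinEps θ hθ)} {r : ℕ}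

theorem isBi_directSum_restr {M : Bimod A} {n : ℤ} {f : M.carrier →ₗ[R] (directSum N).carrier} :
    IsBi (N := directSum fun i => restr (epsInl hθ) (N i)) n f ↔
      IsBi (N := restr (epsInl hθ) (directSum N)) n f :=
  ⟨fun h => ⟨h.lact, h.ract, h.mem⟩, fun h => ⟨h.lact, h.ract, h.mem⟩⟩

/-- A homotopy `g` between zero and `m x_k ↦ F (m x_{k-r})` can be changed so that its values on
`m x_k`, for `k < r`, lie in a finite partial sum. -/
theorem exists_finitelySupported (hβ : β.FinitelySupported) (F : β.res hθ hW t ht ⟶ directSum N)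
    {g : (β.res hθ hW t ht).carrier →ₗ[R] (directSum N).carrier} (hg : IsBi (2 * r - 1) g)
    (hgd : ∀ m, (directSum N).d (g m) + g ((β.res hθ hW t ht).d m) =
      Hom.map F (β.resDrop hθ hW t ht r m)) (k : ℕ) (hk : k ≤ r) :
    ∃ (g' : (β.res hθ hW t ht).carrier →ₗ[R] (directSum N).carrier) (s : Finset ι),
      IsBi (2 * r - 1) g' ∧ (∀ m, (directSum N).d (g' m) + g' ((β.res hθ hW t ht).d m) =
        Hom.map F (β.resDrop hθ hW t ht r m)) ∧
      ∀ j < k, ∀ m, ∀ i ∉ s, g' (β.resSingle hθ hW t ht j m) i = 0 := by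
  induction k with
  | zero => exact ⟨g, ∅, hg, hgd, fun j hj => absurd hj (Nat.not_lt_zero j)⟩
  | succ k ih =>
    obtain ⟨g', s, hg', hgd', hs⟩ := ih (Nat.le_of_succ_le hk)
    have hodd : Odd (2 * (r : ℤ) - 1 - 2 * k) := ⟨r - 1 - k, by ring⟩
    obtain ⟨s', hss', y, hy, hys⟩ := hβ (fun i => restr (epsInl hθ) (N i)) hodd
      (g' ∘ₗ β.resSingle hθ hW t ht k)
      ((isBi_directSum_restr hθ).2 (β.isBi_comp_resSingle hθ hW t ht hg' k)) s (fun m i hi => by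
        have e := hgd' (β.resSingle hθ hW t ht k m)
        rw [β.resDrop_single_lt hθ hW t ht hk, map_zero] at e
        have e' := congrArg (Hom.map (directSumProj N i)) e
        rw [map_add, map_zero] at e'
        have e2 := β.apply_d_resSingle_of_eq_zero hθ hW t ht
          ((Hom.isBi (directSumProj N i)).comp hg') (fun j hj m => hs j hj m i hi) m
        refine Eq.trans ?_ e'
        exact congrArg (Hom.map (directSumProj N i)
          ((directSum N).d (g' (β.resSingle hθ hW t ht k m))) + ·) e2.symm)
    -- a correction which is supported on the multiples of `x_k`; its coboundary does not affect the
    -- multiples of `x_j` for `j < k`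
    let Y : (β.res hθ hW t ht).carrier →ₗ[R] (directSum N).carrier :=
      β.resExt hθ hW t ht (2 * r - 1 - 1) fun j => if j = k then y else 0
    have hY : IsBi (2 * (r : ℤ) - 1 - 1) Y := β.isBi_resExt hθ hW t ht fun j => by
      split_ifs with h
      · subst h
        have := (isBi_directSum_restr hθ).1 hy
        rwa [show 2 * (r : ℤ) - 1 - 2 * j - 1 = 2 * r - 1 - 1 - 2 * j by ring] at this
      · exact IsBi.zero
    have hY1 : ∀ m, Y (β.resSingle hθ hW t ht k m) = y m := fun m => by
      rw [β.resExt_single hθ hW t ht, if_pos rfl]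
    have hY2 : ∀ j < k, ∀ m, Y (β.resSingle hθ hW t ht j m) = 0 := fun j hj m => by
      rw [β.resExt_single hθ hW t ht, if_neg hj.ne, LinearMap.zero_apply]
    have hdY := hY.d_comp
    rw [sub_add_cancel, Int.negOnePow_odd _ (⟨r - 1, by ring⟩ : Odd (2 * (r : ℤ) - 1)),
      Units.neg_smul, one_smul, ← sub_eq_add_neg] at hdY
    refine ⟨g' - ((directSum N).d ∘ₗ Y - Y ∘ₗ (β.res hθ hW t ht).d), s', hg'.sub hdY,
      fun m => ?_, fun j hj m i hi => ?_⟩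
    · simp only [LinearMap.sub_apply, LinearMap.comp_apply]
      rw [map_sub, map_sub, (directSum N).d_d, (β.res hθ hW t ht).d_d, map_zero, ← hgd']
      abel
    · have e : Y ((β.res hθ hW t ht).d (β.resSingle hθ hW t ht j m)) =
          Y (β.resSingle hθ hW t ht j (β.bar.d m)) :=
        β.apply_d_resSingle_of_eq_zero hθ hW t ht hY
          (fun j' hj' => hY2 j' (hj'.trans_le (Nat.lt_succ_iff.1 hj))) m
      rcases (Nat.lt_succ_iff.1 hj).lt_or_eq with h | rfl
      · have : (g' - ((directSum N).d ∘ₗ Y - Y ∘ₗ (β.res hθ hW t ht).d))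
            (β.resSingle hθ hW t ht j m) = g' (β.resSingle hθ hW t ht j m) := by
          simp only [LinearMap.sub_apply, LinearMap.comp_apply]
          rw [e, hY2 j h, hY2 j h, map_zero, sub_zero, sub_zero]
        rw [this]
        exact hs j h m i fun hi' => hi (hss' hi')
      · refine Eq.trans ?_ (hys m i hi)
        simp only [LinearMap.sub_apply, LinearMap.comp_apply]
        rw [e, hY1, hY1]

end Finite

end AdaptedBasis
end DGA

namespace DGA

open DGA.Bimod

namespace AdaptedBasis

variable {R : Type u} [CommRing R] {A : DGA R} (β : A.AdaptedBasis)
  {θ W : A.carrier} (hθ : A.IsCentralCocycle θ) (hW : A.IsCentralCocycle W)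
  (t : R) (ht : θ = algebraMap R A.carrier t - W)

/-- If the map `m x_k ↦ m x_{k-r}` on the resolution is homotopic to zero, then every map from the
resolution to a direct sum is homotopic to one with values in a finite partial sum. -/
theorem exists_homotopic_finitelySupported (hβ : β.FinitelySupported) {r : ℕ}
    {G : (β.res hθ hW t ht).carrier →ₗ[R] (β.res hθ hW t ht).carrier} (hG : IsBi (2 * r - 1) G)
    (hGd : ∀ m, (β.res hθ hW t ht).d (G m) + G ((β.res hθ hW t ht).d m) =
      β.resDrop hθ hW t ht r m)
    {ι : Type u} {N : ι → Bimod (A.adjoinEps θ hθ)} (F : β.res hθ hW t ht ⟶ directSum N) :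
    ∃ (F' : β.res hθ hW t ht ⟶ directSum N) (s : Finset ι), homotopic _ F F' ∧
      ∀ m, ∀ i ∉ s, Hom.map F' m i = 0 := by
  have hg := (Hom.isBi F).comp hG
  rw [add_zero] at hg
  obtain ⟨g, s, hg, hgd, hs⟩ := β.exists_finitelySupported hθ hW t ht hβ F hg (fun m => by
    rw [← hGd, map_add, Hom.map_d]; rfl) r le_rfl
  -- the homotopy `m x_k ↦ g (m x_{k+r})` between `F` and `F'`
  let h : (β.res hθ hW t ht).carrier →ₗ[R] (directSum N).carrier :=
    β.resExt hθ hW t ht (-1) fun k => g ∘ₗ β.resSingle hθ hW t ht (k + r)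
  have hh : IsBi (-1) h := β.isBi_resExt hθ hW t ht fun k => by
    have := β.isBi_comp_resSingle hθ hW t ht hg (k + r)
    rwa [show 2 * (r : ℤ) - 1 - 2 * ((k + r : ℕ) : ℤ) = -1 - 2 * k by push_cast; ring] at this
  have hhs : ∀ k m, h (β.resSingle hθ hW t ht k m) = g (β.resSingle hθ hW t ht (k + r) m) :=
    fun k m => β.resExt_single hθ hW t ht _ _ k m
  have hdh := hh.d_comp
  rw [neg_add_cancel, Int.negOnePow_zero, one_smul] at hdh
  have hodd : Odd (2 * (r : ℤ) - 1) := ⟨r - 1, by ring⟩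
  let F' : β.res hθ hW t ht ⟶ directSum N :=
    ((Hom.isBi F).sub hdh).toHom fun m => by
      simp only [LinearMap.sub_apply, LinearMap.add_apply, LinearMap.comp_apply]
      rw [map_sub, map_add, (directSum N).d_d, (β.res hθ hW t ht).d_d, map_zero, Hom.map_d,
        zero_add, add_zero]
  have hF' : ∀ m, Hom.map F' m = Hom.map F m -
      ((directSum N).d (h m) + h ((β.res hθ hW t ht).d m)) := fun m => rfl
  refine ⟨F', s, ⟨h, hh, fun m => by rw [hF']; abel⟩, fun m i hi => ?_⟩
  have hFg : ∀ k m, Hom.map F (β.resSingle hθ hW t ht k m) =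
      (directSum N).d (g (β.resSingle hθ hW t ht (k + r) m)) +
        g ((β.res hθ hW t ht).d (β.resSingle hθ hW t ht (k + r) m)) := fun k m => by
    rw [hgd, β.resDrop_single_add hθ hW t ht]
  have key : Hom.map (directSumProj N i) ∘ₗ Hom.map F' = 0 := by
    have hb := (Hom.isBi (directSumProj N i)).comp (Hom.isBi F')
    refine β.resMap_eq_zero hθ hW t ht hb fun k m => ?_
    rw [LinearMap.comp_apply, hF', hFg, hhs]
    cases k with
    -- on the multiples of `x_0`, the difference of `F` and the coboundary of `h` consists of values
    -- of `g` on multiples of `x_{r-1}`, which lie in the partial sum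
    | zero =>
      have e1 := β.apply_d_resSingle_zero hθ hW t ht h m
      have e2 := β.apply_d_resSingle_of_eq_zero hθ hW t ht
        ((Hom.isBi (directSumProj N i)).comp hg) (fun j hj m => hs j hj m i hi) m
      rw [e1, hhs, zero_add, add_sub_add_left_eq_sub, map_sub]
      exact sub_eq_zero.2 e2
    -- on the multiples of the other generators, periodicity shows that the coboundary of `h` is `F`
    | succ k =>
      rw [β.apply_d_resSingle_congr hθ hW t ht (by decide) hodd hh hg r hhs, sub_self, map_zero]
  exact LinearMap.congr_fun key m

/-- If the map `m x_k ↦ m x_{k-r}` on the resolution is homotopic to zero, then the diagonal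
bimodule of `A[ε]` is compact. -/
theorem isSmooth_adjoinEps (hβ : β.FinitelySupported) {r : ℕ}
    {G : (β.res hθ hW t ht).carrier →ₗ[R] (β.res hθ hW t ht).carrier} (hG : IsBi (2 * r - 1) G)
    (hGd : ∀ m, (β.res hθ hW t ht).d (G m) + G ((β.res hθ hW t ht).d m) =
      β.resDrop hθ hW t ht r m) : (A.adjoinEps θ hθ).IsSmooth := by
  refine isCompactObject_of_exists_finset fun ι N f => ?_
  have : IsIso ((quasiIso _).Q.map (β.resAug hθ hW t ht)) :=
    (quasiIso _).Q_inverts _ (β.quasiIso_resAug hθ hW t ht)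
  obtain ⟨F, hF⟩ := (β.semiFreeRes hθ hW t ht).exists_Q_map_eq
    ((quasiIso _).Q.map (β.resAug hθ hW t ht) ≫ f)
  obtain ⟨F', s, hFF', hs⟩ :=
    β.exists_homotopic_finitelySupported hθ hW t ht hβ hG hGd F
  refine ⟨s, inv ((quasiIso _).Q.map (β.resAug hθ hW t ht)) ≫
    (quasiIso _).Q.map (F' ≫ directSumRestrict N s), ?_⟩
  rw [Category.assoc, IsIso.inv_comp_eq, ← CategoryTheory.Functor.map_comp,
    comp_directSumRestrict_incl F' s hs, ← Q_map_eq_of_homotopic hFF', hF]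

end AdaptedBasis

section BaseChange

variable {K : Type u} [CommRing K] {A : DGA K}

/-- The dga `(R ⊗ A)[ε]` with `d ε = t - W` is smooth if `p(t)` is invertible in `R`, and
`q ^ r p(W)` bounds in the Hochschild complex. -/
theorem AdaptedBasis.isSmooth_adjoinEps_baseChange (β : A.AdaptedBasis) (hA : A.IsSmooth)
    {W : A.carrier} (hW : A.IsCentralCocycle W) (R : Type u) [CommRing R] [Algebra K R] (t : R)
    {θ : (A.baseChange R).carrier} (hθ : (A.baseChange R).IsCentralCocycle θ)
    (ht : θ = algebraMap R (A.baseChange R).carrier t - A.unitMap R W)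
    {p : K[X]} (hp : IsUnit (aeval t p)) {r : ℕ} (h : A.qPolyClass hW p r = 0) :
    ((A.baseChange R).adjoinEps θ hθ).IsSmooth := by
  obtain ⟨ψ, hψ, hdψ⟩ := exists_cochain_of_qPolyClass_eq_zero hW h
  obtain ⟨Ψ, hΨ, h0, hs⟩ := β.exists_barMaps R hW hψ hdψ
  obtain ⟨c', hc', huc⟩ := exists_algebraMap_aeval R hW t p
  rw [← ht] at huc
  obtain ⟨G, hG, hGd⟩ := (β.baseChange R).exists_homotopy_resDrop hθ (hW.unitMap R) t ht r
    ((β.baseChange R).exists_homotopy_resAug hθ (hW.unitMap R) t ht hp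
      ((A.isCentralCocycle_aeval hW p).unitMap R) hc' huc hΨ h0 hs)
  exact (β.baseChange R).isSmooth_adjoinEps hθ (hW.unitMap R) t ht
    (fun _ _ _ hn _ hx s hxs => β.exists_finset_sub_coboundary hA hn hx hxs) hG hGd

end BaseChange
end DGA

namespace DGA

open DGA.Bimod

/-! ### Invariance of smoothness under isomorphism -/

section Isomorphism

variable {R : Type u} [CommRing R] {A B : DGA R} (φ : Map A B)

/-- The inverse of a bijective homomorphism of differential graded algebras. -/
def Map.inverse (hφ : Function.Bijective φ.hom) : Map B A where
  hom := (AlgEquiv.ofBijective φ.hom hφ).symm.toAlgHom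
  mem i b hb := by
    classical
    let e := AlgEquiv.ofBijective φ.hom hφ
    have he : ∀ a, e a = φ.hom a := fun _ => rfl
    obtain ⟨a, rfl⟩ := hφ.2 b
    change e.symm (e a) ∈ A.gr i
    rw [AlgEquiv.symm_apply_apply]
    -- the component of `φ a` of degree `i` is the image of that of `a`
    have key : ∀ a, φ.hom (GradedAlgebra.proj A.gr i a) = GradedAlgebra.proj B.gr i (φ.hom a) := by
      intro a
      induction a using A.induction_gr with
      | hadd x y hx hy => simp only [map_add, hx, hy]
      | h j a ha =>
        rw [GradedAlgebra.proj_apply, GradedAlgebra.proj_apply]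
        by_cases h : j = i
        · subst h
          rw [DirectSum.decompose_of_mem_same _ ha,
            DirectSum.decompose_of_mem_same _ (φ.mem j a ha)]
        · rw [DirectSum.decompose_of_mem_ne _ ha h,
            DirectSum.decompose_of_mem_ne _ (φ.mem j a ha) h, map_zero]
    have h := key a
    rw [GradedAlgebra.proj_apply, GradedAlgebra.proj_apply,
      DirectSum.decompose_of_mem_same _ hb] at h
    rw [← hφ.1 h]
    exact SetLike.coe_mem _
  map_d b := by
    obtain ⟨a, rfl⟩ := hφ.2 b
    let e := AlgEquiv.ofBijective φ.hom hφ
    change e.symm (B.d (e a)) = A.d (e.symm (e a))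
    rw [AlgEquiv.symm_apply_apply, AlgEquiv.symm_apply_eq]
    exact (φ.map_d a).symm

theorem Map.inverse_apply (hφ : Function.Bijective φ.hom) (a : A.carrier) :
    (φ.inverse hφ).hom (φ.hom a) = a :=
  (AlgEquiv.ofBijective φ.hom hφ).symm_apply_apply a

namespace Bimod

/-- The functoriality of the restriction of bimodules. -/
def restrMap {M N : Bimod B} (f : M ⟶ N) : restr φ M ⟶ restr φ N :=
  (⟨Hom.map (M := M) (N := N) f, fun a m => Hom.map_lact (M := M) (N := N) f (φ.hom a) m,
    fun a m => Hom.map_ract (M := M) (N := N) f (MulOpposite.op (φ.hom a.unop)) m,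
    Hom.map_mem (M := M) (N := N) f, Hom.map_d (M := M) (N := N) f⟩ :
      Hom (restr φ M) (restr φ N))

/-- The restriction of bimodules along a homomorphism, as a functor. -/
abbrev restrFunctor : Bimod B ⥤ Bimod A where
  obj N := restr φ N
  map f := restrMap φ f

/-- Bimodules with the same underlying complex and the same actions are isomorphic. -/
def isoOfEq {M N : Bimod A} (f : M ⟶ N) (g : N ⟶ M) (hfg : ∀ m, Hom.map g (Hom.map f m) = m)
    (hgf : ∀ m, Hom.map f (Hom.map g m) = m) : M ≅ N where
  hom := f
  inv := g
  hom_inv_id := hom_ext hfg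
  inv_hom_id := hom_ext hgf

/-- Restriction along an isomorphism is an equivalence, with inverse given by restriction along the
inverse. -/
theorem isEquivalence_restrFunctor (hφ : Function.Bijective φ.hom) :
    (restrFunctor φ).IsEquivalence where
  faithful := ⟨fun {M N f g} h => hom_ext fun m =>
    congrArg (fun k : restr φ M ⟶ restr φ N => Hom.map k m) h⟩
  full := ⟨fun {M N} f => by
    change restr φ M ⟶ restr φ N at f
    exact ⟨(⟨Hom.map (M := restr φ M) (N := restr φ N) f, fun b m => by
      obtain ⟨a, rfl⟩ := hφ.2 b
      exact Hom.map_lact (M := restr φ M) (N := restr φ N) f a m, fun b m => by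
      obtain ⟨b, rfl⟩ := MulOpposite.op_surjective b
      obtain ⟨a, rfl⟩ := hφ.2 b
      exact Hom.map_ract (M := restr φ M) (N := restr φ N) f (MulOpposite.op a) m,
        Hom.map_mem (M := restr φ M) (N := restr φ N) f,
          Hom.map_d (M := restr φ M) (N := restr φ N) f⟩ : Hom M N), rfl⟩⟩
  essSurj := ⟨fun N => ⟨restr (φ.inverse hφ) N, ⟨isoOfEq
    (M := restr φ (restr (φ.inverse hφ) N)) (N := N)
    (⟨LinearMap.id, fun a m => (congrArg (fun b : A.carrier => N.lact b m)
      (φ.inverse_apply hφ a) :),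
      fun a m => (congrArg (fun b : A.carrier => N.ract (MulOpposite.op b) m)
        (φ.inverse_apply hφ a.unop) :),
      fun _ _ h => h, fun _ => rfl⟩ :
        Hom (restr φ (restr (φ.inverse hφ) N)) N)
    (⟨LinearMap.id, fun a m => (congrArg (fun b : A.carrier => N.lact b m)
      (φ.inverse_apply hφ a).symm :),
      fun a m => (congrArg (fun b : A.carrier => N.ract (MulOpposite.op b) m)
        (φ.inverse_apply hφ a.unop).symm :),
      fun _ _ h => h, fun _ => rfl⟩ :
        Hom N (restr φ (restr (φ.inverse hφ) N))) (fun _ => rfl) (fun _ => rfl)⟩⟩⟩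

/-- Restriction, as a morphism of localizers. -/
def restrLocalizer : LocalizerMorphism (quasiIso B) (quasiIso A) :=
  LocalizerMorphism.ofEq (F := restrFunctor φ) (by
    ext M N f
    rw [MorphismProperty.inverseImage_iff, quasiIso_iff, quasiIso_iff]
    rfl)

theorem quasiIso_iso_hom {M N : Bimod A} (e : M ≅ N) : quasiIso A e.hom := by
  rw [quasiIso_iff]
  intro x y _ hxy
  refine ⟨Hom.map e.inv y, 0, ?_, ?_⟩
  · rw [← Hom.map_d, ← hxy]
    exact congrArg (fun k => Hom.map k x) e.hom_inv_id
  · rw [map_zero, add_zero]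
    exact congrArg (fun k => Hom.map k y) e.inv_hom_id

/-- Quasi-isomorphisms are stable under composition with isomorphisms. -/
instance respectsIso_quasiIso : (quasiIso A).RespectsIso :=
  MorphismProperty.RespectsIso.mk _ (fun e _ hf => quasiIso_comp (quasiIso_iso_hom e) hf)
    fun e _ hf => quasiIso_comp hf (quasiIso_iso_hom e)

/-- The diagonal bimodule of `A` is the restriction of that of `B`. -/
def diagonalIso (hφ : Function.Bijective φ.hom) : diagonal A ≅ restr φ (diagonal B) :=
  isoOfEq
    (⟨φ.hom.toLinearMap, fun a (m : A.carrier) => map_mul φ.hom a m,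
      fun a (m : A.carrier) => map_mul φ.hom m a.unop,
      fun i m h => φ.mem i m h, fun m => φ.map_d m⟩ : Hom (diagonal A) (restr φ (diagonal B)))
    (⟨(φ.inverse hφ).hom.toLinearMap,
      fun a (m : B.carrier) => (map_mul (φ.inverse hφ).hom (φ.hom a) m).trans
        (congrArg (fun b : A.carrier => b * (φ.inverse hφ).hom m) (φ.inverse_apply hφ a)),
      fun a (m : B.carrier) => (map_mul (φ.inverse hφ).hom m (φ.hom a.unop)).trans
        (congrArg (fun b : A.carrier => (φ.inverse hφ).hom m * b) (φ.inverse_apply hφ a.unop)),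
      fun i m h => (φ.inverse hφ).mem i m h, fun m => (φ.inverse hφ).map_d m⟩ :
        Hom (restr φ (diagonal B)) (diagonal A))
    (fun m => φ.inverse_apply hφ m)
    (fun m => (AlgEquiv.ofBijective φ.hom hφ).apply_symm_apply m)

/-- Restriction commutes with direct sums. -/
def restrDirectSumIso {ι : Type u} (N : ι → Bimod B) :
    directSum (fun i => restr φ (N i)) ≅ restr φ (directSum N) :=
  isoOfEq
    (⟨LinearMap.id, fun _ _ => rfl, fun _ _ => rfl, fun _ _ h => h, fun _ => rfl⟩ : Hom _ _)
    (⟨LinearMap.id, fun _ _ => rfl, fun _ _ => rfl, fun _ _ h => h, fun _ => rfl⟩ : Hom _ _)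
    (fun _ => rfl) (fun _ => rfl)

/-- The identification of direct sums is compatible with the inclusions of partial sums. -/
theorem directSumIncl_restrDirectSumIso {ι : Type u} (N : ι → Bimod B) (s : Finset ι) :
    directSumIncl (fun i => restr φ (N i)) s ≫ (restrDirectSumIso φ N).hom =
      (restrDirectSumIso φ fun i : s => N i).hom ≫
        restrMap φ (directSumIncl N s) := directSum_hom_ext fun i => by
  refine hom_ext fun m => ?_
  refine Eq.trans (b := Hom.map (directSumOf N i) m) ?_ ?_
  · exact congrArg (fun k => Hom.map k m)
      (directSumOf_desc (fun i : s => directSumOf (fun i => restr φ (N i)) i) i)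
  · exact (congrArg (fun k => Hom.map (M := N i) (N := directSum N) k m)
      (directSumOf_desc (fun i : s => directSumOf N i) i)).symm

end Bimod

/-- Smoothness is invariant under isomorphism. -/
theorem IsSmooth.of_bijective (hφ : Function.Bijective φ.hom) (hA : A.IsSmooth) : B.IsSmooth := by
  -- restriction gives an equivalence `L` of derived categories, which takes the diagonal bimodule
  -- to the diagonal bimodule, and direct sums to direct sums
  have : (restrLocalizer φ).functor.IsEquivalence := isEquivalence_restrFunctor φ hφ
  have : (restrLocalizer φ).IsInduced := ⟨rfl⟩
  have := (restrLocalizer φ).isLocalizedEquivalence_of_isInduced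
  let QA := (quasiIso A).Q
  let QB := (quasiIso B).Q
  let L := (restrLocalizer φ).localizedFunctor QB QA
  let η : restrFunctor φ ⋙ QA ≅ QB ⋙ L :=
    (CatCommSq.iso (restrLocalizer φ).functor QB QA L)
  have hL : L.IsEquivalence := inferInstance
  refine isCompactObject_of_exists_finset fun ι N f => ?_
  obtain ⟨s, g, hg⟩ := exists_finset_of_isCompactObject (fun i => restr φ (N i)) hA
    (QA.map (diagonalIso φ hφ).hom ≫ η.hom.app _ ≫ L.map f ≫ η.inv.app _ ≫
      QA.map (restrDirectSumIso φ N).inv)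
  let g' : L.obj (QB.obj (diagonal B)) ⟶ L.obj (QB.obj (directSum fun i : s => N i)) :=
    η.inv.app _ ≫ QA.map (diagonalIso φ hφ).inv ≫ g ≫
      QA.map (restrDirectSumIso φ fun i : s => N i).hom ≫ η.hom.app _
  refine ⟨s, L.preimage g', L.map_injective ?_⟩
  have e1 : η.hom.app (directSum fun i : s => N i) ≫ L.map (QB.map (directSumIncl N s)) =
      QA.map (restrMap φ (directSumIncl N s)) ≫ η.hom.app (directSum N) :=
    (η.hom.naturality _).symm
  have e2 := congrArg QA.map (directSumIncl_restrDirectSumIso φ N s)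
  rw [CategoryTheory.Functor.map_comp, CategoryTheory.Functor.map_comp] at e2
  have e3 : QA.map (diagonalIso φ hφ).inv ≫ QA.map (diagonalIso φ hφ).hom = 𝟙 _ := by
    rw [← CategoryTheory.Functor.map_comp, Iso.inv_hom_id, CategoryTheory.Functor.map_id]
  have e4 : QA.map (restrDirectSumIso φ N).inv ≫ QA.map (restrDirectSumIso φ N).hom = 𝟙 _ := by
    rw [← CategoryTheory.Functor.map_comp, Iso.inv_hom_id, CategoryTheory.Functor.map_id]
  rw [CategoryTheory.Functor.map_comp, CategoryTheory.Functor.map_preimage]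
  simp only [g', Category.assoc]
  refine (congrArg (fun k => η.inv.app _ ≫ QA.map (diagonalIso φ hφ).inv ≫ g ≫
    QA.map (restrDirectSumIso φ fun i : s => N i).hom ≫ k) e1).trans ?_
  rw [← reassoc_of% e2, reassoc_of% hg, reassoc_of% e4, reassoc_of% e3]
  rw [Iso.inv_hom_id_app_assoc]
  exact (congrArg (L.map f ≫ ·) (η.inv_hom_id_app _)).trans (Category.comp_id _)

end Isomorphism
end DGA

namespace DGA

/-! ### Extension of constants and the variable `ε` -/

section Tower

variable {K S R : Type u} [CommRing K] [CommRing S] [CommRing R] [Algebra S R]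

/-- The homomorphism `R ⊗ V → T` given by a semilinear homomorphism from `V` to `T`. -/
def Map.ofRingHom {V : DGA S} {T : DGA R} (f : V.carrier →+* T.carrier)
    (hf : ∀ (s : S) v, f (s • v) = algebraMap S R s • f v)
    (hmem : ∀ i v, v ∈ V.gr i → f v ∈ T.gr i) (hd : ∀ v, f (V.d v) = T.d (f v)) :
    Map (V.baseChange R) T :=
  letI : Algebra S T.carrier := Algebra.compHom T.carrier (algebraMap S R)
  haveI : IsScalarTower S R T.carrier := ⟨fun s r x => by
    rw [Algebra.smul_def s r, mul_smul]; rfl⟩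
  let F : (V.baseChange R).carrier →ₐ[R] T.carrier :=
    Algebra.TensorProduct.lift (Algebra.ofId R T.carrier)
      { f with
        commutes' := fun s => by
          change f (algebraMap S V.carrier s) = algebraMap R T.carrier (algebraMap S R s)
          rw [Algebra.algebraMap_eq_smul_one (R := S), hf, map_one]
          exact (Algebra.algebraMap_eq_smul_one _).symm }
      fun r v => Algebra.commutes r _
  have hF : ∀ (r : R) (v : V.carrier), F (show R ⊗[S] V.carrier from r ⊗ₜ[S] v) = r • f v :=
    fun r v =>
    (Algebra.TensorProduct.lift_tmul _ _ _ r v).trans (Algebra.smul_def r (f v)).symm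
  { hom := F
    mem := fun i x hx => by
      change x ∈ (V.gr i).baseChange R at hx
      rw [Submodule.baseChange_eq_span] at hx
      induction hx using Submodule.span_induction with
      | mem x hx =>
        obtain ⟨y, hy, rfl⟩ := hx
        have : F (V.unitMap R y) ∈ T.gr i := by
          rw [show F (V.unitMap R y) = f y from (hF 1 y).trans (one_smul _ _)]
          exact hmem i y hy
        exact this
      | zero => rw [map_zero]; exact zero_mem _
      | add x y _ _ hx hy => rw [map_add]; exact add_mem hx hy
      | smul c x _ hx => rw [map_smul]; exact Submodule.smul_mem _ _ hx
    map_d := fun x => by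
      induction x using baseChange_induction R with
      | h s a =>
        have : ∀ a : V.carrier, F (V.unitMap R a) = f a := fun a => (hF 1 a).trans (one_smul _ _)
        rw [map_smul, unitMap_d, map_smul, map_smul, this, hd, map_smul, this]
      | hadd x y hx hy => rw [map_add, map_add, hx, hy, map_add, map_add] }

theorem Map.ofRingHom_tmul {V : DGA S} {T : DGA R} (f : V.carrier →+* T.carrier)
    (hf : ∀ (s : S) v, f (s • v) = algebraMap S R s • f v)
    (hmem : ∀ i v, v ∈ V.gr i → f v ∈ T.gr i) (hd : ∀ v, f (V.d v) = T.d (f v)) (r : R)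
    (v : V.carrier) : (Map.ofRingHom f hf hmem hd).hom (r ⊗ₜ[S] v) = r • f v :=
  letI : Algebra S T.carrier := Algebra.compHom T.carrier (algebraMap S R)
  haveI : IsScalarTower S R T.carrier := ⟨fun s r x => by
    rw [Algebra.smul_def s r, mul_smul]; rfl⟩
  (Algebra.TensorProduct.lift_tmul _ _ (by exact fun r _ => Algebra.commutes r _) r v).trans
    (Algebra.smul_def r (f v)).symm

variable [Algebra K S] [Algebra K R] [IsScalarTower K S R] (A : DGA K)

variable (S R) in
/-- The ring homomorphism from `S ⊗ A` to `R ⊗ A`. -/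
def towerHom : (A.baseChange S).carrier →+* (A.baseChange R).carrier :=
  (Algebra.TensorProduct.map (IsScalarTower.toAlgHom K S R) (AlgHom.id K A.carrier)).toRingHom

theorem towerHom_unitMap (a : A.carrier) : A.towerHom S R (A.unitMap S a) = A.unitMap R a := by
  refine (Algebra.TensorProduct.map_tmul _ _ (1 : S) a).trans ?_
  rw [map_one]; rfl

theorem towerHom_smul (s : S) (x : (A.baseChange S).carrier) :
    A.towerHom S R (s • x) = algebraMap S R s • A.towerHom S R x := by
  change S ⊗[K] A.carrier at x
  let f := Algebra.TensorProduct.map (IsScalarTower.toAlgHom K S R) (AlgHom.id K A.carrier)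
  change f (s • x) = algebraMap S R s • f x
  induction x using TensorProduct.induction_on with
  | zero => rw [smul_zero, map_zero, smul_zero]
  | tmul s' a =>
    rw [TensorProduct.smul_tmul', Algebra.TensorProduct.map_tmul, Algebra.TensorProduct.map_tmul,
      TensorProduct.smul_tmul', smul_eq_mul, map_mul]
    rfl
  | add x y hx hy => rw [smul_add, map_add, map_add, smul_add, hx, hy]

theorem towerHom_mem {i : ℤ} {x : (A.baseChange S).carrier} (hx : x ∈ (A.baseChange S).gr i) :
    A.towerHom S R x ∈ (A.baseChange R).gr i := by
  change x ∈ (A.gr i).baseChange S at hx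
  rw [Submodule.baseChange_eq_span] at hx
  induction hx using Submodule.span_induction with
  | mem x hx =>
    obtain ⟨y, hy, rfl⟩ := hx
    exact (congrArg (· ∈ (A.baseChange R).gr i) (A.towerHom_unitMap y)).mpr (unitMap_mem R hy)
  | zero => rw [map_zero]; exact zero_mem _
  | add x y _ _ hx hy => rw [map_add]; exact add_mem hx hy
  | smul c x _ hx =>
    exact (congrArg (· ∈ (A.baseChange R).gr i) (A.towerHom_smul c x)).mpr
      (Submodule.smul_mem _ _ hx)

theorem towerHom_d (x : (A.baseChange S).carrier) :
    A.towerHom S R ((A.baseChange S).d x) = (A.baseChange R).d (A.towerHom S R x) := by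
  induction x using baseChange_induction S with
  | h s a =>
    rw [map_smul, unitMap_d, towerHom_smul, towerHom_smul, towerHom_unitMap, towerHom_unitMap,
      map_smul, unitMap_d]
  | hadd x y hx hy => rw [map_add, map_add, hx, hy, map_add, map_add]

theorem towerHom_twist (n : ℤ) (x : (A.baseChange S).carrier) :
    A.towerHom S R ((A.baseChange S).twist n x) =
      (A.baseChange R).twist n (A.towerHom S R x) := by
  induction x using baseChange_induction S with
  | h s a =>
    rw [map_smul, unitMap_twist, towerHom_smul, towerHom_smul, towerHom_unitMap,
      towerHom_unitMap, map_smul, unitMap_twist]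
  | hadd x y hx hy => rw [map_add, map_add, hx, hy, map_add, map_add]

variable {A} {θ : (A.baseChange S).carrier} (hθ : (A.baseChange S).IsCentralCocycle θ)
  {θ' : (A.baseChange R).carrier} (hθ' : (A.baseChange R).IsCentralCocycle θ')
  (h : A.towerHom S R θ = θ')

/-- The ring homomorphism from `(S ⊗ A)[ε]` to `(R ⊗ A)[ε]`. -/
def epsTowerHom (A : DGA K) : (A.baseChange S).Eps →+* (A.baseChange R).Eps where
  toFun x := ⟨A.towerHom S R x.fst, A.towerHom S R x.snd⟩
  map_one' := Eps.ext (map_one _) (map_zero _)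
  map_zero' := Eps.ext (map_zero _) (map_zero _)
  map_add' x y := Eps.ext (map_add _ _ _) (map_add _ _ _)
  map_mul' x y := Eps.ext (map_mul _ _ _) (by
    simp only [Eps.snd_mul, map_add, map_mul, towerHom_twist])

/-- The homomorphism from `R ⊗ ((S ⊗ A)[ε])` to `(R ⊗ A)[ε]`. -/
def epsTowerMap : Map (((A.baseChange S).adjoinEps θ hθ).baseChange R)
    ((A.baseChange R).adjoinEps θ' hθ') :=
  Map.ofRingHom (V := (A.baseChange S).adjoinEps θ hθ) (T := (A.baseChange R).adjoinEps θ' hθ')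
    (epsTowerHom A)
    (fun s _ => Eps.ext (A.towerHom_smul s _) (A.towerHom_smul s _))
    (fun _ _ hx => ⟨A.towerHom_mem hx.1, A.towerHom_mem hx.2⟩)
    (fun x => Eps.ext
      (by
        change A.towerHom S R ((A.baseChange S).d x.fst + θ * x.snd) =
          (A.baseChange R).d (A.towerHom S R x.fst) + θ' * A.towerHom S R x.snd
        rw [map_add, map_mul, towerHom_d, h])
      (by
        change A.towerHom S R (-(A.baseChange S).d x.snd) =
          -(A.baseChange R).d (A.towerHom S R x.snd)
        rw [map_neg, towerHom_d]))

/-- Underlying `epsTowerMap` is the linear equivalence given by the compatibility of tensor products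
with direct sums, and the transitivity of extension of constants. -/
theorem bijective_epsTowerMap : Function.Bijective (epsTowerMap hθ hθ' h).hom := by
  let p : (A.baseChange S).Eps ≃ₗ[S] (S ⊗[K] A.carrier) × (S ⊗[K] A.carrier) :=
    { Eps.equivProd (A.baseChange S) with
      map_add' := fun _ _ => rfl
      map_smul' := fun _ _ => rfl }
  let c := TensorProduct.AlgebraTensorModule.cancelBaseChange K S R R A.carrier
  let E : R ⊗[S] (A.baseChange S).Eps ≃ₗ[R] (R ⊗[K] A.carrier) × (R ⊗[K] A.carrier) :=
    TensorProduct.AlgebraTensorModule.congr (LinearEquiv.refl R R) p ≪≫ₗ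
      TensorProduct.prodRight S R R _ _ ≪≫ₗ c.prodCongr c
  have hc : ∀ (r : R) (x : S ⊗[K] A.carrier), c (r ⊗ₜ[S] x) =
      r • (show R ⊗[K] A.carrier from A.towerHom S R x) := fun r x => by
    induction x using TensorProduct.induction_on with
    | zero => rw [TensorProduct.tmul_zero,
      map_zero]; exact ((congrArg (r • ·) (map_zero (A.towerHom S R))).trans (smul_zero r)).symm
    | tmul s a =>
      rw [TensorProduct.AlgebraTensorModule.cancelBaseChange_tmul]
      change _ = r • (algebraMap S R s ⊗ₜ[K] a)
      rw [TensorProduct.smul_tmul', smul_eq_mul, Algebra.smul_def, mul_comm]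
    | add x y hx hy =>
      rw [TensorProduct.tmul_add, map_add, hx, hy]
      exact ((congrArg (r • ·) (map_add (A.towerHom S R) x y)).trans (smul_add r _ _)).symm
  have hE : ∀ x : R ⊗[S] (A.baseChange S).Eps, (epsTowerMap hθ hθ' h).hom x =
      (⟨(E x).1, (E x).2⟩ : (A.baseChange R).Eps) := fun x => by
    induction x using TensorProduct.induction_on with
    | zero =>
      rw [map_zero]
      exact (map_zero (epsTowerMap hθ hθ' h).hom).trans rfl
    | tmul r x =>
      refine (Map.ofRingHom_tmul (V := (A.baseChange S).adjoinEps θ hθ)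
        (T := (A.baseChange R).adjoinEps θ' hθ') _ _ _ _ r x).trans ?_
      exact Eps.ext (hc r x.fst).symm (hc r x.snd).symm
    | add x y hx hy =>
      refine (map_add (epsTowerMap hθ hθ' h).hom x y).trans ?_
      rw [map_add]
      exact congrArg₂ (fun x y : (A.baseChange R).Eps => x + y) hx hy
  constructor
  · intro x y hxy
    have := (hE x).symm.trans (hxy.trans (hE y))
    exact E.injective (Prod.ext (congrArg Eps.fst this) (congrArg Eps.snd this))
  · intro y
    change (A.baseChange R).Eps at y
    obtain ⟨x, hx⟩ := E.surjective (y.fst, y.snd)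
    exact ⟨x, (hE x).trans (Eps.ext (congrArg Prod.fst hx) (congrArg Prod.snd hx))⟩

end Tower

/-! ### Adapted bases over a field -/

section Field

variable {K : Type u} [Field K] (A : DGA K)

/-- In each degree, the union of a basis of the space of cocycles and a basis of a complement. -/
theorem nonempty_adaptedBasis : Nonempty A.AdaptedBasis := by
  classical
  let Z : ∀ n, Submodule K (A.gr n) := fun n => LinearMap.ker (A.d ∘ₗ (A.gr n).subtype)
  choose C hC using fun n => (Z n).exists_isCompl
  let bZ := fun n => Module.Basis.ofVectorSpace K (Z n)
  let bC := fun n => Module.Basis.ofVectorSpace K (C n)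
  let b := fun n => ((bZ n).prod (bC n)).map (Submodule.prodEquivOfIsCompl _ _ (hC n))
  have hint := DirectSum.Decomposition.isInternal A.gr
  let e := hint.collectedBasis b
  have heZ : ∀ n i, e ⟨n, Sum.inl i⟩ = ((bZ n i : A.gr n) : A.carrier) := fun n i => by
    simp [e, b]
  have heC : ∀ n i, e ⟨n, Sum.inr i⟩ = ((bC n i : A.gr n) : A.carrier) := fun n i => by
    simp [e, b]
  -- cocycles have level `0`, elements of the complements have level `1`
  let level : (Σ n, Module.Basis.ofVectorSpaceIndex K (Z n) ⊕
    Module.Basis.ofVectorSpaceIndex K (C n)) → ℕ := fun x => Sum.elim (fun _ => 0) (fun _ => 1) x.2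
  refine ⟨⟨_, e, Sigma.fst, level, fun i => hint.collectedBasis_mem b i, ?_, ?_⟩⟩
  · rintro ⟨n, i | i⟩
    · exact zero_le_one
    · exact le_rfl
  · rintro ⟨n, i | i⟩
    · rw [heZ, show A.d ((bZ n i : A.gr n) : A.carrier) = 0 from (bZ n i).2]
      exact zero_mem _
    -- the differential of a basis element is a cocycle
    · have hz : (⟨A.d (e ⟨n, Sum.inr i⟩), A.d_mem n _ (hint.collectedBasis_mem b ⟨n, Sum.inr i⟩)⟩ :
          A.gr (n + 1)) ∈ Z (n + 1) := A.d_d _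
      have := Submodule.mem_map_of_mem (f := (A.gr (n + 1)).subtype ∘ₗ (Z (n + 1)).subtype)
        ((bZ (n + 1)).mem_span ⟨_, hz⟩)
      rw [Submodule.map_span] at this
      refine Submodule.span_mono ?_ this
      rintro _ ⟨_, ⟨j, rfl⟩, rfl⟩
      exact ⟨⟨n + 1, Sum.inl j⟩, Nat.zero_lt_one, heZ _ _⟩

end Field

end DGA

theorem mainTheorem4 {K : Type u} [Field K] (A : DGA K) [Nontrivial A.carrier]
    (W : A.carrier) (hW : A.IsCentralCocycle W)
    (hA : A.IsSmooth)
    (p : K[X]) (hp : p ≠ 0) (r : ℕ) (hr : 0 < r)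
    (h : A.qPolyClass hW p r = 0) :
    (A.fibreAway W hW p).IsSmooth := by
  obtain ⟨β⟩ := A.nonempty_adaptedBasis
  let R := Localization.Away p
  let t : R := algebraMap K[X] R X
  have hθ := A.isCentralCocycle_sub hW
  -- the differential of `ε`, transported from `K[t] ⊗ A` to `R ⊗ A`
  have e : A.towerHom K[X] R ((X : K[X]) ⊗ₜ[K] (1 : A.carrier) - (1 : K[X]) ⊗ₜ[K] W) =
      algebraMap R (A.baseChange R).carrier t - A.unitMap R W := by
    refine (map_sub (A.towerHom K[X] R) _ _).trans ?_
    exact congrArg₂ (fun x y : (A.baseChange R).carrier => x - y) rfl (A.towerHom_unitMap W)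
  have hθ' : (A.baseChange R).IsCentralCocycle
      (algebraMap R (A.baseChange R).carrier t - A.unitMap R W) := by
    have := (A.baseChange R).isCentralCocycle_aeval (hW.unitMap R) (C t - X)
    rwa [map_sub, aeval_C, aeval_X] at this
  -- `p(t)` is the image of `p` in the localization `K[t, 1/p]`
  have hu : IsUnit (aeval t p) := by
    have : aeval t p = algebraMap K[X] R p := by
      rw [aeval_algebraMap_apply, aeval_X_left_apply]
    rw [this]
    exact IsLocalization.Away.algebraMap_isUnit p
  have hs : ((A.baseChange R).adjoinEps _ hθ').IsSmooth :=
    β.isSmooth_adjoinEps_baseChange hA hW R t hθ' rfl hu h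
  have hφ := DGA.bijective_epsTowerMap hθ hθ' e
  exact DGA.IsSmooth.of_bijective ((DGA.epsTowerMap hθ hθ' e).inverse hφ)
    (AlgEquiv.ofBijective _ hφ).symm.bijective hs

end
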